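/- **Conventions.** Let $p$ be an odd prime, $\Lambda=\mathbb Z/p$, $\Sigma_p$ the symmetric group, and $\pi\subseteq\Sigma_p$ the cyclic subgroup generated by the $p$-cycle $\alpha\colon i\mapsto i+1$. A $\Lambda$-complex is a $\mathbb Z$-graded complex of $\Lambda$-modules with differential of degree $+1$; a chain complex is regarded as one by placing its degree $n$ part in degree $-n$. Tensor products carry $d(x\otimes y)=dx\otimes y+(-1)^{\deg x}x\otimes dy$, $K^p$ is the $p$-fold tensor power of $K$, and $\Sigma_p$ acts on $K^p$ by permuting the factors, $\sigma(x_1\otimes\cdots\otimes x_p)=\pm\,x_{\sigma^{-1}(1)}\otimes\cdots\otimes x_{\sigma^{-1}(p)}$ with the Koszul sign. Homotopies are written with $f-g=dh+hd$. $C(L)$ denotes the normalized chain complex, with coefficients in $\Lambda$, of a simplicial set $L$. Let $W$ be the complex of free $\Lambda\pi$-modules with one generator $e_i$ in degree $-i$ for each $i\ge 0$, with $d e_{2i+1}=(\alpha-1)e_{2i}$, $d e_{2i}=(1+\alpha+\cdots+\alpha^{p-1})e_{2i-1}$ for $i>0$, augmentation $\epsilon(\alpha^je_0)=1$, and the $\Lambda\pi$-coproduct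 $\psi\colon W\to W\otimes W$ given by $$\psi(e_{2i+1})=\sum_{j+k=i}e_{2j}\otimes e_{2k+1}+\sum_{j+k=i}e_{2j+1}\otimes\alpha e_{2k},$$ $$\psi(e_{2i})=\sum_{j+k=i}e_{2j}\otimes e_{2k}+\sum_{j+k=i-1}\ \sum_{0\le r<s<p}\alpha^re_{2j+1}\otimes\alpha^se_{2k+1}.$$ Let $V$ be any $\Lambda\Sigma_p$-free resolution of $\Lambda$ and $j\colon W\to V$ any augmentation preserving morphism of $\Lambda\pi$-complexes. **The category $\mathfrak C(p)$.** An object is a pair $(K,\theta)$ where $K$ is a homotopy associative differential $\Lambda$-algebra (a $\Lambda$-complex with a product $K\otimes K\to K$ that is a morphism of complexes and is associative up to homotopy) and $\theta\colon W\otimes K^p\to K$ is a $\pi$-equivariant morphism of complexes ($\pi$ acting diagonally on the source and trivially on $K$) such that (1) the restriction of $\theta$ to $e_0\otimes K^p$ is homotopic to the iterated product $K^p\to K$, associated in some order, and (2) $\theta$ is $\Lambda\pi$-homotopic to a composite $\phi\circ(j\otimes 1)$, where $\phi\colon V\otimes K^p\to K$ is a $\Sigma_p$-equivariant morphism of complexes.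 A morphism $f\colon(K,\theta)\to(K',\theta')$ is a morphism of complexes such that $f\circ\theta$ and $\theta'\circ(1\otimes f^p)$ are $\Lambda\pi$-homotopic. The tensor product of $(K,\theta)$ and $(K',\theta')$ is $(K\otimes K',\tilde\theta)$, where $\tilde\theta$ is the composite $$W\otimes(K\otimes K')^p\to W\otimes W\otimes K^p\otimes K'^p\to W\otimes K^p\otimes W\otimes K'^p\xrightarrow{\theta\otimes\theta'}K\otimes K'$$ of $\psi\otimes(\text{shuffle})$, the interchange of the two middle factors (both with Koszul signs), and $\theta\otimes\theta'$. An object $(K,\theta)$ is a *Cartan object* if its product is a morphism $(K\otimes K,\tilde\theta)\to(K,\theta)$. **The cochain algebra.** Let $G$ be a discrete group and $O_G$ its category of orbits $G/H$, $H\subseteq G$, and $G$-maps. Let $(T,M_0,\rho)$ be an object of $\mathcal A_\Lambda$: contravariant functors $T$, $M_0$, $\rho$ from $O_G$ to simplicial sets, commutative unital $\Lambda$-algebras and groups, respectively, with actions of $\rho(G/H)$ on $T(G/H)$ by simplicial maps and on $M_0(G/H)$ by algebra automorphisms, natural in $G/H$. Let $C^n_\rho(T;M_0)$ be the module of the natural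 transformations $f\colon C_n(T(-))\to M_0$ of $\Lambda$-modules over $O_G$ that respect the action of $\rho$, with $\delta f=(-1)^{n+1}f\circ\partial$. The complex $C^*_\rho(T;M_0)$ has the cup product $$(f\cup g)(G/H)=\alpha(f\otimes g)\circ\xi,\qquad \alpha(f\otimes g)(x\otimes y)=(-1)^{\deg x\deg y}f(x)g(y),$$ where $\xi\colon C(L)\to C(L\times L)\to C(L)\otimes C(L)$, $L=T(G/H)$, is the Alexander–Whitney diagonal. **The map $\theta$.** A *Steenrod diagonal* is a morphism of complexes $$\Phi\colon W\otimes C(L_1\times\cdots\times L_p)\to W\otimes C(L_1)\otimes\cdots\otimes C(L_p),$$ natural in the simplicial sets $L_1,\dots,L_p$, which (1) commutes with the action of every $\sigma\in\pi$ (on $W$ and by permuting the factors), (2) is the identity on $W\otimes C_0(L_1\times\cdots\times L_p)$, (3) satisfies $\Phi(e_0\otimes x)=e_0\otimes\xi(x)$ with $\xi$ the Alexander–Whitney map, and (4) maps $W\otimes C_j(L_1\times\cdots\times L_p)$ into $\sum_{k\le pj}W\otimes[C(L_1)\otimes\cdots\otimes C(L_p)]_k$. Given $\Phi$, let $\Delta$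 be the composite $$W\otimes C(L)\to W\otimes C(L^p)\xrightarrow{\Phi}W\otimes C(L)^p\xrightarrow{\epsilon\otimes1}C(L)^p,$$ the first map being induced by the diagonal $L\to L^p$, and define $\theta\colon W\otimes C^*_\rho(T;M_0)^p\to C^*_\rho(T;M_0)$ by $$\theta(w\otimes f)(G/H)(x)=(-1)^{\deg w\,\deg f}\,\alpha(f)\bigl(\Delta(w\otimes x)\bigr),\qquad L=T(G/H),$$ $$\alpha(f_1\otimes\cdots\otimes f_p)(x_1\otimes\cdots\otimes x_p)=(-1)^{\sum_{i<j}\deg x_i\deg x_j}f_1(x_1)\cdots f_p(x_p).$$ **Proposition.** A Steenrod diagonal $\Phi$ exists. For every Steenrod diagonal $\Phi$ and every object $(T,M_0,\rho)$ of $\mathcal A_\Lambda$, the pair $(C^*_\rho(T;M_0),\theta)$, with the cup product, is a Cartan object of $\mathfrak C(p)$: it is an object of $\mathfrak C(p)$, and the cup product $C^*_\rho(T;M_0)\otimes C^*_\rho(T;M_0)\to C^*_\rho(T;M_0)$ is a morphism $(C^*_\rho(T;M_0)\otimes C^*_\rho(T;M_0),\tilde\theta)\to(C^*_\rho(T;M_0),\theta)$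 of $\mathfrak C(p)$. -/

import Mathlib

open CategoryTheory Opposite
open scoped TensorProduct DirectSum

universe u v w a b c

noncomputable section

/-- A complex of `R`-modules: a module `K = ⨁ n, Kⁿ` graded by `ℤ` with a differential of
degree `1`.  A chain complex `C` is regarded as such a complex by putting `C_n` in degree `-n`. -/
structure GrComplex (R : Type) [CommRing R] where
  carrier : Type v
  [grp : AddCommGroup carrier]
  [mod : Module R carrier]
  gr : ℤ → Submodule R carrier
  internal : DirectSum.IsInternal gr
  d : carrier →ₗ[R] carrier
  d_mem : ∀ n x, x ∈ gr n → d x ∈ gr (n + 1)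
  d_d : ∀ x, d (d x) = 0

namespace GrComplex

attribute [instance] GrComplex.grp GrComplex.mod

instance (R : Type) [CommRing R] : CoeSort (GrComplex.{v} R) (Type v) := ⟨GrComplex.carrier⟩

variable {R : Type} [CommRing R]

/-- A criterion for a family of submodules to be a grading. -/
theorem isInternal_of_split {M : Type*} [AddCommGroup M] [Module R M] {D : ℤ → Submodule R M}
    (δ : M →ₗ[R] (ℤ → M)) (hδ : ∀ n, ∀ x ∈ D n, δ x = Pi.single n x) (hD : ⨆ n, D n = ⊤) :
    DirectSum.IsInternal D := by
  classical
  refine DirectSum.isInternal_submodule_of_iSupIndep_of_iSup_eq_top ?_ hD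
  rw [iSupIndep_def]
  intro n
  rw [Submodule.disjoint_def]
  intro x hx hx'
  have h1 : (δ x) n = x := by rw [hδ n x hx]; simp
  have h2 : ⨆ j, ⨆ (_ : j ≠ n), D j ≤ LinearMap.ker (LinearMap.proj n ∘ₗ δ) := by
    refine iSup_le fun j => iSup_le fun hj y hy => ?_
    simp [LinearMap.mem_ker, hδ j y hy, Pi.single_eq_of_ne (Ne.symm hj)]
  have h3 := h2 hx'
  rw [← h1]
  simpa [LinearMap.mem_ker] using h3

/-- The direct sum decomposition of a complex. -/
def decomp (K : GrComplex.{v} R) : (⨁ n, K.gr n) ≃ₗ[R] K :=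
  LinearEquiv.ofBijective (DirectSum.coeLinearMap K.gr) K.internal

/-- The linear map which multiplies elements of degree `n` by `c n`. -/
def scale (K : GrComplex.{v} R) (c : ℤ → R) : K →ₗ[R] K :=
  DirectSum.toModule R ℤ K (fun n => c n • (K.gr n).subtype) ∘ₗ K.decomp.symm.toLinearMap

theorem decomp_symm_of_mem (K : GrComplex.{v} R) {n : ℤ} {x : K} (hx : x ∈ K.gr n) :
    K.decomp.symm x = DirectSum.lof R ℤ (fun n => K.gr n) n ⟨x, hx⟩ := by
  rw [LinearEquiv.symm_apply_eq]
  exact (DirectSum.coeLinearMap_lof K.gr n ⟨x, hx⟩).symm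

theorem scale_of_mem (K : GrComplex.{v} R) (c : ℤ → R) {n : ℤ} {x : K} (hx : x ∈ K.gr n) :
    K.scale c x = c n • x := by
  simp [scale, decomp_symm_of_mem K hx]

/-- Linear maps which agree on homogeneous elements are equal. -/
theorem hom_ext (K : GrComplex.{v} R) {M : Type*} [AddCommGroup M] [Module R M]
    {f g : K →ₗ[R] M} (h : ∀ n, ∀ x ∈ K.gr n, f x = g x) : f = g := by
  have h2 : (⨆ n, K.gr n) ≤ LinearMap.eqLocus f g := iSup_le fun n x hx => h n x hx
  rw [K.internal.submodule_iSup_eq_top] at h2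
  ext x
  exact h2 Submodule.mem_top

/-- The sign involution `x ↦ (-1) ^ deg x • x`. -/
def sgn (K : GrComplex.{v} R) : K →ₗ[R] K := K.scale fun n => if Even n then 1 else -1

/-- The projection of `K` onto its part of even degree. -/
def evenPart (K : GrComplex.{v} R) : K →ₗ[R] K := K.scale fun n => if Even n then 1 else 0

/-- The projection of `K` onto its part of odd degree. -/
def oddPart (K : GrComplex.{v} R) : K →ₗ[R] K := K.scale fun n => if Even n then 0 else 1

theorem sgn_of_mem (K : GrComplex.{v} R) {n : ℤ} {x : K} (hx : x ∈ K.gr n) :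
    K.sgn x = (if Even n then (1 : R) else -1) • x := K.scale_of_mem _ hx

theorem sgn_mem (K : GrComplex.{v} R) {n : ℤ} {x : K} (hx : x ∈ K.gr n) : K.sgn x ∈ K.gr n := by
  rw [K.sgn_of_mem hx]
  exact Submodule.smul_mem _ _ hx

theorem sgn_sgn (K : GrComplex.{v} R) (x : K) : K.sgn (K.sgn x) = x := by
  have : K.sgn ∘ₗ K.sgn = LinearMap.id := K.hom_ext fun n x hx => by
    have := K.sgn_of_mem hx
    by_cases h : Even n <;> simp [h, this]
  exact LinearMap.congr_fun this x

theorem d_sgn (K : GrComplex.{v} R) (x : K) : K.d (K.sgn x) = - K.sgn (K.d x) := by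
  have : K.d ∘ₗ K.sgn = - (K.sgn ∘ₗ K.d) := K.hom_ext fun n x hx => by
    have h1 := K.sgn_of_mem hx
    have h2 := K.sgn_of_mem (K.d_mem n x hx)
    by_cases h : Even n <;> simp [h, h1, h2, ← Int.not_even_iff_odd]
  exact LinearMap.congr_fun this x

/-! ### Tensor products -/

/-- The part of degree `n` of `K ⊗ L`, spanned by the `x ⊗ y` with `deg x + deg y = n`. -/
def tensorGr (K : GrComplex.{v} R) (L : GrComplex.{w} R) (n : ℤ) : Submodule R (K ⊗[R] L) :=
  Submodule.span R {z | ∃ a b : ℤ, a + b = n ∧ ∃ x ∈ K.gr a, ∃ y ∈ L.gr b, z = x ⊗ₜ[R] y}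

theorem tensor_iSup (K : GrComplex.{v} R) (L : GrComplex.{w} R) : ⨆ n, tensorGr K L n = ⊤ := by
  rw [eq_top_iff]
  rintro z -
  induction z using TensorProduct.induction_on with
  | zero => exact Submodule.zero_mem _
  | add x y hx hy => exact Submodule.add_mem _ hx hy
  | tmul x y =>
    have hx : x ∈ ⨆ n, K.gr n := by rw [K.internal.submodule_iSup_eq_top]; trivial
    have hy : y ∈ ⨆ n, L.gr n := by rw [L.internal.submodule_iSup_eq_top]; trivial
    induction hx using Submodule.iSup_induction' with
    | zero => simp
    | add x x' _ _ h h' => rw [TensorProduct.add_tmul]; exact Submodule.add_mem _ h h'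
    | mem a x hx =>
      induction hy using Submodule.iSup_induction' with
      | zero => simp
      | add y y' _ _ h h' => rw [TensorProduct.tmul_add]; exact Submodule.add_mem _ h h'
      | mem b y hy =>
        exact Submodule.mem_iSup_of_mem (a + b)
          (Submodule.subset_span ⟨a, b, rfl, x, hx, y, hy, rfl⟩)

/-- The map which sends `x ⊗ y` to the family with entry `x ⊗ y` in degree `deg x + deg y`. -/
def tensorSplit (K : GrComplex.{v} R) (L : GrComplex.{w} R) : K ⊗[R] L →ₗ[R] (ℤ → K ⊗[R] L) :=
  DirectSum.toModule R (ℤ × ℤ) _ (fun ab => LinearMap.single R (fun _ => K ⊗[R] L) (ab.1 + ab.2) ∘ₗ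
      TensorProduct.map (K.gr ab.1).subtype (L.gr ab.2).subtype) ∘ₗ
    (TensorProduct.directSum R R (fun n => K.gr n) (fun n => L.gr n)).toLinearMap ∘ₗ
    TensorProduct.map K.decomp.symm.toLinearMap L.decomp.symm.toLinearMap

theorem tensor_internal (K : GrComplex.{v} R) (L : GrComplex.{w} R) :
    DirectSum.IsInternal (tensorGr K L) := by
  refine isInternal_of_split (tensorSplit K L) (fun n z hz => ?_) (tensor_iSup K L)
  have : tensorGr K L n ≤
      LinearMap.eqLocus (tensorSplit K L) (LinearMap.single R (fun _ => K ⊗[R] L) n) := by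
    refine Submodule.span_le.2 ?_
    rintro _ ⟨a, b, rfl, x, hx, y, hy, rfl⟩
    simp [tensorSplit, decomp_symm_of_mem K hx, decomp_symm_of_mem L hy,
      TensorProduct.directSum_lof_tmul_lof]
  exact this hz

/-- The tensor product of complexes, with `d (x ⊗ y) = d x ⊗ y + (-1) ^ deg x • x ⊗ d y`. -/
abbrev tensor (K : GrComplex.{v} R) (L : GrComplex.{w} R) : GrComplex.{max v w} R where
  carrier := K ⊗[R] L
  gr := tensorGr K L
  internal := tensor_internal K L
  d := TensorProduct.map K.d LinearMap.id + TensorProduct.map K.sgn L.d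
  d_mem n z hz := by
    have : tensorGr K L n ≤ (tensorGr K L (n + 1)).comap
        (TensorProduct.map K.d LinearMap.id + TensorProduct.map K.sgn L.d) := by
      refine Submodule.span_le.2 ?_
      rintro _ ⟨a, b, rfl, x, hx, y, hy, rfl⟩
      simp only [Submodule.comap_coe, Set.mem_preimage, LinearMap.add_apply,
        TensorProduct.map_tmul, LinearMap.id_apply, SetLike.mem_coe]
      refine Submodule.add_mem _ (Submodule.subset_span ?_) (Submodule.subset_span ?_)
      · exact ⟨a + 1, b, by ring, _, K.d_mem a x hx, y, hy, rfl⟩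
      · exact ⟨a, b + 1, by ring, _, K.sgn_mem hx, _, L.d_mem b y hy, rfl⟩
    exact this hz
  d_d z := by
    induction z using TensorProduct.induction_on with
    | zero => simp
    | add x y hx hy => rw [map_add, map_add, hx, hy, add_zero]
    | tmul x y => simp [K.d_d, L.d_d, d_sgn, TensorProduct.neg_tmul]

/-- The Koszul sign `x ⊗ y ↦ (-1) ^ (deg x * deg y) • x ⊗ y`. -/
def koszul (K : GrComplex.{v} R) (L : GrComplex.{w} R) : K ⊗[R] L →ₗ[R] K ⊗[R] L :=
  TensorProduct.map K.evenPart LinearMap.id + TensorProduct.map K.oddPart L.sgn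

/-- The interchange `x ⊗ y ↦ (-1) ^ (deg x * deg y) • y ⊗ x`. -/
def swap (K : GrComplex.{v} R) (L : GrComplex.{w} R) : K ⊗[R] L →ₗ[R] L ⊗[R] K :=
  (TensorProduct.comm R K L).toLinearMap ∘ₗ koszul K L

variable {ι : Type} [Fintype ι]

/-- The part of degree `n` of `⨂ i, K i`, spanned by the `⨂ i, x i` with `∑ i, deg (x i) = n`. -/
def piGr (K : ι → GrComplex.{v} R) (n : ℤ) : Submodule R (⨂[R] i, K i) :=
  Submodule.span R {z | ∃ a : ι → ℤ, ∑ i, a i = n ∧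
    ∃ x : ∀ i, K i, (∀ i, x i ∈ (K i).gr (a i)) ∧ z = PiTensorProduct.tprod R x}

/-- The map which sends `⨂ i, x i` to the family with this entry in degree `∑ i, deg (x i)`. -/
def piSplit (K : ι → GrComplex.{v} R) : (⨂[R] i, K i) →ₗ[R] (ℤ → ⨂[R] i, K i) :=
  open scoped Classical in
  DirectSum.toModule R (ι → ℤ) _ (fun a => LinearMap.single R (fun _ => ⨂[R] i, K i) (∑ i, a i) ∘ₗ
      PiTensorProduct.map (fun i => ((K i).gr (a i)).subtype)) ∘ₗ
    (PiTensorProduct.ofDirectSumEquiv (R := R) (M := fun i n => (K i).gr n)).toLinearMap ∘ₗ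
    PiTensorProduct.map (fun i => (K i).decomp.symm.toLinearMap)

theorem piSplit_tprod (K : ι → GrComplex.{v} R) (a : ι → ℤ) (x : ∀ i, K i)
    (hx : ∀ i, x i ∈ (K i).gr (a i)) :
    piSplit K (PiTensorProduct.tprod R x) =
      Pi.single (∑ i, a i) (PiTensorProduct.tprod R x) := by
  classical
  have h : ∀ i, (K i).decomp.symm (x i) =
      DirectSum.lof R ℤ (fun n => (K i).gr n) (a i) ⟨x i, hx i⟩ :=
    fun i => decomp_symm_of_mem _ (hx i)
  simp only [piSplit, LinearMap.comp_apply, PiTensorProduct.map_tprod, LinearEquiv.coe_coe, h]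
  rw [PiTensorProduct.ofDirectSumEquiv_tprod_lof (R := R) (M := fun i n => (K i).gr n) a
    (fun i => ⟨x i, hx i⟩)]
  erw [DirectSum.toModule_lof]
  simp [PiTensorProduct.map_tprod]

theorem pi_iSup (K : ι → GrComplex.{v} R) : ⨆ n, piGr K n = ⊤ := by
  classical
  have key : ∀ (s : Finset ι) (x : ∀ i, K i),
      (∀ i ∉ s, ∃ a, x i ∈ (K i).gr a) → PiTensorProduct.tprod R x ∈ ⨆ n, piGr K n := by
    intro s
    induction s using Finset.induction_on with
    | empty =>
      intro x hx
      choose a ha using fun i => hx i (by simp)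
      exact Submodule.mem_iSup_of_mem (∑ i, a i) (Submodule.subset_span ⟨a, rfl, x, ha, rfl⟩)
    | insert j s hj ih =>
      intro x hx
      have hxj : x j ∈ ⨆ n, (K j).gr n := by
        rw [(K j).internal.submodule_iSup_eq_top]; trivial
      have hle : (⨆ n, (K j).gr n) ≤ (⨆ n, piGr K n).comap
          ((PiTensorProduct.tprod R).toLinearMap x j) := by
        refine iSup_le fun n y hy => ?_
        refine ih (Function.update x j y) fun i hi => ?_
        by_cases hij : i = j
        · subst hij; exact ⟨n, by simpa using hy⟩
        · obtain ⟨a, ha⟩ := hx i (by simp [hij, hi])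
          exact ⟨a, by simpa [hij] using ha⟩
      simpa using hle hxj
  rw [eq_top_iff, ← PiTensorProduct.span_tprod_eq_top, Submodule.span_le]
  rintro _ ⟨x, rfl⟩
  exact key Finset.univ x (by simp)

theorem pi_internal (K : ι → GrComplex.{v} R) : DirectSum.IsInternal (piGr K) := by
  classical
  refine isInternal_of_split (piSplit K) (fun n z hz => ?_) (pi_iSup K)
  have : piGr K n ≤
      LinearMap.eqLocus (piSplit K) (LinearMap.single R (fun _ => ⨂[R] i, K i) n) := by
    refine Submodule.span_le.2 ?_
    rintro _ ⟨a, rfl, x, hx, rfl⟩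
    simpa using piSplit_tprod K a x hx
  exact this hz

variable {n : ℕ}

/-- The summand `x₀ ⊗ ⋯ ⊗ x_{n-1} ↦ ± x₀ ⊗ ⋯ ⊗ d x_k ⊗ ⋯ ⊗ x_{n-1}` of the differential, with the
sign `(-1) ^ (deg x₀ + ⋯ + deg x_{k-1})`. -/
def piD (K : Fin n → GrComplex.{v} R) (k : Fin n) : (⨂[R] i, K i) →ₗ[R] ⨂[R] i, K i :=
  PiTensorProduct.map fun i => if i < k then (K i).sgn else if i = k then (K i).d else LinearMap.id

theorem piD_piD (K : Fin n → GrComplex.{v} R) (k l : Fin n) (z : ⨂[R] i, K i) :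
    piD K k (piD K l z) = - piD K l (piD K k z) := by
  wlog hkl : k ≤ l generalizing k l
  · rw [this l k (le_of_not_ge hkl), neg_neg]
  have key : piD K k ∘ₗ piD K l = - (piD K l ∘ₗ piD K k) := by
    ext x
    simp only [LinearMap.compMultilinearMap_apply, LinearMap.comp_apply, LinearMap.neg_apply, piD,
      PiTensorProduct.map_tprod]
    have e := Function.update_eq_self k (fun i =>
      (if i < l then (K i).sgn else if i = l then (K i).d else LinearMap.id)
        ((if i < k then (K i).sgn else if i = k then (K i).d else LinearMap.id) (x i)))
    rw [← e]
    rw [← MultilinearMap.map_update_neg]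
    congr 1
    funext i
    by_cases hi : i = k
    · subst hi
      rcases hkl.eq_or_lt with h | h
      · subst h; simp [(K i).d_d]
      · simp [h, d_sgn]
    · rcases lt_trichotomy i k with h | h | h
      · simp [hi, h, h.trans_le hkl]
      · exact absurd h hi
      · simp [hi, h.not_gt]
  exact LinearMap.congr_fun key z

/-- The tensor product `K₀ ⊗ ⋯ ⊗ K_{n-1}` of complexes. -/
abbrev piTensor (K : Fin n → GrComplex.{v} R) : GrComplex.{v} R where
  carrier := ⨂[R] i, K i
  gr := piGr K
  internal := pi_internal K
  d := ∑ k, piD K k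
  d_mem m z hz := by
    have : piGr K m ≤ (piGr K (m + 1)).comap (∑ k, piD K k) := by
      refine Submodule.span_le.2 ?_
      rintro _ ⟨a, rfl, x, hx, rfl⟩
      simp only [Submodule.comap_coe, Set.mem_preimage, LinearMap.sum_apply, SetLike.mem_coe]
      refine Submodule.sum_mem _ fun k _ => Submodule.subset_span ?_
      refine ⟨fun i => a i + if i = k then 1 else 0, by simp [Finset.sum_add_distrib], _, ?_,
        PiTensorProduct.map_tprod _ _⟩
      intro i
      rcases lt_trichotomy i k with h | h | h
      · simpa [h, h.ne] using (K i).sgn_mem (hx i)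
      · subst h; simpa using (K i).d_mem _ _ (hx i)
      · simpa [h.not_gt, h.ne'] using hx i
    exact this hz
  d_d z := by
    simp only [LinearMap.sum_apply, map_sum]
    rw [← Finset.sum_product']
    refine Finset.sum_involution (fun kl _ => (kl.2, kl.1)) ?_ ?_ ?_ ?_
    · rintro ⟨k, l⟩ -
      simp only
      rw [piD_piD K l k, neg_add_cancel]
    · rintro ⟨k, l⟩ - h h'
      simp only [Prod.mk.injEq] at h'
      obtain ⟨rfl, -⟩ := h'
      refine h ?_
      simp only
      have key : piD K l ∘ₗ piD K l = 0 := by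
        ext x
        simp only [LinearMap.compMultilinearMap_apply, LinearMap.comp_apply, LinearMap.zero_apply,
          piD, PiTensorProduct.map_tprod]
        exact MultilinearMap.map_coord_zero _ l (by simp [(K l).d_d])
      exact LinearMap.congr_fun key z
    · intros; simp
    · intros; rfl

/-- The `n`-fold tensor power `Kⁿ`. -/
abbrev power (K : GrComplex.{v} R) (n : ℕ) : GrComplex.{v} R := piTensor fun _ : Fin n => K

/-- The projection of `⨂ i, K i` onto the part spanned by the `⨂ i, x i` such that `x i` has odd
degree for `i ∈ S` and even degree for `i ∉ S`. -/
def parityPart (K : Fin n → GrComplex.{v} R) (S : Finset (Fin n)) :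
    (⨂[R] i, K i) →ₗ[R] ⨂[R] i, K i :=
  PiTensorProduct.map fun i => if i ∈ S then (K i).oddPart else (K i).evenPart

theorem parityPart_tprod (K : Fin n → GrComplex.{v} R) (S : Finset (Fin n)) (a : Fin n → ℤ)
    (x : ∀ i, K i) (hx : ∀ i, x i ∈ (K i).gr (a i)) :
    parityPart K S (PiTensorProduct.tprod R x) =
      if S = Finset.univ.filter (fun i => Odd (a i)) then PiTensorProduct.tprod R x else 0 := by
  rw [parityPart, PiTensorProduct.map_tprod]
  split_ifs with h
  · congr 1
    funext i
    by_cases hi : Odd (a i)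
    · have : ¬ Even (a i) := by simpa using hi
      simp [h, hi, oddPart, scale_of_mem _ _ (hx i), this]
    · have : Even (a i) := by simpa using hi
      simp [h, hi, this, evenPart, scale_of_mem _ _ (hx i)]
  · obtain ⟨i, hi⟩ : ∃ i, ¬ (i ∈ S ↔ Odd (a i)) := by
      by_contra hc
      push Not at hc
      exact h (by ext i; simpa using hc i)
    refine MultilinearMap.map_coord_zero _ i ?_
    by_cases hS : i ∈ S
    · have : Even (a i) := by simpa [hS] using hi
      simp [hS, oddPart, scale_of_mem _ _ (hx i), this]
    · have : ¬ Even (a i) := by simpa [hS] using hi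
      simp [hS, evenPart, scale_of_mem _ _ (hx i), this]

/-- The operator which multiplies `⨂ i, x i` by the sign `c S`, where `S` is the set of the `i` such
that `x i` has odd degree. -/
def signOp (K : Fin n → GrComplex.{v} R) (c : Finset (Fin n) → R) :
    (⨂[R] i, K i) →ₗ[R] ⨂[R] i, K i :=
  ∑ S, c S • parityPart K S

theorem signOp_tprod (K : Fin n → GrComplex.{v} R) (c : Finset (Fin n) → R) (a : Fin n → ℤ)
    (x : ∀ i, K i) (hx : ∀ i, x i ∈ (K i).gr (a i)) :
    signOp K c (PiTensorProduct.tprod R x) =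
      c (Finset.univ.filter fun i => Odd (a i)) • PiTensorProduct.tprod R x := by
  simp [signOp, parityPart_tprod K _ a x hx]

/-- The action of a permutation `σ` on tensors,
`⨂ i, x i ↦ ± ⨂ i, x (σ⁻¹ i)`, where the sign is the product of the
`(-1) ^ (deg (x i) * deg (x j))` over the pairs `i < j` with `σ j < σ i`. -/
def permute (K : Fin n → GrComplex.{v} R) (σ : Equiv.Perm (Fin n)) :
    (⨂[R] i, K i) →ₗ[R] ⨂[R] i, K (σ.symm i) :=
  (PiTensorProduct.reindex R (fun i => K i) σ).toLinearMap ∘ₗ signOp K fun S =>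
    (-1) ^ (Finset.univ.filter fun ij : Fin n × Fin n =>
      ij.1 < ij.2 ∧ σ ij.2 < σ ij.1 ∧ ij.1 ∈ S ∧ ij.2 ∈ S).card

/-- The Koszul sign of the evaluation of `f₀ ⊗ ⋯ ⊗ f_{n-1}` on `x₀ ⊗ ⋯ ⊗ x_{n-1}`, where
`deg (f i) = - deg (x i)`, as an operator on the tensors `⨂ i, x i`: the product of the
`(-1) ^ (deg (x i) * deg (x j))` over the pairs `i < j`. -/
def evalSign (K : Fin n → GrComplex.{v} R) : (⨂[R] i, K i) →ₗ[R] ⨂[R] i, K i :=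
  signOp K fun S => (-1) ^ (Finset.univ.filter fun ij : Fin n × Fin n =>
    ij.1 < ij.2 ∧ ij.1 ∈ S ∧ ij.2 ∈ S).card

section Shuffle

variable (K : GrComplex.{v} R) (L : GrComplex.{w} R)

/-- `x ⊗ (x₁ ⊗ ⋯ ⊗ x_n) ↦ x ⊗ x₁ ⊗ ⋯ ⊗ x_n`. -/
def consTensor (K : Type v) [AddCommGroup K] [Module R K] (n : ℕ) :
    K →ₗ[R] (⨂[R] _ : Fin n, K) →ₗ[R] ⨂[R] _ : Fin (n + 1), K :=
  (PiTensorProduct.lift (R := R) (s := fun _ : Fin n => K)).toLinearMap ∘ₗ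
    (PiTensorProduct.tprod R (s := fun _ : Fin (n + 1) => K)).curryLeft

/-- `(x ⊗ y) ⊗ (⨂ i, x i) ⊗ (⨂ i, y i) ↦ (x ⊗ x₁ ⊗ ⋯ ⊗ x_n) ⊗ (y ⊗ y₁ ⊗ ⋯ ⊗ y_n)`. -/
def consTensor₂ (n : ℕ) : K ⊗[R] L →ₗ[R] ((⨂[R] _i : Fin n, K) ⊗[R] (⨂[R] _i : Fin n, L)) →ₗ[R]
    (⨂[R] _i : Fin (n + 1), K) ⊗[R] (⨂[R] _i : Fin (n + 1), L) :=
  TensorProduct.homTensorHomMap (RingHom.id R) _ _ _ _ ∘ₗ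
    TensorProduct.map (consTensor (R := R) K n) (consTensor (R := R) L n)

/-- The multilinear map `(x i ⊗ y i)_i ↦ (⨂ i, x i) ⊗ (⨂ i, y i)`. -/
def unshuffleAux (n : ℕ) : MultilinearMap R (fun _ : Fin n => K ⊗[R] L)
    ((⨂[R] _i : Fin n, K) ⊗[R] (⨂[R] _i : Fin n, L)) :=
  match n with
  | 0 => MultilinearMap.constOfIsEmpty R _
      (PiTensorProduct.tprod R Fin.elim0 ⊗ₜ[R] PiTensorProduct.tprod R Fin.elim0)
  | n + 1 => LinearMap.uncurryLeft
      { toFun := fun z => (consTensor₂ K L n z).compMultilinearMap (unshuffleAux n)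
        map_add' := fun z z' => by ext; simp
        map_smul' := fun c z => by ext; simp }

theorem unshuffleAux_apply (n : ℕ) (x : Fin n → K) (y : Fin n → L) :
    unshuffleAux K L n (fun i => x i ⊗ₜ[R] y i) =
      PiTensorProduct.tprod R x ⊗ₜ[R] PiTensorProduct.tprod R y := by
  induction n with
  | zero =>
    change PiTensorProduct.tprod R _ ⊗ₜ[R] PiTensorProduct.tprod R _ = _
    congr 2 <;> exact Subsingleton.elim _ _
  | succ n ih =>
    change consTensor₂ K L n (x 0 ⊗ₜ[R] y 0)
      (unshuffleAux K L n fun i => x i.succ ⊗ₜ[R] y i.succ) = _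
    rw [ih]
    simp only [consTensor₂, consTensor, LinearMap.comp_apply, TensorProduct.map_tmul,
      TensorProduct.homTensorHomMap_apply, LinearEquiv.coe_coe, PiTensorProduct.lift.tprod,
      MultilinearMap.curryLeft_apply]
    congr 2 <;> exact Fin.cons_self_tail _

/-- The shuffling isomorphism `(K ⊗ L)ⁿ → Kⁿ ⊗ Lⁿ`, which sends `⨂ i, (x i ⊗ y i)` to
`± (⨂ i, x i) ⊗ (⨂ i, y i)`, where the sign is the product of the
`(-1) ^ (deg (y i) * deg (x j))` over the pairs `i < j`. -/
def unshuffle (n : ℕ) : (power (tensor K L) n) →ₗ[R] (power K n) ⊗[R] (power L n) :=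
  (∑ S : Finset (Fin n), ∑ T : Finset (Fin n),
    ((-1 : R) ^ (Finset.univ.filter fun ij : Fin n × Fin n =>
      ij.1 < ij.2 ∧ ij.1 ∈ T ∧ ij.2 ∈ S).card) •
      TensorProduct.map (parityPart (fun _ : Fin n => K) S) (parityPart (fun _ : Fin n => L) T)) ∘ₗ
  PiTensorProduct.lift (unshuffleAux K L n)

theorem unshuffle_apply (n : ℕ) (a b : Fin n → ℤ) (x : Fin n → K) (y : Fin n → L)
    (hx : ∀ i, x i ∈ K.gr (a i)) (hy : ∀ i, y i ∈ L.gr (b i)) :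
    unshuffle K L n (PiTensorProduct.tprod R fun i => x i ⊗ₜ[R] y i) =
      ((-1 : R) ^ (Finset.univ.filter fun ij : Fin n × Fin n =>
        ij.1 < ij.2 ∧ Odd (b ij.1) ∧ Odd (a ij.2)).card) •
      (PiTensorProduct.tprod R x ⊗ₜ[R] PiTensorProduct.tprod R y) := by
  have h : PiTensorProduct.lift (unshuffleAux K L n)
      (PiTensorProduct.tprod R fun i => x i ⊗ₜ[R] y i) =
      PiTensorProduct.tprod R x ⊗ₜ[R] PiTensorProduct.tprod R y := by
    rw [PiTensorProduct.lift.tprod, unshuffleAux_apply]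
  rw [unshuffle, LinearMap.comp_apply, h]
  simp only [LinearMap.sum_apply, LinearMap.smul_apply, TensorProduct.map_tmul,
    parityPart_tprod _ _ a x hx, parityPart_tprod _ _ b y hy]
  rw [Finset.sum_eq_single (Finset.univ.filter fun i => Odd (a i)),
    Finset.sum_eq_single (Finset.univ.filter fun i => Odd (b i))]
  · simp
  · intro T _ hT; simp [hT]
  · simp
  · intro S _ hS; simp [hS]
  · simp

end Shuffle

end GrComplex

/-! ### Complexes with a graded basis, normalized chains, and the cyclic resolution -/

namespace GrComplex

variable {R : Type} [CommRing R] {B : Type v}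

theorem supported_internal (deg : B → ℤ) :
    DirectSum.IsInternal fun n => Finsupp.supported R R (deg ⁻¹' {n}) := by
  classical
  refine isInternal_of_split
    (Finsupp.linearCombination R fun b => Pi.single (deg b) (Finsupp.single b (1 : R))) ?_ ?_
  · intro n x hx
    have : Finsupp.supported R R (deg ⁻¹' {n}) ≤ LinearMap.eqLocus
        (Finsupp.linearCombination R fun b => Pi.single (deg b) (Finsupp.single b (1 : R)))
        (LinearMap.single R (fun _ => B →₀ R) n) := by
      rw [Finsupp.supported_eq_span_single, Submodule.span_le]
      rintro _ ⟨b, rfl, rfl⟩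
      simp
    exact this hx
  · rw [eq_top_iff]
    rintro x -
    induction x using Finsupp.induction_linear with
    | zero => exact Submodule.zero_mem _
    | add x y hx hy => exact Submodule.add_mem _ hx hy
    | single b c => exact Submodule.mem_iSup_of_mem (deg b) (Finsupp.single_mem_supported R c rfl)

/-- The complex which is free on the basis `B`, where `b` has degree `deg b` and differential
`D b`. -/
abbrev ofBasis (deg : B → ℤ) (D : B → B →₀ R)
    (hD : ∀ b, D b ∈ Finsupp.supported R R (deg ⁻¹' {deg b + 1}))
    (hDD : ∀ b, Finsupp.linearCombination R D (D b) = 0) : GrComplex.{v} R where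
  carrier := B →₀ R
  gr n := Finsupp.supported R R (deg ⁻¹' {n})
  internal := supported_internal deg
  d := Finsupp.linearCombination R D
  d_mem n x hx := by
    have : Finsupp.supported R R (deg ⁻¹' {n}) ≤
        (Finsupp.supported R R (deg ⁻¹' {n + 1})).comap
          (Finsupp.linearCombination R D) := by
      rw [Finsupp.supported_eq_span_single, Submodule.span_le]
      rintro _ ⟨b, rfl, rfl⟩
      simpa using hD b
    exact this hx
  d_d x := by
    have : Finsupp.linearCombination R D ∘ₗ Finsupp.linearCombination R D = 0 := by
      ext b : 2
      simpa using hDD b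
    exact LinearMap.congr_fun this x

end GrComplex

namespace SSet

open Simplicial

variable (R : Type) [CommRing R]

open scoped Classical in
/-- The element of the normalized chains given by a simplex: the corresponding basis element for a
nondegenerate simplex, and `0` for a degenerate simplex. -/
def simplexChain {X : SSet.{u}} {n : ℕ} (x : X _⦋n⦌) : X.N →₀ R :=
  if h : x ∈ X.nonDegenerate n then Finsupp.single (N.mk x h) 1 else 0

theorem simplexChain_degenerate {X : SSet.{u}} {n : ℕ} (x : X _⦋n⦌) (hx : x ∈ X.degenerate n) :
    simplexChain R x = 0 := dif_neg fun h => h hx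

theorem simplexChain_N {X : SSet.{u}} (s : X.N) :
    simplexChain R s.simplex = Finsupp.single s 1 := dif_pos s.nonDegenerate

/-- The alternating sum of the faces of a simplex, in the normalized chains. -/
def faceSum {X : SSet.{u}} {n : ℕ} (x : X _⦋n⦌) : X.N →₀ R :=
  match n, x with
  | 0, _ => 0
  | n + 1, x => ∑ i : Fin (n + 2), (-1 : R) ^ (i : ℕ) • simplexChain R (X.δ i x)

theorem faceSum_succ {X : SSet.{u}} {n : ℕ} (x : X _⦋n + 1⦌) :
    faceSum R x = ∑ i : Fin (n + 2), (-1 : R) ^ (i : ℕ) • simplexChain R (X.δ i x) := rfl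

theorem simplexChain_mem {X : SSet.{u}} {n : ℕ} (x : X _⦋n⦌) :
    simplexChain R x ∈ Finsupp.supported R R ((fun s : X.N => -(s.dim : ℤ)) ⁻¹' {-(n : ℤ)}) := by
  unfold simplexChain
  split_ifs with h
  · exact Finsupp.single_mem_supported R 1 rfl
  · exact Submodule.zero_mem _

theorem faceSum_mem {X : SSet.{u}} {n : ℕ} (x : X _⦋n⦌) :
    faceSum R x ∈ Finsupp.supported R R ((fun s : X.N => -(s.dim : ℤ)) ⁻¹' {-(n : ℤ) + 1}) := by
  cases n with
  | zero => exact Submodule.zero_mem _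
  | succ n =>
    refine Submodule.sum_mem _ fun i _ => Submodule.smul_mem _ _ ?_
    have := simplexChain_mem R (X.δ i x)
    convert this using 3
    push_cast
    ring_nf

theorem faceSum_degenerate {X : SSet.{u}} {n : ℕ} (x : X _⦋n⦌) (hx : x ∈ X.degenerate n) :
    faceSum R x = 0 := by
  cases n with
  | zero => rfl
  | succ n =>
    rw [degenerate_eq_iUnion_range_σ] at hx
    obtain ⟨j, y, rfl⟩ := Set.mem_iUnion.1 hx
    rw [faceSum_succ, ← Finset.sum_subset (Finset.subset_univ {j.castSucc, j.succ})]
    · rw [Finset.sum_pair (by simp [Fin.ext_iff])]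
      have h1 : X.δ j.castSucc (X.σ j y) = y := by
        rw [← ConcreteCategory.comp_apply, SimplicialObject.δ_comp_σ_self]; rfl
      have h2 : X.δ j.succ (X.σ j y) = y := by
        rw [← ConcreteCategory.comp_apply, SimplicialObject.δ_comp_σ_succ]; rfl
      rw [h1, h2]
      simp [pow_succ]
    · intro i _ hi
      simp only [Finset.mem_insert, Finset.mem_singleton, not_or] at hi
      rw [simplexChain_degenerate, smul_zero]
      cases n with
      | zero =>
        exfalso
        obtain ⟨i, hi'⟩ := i
        obtain ⟨j, hj'⟩ := j
        simp [Fin.ext_iff] at hi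
        omega
      | succ n =>
        rcases lt_or_ge i j.castSucc with h | h
        · obtain ⟨j, rfl⟩ := Fin.eq_succ_of_ne_zero (i := j) (by
            rintro rfl; simp at h)
          have hi0 : i ≠ Fin.last _ := by
            rintro rfl
            simp [Fin.lt_def] at h
            omega
          obtain ⟨i, rfl⟩ := Fin.exists_castSucc_eq.2 hi0
          rw [← ConcreteCategory.comp_apply, SimplicialObject.δ_comp_σ_of_le]
          · exact σ_mem_degenerate _ _ _
          · simp [Fin.lt_def, Fin.le_def] at h ⊢
            omega
        · have h' : j.succ < i := by
            simp [Fin.ext_iff, Fin.lt_def, Fin.le_def] at h hi ⊢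
            omega
          obtain ⟨i, rfl⟩ := Fin.eq_succ_of_ne_zero (i := i) (by
            rintro rfl; simp at h')
          have hj0 : j ≠ Fin.last _ := by
            rintro rfl
            simp [Fin.lt_def] at h'
            omega
          obtain ⟨j, rfl⟩ := Fin.exists_castSucc_eq.2 hj0
          rw [← ConcreteCategory.comp_apply, SimplicialObject.δ_comp_σ_of_gt]
          · exact σ_mem_degenerate _ _ _
          · simp [Fin.lt_def] at h' ⊢
            omega

theorem linearCombination_simplexChain {X : SSet.{u}} {M : Type*} [AddCommGroup M] [Module R M]
    (g : ∀ {n : ℕ}, X _⦋n⦌ → M) (hg : ∀ {n : ℕ} (x : X _⦋n⦌), x ∈ X.degenerate n → g x = 0)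
    {n : ℕ} (x : X _⦋n⦌) :
    Finsupp.linearCombination R (fun s : X.N => g s.simplex) (simplexChain R x) = g x := by
  by_cases h : x ∈ X.nonDegenerate n
  · rw [simplexChain, dif_pos h, Finsupp.linearCombination_single, one_smul]; rfl
  · rw [simplexChain, dif_neg h, map_zero, hg x (by simpa [nonDegenerate] using h)]

theorem faceSum_faceSum {X : SSet.{u}} {n : ℕ} (x : X _⦋n⦌) :
    Finsupp.linearCombination R (fun s : X.N => faceSum R s.simplex) (faceSum R x) = 0 := by
  have h := fun {n : ℕ} (y : X _⦋n⦌) =>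
    linearCombination_simplexChain R (X := X) (fun {n} (x : X _⦋n⦌) => faceSum R x)
      (fun x hx => faceSum_degenerate R x hx) y
  match n, x with
  | 0, _ => exact map_zero _
  | 1, x =>
    have h0 : ∀ y : X _⦋0⦌, faceSum R y = 0 := fun _ => rfl
    simp [faceSum_succ, h, h0]
  | n + 2, x =>
    rw [faceSum_succ]
    simp only [map_sum, map_smul, h]
    simp only [faceSum_succ, Finset.smul_sum, smul_smul]
    rw [← Finset.sum_product']
    let P := Fin (n + 3) × Fin (n + 2)
    let S : Finset P := Finset.univ.filter fun ij : P => (ij.1 : ℕ) ≤ (ij.2 : ℕ)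
    rw [Finset.univ_product_univ, ← Finset.sum_add_sum_compl S, ← eq_neg_iff_add_eq_zero,
      ← Finset.sum_neg_distrib]
    refine Finset.sum_bij (fun ij (hij : ij ∈ S) => (ij.2.succ,
      Fin.castLT ij.1 (lt_of_le_of_lt (Finset.mem_filter.mp hij).right (Fin.is_lt ij.2)))) ?_ ?_ ?_ ?_
    · intro ij hij
      simp only [S, Finset.compl_filter, Finset.mem_filter_univ, Fin.val_succ,
        Fin.val_castLT] at hij ⊢
      omega
    · rintro ⟨i, j⟩ hij ⟨i', j'⟩ hij' h
      have h1 := congrArg (fun z => (z.1 : ℕ)) h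
      have h2 := congrArg (fun z => (z.2 : ℕ)) h
      simp only [Fin.val_succ, Fin.val_castLT] at h1 h2
      exact Prod.ext (Fin.ext h2) (Fin.ext (by simpa using h1))
    · rintro ⟨i, j⟩ hij
      simp only [S, Finset.compl_filter, Finset.mem_filter_univ, not_le] at hij
      refine ⟨(j.castSucc, i.pred ?_), ?_, ?_⟩
      · rintro rfl; simp at hij
      · simp only [S, Finset.mem_filter_univ, Fin.val_castSucc, Fin.val_pred]
        omega
      · simp
    · rintro ⟨i, j⟩ hij
      have hij' : (i : ℕ) ≤ j := by simpa [S] using hij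
      dsimp only
      rw [← neg_smul]
      congr 1
      · rw [Fin.val_succ, Fin.val_castLT]; ring
      · rw [← ConcreteCategory.comp_apply, ← ConcreteCategory.comp_apply]
        rw [← SimplicialObject.δ_comp_δ'' (X := X) (i := i) (j := j) hij']

/-- The normalized chain complex `C(X)`: free on the nondegenerate simplices, with the alternating
sum of faces as differential; the `n`-simplices are in degree `-n`. -/
abbrev chains (X : SSet.{u}) : GrComplex.{u} R :=
  GrComplex.ofBasis (fun s : X.N => -(s.dim : ℤ)) (fun s => faceSum R s.simplex)
    (fun s => faceSum_mem R s.simplex) (fun s => faceSum_faceSum R s.simplex)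

/-- The map of normalized chains induced by a simplicial map. -/
def chainsMap {X Y : SSet.{u}} (f : X ⟶ Y) : chains R X →ₗ[R] chains R Y :=
  Finsupp.linearCombination R fun s : X.N => simplexChain R (f.app _ s.simplex)

theorem chainsMap_simplexChain {X Y : SSet.{u}} (f : X ⟶ Y) {n : ℕ} (x : X _⦋n⦌) :
    chainsMap R f (simplexChain R x) = simplexChain R (f.app _ x) :=
  linearCombination_simplexChain R (X := X) (fun {n} (x : X _⦋n⦌) => simplexChain R (f.app _ x))
    (fun _ hx => simplexChain_degenerate R _ (degenerate_app_apply hx f)) x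

/-! ### Products of simplicial sets and the Alexander-Whitney maps -/

/-- The face of the `n`-simplex `x` on the `l + 1` consecutive vertices `a, a + 1, …, a + l`
(used only for `a + l ≤ n`, where the minimum plays no role). -/
def segment {X : SSet.{u}} {n : ℕ} (x : X _⦋n⦌) (a l : ℕ) : X _⦋l⦌ :=
  X.map (SimplexCategory.mkHom
    { toFun := fun j : Fin (l + 1) => (⟨min (a + j) n, by omega⟩ : Fin (n + 1))
      monotone' := fun i j hij => by
        have : (i : ℕ) ≤ j := hij
        simp only [Fin.mk_le_mk]
        omega } : ⦋l⦌ ⟶ ⦋n⦌).op x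

/-- The product `L₀ × ⋯ × L_{n-1}` of simplicial sets. -/
def piSSet {n : ℕ} (L : Fin n → SSet.{u}) : SSet.{u} where
  obj Δ := ∀ i, (L i).obj Δ
  map f := TypeCat.ofHom fun x i => (L i).map f (x i)

/-- The product of simplicial maps. -/
def piSSetMap {n : ℕ} {L L' : Fin n → SSet.{u}} (f : ∀ i, L i ⟶ L' i) : piSSet L ⟶ piSSet L' where
  app Δ := TypeCat.ofHom fun x i => (f i).app Δ (x i)
  naturality Δ Δ' g := by
    ext x
    funext i
    exact NatTrans.naturality_apply (f i) g (x i)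

/-- The diagonal `X → X × ⋯ × X`. -/
def piDiag (n : ℕ) (X : SSet.{u}) : X ⟶ piSSet fun _ : Fin n => X where
  app Δ := TypeCat.ofHom fun x _ => x

/-- The permutation of the factors of a product by `σ`, `(x_i)_i ↦ (x_{σ⁻¹ i})_i`. -/
def piPermute {n : ℕ} (L : Fin n → SSet.{u}) (σ : Equiv.Perm (Fin n)) :
    piSSet L ⟶ piSSet fun i => L (σ.symm i) where
  app Δ := TypeCat.ofHom fun x i => x (σ.symm i)

/-- The Alexander-Whitney map `C(X × Y) → C(X) ⊗ C(Y)`. -/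
def alexanderWhitney₂ (X Y : SSet.{u}) :
    chains R (MonoidalCategoryStruct.tensorObj X Y) →ₗ[R] GrComplex.tensor (chains R X) (chains R Y) :=
  Finsupp.linearCombination R fun s =>
    ∑ ij ∈ Finset.HasAntidiagonal.antidiagonal s.dim,
      simplexChain R (segment ((CartesianMonoidalCategory.fst X Y).app _ s.simplex) 0 ij.1) ⊗ₜ[R]
      simplexChain R (segment ((CartesianMonoidalCategory.snd X Y).app _ s.simplex) ij.1 ij.2)

/-- The Alexander-Whitney map `C(L₀ × ⋯ × L_{n-1}) → C(L₀) ⊗ ⋯ ⊗ C(L_{n-1})`: the sum over all ways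
to cut `0, …, m` into consecutive segments of lengths `l₀, …, l_{n-1}`, of the tensor
product of the restrictions of the `k`-th coordinate to the `k`-th segment. -/
def alexanderWhitney {n : ℕ} (L : Fin n → SSet.{u}) :
    chains R (piSSet L) →ₗ[R] GrComplex.piTensor fun i => chains R (L i) :=
  Finsupp.linearCombination R fun s =>
    ∑ l ∈ Finset.piAntidiag (Finset.univ : Finset (Fin n)) s.dim,
      PiTensorProduct.tprod R fun k =>
        simplexChain R (segment (X := L k) (s.simplex k) (∑ i ∈ Finset.univ.filter (· < k), l i) (l k))

end SSet

/-! ### The cyclic resolution -/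

/-- The cyclic group `π ⊆ Σ_p` generated by the cycle `α : i ↦ i + 1`. -/
abbrev cyclicSubgroup (p : ℕ) : Subgroup (Equiv.Perm (Fin p)) := Subgroup.zpowers (finRotate p)

/-- The generator `α` of `π`. -/
def cyclicGen (p : ℕ) : cyclicSubgroup p := ⟨finRotate p, Subgroup.mem_zpowers _⟩

theorem cyclicGen_pow (p : ℕ) : cyclicGen p ^ p = 1 := by
  match p with
  | 0 => simp
  | 1 => ext i; exact congrArg _ (Subsingleton.elim _ _)
  | n + 2 =>
    have h : orderOf (finRotate (n + 2)) = n + 2 := by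
      rw [isCycle_finRotate.orderOf, support_finRotate]; simp
    ext1
    simpa [cyclicGen, h] using pow_orderOf_eq_one (finRotate (n + 2))

/-- The differential of the basis element `τ e_n` of `W`: it is `τ (α - 1) e_{n-1}` for odd `n` and
`τ (1 + α + ⋯ + α ^ (p - 1)) e_{n-1}` for even `n > 0`. -/
def cyclicD (p : ℕ) (b : ℕ × cyclicSubgroup p) : ℕ × cyclicSubgroup p →₀ ZMod p :=
  match b with
  | (0, _) => 0
  | (n + 1, τ) =>
    if Even n then Finsupp.single (n, τ * cyclicGen p) 1 - Finsupp.single (n, τ) 1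
    else ∑ k ∈ Finset.range p, Finsupp.single (n, τ * cyclicGen p ^ k) 1

/-- The canonical resolution `W` of `Λ = ℤ/p`, which has the `Λ`-basis `τ e_n` with `τ ∈ π`,
`n ≥ 0`, encoded as the pairs `(n, τ)`. -/
abbrev cyclicResolution (p : ℕ) : GrComplex.{0} (ZMod p) :=
  GrComplex.ofBasis (fun b : ℕ × cyclicSubgroup p => -(b.1 : ℤ)) (cyclicD p)
    (by
      rintro ⟨n, τ⟩
      match n with
      | 0 => exact Submodule.zero_mem _
      | n + 1 =>
        have h : ∀ σ : cyclicSubgroup p, Finsupp.single (n, σ) (1 : ZMod p) ∈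
            Finsupp.supported (ZMod p) (ZMod p)
              ((fun b : ℕ × cyclicSubgroup p => -(b.1 : ℤ)) ⁻¹' {-((n + 1 : ℕ) : ℤ) + 1}) :=
          fun σ => Finsupp.single_mem_supported _ _ (by simp)
        unfold cyclicD
        dsimp only
        split_ifs
        · exact Submodule.sub_mem _ (h _) (h _)
        · exact Submodule.sum_mem _ fun k _ => h _)
    (by
      rintro ⟨n, τ⟩
      match n with
      | 0 => exact map_zero _
      | 1 => simp [cyclicD]
      | n + 2 =>
        have key : ∀ σ : cyclicSubgroup p,
            ∑ k ∈ Finset.range p, (Finsupp.single (n, σ * cyclicGen p ^ k * cyclicGen p) (1 : ZMod p) -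
              Finsupp.single (n, σ * cyclicGen p ^ k) 1) = 0 := by
          intro σ
          have := Finset.sum_range_sub
            (fun k => Finsupp.single (n, σ * cyclicGen p ^ k) (1 : ZMod p)) p
          simp only [pow_succ, ← mul_assoc] at this
          rw [this]
          simp [cyclicGen_pow]
        by_cases hn : Even n
        · have hn' : ¬ Even (n + 1) := by simpa [Nat.even_add_one] using hn
          simpa [cyclicD, hn, hn'] using key τ
        · have hn' : Even (n + 1) := by simpa [Nat.even_add_one] using hn
          have := key τ
          simp only [cyclicD, hn, hn', if_true, if_false, map_sub,
            Finsupp.linearCombination_single, one_smul]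
          rw [Finset.sum_sub_distrib] at this
          simpa only [mul_assoc, (Commute.refl (cyclicGen p)).pow_right _ |>.eq] using this)

/-- The basis element `τ e_n` of `W`. -/
def cyclicBasis (p n : ℕ) (τ : cyclicSubgroup p) : cyclicResolution p := Finsupp.single (n, τ) 1

/-- The action of `π` on `W`. -/
def cyclicAct (p : ℕ) (σ : cyclicSubgroup p) :
    cyclicResolution p →ₗ[ZMod p] cyclicResolution p :=
  Finsupp.lmapDomain (ZMod p) (ZMod p) fun b => (b.1, σ * b.2)

/-- The augmentation `ε : W → Λ`. -/
def cyclicAug (p : ℕ) : cyclicResolution p →ₗ[ZMod p] ZMod p :=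
  Finsupp.linearCombination (ZMod p) fun b => if b.1 = 0 then 1 else 0

/-- The part of the coproduct of `e_{a+b}` in `W_a ⊗ W_b`. -/
def cyclicCoprodTerm (p a b : ℕ) : cyclicResolution p ⊗[ZMod p] cyclicResolution p :=
  if Even a then cyclicBasis p a 1 ⊗ₜ cyclicBasis p b 1
  else if Even b then cyclicBasis p a 1 ⊗ₜ cyclicBasis p b (cyclicGen p)
  else ∑ s ∈ Finset.range p, ∑ r ∈ Finset.range s,
    cyclicBasis p a (cyclicGen p ^ r) ⊗ₜ cyclicBasis p b (cyclicGen p ^ s)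

/-- The coproduct `ψ : W → W ⊗ W`, the `π`-equivariant map with
`ψ e_{2i+1} = ∑_{j+k=i} e_{2j} ⊗ e_{2k+1} + ∑_{j+k=i} e_{2j+1} ⊗ α e_{2k}` and
`ψ e_{2i} = ∑_{j+k=i} e_{2j} ⊗ e_{2k} + ∑_{j+k=i-1} ∑_{0≤r<s<p} α^r e_{2j+1} ⊗ α^s e_{2k+1}`. -/
def cyclicCoprod (p : ℕ) :
    cyclicResolution p →ₗ[ZMod p] GrComplex.tensor (cyclicResolution p) (cyclicResolution p) :=
  Finsupp.linearCombination (ZMod p) fun b =>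
    TensorProduct.map (cyclicAct p b.2) (cyclicAct p b.2)
      (∑ ij ∈ Finset.HasAntidiagonal.antidiagonal b.1, cyclicCoprodTerm p ij.1 ij.2)

/-! ### The category of algebras with a reduced power structure -/

namespace GrComplex

variable {R : Type} [CommRing R]

/-- `f` is a morphism of complexes: it preserves degrees and commutes with the differentials. -/
def IsMor (K : GrComplex.{v} R) (L : GrComplex.{w} R) (f : K →ₗ[R] L) : Prop :=
  (∀ n, ∀ x ∈ K.gr n, f x ∈ L.gr n) ∧ ∀ x, f (K.d x) = L.d (f x)

/-- `h` is a homotopy from `f` to `g`. -/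
def IsHomotopy (K : GrComplex.{v} R) (L : GrComplex.{w} R) (f g h : K →ₗ[R] L) : Prop :=
  (∀ n, ∀ x ∈ K.gr n, h x ∈ L.gr (n - 1)) ∧ ∀ x, f x - g x = L.d (h x) + h (K.d x)

/-- `f` and `g` are homotopic. -/
def Homotopic (K : GrComplex.{v} R) (L : GrComplex.{w} R) (f g : K →ₗ[R] L) : Prop :=
  ∃ h, IsHomotopy K L f g h

/-- `f` and `g` are equivariantly homotopic, for an action `act` of `Γ` on `K` and the trivial
action on `L`. -/
def EquivHomotopic {Γ : Type*} (K : GrComplex.{v} R) (L : GrComplex.{w} R) (act : Γ → K →ₗ[R] K)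
    (f g : K →ₗ[R] L) : Prop :=
  ∃ h, IsHomotopy K L f g h ∧ ∀ σ x, h (act σ x) = h x

end GrComplex

open GrComplex

/-- A free resolution `V` of the trivial module `R` over the group ring `R[Γ]`, with `V_n` in
degree `-n`. -/
structure FreeResolution (R : Type) [CommRing R] (Γ : Type) [Group Γ] where
  cx : GrComplex.{w} R
  act : Γ →* (cx →ₗ[R] cx)
  act_mor : ∀ σ, IsMor cx cx (act σ)
  gr_pos : ∀ n, 0 < n → cx.gr n = ⊥
  /-- freeness over `R[Γ]` on a set of homogeneous elements -/
  free : ∃ (B : Type w) (b : Module.Basis (Γ × B) R cx) (deg : B → ℤ),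
    (∀ β, b (1, β) ∈ cx.gr (deg β)) ∧ ∀ σ β, b (σ, β) = act σ (b (1, β))
  aug : cx →ₗ[R] R
  aug_act : ∀ σ x, aug (act σ x) = aug x
  aug_of_ne : ∀ n, n ≠ 0 → ∀ x ∈ cx.gr n, aug x = 0
  aug_d : ∀ x, aug (cx.d x) = 0
  aug_surjective : Function.Surjective aug
  exact : ∀ n, ∀ x ∈ cx.gr n, cx.d x = 0 → aug x = 0 → ∃ y ∈ cx.gr (n - 1), cx.d y = x

/-- A morphism `j : W → V` of complexes of `Λ[π]`-modules over `Λ`, where `V` is a free resolution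
of `Λ` over `Λ[Σ_p]`. -/
structure ResolutionMap (p : ℕ) (V : FreeResolution.{w} (ZMod p) (Equiv.Perm (Fin p))) where
  map : cyclicResolution p →ₗ[ZMod p] V.cx
  mor : IsMor (cyclicResolution p) V.cx map
  equivariant : ∀ (σ : cyclicSubgroup p) x, map (cyclicAct p σ x) = V.act σ (map x)
  aug : ∀ x, V.aug (map x) = cyclicAug p x

/-- The diagonal action of `σ ∈ π` on `W ⊗ K^p`. -/
def cyclicPowerAct (p : ℕ) (K : GrComplex.{v} (ZMod p)) (σ : cyclicSubgroup p) :
    tensor (cyclicResolution p) (power K p) →ₗ[ZMod p] tensor (cyclicResolution p) (power K p) :=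
  TensorProduct.map (cyclicAct p σ) (permute (fun _ : Fin p => K) σ)

/-- A complex `K` with a map `θ : W ⊗ K^p → K`. -/
structure MayPair (p : ℕ) where
  cx : GrComplex.{v} (ZMod p)
  θ : tensor (cyclicResolution p) (power cx p) →ₗ[ZMod p] cx

/-- A pair `(K, θ)` together with a product `K ⊗ K → K`. -/
structure MayAlgebra (p : ℕ) extends MayPair.{v} p where
  mul : tensor cx cx →ₗ[ZMod p] cx

/-- `f : Kⁿ → K` is the iterated product, associated in some order. -/
inductive IsIteratedProduct {p : ℕ} (A : MayAlgebra.{v} p) : (n : ℕ) → ((Fin n → A.cx) → A.cx) → Prop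
  | one : IsIteratedProduct A 1 fun x => x 0
  | mul {m n : ℕ} {f : (Fin m → A.cx) → A.cx} {g : (Fin n → A.cx) → A.cx} :
      IsIteratedProduct A m f → IsIteratedProduct A n g →
      IsIteratedProduct A (m + n) fun x =>
        A.mul (f (fun i => x (Fin.castAdd n i)) ⊗ₜ g (fun i => x (Fin.natAdd m i)))

/-- `(K, θ)` is an object of the category `𝔠(p)`, defined with the resolution `V` and the map
`j : W → V`. -/
structure IsMayObject {p : ℕ} (V : FreeResolution.{w} (ZMod p) (Equiv.Perm (Fin p)))
    (j : ResolutionMap p V) (A : MayAlgebra.{v} p) : Prop where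
  mul_mor : IsMor (tensor A.cx A.cx) A.cx A.mul
  /-- the product is homotopy associative -/
  mul_assoc : Homotopic (tensor (tensor A.cx A.cx) A.cx) A.cx
    (A.mul ∘ₗ TensorProduct.map A.mul LinearMap.id)
    (A.mul ∘ₗ TensorProduct.map LinearMap.id A.mul ∘ₗ
      (TensorProduct.assoc (ZMod p) A.cx A.cx A.cx).toLinearMap)
  θ_mor : IsMor (tensor (cyclicResolution p) (power A.cx p)) A.cx A.θ
  θ_equivariant : ∀ σ x, A.θ (cyclicPowerAct p A.cx σ x) = A.θ x
  /-- the restriction of `θ` to `e₀ ⊗ K^p` is homotopic to the iterated product -/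
  iterated : ∃ m : power A.cx p →ₗ[ZMod p] A.cx,
    IsIteratedProduct A p (fun x => m (PiTensorProduct.tprod (ZMod p) x)) ∧
    Homotopic (power A.cx p) A.cx
      (A.θ ∘ₗ TensorProduct.mk (ZMod p) _ _ (cyclicBasis p 0 1)) m
  /-- up to equivariant homotopy, `θ` extends to a morphism of `Λ[Σ_p]`-complexes on `V ⊗ K^p` -/
  symmetric : ∃ φ : tensor V.cx (power A.cx p) →ₗ[ZMod p] A.cx,
    IsMor (tensor V.cx (power A.cx p)) A.cx φ ∧
    (∀ (σ : Equiv.Perm (Fin p)) x,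
      φ (TensorProduct.map (V.act σ) (permute (fun _ : Fin p => A.cx) σ) x) = φ x) ∧
    EquivHomotopic (tensor (cyclicResolution p) (power A.cx p)) A.cx (cyclicPowerAct p A.cx) A.θ
      (φ ∘ₗ TensorProduct.map j.map LinearMap.id)

/-- `f : (K, θ) → (K', θ')` is a morphism of `𝔠(p)`: a morphism of complexes such that `f ∘ θ` and
`θ' ∘ (id ⊗ f^p)` are `Λ[π]`-homotopic. -/
def IsMayMorphism {p : ℕ} (A : MayPair.{v} p) (B : MayPair.{w} p)
    (f : A.cx →ₗ[ZMod p] B.cx) : Prop :=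
  IsMor A.cx B.cx f ∧
    EquivHomotopic (tensor (cyclicResolution p) (power A.cx p)) B.cx (cyclicPowerAct p A.cx)
      (f ∘ₗ A.θ) (B.θ ∘ₗ TensorProduct.map LinearMap.id (PiTensorProduct.map fun _ => f))

/-- The tensor product `(K ⊗ K', θ̃)` of two pairs, where `θ̃` is the composite
`W ⊗ (K ⊗ K')^p → (W ⊗ W) ⊗ (K^p ⊗ K'^p) → (W ⊗ K^p) ⊗ (W ⊗ K'^p) → K ⊗ K'`. -/
def MayPair.tensor {p : ℕ} (A : MayPair.{v} p) (B : MayPair.{w} p) : MayPair.{max v w} p where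
  cx := GrComplex.tensor A.cx B.cx
  θ := TensorProduct.map A.θ B.θ ∘ₗ
    -- `id ⊗ swap ⊗ id`
    (TensorProduct.assoc (ZMod p) (cyclicResolution p) (power A.cx p) _).symm.toLinearMap ∘ₗ
    TensorProduct.map LinearMap.id
      ((TensorProduct.assoc (ZMod p) (power A.cx p) (cyclicResolution p) (power B.cx p)).toLinearMap ∘ₗ
        TensorProduct.map (swap (cyclicResolution p) (power A.cx p)) LinearMap.id ∘ₗ
        (TensorProduct.assoc (ZMod p) (cyclicResolution p) (power A.cx p)
          (power B.cx p)).symm.toLinearMap) ∘ₗ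
    (TensorProduct.assoc (ZMod p) (cyclicResolution p) (cyclicResolution p) _).toLinearMap ∘ₗ
    TensorProduct.map (cyclicCoprod p) (unshuffle A.cx B.cx p)

/-- `(K, θ)` is a Cartan object: an object of `𝔠(p)` whose product is a morphism
`(K ⊗ K, θ̃) → (K, θ)`. -/
def IsCartanObject {p : ℕ} (V : FreeResolution.{w} (ZMod p) (Equiv.Perm (Fin p)))
    (j : ResolutionMap p V) (A : MayAlgebra.{v} p) : Prop :=
  IsMayObject V j A ∧ IsMayMorphism (A.toMayPair.tensor A.toMayPair) A.toMayPair A.mul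

/-! ### Further facts on chains -/

namespace GrComplex

variable {R : Type} [CommRing R]

theorem scale_natural {K : GrComplex.{v} R} {L : GrComplex.{w} R} (c : ℤ → R) (g : K →ₗ[R] L)
    (hg : ∀ n, ∀ x ∈ K.gr n, g x ∈ L.gr n) (x : K) : g (K.scale c x) = L.scale c (g x) := by
  have : g ∘ₗ K.scale c = L.scale c ∘ₗ g := K.hom_ext fun n x hx => by
    simp [scale_of_mem K c hx, scale_of_mem L c (hg n x hx)]
  exact LinearMap.congr_fun this x

theorem parityPart_natural {n : ℕ} {K : Fin n → GrComplex.{v} R} {L : Fin n → GrComplex.{w} R}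
    (S : Finset (Fin n)) (g : ∀ i, K i →ₗ[R] L i)
    (hg : ∀ i, ∀ m, ∀ x ∈ (K i).gr m, g i x ∈ (L i).gr m) (z : ⨂[R] i, K i) :
    PiTensorProduct.map g (parityPart K S z) = parityPart L S (PiTensorProduct.map g z) := by
  have : PiTensorProduct.map g ∘ₗ parityPart K S = parityPart L S ∘ₗ PiTensorProduct.map g := by
    unfold parityPart
    rw [← PiTensorProduct.map_comp, ← PiTensorProduct.map_comp]
    congr 1
    funext i
    split_ifs <;> ext x <;> exact scale_natural _ (g i) (hg i) x
  exact LinearMap.congr_fun this z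

theorem evalSign_natural {n : ℕ} {K : Fin n → GrComplex.{v} R} {L : Fin n → GrComplex.{w} R}
    (g : ∀ i, K i →ₗ[R] L i)
    (hg : ∀ i, ∀ m, ∀ x ∈ (K i).gr m, g i x ∈ (L i).gr m) (z : ⨂[R] i, K i) :
    PiTensorProduct.map g (evalSign K z) = evalSign L (PiTensorProduct.map g z) := by
  simp only [evalSign, signOp, LinearMap.sum_apply, LinearMap.smul_apply, map_sum, map_smul,
    parityPart_natural _ g hg]

theorem koszul_natural {K : GrComplex.{v} R} {L : GrComplex.{w} R}
    {K' : GrComplex.{v} R} {L' : GrComplex.{w} R} (g : K →ₗ[R] K') (h : L →ₗ[R] L')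
    (hg : ∀ n, ∀ x ∈ K.gr n, g x ∈ K'.gr n) (hh : ∀ n, ∀ x ∈ L.gr n, h x ∈ L'.gr n)
    (z : K ⊗[R] L) :
    TensorProduct.map g h (koszul K L z) = koszul K' L' (TensorProduct.map g h z) := by
  induction z using TensorProduct.induction_on with
  | zero => simp
  | add x y hx hy => simp only [map_add, hx, hy]
  | tmul x y =>
    simp [koszul, evenPart, oddPart, sgn, scale_natural _ g hg, scale_natural _ h hh]

theorem koszul_tmul {K : GrComplex.{v} R} {L : GrComplex.{w} R} {m n : ℤ} {x : K} {y : L}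
    (hx : x ∈ K.gr m) (hy : y ∈ L.gr n) :
    koszul K L (x ⊗ₜ[R] y) = (if Odd m ∧ Odd n then (-1 : R) else 1) • x ⊗ₜ[R] y := by
  by_cases h : Even m <;> by_cases h' : Even n <;>
    simp [koszul, evenPart, oddPart, sgn, scale_of_mem K _ hx, scale_of_mem L _ hy, h, h',
      ← Int.not_even_iff_odd, TensorProduct.tmul_neg]

theorem ofBasis_gr_pos {B : Type v} {deg : B → ℤ} (hdeg : ∀ b, deg b ≤ 0) {n : ℤ} (hn : 0 < n)
    {x : B →₀ R} (hx : x ∈ Finsupp.supported R R (deg ⁻¹' {n})) : x = 0 := by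
  have : deg ⁻¹' {n} = ∅ := by
    ext b
    have := hdeg b
    simp
    omega
  rw [this] at hx
  simpa using hx

end GrComplex

namespace SSet

open Simplicial

variable (R : Type) [CommRing R]

theorem simplexChain_mem_gr {X : SSet.{u}} {n : ℕ} (x : X _⦋n⦌) :
    simplexChain R x ∈ (chains R X).gr (-(n : ℤ)) := simplexChain_mem R x

theorem chains_gr_pos {X : SSet.{u}} {n : ℤ} (hn : 0 < n) {x : chains R X}
    (hx : x ∈ (chains R X).gr n) : x = 0 :=
  GrComplex.ofBasis_gr_pos (fun s => by simp) hn hx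

theorem chains_hom_ext {X : SSet.{u}} {M : Type*} [AddCommGroup M] [Module R M]
    {f g : chains R X →ₗ[R] M}
    (h : ∀ (n : ℕ) (x : X _⦋n⦌), f (simplexChain R x) = g (simplexChain R x)) : f = g := by
  ext s
  simpa [simplexChain_N] using h s.dim s.simplex

theorem chainsMap_mem {X Y : SSet.{u}} (f : X ⟶ Y) (n : ℤ) (x : chains R X)
    (hx : x ∈ (chains R X).gr n) : chainsMap R f x ∈ (chains R Y).gr n := by
  have : (chains R X).gr n ≤ ((chains R Y).gr n).comap (chainsMap R f) := by
    dsimp only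
    rw [Finsupp.supported_eq_span_single, Submodule.span_le]
    rintro _ ⟨s, rfl, rfl⟩
    have h := simplexChain_mem_gr R (f.app _ s.simplex)
    rw [← chainsMap_simplexChain, simplexChain_N] at h
    exact h
  exact this hx

theorem chainsMap_comp {X Y Z : SSet.{u}} (f : X ⟶ Y) (g : Y ⟶ Z) (x : chains R X) :
    chainsMap R (f ≫ g) x = chainsMap R g (chainsMap R f x) := by
  have : chainsMap R (f ≫ g) = chainsMap R g ∘ₗ chainsMap R f := by
    refine chains_hom_ext (X := X) R fun n x => ?_
    rw [LinearMap.comp_apply, chainsMap_simplexChain, chainsMap_simplexChain,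
      chainsMap_simplexChain]
    rfl
  exact LinearMap.congr_fun this x

theorem chains_d_simplexChain {X : SSet.{u}} {n : ℕ} (x : X _⦋n⦌) :
    (chains R X).d (simplexChain R x) = faceSum R x :=
  linearCombination_simplexChain R (X := X) (fun {n} (x : X _⦋n⦌) => faceSum R x)
    (fun x hx => faceSum_degenerate R x hx) x

theorem chainsMap_d {X Y : SSet.{u}} (f : X ⟶ Y) (x : chains R X) :
    chainsMap R f ((chains R X).d x) = (chains R Y).d (chainsMap R f x) := by
  have : chainsMap R f ∘ₗ (chains R X).d = (chains R Y).d ∘ₗ chainsMap R f := by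
      refine chains_hom_ext (X := X) R fun n x => ?_
      rw [LinearMap.comp_apply, LinearMap.comp_apply, chains_d_simplexChain,
        chainsMap_simplexChain, chains_d_simplexChain]
      cases n with
      | zero => exact map_zero _
      | succ n =>
        rw [faceSum_succ, faceSum_succ, map_sum]
        refine Finset.sum_congr rfl fun i _ => ?_
        rw [map_smul, chainsMap_simplexChain]
        congr 2
        exact NatTrans.naturality_apply f (SimplexCategory.δ i).op x
  exact LinearMap.congr_fun this x

theorem segment_naturality {X Y : SSet.{u}} (f : X ⟶ Y) {n : ℕ} (x : X _⦋n⦌) (a l : ℕ) :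
    segment (f.app _ x) a l = f.app _ (segment x a l) :=
  (NatTrans.naturality_apply f _ x).symm

theorem segment_degenerate {X : SSet.{u}} {n : ℕ} (x : X _⦋n⦌) (k : Fin (n + 1)) (a l : ℕ)
    (h1 : a ≤ k) (h2 : (k : ℕ) + 1 ≤ a + l) :
    segment (X.σ k x) a l ∈ X.degenerate l := by
  by_contra h
  have h' : segment (X.σ k x) a l ∈ X.nonDegenerate l := h
  unfold segment at h'
  rw [SimplicialObject.σ, ← ConcreteCategory.comp_apply, ← Functor.map_comp, ← op_comp] at h'
  have hm := X.mono_of_nonDegenerate ⟨_, h'⟩ _ x rfl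
  rw [SimplexCategory.mono_iff_injective] at hm
  have hk := k.is_lt
  have e := @hm (⟨k - a, by omega⟩ : Fin (l + 1)) (⟨k + 1 - a, by omega⟩ : Fin (l + 1)) (by
    have e1 : min (a + (k - a)) (n + 1) = (k : ℕ) := by omega
    have e2 : min (a + (k + 1 - a)) (n + 1) = (k : ℕ) + 1 := by omega
    change Fin.predAbove k ⟨min (a + (k - a)) (n + 1), _⟩ =
      Fin.predAbove k ⟨min (a + (k + 1 - a)) (n + 1), _⟩
    simp only [e1, e2]
    have c1 : (⟨k, by omega⟩ : Fin (n + 2)) = k.castSucc := rfl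
    have c2 : (⟨(k : ℕ) + 1, by omega⟩ : Fin (n + 2)) = k.succ := rfl
    rw [c1, c2]
    simp)
  simp only [Fin.mk.injEq] at e
  omega

/-- The Alexander-Whitney diagonal `C(X) → C(X × X) → C(X) ⊗ C(X)`. -/
def chainsDiag (X : SSet.{u}) : chains R X →ₗ[R] GrComplex.tensor (chains R X) (chains R X) :=
  alexanderWhitney₂ R X X ∘ₗ chainsMap R (CartesianMonoidalCategory.lift (𝟙 X) (𝟙 X))

theorem chainsDiag_simplexChain {X : SSet.{u}} {n : ℕ} (x : X _⦋n⦌) :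
    chainsDiag R X (simplexChain R x) = ∑ ij ∈ Finset.HasAntidiagonal.antidiagonal n,
      simplexChain R (segment x 0 ij.1) ⊗ₜ[R] simplexChain R (segment x ij.1 ij.2) := by
  by_cases h : x ∈ X.nonDegenerate n
  · rw [chainsDiag, LinearMap.comp_apply, chainsMap_simplexChain]
    have h' : (CartesianMonoidalCategory.lift (𝟙 X) (𝟙 X)).app _ x ∈
        (MonoidalCategoryStruct.tensorObj X X).nonDegenerate n := fun hd =>
      h (degenerate_app_apply hd (CartesianMonoidalCategory.fst X X))
    rw [simplexChain, dif_pos h', alexanderWhitney₂, Finsupp.linearCombination_single, one_smul]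
    rfl
  · have hx : x ∈ X.degenerate n := by simpa [nonDegenerate] using h
    rw [simplexChain_degenerate R x hx, map_zero]
    symm
    refine Finset.sum_eq_zero fun ij hij => ?_
    rw [Finset.HasAntidiagonal.mem_antidiagonal] at hij
    cases n with
    | zero => simp at hx
    | succ n =>
      rw [degenerate_eq_iUnion_range_σ] at hx
      obtain ⟨k, y, rfl⟩ := Set.mem_iUnion.1 hx
      have hk := k.is_lt
      by_cases hki : (k : ℕ) + 1 ≤ ij.1
      · rw [simplexChain_degenerate R _ (segment_degenerate y k 0 ij.1 (by omega) (by omega)),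
          TensorProduct.zero_tmul]
      · rw [simplexChain_degenerate R _ (segment_degenerate y k ij.1 ij.2 (by omega) (by omega)),
          TensorProduct.tmul_zero]

theorem chainsDiag_natural {X Y : SSet.{u}} (f : X ⟶ Y) (x : chains R X) :
    TensorProduct.map (chainsMap R f) (chainsMap R f) (chainsDiag R X x) =
      chainsDiag R Y (chainsMap R f x) := by
  have : TensorProduct.map (chainsMap R f) (chainsMap R f) ∘ₗ chainsDiag R X =
      chainsDiag R Y ∘ₗ chainsMap R f := by
    refine chains_hom_ext (X := X) (M := chains R Y ⊗[R] chains R Y) R fun n x => ?_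
    rw [LinearMap.comp_apply, LinearMap.comp_apply, chainsMap_simplexChain,
      chainsDiag_simplexChain, chainsDiag_simplexChain, map_sum]
    refine Finset.sum_congr rfl fun ij _ => ?_
    rw [TensorProduct.map_tmul, chainsMap_simplexChain, chainsMap_simplexChain,
      segment_naturality, segment_naturality]
  exact LinearMap.congr_fun this x

end SSet

/-! ### Systems over the orbit category -/

/-- The category `O_G` of the orbits `G/H` of `G`, with the `G`-maps as morphisms. -/
structure OrbitCat (G : Type*) [Group G] where
  subgroup : Subgroup G

instance (G : Type*) [Group G] : Category (OrbitCat G) where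
  Hom H K := (G ⧸ H.subgroup) →[G] (G ⧸ K.subgroup)
  id H := MulActionHom.id G
  comp f g := MulActionHom.comp g f

/-- An action of the `O_G`-group `ρ` on an object `F` of `C` over `O_G`: actions of the groups
`ρ(G/H)` on the `F(G/H)` by morphisms of `C`, natural in `G/H`. -/
structure OGAction {G : Type a} [Group G] (ρ : (OrbitCat G)ᵒᵖ ⥤ GrpCat.{b}) {C : Type*} [Category C]
    (F : (OrbitCat G)ᵒᵖ ⥤ C) where
  act : ∀ H, ρ.obj H →* End (F.obj H)
  naturality : ∀ {H K} (f : H ⟶ K) (σ : ρ.obj H),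
    End.asHom (act H σ) ≫ F.map f = F.map f ≫ End.asHom (act K (ρ.map f σ))

/-- The objects `(T, M, ρ)` of the category `𝒜_Λ`: an `O_G`-simplicial set `T`, an
`O_G`-`Λ`-algebra `M` and an `O_G`-group `ρ` which operates on both `T` and `M`. -/
structure OrbitTriple (p : ℕ) (G : Type a) [Group G] where
  T : (OrbitCat G)ᵒᵖ ⥤ SSet.{u}
  M : (OrbitCat G)ᵒᵖ ⥤ CommAlgCat.{c} (ZMod p)
  ρ : (OrbitCat G)ᵒᵖ ⥤ GrpCat.{b}
  actT : OGAction ρ T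
  actM : OGAction ρ M

namespace OrbitTriple

variable {p : ℕ} {G : Type a} [Group G] (X : OrbitTriple.{u, a, b, c} p G)

/-- The chain complex `C(T(G/H))`. -/
abbrev C (H : (OrbitCat G)ᵒᵖ) : GrComplex.{u} (ZMod p) := SSet.chains (ZMod p) (X.T.obj H)

/-- The families of linear maps `C(T(G/H)) → M(G/H)` which are natural in `G/H` and
`ρ`-equivariant, and vanish in all large degrees, i.e. the direct sum over `n` of the modules
`Hom_ρ(C_n(T), M)`. -/
def cochainSubmodule : Submodule (ZMod p) (∀ H, X.C H →ₗ[ZMod p] X.M.obj H) where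
  carrier := {f |
    (∀ ⦃H K⦄ (g : H ⟶ K) x, f K (SSet.chainsMap (ZMod p) (X.T.map g) x) = (X.M.map g).hom (f H x)) ∧
    (∀ H (σ : X.ρ.obj H) x, f H (SSet.chainsMap (ZMod p) (End.asHom (X.actT.act H σ)) x) =
      (End.asHom (X.actM.act H σ)).hom (f H x)) ∧
    ∃ N : ℕ, ∀ H, ∀ n : ℕ, N ≤ n → ∀ x ∈ (X.C H).gr (-(n : ℤ)), f H x = 0}
  zero_mem' := ⟨by simp, by simp, 0, by simp⟩
  add_mem' := by
    rintro f f' ⟨h1, h2, N, h3⟩ ⟨h1', h2', N', h3'⟩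
    refine ⟨fun H K g x => ?_, fun H σ x => ?_, max N N', fun H n hn x hx => ?_⟩
    · simp [h1 g, h1' g]
    · simp [h2, h2']
    · simp [h3 H n (by omega) x hx, h3' H n (by omega) x hx]
  smul_mem' := by
    rintro c f ⟨h1, h2, N, h3⟩
    refine ⟨fun H K g x => ?_, fun H σ x => ?_, N, fun H n hn x hx => ?_⟩
    · simp [h1 g]
    · simp [h2]
    · simp [h3 H n hn x hx]

/-- The cochains of degree `k`: those which vanish on `C_n(T)` for `n ≠ k`. -/
def cochainGr (k : ℤ) : Submodule (ZMod p) X.cochainSubmodule where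
  carrier := {f | ∀ H, ∀ n, n ≠ -k → ∀ x ∈ (X.C H).gr n, f.1 H x = 0}
  zero_mem' := by simp
  add_mem' := by
    intro f f' h h' H n hn x hx
    simp [h H n hn x hx, h' H n hn x hx]
  smul_mem' := by
    intro c f h H n hn x hx
    simp [h H n hn x hx]

/-- The component of degree `k` of a cochain. -/
def cochainProj (k : ℤ) : X.cochainSubmodule →ₗ[ZMod p] X.cochainSubmodule :=
  LinearMap.restrict
    (LinearMap.pi fun H => LinearMap.lcomp (ZMod p) _ ((X.C H).scale (Pi.single (-k) 1)) ∘ₗ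
      LinearMap.proj H) (by
    rintro f ⟨h1, h2, N, h3⟩
    refine ⟨fun H K g x => ?_, fun H σ x => ?_, N, fun H n hn x hx => ?_⟩
    · simp only [LinearMap.pi_apply, LinearMap.comp_apply, LinearMap.proj_apply,
        LinearMap.lcomp_apply]
      rw [← GrComplex.scale_natural _ _ (SSet.chainsMap_mem (ZMod p) (X.T.map g)), h1]
    · simp only [LinearMap.pi_apply, LinearMap.comp_apply, LinearMap.proj_apply,
        LinearMap.lcomp_apply]
      rw [← GrComplex.scale_natural _ _ (SSet.chainsMap_mem (ZMod p) _), h2]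
    · simp only [LinearMap.pi_apply, LinearMap.comp_apply, LinearMap.proj_apply,
        LinearMap.lcomp_apply]
      rw [GrComplex.scale_of_mem _ _ hx, map_smul, h3 H n hn x hx, smul_zero])

theorem cochainProj_apply (k : ℤ) (f : X.cochainSubmodule) (H : (OrbitCat G)ᵒᵖ) {n : ℤ} {x : X.C H}
    (hx : x ∈ (X.C H).gr n) : (X.cochainProj k f).1 H x = if n = -k then f.1 H x else 0 := by
  change f.1 H ((X.C H).scale (Pi.single (-k) 1) x) = _
  rw [GrComplex.scale_of_mem _ _ hx]
  split_ifs with h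
  · subst h; simp
  · simp [Pi.single_eq_of_ne h]

theorem cochain_ext {f g : X.cochainSubmodule}
    (h : ∀ H, ∀ n, ∀ x ∈ (X.C H).gr n, f.1 H x = g.1 H x) : f = g :=
  Subtype.ext (funext fun H => (X.C H).hom_ext (h H))

theorem cochain_internal : DirectSum.IsInternal X.cochainGr := by
  refine GrComplex.isInternal_of_split (LinearMap.pi fun k => X.cochainProj k) ?_ ?_
  · intro n f hf
    funext k
    refine X.cochain_ext fun H m x hx => ?_
    rw [LinearMap.pi_apply, X.cochainProj_apply k f H hx]
    by_cases hk : k = n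
    · subst hk
      split_ifs with h
      · simp
      · simp [hf H m h x hx]
    · rw [Pi.single_eq_of_ne hk]
      split_ifs with h
      · exact hf H m (by omega) x hx
      · rfl
  · rw [eq_top_iff]
    rintro f -
    obtain ⟨N, hN⟩ := f.2.2.2
    have : f = ∑ k ∈ Finset.range N, X.cochainProj k f := by
      refine X.cochain_ext fun H m x hx => ?_
      rw [AddSubmonoidClass.coe_finsetSum, Finset.sum_apply, LinearMap.sum_apply,
        Finset.sum_congr rfl fun (k : ℕ) _ => X.cochainProj_apply (k : ℤ) f H hx]
      by_cases hm : 0 < m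
      · rw [SSet.chains_gr_pos _ hm hx]; simp
      · obtain ⟨k, rfl⟩ : ∃ k : ℕ, m = -k := ⟨m.natAbs, by omega⟩
        simp only [neg_inj, Nat.cast_inj, Finset.sum_ite_eq, Finset.mem_range]
        split_ifs with h
        · rfl
        · exact hN H k (by omega) x hx
    rw [this]
    refine Submodule.sum_mem _ fun k _ => Submodule.mem_iSup_of_mem (k : ℤ) ?_
    intro H n hn x hx
    rw [X.cochainProj_apply k f H hx, if_neg hn]

/-- The complex `C_ρ(T; M)`, with `(δ f) x = (-1) ^ deg x • f (∂ x)`, i.e.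
`δ f = (-1) ^ (n + 1) • f ∘ ∂` for `f` of degree `n`. -/
abbrev cochains : GrComplex.{max a u c} (ZMod p) where
  carrier := X.cochainSubmodule
  gr := X.cochainGr
  internal := X.cochain_internal
  d := LinearMap.restrict
    (LinearMap.pi fun H => LinearMap.lcomp (ZMod p) _ ((X.C H).d ∘ₗ (X.C H).sgn) ∘ₗ
      LinearMap.proj H) (by
    rintro f ⟨h1, h2, N, h3⟩
    refine ⟨fun H K g x => ?_, fun H σ x => ?_, N + 1, fun H n hn x hx => ?_⟩
    · simp only [LinearMap.pi_apply, LinearMap.comp_apply, LinearMap.proj_apply,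
        LinearMap.lcomp_apply]
      rw [GrComplex.sgn, GrComplex.sgn,
        ← GrComplex.scale_natural _ _ (SSet.chainsMap_mem (ZMod p) (X.T.map g)),
        ← SSet.chainsMap_d, h1]
    · simp only [LinearMap.pi_apply, LinearMap.comp_apply, LinearMap.proj_apply,
        LinearMap.lcomp_apply]
      rw [GrComplex.sgn, ← GrComplex.scale_natural _ _ (SSet.chainsMap_mem (ZMod p) _),
        ← SSet.chainsMap_d, h2]
    · obtain ⟨n, rfl⟩ : ∃ m, n = m + 1 := ⟨n - 1, by omega⟩
      have h := (X.C H).d_mem _ _ ((X.C H).sgn_mem hx)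
      rw [show -((n + 1 : ℕ) : ℤ) + 1 = -(n : ℤ) by push_cast; ring] at h
      exact h3 H n (by omega) _ h)
  d_mem k f hf H n hn x hx :=
    hf H (n + 1) (by omega) _ ((X.C H).d_mem _ _ ((X.C H).sgn_mem hx))
  d_d f := by
    refine X.cochain_ext fun H n x hx => ?_
    change f.1 H ((X.C H).d ((X.C H).sgn ((X.C H).d ((X.C H).sgn x)))) = 0
    rw [GrComplex.d_sgn, (X.C H).d_d, map_zero, neg_zero, map_zero]

/-- Evaluation of cochains on `C(T(G/H))`. -/
def evalAt (H : (OrbitCat G)ᵒᵖ) : X.cochains →ₗ[ZMod p] X.C H →ₗ[ZMod p] X.M.obj H :=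
  LinearMap.proj H ∘ₗ X.cochainSubmodule.subtype

end OrbitTriple

/-! ### The Steenrod diagonal and the operations on cochains -/

/-- A natural transformation `Φ : W ⊗ C(L₁ × ⋯ × L_p) → W ⊗ C(L₁) ⊗ ⋯ ⊗ C(L_p)` of the kind
provided by the method of acyclic models. -/
structure SteenrodDiagonal (p : ℕ) where
  Φ : ∀ L : Fin p → SSet.{u},
    GrComplex.tensor (cyclicResolution p) (SSet.chains (ZMod p) (SSet.piSSet L)) →ₗ[ZMod p]
      GrComplex.tensor (cyclicResolution p) (piTensor fun i => SSet.chains (ZMod p) (L i))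
  mor : ∀ L, IsMor _ _ (Φ L)
  /-- naturality in the `L i` -/
  natural : ∀ (L L' : Fin p → SSet.{u}) (f : ∀ i, L i ⟶ L' i) z,
    Φ L' (TensorProduct.map LinearMap.id (SSet.chainsMap (ZMod p) (SSet.piSSetMap f)) z) =
      TensorProduct.map LinearMap.id
        (PiTensorProduct.map fun i => SSet.chainsMap (ZMod p) (f i)) (Φ L z)
  /-- compatibility with the action of `π`, which permutes the factors -/
  equivariant : ∀ (L : Fin p → SSet.{u}) (σ : cyclicSubgroup p) z,
    Φ (fun i => L (σ.1.symm i)) (TensorProduct.map (cyclicAct p σ)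
        (SSet.chainsMap (ZMod p) (SSet.piPermute L σ)) z) =
      TensorProduct.map (cyclicAct p σ)
        (permute (fun i => SSet.chains (ZMod p) (L i)) σ) (Φ L z)
  /-- `Φ` is the identity on `W ⊗ C₀(L₁ × ⋯ × L_p)` -/
  zero : ∀ (L : Fin p → SSet.{u}) (w : cyclicResolution p)
    (x : (SSet.piSSet L).obj (op (SimplexCategory.mk 0))),
    Φ L (w ⊗ₜ SSet.simplexChain (ZMod p) x) =
      w ⊗ₜ PiTensorProduct.tprod (ZMod p) fun i => SSet.simplexChain (ZMod p) (X := L i) (x i)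
  /-- `Φ` is the Alexander-Whitney map on `e₀ ⊗ C(L₁ × ⋯ × L_p)` -/
  aw : ∀ (L : Fin p → SSet.{u}) (x : SSet.chains (ZMod p) (SSet.piSSet L)),
    Φ L (cyclicBasis p 0 1 ⊗ₜ x) = cyclicBasis p 0 1 ⊗ₜ SSet.alexanderWhitney (ZMod p) L x
  /-- `Φ` maps `W ⊗ C_j` to the sum over `k ≤ p j` of the `W ⊗ [C(L₁) ⊗ ⋯ ⊗ C(L_p)]_k` -/
  bound : ∀ (L : Fin p → SSet.{u}) (w : cyclicResolution p) (j : ℕ),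
    ∀ x ∈ (SSet.chains (ZMod p) (SSet.piSSet L)).gr (-(j : ℤ)),
    Φ L (w ⊗ₜ x) ∈ Submodule.span (ZMod p) {z | ∃ w' : cyclicResolution p, ∃ k : ℕ, k ≤ p * j ∧
      ∃ y ∈ (piTensor fun i => SSet.chains (ZMod p) (L i)).gr (-(k : ℤ)), z = w' ⊗ₜ y}

namespace SteenrodDiagonal

variable {p : ℕ} (D : SteenrodDiagonal.{u} p)

/-- The map `Δ : W ⊗ C(L) → C(L)^p`, the composite
`W ⊗ C(L) → W ⊗ C(L^p) → W ⊗ C(L)^p → C(L)^p`. -/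
def diag (L : SSet.{u}) :
    GrComplex.tensor (cyclicResolution p) (SSet.chains (ZMod p) L) →ₗ[ZMod p]
      power (SSet.chains (ZMod p) L) p :=
  (TensorProduct.lid (ZMod p) (power (SSet.chains (ZMod p) L) p)).toLinearMap ∘ₗ
    TensorProduct.map (cyclicAug p) LinearMap.id ∘ₗ D.Φ (fun _ => L) ∘ₗ
    TensorProduct.map LinearMap.id (SSet.chainsMap (ZMod p) (SSet.piDiag p L))

theorem diag_natural {L L' : SSet.{u}} (f : L ⟶ L') (w : cyclicResolution p)
    (x : SSet.chains (ZMod p) L) :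
    D.diag L' (w ⊗ₜ SSet.chainsMap (ZMod p) f x) =
      PiTensorProduct.map (fun _ => SSet.chainsMap (ZMod p) f) (D.diag L (w ⊗ₜ x)) := by
  have h1 : SSet.chainsMap (ZMod p) (SSet.piDiag p L') (SSet.chainsMap (ZMod p) f x) =
      SSet.chainsMap (ZMod p) (SSet.piSSetMap fun _ : Fin p => f)
        (SSet.chainsMap (ZMod p) (SSet.piDiag p L) x) := by
    rw [← SSet.chainsMap_comp, ← SSet.chainsMap_comp]
    rfl
  have h2 := D.natural (fun _ => L) (fun _ => L') (fun _ => f)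
    (w ⊗ₜ SSet.chainsMap (ZMod p) (SSet.piDiag p L) x)
  simp only [TensorProduct.map_tmul, LinearMap.id_apply] at h2
  simp only [diag, LinearMap.comp_apply, TensorProduct.map_tmul, LinearMap.id_apply, h1]
  erw [h2]
  generalize D.Φ (fun _ => L) (w ⊗ₜ SSet.chainsMap (ZMod p) (SSet.piDiag p L) x) = z
  induction z using TensorProduct.induction_on with
  | zero => simp
  | add y z hy hz => simp only [map_add, hy, hz]
  | tmul y z => simp

theorem cyclicAug_of_ne {n : ℤ} (hn : n ≠ 0) {w : cyclicResolution p}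
    (hw : w ∈ (cyclicResolution p).gr n) : cyclicAug p w = 0 := by
  have : (cyclicResolution p).gr n ≤ LinearMap.ker (cyclicAug p) := by
    dsimp only
    rw [Finsupp.supported_eq_span_single, Submodule.span_le]
    rintro _ ⟨s, rfl, rfl⟩
    have : s.1 ≠ 0 := by rintro h; simp [h] at hn
    simp [cyclicAug, this]
  exact this hw

theorem diag_mem (L : SSet.{u}) {m n : ℤ} {w : cyclicResolution p}
    {x : SSet.chains (ZMod p) L} (hw : w ∈ (cyclicResolution p).gr m)
    (hx : x ∈ (SSet.chains (ZMod p) L).gr n) :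
    D.diag L (w ⊗ₜ x) ∈ (power (SSet.chains (ZMod p) L) p).gr (m + n) := by
  have h1 := (D.mor fun _ => L).1 (m + n)
    (w ⊗ₜ SSet.chainsMap (ZMod p) (SSet.piDiag p L) x) (Submodule.subset_span
      ⟨m, n, rfl, w, hw, _, SSet.chainsMap_mem _ _ _ _ hx, rfl⟩)
  have h2 : (GrComplex.tensor (cyclicResolution p) (power (SSet.chains (ZMod p) L) p)).gr (m + n) ≤
      ((power (SSet.chains (ZMod p) L) p).gr (m + n)).comap
        ((TensorProduct.lid (ZMod p) (power (SSet.chains (ZMod p) L) p)).toLinearMap ∘ₗ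
          TensorProduct.map (cyclicAug p) LinearMap.id) := by
    refine Submodule.span_le.2 ?_
    rintro _ ⟨i, j, hij, w', hw', y, hy, rfl⟩
    by_cases hi : i = 0
    · subst hi
      rw [zero_add] at hij
      subst hij
      simpa using Submodule.smul_mem _ _ hy
    · simp [cyclicAug_of_ne hi hw']
  exact h2 h1

end SteenrodDiagonal

namespace OrbitTriple

variable {p : ℕ} {G : Type a} [Group G] (X : OrbitTriple.{u, a, b, c} p G)

/-- The map `α : C_ρ(T; M)^p → Hom(C(T(G/H))^p, M(G/H))`, with
`α (f₁ ⊗ ⋯ ⊗ f_p) (x₁ ⊗ ⋯ ⊗ x_p) = ± f₁ x₁ ⋯ f_p x_p`, where the sign is `(-1) ^ e` with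
`e = ∑_{i<j} deg x_i * deg x_j`. -/
def evalPower (H : (OrbitCat G)ᵒᵖ) :
    power X.cochains p →ₗ[ZMod p] power (X.C H) p →ₗ[ZMod p] X.M.obj H :=
  LinearMap.compr₂ (PiTensorProduct.piTensorHomMap ∘ₗ PiTensorProduct.map fun _ => X.evalAt H)
    (PiTensorProduct.lift (MultilinearMap.mkPiAlgebra (ZMod p) (Fin p) (X.M.obj H))) |>.compl₂
    (evalSign fun _ => X.C H)

/-- The map `w ⊗ f ↦ (x ↦ α(f) (Δ (w ⊗ x)))`. -/
def steenrodEval (D : SteenrodDiagonal.{u} p) :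
    (cyclicResolution p) ⊗[ZMod p] (power X.cochains p) →ₗ[ZMod p]
      ∀ H, X.C H →ₗ[ZMod p] X.M.obj H :=
  LinearMap.pi fun H => TensorProduct.lift
    (LinearMap.flip (LinearMap.llcomp (ZMod p) _ _ _ ∘ₗ X.evalPower H) |>.comp
      (TensorProduct.mk (ZMod p) _ _ |>.compr₂ (D.diag (X.T.obj H))))

theorem steenrodEval_tmul (D : SteenrodDiagonal.{u} p) (w : cyclicResolution p)
    (f : power X.cochains p) (H : (OrbitCat G)ᵒᵖ) (x : X.C H) :
    X.steenrodEval D (w ⊗ₜ f) H x = X.evalPower H f (D.diag (X.T.obj H) (w ⊗ₜ x)) := rfl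

theorem evalPower_natural {H K : (OrbitCat G)ᵒᵖ} (t : X.T.obj H ⟶ X.T.obj K)
    (m : X.M.obj H →ₐ[ZMod p] X.M.obj K)
    (h : ∀ (f : X.cochains) x, X.evalAt K f (SSet.chainsMap (ZMod p) t x) = m (X.evalAt H f x))
    (f : power X.cochains p) (x : power (X.C H) p) :
    X.evalPower K f (PiTensorProduct.map (fun _ => SSet.chainsMap (ZMod p) t) x) =
      m (X.evalPower H f x) := by
  have key : ∀ y : power (X.C H) p,
      PiTensorProduct.lift (MultilinearMap.mkPiAlgebra (ZMod p) (Fin p) (X.M.obj K))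
        (PiTensorProduct.piTensorHomMap (PiTensorProduct.map (fun _ => X.evalAt K) f)
          (PiTensorProduct.map (fun _ => SSet.chainsMap (ZMod p) t) y)) =
      m (PiTensorProduct.lift (MultilinearMap.mkPiAlgebra (ZMod p) (Fin p) (X.M.obj H))
        (PiTensorProduct.piTensorHomMap (PiTensorProduct.map (fun _ => X.evalAt H) f) y)) := by
    intro y
    induction f using PiTensorProduct.induction_on with
    | add f g hf hg => simp only [map_add, LinearMap.add_apply, hf, hg]
    | smul_tprod r f =>
      induction y using PiTensorProduct.induction_on with
      | add y z hy hz => simp only [map_add, hy, hz]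
      | smul_tprod s y => simp [h, map_prod]
  have e := evalSign_natural (fun _ : Fin p => SSet.chainsMap (ZMod p) t)
    (fun _ => SSet.chainsMap_mem (ZMod p) t) x
  change PiTensorProduct.lift _ (PiTensorProduct.piTensorHomMap _ (evalSign _ _)) =
    m (PiTensorProduct.lift _ (PiTensorProduct.piTensorHomMap _ (evalSign _ _)))
  rw [← e]
  exact key _

theorem steenrodEval_natural (D : SteenrodDiagonal.{u} p) {H K : (OrbitCat G)ᵒᵖ}
    (t : X.T.obj H ⟶ X.T.obj K) (m : X.M.obj H →ₐ[ZMod p] X.M.obj K)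
    (h : ∀ (f : X.cochains) x, X.evalAt K f (SSet.chainsMap (ZMod p) t x) = m (X.evalAt H f x))
    (z : (cyclicResolution p) ⊗[ZMod p] (power X.cochains p)) (x : X.C H) :
    X.steenrodEval D z K (SSet.chainsMap (ZMod p) t x) = m (X.steenrodEval D z H x) := by
  induction z using TensorProduct.induction_on with
  | zero => simp
  | add y z hy hz => simp only [map_add, Pi.add_apply, LinearMap.add_apply, hy, hz]
  | tmul w f =>
    rw [steenrodEval_tmul, steenrodEval_tmul, D.diag_natural, X.evalPower_natural t m h]

theorem evalPower_eq_zero {N : Fin p → ℕ} {f : Fin p → X.cochains}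
    (hf : ∀ i H, ∀ n : ℕ, N i ≤ n → ∀ x ∈ (X.C H).gr (-(n : ℤ)), X.evalAt H (f i) x = 0)
    (H : (OrbitCat G)ᵒᵖ) {n : ℕ} (hn : ∑ i, N i < n) {x : power (X.C H) p}
    (hx : x ∈ (power (X.C H) p).gr (-(n : ℤ))) :
    X.evalPower H (PiTensorProduct.tprod (ZMod p) f) x = 0 := by
  have : (power (X.C H) p).gr (-(n : ℤ)) ≤
      LinearMap.ker (X.evalPower H (PiTensorProduct.tprod (ZMod p) f)) := by
    refine Submodule.span_le.2 ?_
    rintro _ ⟨a, ha, x, hx, rfl⟩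
    change PiTensorProduct.lift _ (PiTensorProduct.piTensorHomMap _ (evalSign _ _)) = 0
    rw [evalSign, signOp_tprod _ _ a x hx]
    simp only [map_smul, PiTensorProduct.map_tprod, PiTensorProduct.piTensorHomMap_tprod_tprod,
      PiTensorProduct.lift.tprod, MultilinearMap.mkPiAlgebra_apply]
    obtain ⟨i, hi⟩ : ∃ i, X.evalAt H (f i) (x i) = 0 := by
      by_contra! hc
      have h : ∀ i, -(N i : ℤ) ≤ a i := by
        intro i
        by_contra! hi
        have := hx i
        rw [show a i = -((a i).natAbs : ℤ) by omega] at this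
        exact hc i (hf i H (a i).natAbs (by omega) (x i) this)
      have h' := Finset.sum_le_sum fun i (_ : i ∈ Finset.univ) => h i
      rw [ha, Finset.sum_neg_distrib] at h'
      have h'' : (n : ℤ) ≤ ((∑ i, N i : ℕ) : ℤ) := by push_cast; linarith
      omega
    rw [Finset.prod_eq_zero (Finset.mem_univ i) hi, smul_zero]
  exact this hx

theorem steenrodEval_mem (D : SteenrodDiagonal.{u} p)
    (z : (cyclicResolution p) ⊗[ZMod p] (power X.cochains p)) :
    X.steenrodEval D z ∈ X.cochainSubmodule := by
  refine ⟨fun H K g x => ?_, fun H σ x => ?_, ?_⟩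
  · exact X.steenrodEval_natural D _ (X.M.map g).hom (fun f => f.2.1 g) z x
  · exact X.steenrodEval_natural D _ (End.asHom (X.actM.act H σ)).hom (fun f => f.2.2.1 H σ) z x
  · induction z using TensorProduct.induction_on with
    | zero => exact ⟨0, by simp⟩
    | add y z hy hz =>
      obtain ⟨N, hN⟩ := hy
      obtain ⟨N', hN'⟩ := hz
      refine ⟨max N N', fun H n hn x hx => ?_⟩
      simp [hN H n (by omega) x hx, hN' H n (by omega) x hx]
    | tmul w f =>
      induction f using PiTensorProduct.induction_on with
      | add f g hf hg =>
        obtain ⟨N, hN⟩ := hf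
        obtain ⟨N', hN'⟩ := hg
        refine ⟨max N N', fun H n hn x hx => ?_⟩
        simp [TensorProduct.tmul_add, hN H n (by omega) x hx, hN' H n (by omega) x hx]
      | smul_tprod r f =>
        choose N hN using fun i => (f i).2.2.2
        refine ⟨∑ i, N i + 1, fun H n hn x hx => ?_⟩
        rw [steenrodEval_tmul, map_smul, LinearMap.smul_apply]
        have key : X.evalPower H (PiTensorProduct.tprod (ZMod p) f) ∘ₗ D.diag (X.T.obj H) ∘ₗ
            (TensorProduct.mk (ZMod p) (cyclicResolution p) (X.C H)).flip x = 0 := by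
          refine GrComplex.hom_ext (cyclicResolution p) fun m w hw => ?_
          rcases lt_or_ge 0 m with hm | hm
          · rw [GrComplex.ofBasis_gr_pos (fun b => by simp) hm hw, map_zero, map_zero]
          · obtain ⟨k, rfl⟩ : ∃ k : ℕ, m = -k := ⟨m.natAbs, by omega⟩
            have h := D.diag_mem (X.T.obj H) hw hx
            rw [show -(k : ℤ) + -(n : ℤ) = -((k + n : ℕ) : ℤ) by push_cast; ring] at h
            exact X.evalPower_eq_zero hN H (by omega) h
        have := LinearMap.congr_fun key w
        simp only [LinearMap.comp_apply, LinearMap.flip_apply, TensorProduct.mk_apply,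
          LinearMap.zero_apply] at this
        rw [this, smul_zero]

/-- The map `θ : W ⊗ C_ρ(T; M)^p → C_ρ(T; M)`,
`θ (w ⊗ f) (x) = (-1) ^ (deg w * deg f) • α(f) (Δ (w ⊗ x))`. -/
def steenrodOperation (D : SteenrodDiagonal.{u} p) :
    GrComplex.tensor (cyclicResolution p) (power X.cochains p) →ₗ[ZMod p] X.cochains :=
  (LinearMap.codRestrict X.cochainSubmodule (X.steenrodEval D) (X.steenrodEval_mem D)) ∘ₗ
    koszul (cyclicResolution p) (power X.cochains p)

/-- The map `f ⊗ g ↦ (x ⊗ y ↦ (-1) ^ (deg x * deg y) • f x * g y)`. -/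
def evalTensor (H : (OrbitCat G)ᵒᵖ) :
    X.cochains ⊗[ZMod p] X.cochains →ₗ[ZMod p] X.C H ⊗[ZMod p] X.C H →ₗ[ZMod p] X.M.obj H :=
  LinearMap.compr₂ (TensorProduct.homTensorHomMap (RingHom.id (ZMod p)) _ _ _ _ ∘ₗ
      TensorProduct.map (X.evalAt H) (X.evalAt H)) (LinearMap.mul' (ZMod p) (X.M.obj H)) |>.compl₂
    (koszul (X.C H) (X.C H))

theorem evalTensor_tmul (H : (OrbitCat G)ᵒᵖ) (f g : X.cochains) (z : X.C H ⊗[ZMod p] X.C H) :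
    X.evalTensor H (f ⊗ₜ g) z = LinearMap.mul' (ZMod p) (X.M.obj H)
      (TensorProduct.map (X.evalAt H f) (X.evalAt H g) (koszul (X.C H) (X.C H) z)) := rfl

/-- The map `f ⊗ g ↦ (x ↦ α(f ⊗ g) (ξ x))`, where `ξ` is the Alexander-Whitney diagonal. -/
def cupEval : X.cochains ⊗[ZMod p] X.cochains →ₗ[ZMod p] ∀ H, X.C H →ₗ[ZMod p] X.M.obj H :=
  LinearMap.pi fun H => X.evalTensor H |>.compl₂ (SSet.chainsDiag (ZMod p) (X.T.obj H))

theorem cupEval_natural {H K : (OrbitCat G)ᵒᵖ} (t : X.T.obj H ⟶ X.T.obj K)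
    (m : X.M.obj H →ₐ[ZMod p] X.M.obj K)
    (h : ∀ (f : X.cochains) x, X.evalAt K f (SSet.chainsMap (ZMod p) t x) = m (X.evalAt H f x))
    (z : X.cochains ⊗[ZMod p] X.cochains) (x : X.C H) :
    X.cupEval z K (SSet.chainsMap (ZMod p) t x) = m (X.cupEval z H x) := by
  change X.evalTensor K z (SSet.chainsDiag (ZMod p) _ (SSet.chainsMap (ZMod p) t x)) =
    m (X.evalTensor H z (SSet.chainsDiag (ZMod p) _ x))
  rw [← SSet.chainsDiag_natural]
  generalize SSet.chainsDiag (ZMod p) (X.T.obj H) x = y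
  change LinearMap.mul' _ _ (TensorProduct.homTensorHomMap _ _ _ _ _ (TensorProduct.map _ _ z)
      (koszul _ _ _)) =
    m (LinearMap.mul' _ _ (TensorProduct.homTensorHomMap _ _ _ _ _ (TensorProduct.map _ _ z)
      (koszul _ _ _)))
  rw [← koszul_natural (SSet.chainsMap (ZMod p) t) (SSet.chainsMap (ZMod p) t)
    (SSet.chainsMap_mem (ZMod p) t) (SSet.chainsMap_mem (ZMod p) t)]
  generalize koszul (X.C H) (X.C H) y = y
  induction z using TensorProduct.induction_on with
  | zero => simp
  | add f g hf hg => simp only [map_add, LinearMap.add_apply, hf, hg]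
  | tmul f g =>
    induction y using TensorProduct.induction_on with
    | zero => simp
    | add y z hy hz => simp only [map_add, hy, hz]
    | tmul y z => simp [h]

theorem cupEval_mem (z : X.cochains ⊗[ZMod p] X.cochains) : X.cupEval z ∈ X.cochainSubmodule := by
  refine ⟨fun H K g x => ?_, fun H σ x => ?_, ?_⟩
  · exact X.cupEval_natural _ (X.M.map g).hom (fun f => f.2.1 g) z x
  · exact X.cupEval_natural _ (End.asHom (X.actM.act H σ)).hom (fun f => f.2.2.1 H σ) z x
  · induction z using TensorProduct.induction_on with
    | zero => exact ⟨0, by simp⟩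
    | add y z hy hz =>
      obtain ⟨N, hN⟩ := hy
      obtain ⟨N', hN'⟩ := hz
      refine ⟨max N N', fun H n hn x hx => ?_⟩
      simp [hN H n (by omega) x hx, hN' H n (by omega) x hx]
    | tmul f g =>
      obtain ⟨N, hN⟩ := f.2.2.2
      obtain ⟨N', hN'⟩ := g.2.2.2
      refine ⟨N + N', fun H n hn x hx => ?_⟩
      have : (X.C H).gr (-(n : ℤ)) ≤ LinearMap.ker (X.cupEval (f ⊗ₜ g) H) := by
        dsimp only
        rw [Finsupp.supported_eq_span_single, Submodule.span_le]
        rintro _ ⟨s, hs, rfl⟩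
        have hs' : s.dim = n := by simpa using hs
        dsimp only
        rw [← SSet.simplexChain_N]
        change X.evalTensor H (f ⊗ₜ g)
          (SSet.chainsDiag (ZMod p) _ (SSet.simplexChain (ZMod p) s.simplex)) = 0
        rw [SSet.chainsDiag_simplexChain, map_sum]
        refine Finset.sum_eq_zero fun ij hij => ?_
        rw [Finset.HasAntidiagonal.mem_antidiagonal] at hij
        have m1 := SSet.simplexChain_mem_gr (ZMod p) (SSet.segment s.simplex 0 ij.1)
        have m2 := SSet.simplexChain_mem_gr (ZMod p) (SSet.segment s.simplex ij.1 ij.2)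
        rw [evalTensor_tmul, koszul_tmul m1 m2]
        have : f.1 H (SSet.simplexChain (ZMod p) (SSet.segment s.simplex 0 ij.1)) *
            g.1 H (SSet.simplexChain (ZMod p) (SSet.segment s.simplex ij.1 ij.2)) = 0 := by
          by_cases h : N ≤ ij.1
          · rw [hN H _ h _ m1, zero_mul]
          · rw [hN' H _ (by omega) _ m2, mul_zero]
        rw [map_smul, map_smul]
        refine smul_eq_zero_of_right _ ?_
        simpa [evalAt] using this
      exact this hx

/-- The cup product on `C_ρ(T; M)`. -/
def cup : GrComplex.tensor X.cochains X.cochains →ₗ[ZMod p] X.cochains :=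
  LinearMap.codRestrict X.cochainSubmodule X.cupEval X.cupEval_mem

/-- The pair `Γ(T, M, ρ) = (C_ρ(T; M), θ)`, with the cup product. -/
def gamma (D : SteenrodDiagonal.{u} p) : MayAlgebra p where
  cx := X.cochains
  θ := X.steenrodOperation D
  mul := X.cup

end OrbitTriple

end

/-! The proof is the method of acyclic models, arranged so that everything happens in complexes of
natural operations and is transported to cochains at the end. For a functor `T` from simplicial sets
to augmented complexes (`ChainFunctor`), let `T.ops` be the complex of natural transformations `C(L)
→ T(L)`. If the values of `T` on the standard simplices are contractible, compatibly with
degeneracies, then `T.ops` is acyclic in degrees `≤ 0` relative to its augmentation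
(`ChainFunctor.ops_acyclic`). Indeed a natural transformation is determined by its values on the
universal simplices, and a primitive of a cycle is found by applying the contraction there, one
dimension after the other. Coning from the vertex `0` contracts `C(Δ[n])`, and the contraction
passes to tensor products and tensor powers.

Let a group act on such a complex of operations, preserving the augmentation. A free complex over
the group then maps to it equivariantly over any given invariant augmentation, and any two such maps
are equivariantly homotopic (`FreeComplex.exists_mor`, `FreeComplex.exists_homotopy`).

Existence of `Φ`: the freeness of `W` over `π` gives an equivariant `Ψ` from `W` to the operations
`C(L) → C(L)^p`, with `Ψ e₀` the iterated Alexander-Whitney diagonal. Composing with the projections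
of `L₁ × ⋯ × L_p` and with the coproduct of `W` gives `Φ`. The counit property of the coproduct
makes it the identity on `W ⊗ C₀`. The dimension bound holds because the normalized chains of `Δ[j]`
vanish above dimension `j`.

Passage to cochains: evaluation of cochains on chains extends to tensor products and powers
(`Pairing`), and composing an operation with a cochain is a morphism of complexes `T.ops ⊗ Q →
C_ρ(T; M)` (`Pairing.isMor_product`). A homotopy between maps into `T.ops` therefore becomes a
homotopy between maps into cochains, and equivariance becomes invariance.

Object of `𝔠(p)`: `θ` is the image under this morphism of the map `D.toOps` from `W` to operations.
The cup product is strictly associative because the diagonal is coassociative, and `θ` restricted to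
`e₀` is strictly the iterated cup product. For the symmetry condition, map `V` equivariantly under
`Σ_p` to the operations; its restriction along `j` and `D.toOps` are two `π`-maps over the same
augmentation, hence homotopic.

Cartan formula: the two sides come from two `π`-maps from `W` to the operations `C(L) → C(L)^p ⊗
C(L)^p`. One applies `Δ` and then the diagonal in every factor (`diagOps`); the other applies the
coproduct of `W`, the diagonal, and `Δ ⊗ Δ` (`diagOps₂ ∘ₗ cyclicCoprod`). They have the same
augmentation, so they are homotopic (`exists_cartan_homotopy`).

Koszul signs are handled as exponents in `ZMod 2`. Most sign identities for evaluations hold only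
when the degrees of cochains and chains match; otherwise both sides are zero. -/

noncomputable section

universe v' w'

section

/-! ### Signs -/

/-- The sign `(-1) ^ z`. -/
def sg (R : Type) [CommRing R] (z : ZMod 2) : R := if z = 0 then 1 else -1

section Sign

variable (R : Type) [CommRing R]

@[simp] theorem sg_zero : sg R 0 = 1 := by simp [sg]

@[simp] theorem sg_one : sg R 1 = -1 := by simp [sg]

theorem sg_add (x y : ZMod 2) : sg R (x + y) = sg R x * sg R y := by
  have h : ∀ x : ZMod 2, x = 0 ∨ x = 1 := by decide
  rcases h x with rfl | rfl <;> rcases h y with rfl | rfl <;>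
    simp [sg, CharTwo.add_self_eq_zero]

@[simp] theorem sg_mul_self (x : ZMod 2) : sg R x * sg R x = 1 := by
  rw [← sg_add, CharTwo.add_self_eq_zero, sg_zero]

theorem intCast_even_iff (n : ℤ) : (n : ZMod 2) = 0 ↔ Even n := by
  rw [ZMod.intCast_zmod_eq_zero_iff_dvd, even_iff_two_dvd]; rfl

theorem intCast_of_odd {n : ℤ} (h : Odd n) : (n : ZMod 2) = 1 := by
  obtain ⟨k, rfl⟩ := h
  have : (2 : ZMod 2) = 0 := rfl
  simp [this]

theorem sg_intCast (n : ℤ) : (if Even n then (1 : R) else -1) = sg R (n : ZMod 2) := by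
  simp only [sg, intCast_even_iff]

theorem sg_natCast (n : ℕ) : sg R (n : ZMod 2) = (-1) ^ n := by
  induction n with
  | zero => simp
  | succ n ih => rw [Nat.cast_succ, sg_add, ih, sg_one, pow_succ]

/-- The signs of `permute`, `evalSign` and `unshuffle` are defined by counting pairs of odd indices.
Modulo `2` such a count is a bilinear expression in the degrees, so that identities of signs become
identities of polynomials over `ZMod 2`. -/
theorem card_pairs {n : ℕ} (Q : Fin n → Fin n → Prop) [DecidableRel Q] (a b : Fin n → ℤ) :
    (((Finset.univ.filter fun ij : Fin n × Fin n =>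
      Q ij.1 ij.2 ∧ Odd (a ij.1) ∧ Odd (b ij.2)).card : ℕ) : ZMod 2) =
      ∑ i, ∑ j, (if Q i j then 1 else 0) * ((a i : ZMod 2) * (b j : ZMod 2)) := by
  rw [Finset.natCast_card_filter, Fintype.sum_prod_type]
  refine Finset.sum_congr rfl fun i _ => Finset.sum_congr rfl fun j _ => ?_
  by_cases h1 : Odd (a i)
  · by_cases h2 : Odd (b j)
    · simp [h1, h2, intCast_of_odd]
    · have := (intCast_even_iff (b j)).2 (by simpa using h2)
      simp [h2, this]
  · have := (intCast_even_iff (a i)).2 (by simpa using h1)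
    simp [h1, this]

/-- A quadratic expression with symmetric coefficients vanishes modulo `2`. -/
theorem sum_symm_eq_zero {n : ℕ} (c : Fin n → Fin n → ZMod 2) (a : Fin n → ZMod 2)
    (hc : ∀ i j, i < j → c i j = c j i) (hd : ∀ i, c i i = 0) :
    ∑ i, ∑ j, c i j * (a i * a j) = 0 := by
  rw [← Fintype.sum_prod_type (f := fun ij : Fin n × Fin n => c ij.1 ij.2 * (a ij.1 * a ij.2))]
  refine Finset.sum_involution (fun ij _ => (ij.2, ij.1)) ?_ ?_ ?_ ?_
  · rintro ⟨i, j⟩ -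
    dsimp only
    have : c i j = c j i := by
      rcases lt_trichotomy i j with h | h | h
      · exact hc i j h
      · rw [h]
      · exact (hc j i h).symm
    rw [this, mul_comm (a i), CharTwo.add_self_eq_zero]
  · rintro ⟨i, j⟩ - h h'
    simp only [Prod.mk.injEq] at h'
    obtain ⟨rfl, -⟩ := h'
    exact h (by simp [hd])
  · intros; simp
  · intros; rfl

/-- Since `a i * a j` is symmetric, only the diagonal coefficients and the sums `c i j + c j i`
matter. This is what allows sign exponents to be compared after reindexing by a permutation, which
does not respect `i < j`. -/
theorem sum_symm_congr {n : ℕ} (c c' : Fin n → Fin n → ZMod 2) (a : Fin n → ZMod 2)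
    (hc : ∀ i j, i < j → c i j + c j i = c' i j + c' j i) (hd : ∀ i, c i i = c' i i) :
    ∑ i, ∑ j, c i j * (a i * a j) = ∑ i, ∑ j, c' i j * (a i * a j) := by
  rw [← sub_eq_zero, ← Finset.sum_sub_distrib]
  simp only [← Finset.sum_sub_distrib, ← sub_mul]
  refine sum_symm_eq_zero _ _ (fun i j h => ?_) (fun i => by rw [hd, sub_self])
  have := hc i j h
  have e : c i j - c' i j - (c j i - c' j i) = (c i j + c j i - (c' i j + c' j i)) - 2 * c j i + 2 * c' j i := by ring
  have h2 : (2 : ZMod 2) = 0 := rfl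
  rw [← sub_eq_zero, e, this, h2]; ring

end Sign

/-! ### Morphisms of complexes -/

namespace GrComplex

variable {R : Type} [CommRing R]

theorem sgn_eq (K : GrComplex.{v} R) {n : ℤ} {x : K} (hx : x ∈ K.gr n) :
    K.sgn x = sg R (n : ZMod 2) • x := by
  rw [K.sgn_of_mem hx, sg_intCast]

theorem koszul_eq {K : GrComplex.{v} R} {L : GrComplex.{w} R} {m n : ℤ} {x : K} {y : L}
    (hx : x ∈ K.gr m) (hy : y ∈ L.gr n) :
    koszul K L (x ⊗ₜ[R] y) = sg R ((m : ZMod 2) * (n : ZMod 2)) • x ⊗ₜ[R] y := by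
  rw [koszul_tmul hx hy]
  congr 1
  by_cases h1 : Odd m
  · by_cases h2 : Odd n
    · simp [h1, h2, intCast_of_odd]
    · simp [h2, (intCast_even_iff n).2 (by simpa using h2)]
  · simp [h1, (intCast_even_iff m).2 (by simpa using h1)]

theorem swap_eq {K : GrComplex.{v} R} {L : GrComplex.{w} R} {m n : ℤ} {x : K} {y : L}
    (hx : x ∈ K.gr m) (hy : y ∈ L.gr n) :
    swap K L (x ⊗ₜ[R] y) = sg R ((m : ZMod 2) * (n : ZMod 2)) • y ⊗ₜ[R] x := by
  rw [swap, LinearMap.comp_apply, koszul_eq hx hy, map_smul]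
  rfl

theorem tensor_hom_ext {K : GrComplex.{v} R} {L : GrComplex.{w} R} {M : Type*} [AddCommGroup M]
    [Module R M] {f g : K ⊗[R] L →ₗ[R] M}
    (h : ∀ m n, ∀ x ∈ K.gr m, ∀ y ∈ L.gr n, f (x ⊗ₜ y) = g (x ⊗ₜ y)) : f = g := by
  refine TensorProduct.ext (K.hom_ext fun m x hx => L.hom_ext fun n y hy => h m n x hx y hy)

theorem pi_hom_ext {n : ℕ} {K : Fin n → GrComplex.{v} R} {M : Type*} [AddCommGroup M]
    [Module R M] {f g : (⨂[R] i, K i) →ₗ[R] M}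
    (h : ∀ a : Fin n → ℤ, ∀ x : ∀ i, K i, (∀ i, x i ∈ (K i).gr (a i)) →
      f (PiTensorProduct.tprod R x) = g (PiTensorProduct.tprod R x)) : f = g := by
  refine (piTensor K).hom_ext fun m z hz => ?_
  have : piGr K m ≤ LinearMap.eqLocus f g := by
    refine Submodule.span_le.2 ?_
    rintro _ ⟨a, -, x, hx, rfl⟩
    exact h a x hx
  exact this hz

theorem piTensor_d_apply {n : ℕ} (K : Fin n → GrComplex.{v} R) (z : ⨂[R] i, K i) :
    (piTensor K).d z = ∑ k, piD K k z := LinearMap.sum_apply _ _ _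

theorem tmul_mem {K : GrComplex.{v} R} {L : GrComplex.{w} R} {m n : ℤ} {x : K} {y : L}
    (hx : x ∈ K.gr m) (hy : y ∈ L.gr n) : x ⊗ₜ[R] y ∈ (tensor K L).gr (m + n) :=
  Submodule.subset_span ⟨m, n, rfl, x, hx, y, hy, rfl⟩

theorem tprod_mem {n : ℕ} {K : Fin n → GrComplex.{v} R} {a : Fin n → ℤ} {x : ∀ i, K i}
    (hx : ∀ i, x i ∈ (K i).gr (a i)) :
    PiTensorProduct.tprod R x ∈ (piTensor K).gr (∑ i, a i) :=
  Submodule.subset_span ⟨a, rfl, x, hx, rfl⟩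

theorem tensor_d_tmul {K : GrComplex.{v} R} {L : GrComplex.{w} R} (x : K) (y : L) :
    (tensor K L).d (x ⊗ₜ y) = K.d x ⊗ₜ y + K.sgn x ⊗ₜ L.d y := rfl

theorem piD_eq {n : ℕ} {K : Fin n → GrComplex.{v} R} {a : Fin n → ℤ} {x : ∀ i, K i}
    (hx : ∀ i, x i ∈ (K i).gr (a i)) (k : Fin n) :
    piD K k (PiTensorProduct.tprod R x) =
      sg R (∑ i, (if i < k then 1 else 0) * (a i : ZMod 2)) •
        PiTensorProduct.tprod R (Function.update x k ((K k).d (x k))) := by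
  -- On homogeneous factors the sign involutions before `k` are scalars; multilinearity collects
  -- them into one product.
  have key : ∀ (s : Finset (Fin n)) (y : ∀ i, K i) (c : Fin n → R),
      PiTensorProduct.tprod R (fun i => (if i ∈ s then c i else 1) • y i) =
        (∏ i ∈ s, c i) • PiTensorProduct.tprod R y := by
    intro s y c
    rw [MultilinearMap.map_smul_univ, Finset.prod_ite_mem, Finset.univ_inter]
  have hs : sg R (∑ i, (if i < k then 1 else 0) * (a i : ZMod 2)) =
      ∏ i ∈ Finset.univ.filter (· < k), sg R (a i : ZMod 2) := by
    have hprod : ∀ s : Finset (Fin n), sg R (∑ i ∈ s, (if i < k then 1 else 0) * (a i : ZMod 2)) =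
        ∏ i ∈ s, (if i < k then sg R (a i : ZMod 2) else 1) := by
      intro s
      induction s using Finset.induction_on with
      | empty => simp
      | insert i s hi ih =>
        rw [Finset.sum_insert hi, Finset.prod_insert hi, sg_add, ih]
        split_ifs <;> simp
    rw [hprod, Finset.prod_filter]
  rw [piD, PiTensorProduct.map_tprod, hs, ← key]
  congr 1
  funext i
  rcases lt_trichotomy i k with h | h | h
  · simp [h, h.ne, sgn_eq (K i) (hx i)]
  · subst h; simp
  · simp [h.not_gt, h.ne']

theorem update_mem {n : ℕ} {K : Fin n → GrComplex.{v} R} {a : Fin n → ℤ} {x : ∀ i, K i}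
    (hx : ∀ i, x i ∈ (K i).gr (a i)) (k : Fin n) (i : Fin n) :
    Function.update x k ((K k).d (x k)) i ∈ (K i).gr (a i + if i = k then 1 else 0) := by
  by_cases h : i = k
  · subst h; simpa using (K i).d_mem _ _ (hx i)
  · simpa [h] using hx i

theorem permute_eq {n : ℕ} {K : Fin n → GrComplex.{v} R} (σ : Equiv.Perm (Fin n)) {a : Fin n → ℤ}
    {x : ∀ i, K i} (hx : ∀ i, x i ∈ (K i).gr (a i)) :
    permute K σ (PiTensorProduct.tprod R x) =
      sg R (∑ i, ∑ j, (if i < j ∧ σ j < σ i then 1 else 0) * ((a i : ZMod 2) * (a j : ZMod 2))) •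
        PiTensorProduct.tprod R fun i => x (σ.symm i) := by
  rw [permute, LinearMap.comp_apply, signOp_tprod K _ a x hx, map_smul, LinearEquiv.coe_coe,
    PiTensorProduct.reindex_tprod, ← card_pairs, sg_natCast]
  simp only [Finset.mem_filter_univ, and_assoc]

theorem evalSign_eq {n : ℕ} {K : Fin n → GrComplex.{v} R} {a : Fin n → ℤ}
    {x : ∀ i, K i} (hx : ∀ i, x i ∈ (K i).gr (a i)) :
    evalSign K (PiTensorProduct.tprod R x) =
      sg R (∑ i, ∑ j, (if i < j then 1 else 0) * ((a i : ZMod 2) * (a j : ZMod 2))) •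
        PiTensorProduct.tprod R x := by
  rw [evalSign, signOp_tprod K _ a x hx, ← card_pairs, sg_natCast]
  simp only [Finset.mem_filter_univ]

theorem unshuffle_eq {K : GrComplex.{v} R} {L : GrComplex.{w} R} {n : ℕ} {a b : Fin n → ℤ}
    {x : Fin n → K} {y : Fin n → L}
    (hx : ∀ i, x i ∈ K.gr (a i)) (hy : ∀ i, y i ∈ L.gr (b i)) :
    unshuffle K L n (PiTensorProduct.tprod R fun i => x i ⊗ₜ[R] y i) =
      sg R (∑ i, ∑ j, (if i < j then 1 else 0) * ((b i : ZMod 2) * (a j : ZMod 2))) •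
        (PiTensorProduct.tprod R x ⊗ₜ[R] PiTensorProduct.tprod R y) := by
  rw [unshuffle_apply K L n a b x y hx hy, ← card_pairs, sg_natCast]

/-! #### Formal properties of morphisms and homotopies -/

variable {K : GrComplex.{v} R} {L : GrComplex.{w} R}

theorem IsMor.id : IsMor K K LinearMap.id := ⟨fun _ _ h => h, fun _ => rfl⟩

theorem IsMor.comp {M : GrComplex.{u} R} {g : L →ₗ[R] M} {f : K →ₗ[R] L} (hg : IsMor L M g)
    (hf : IsMor K L f) : IsMor K M (g ∘ₗ f) :=
  ⟨fun n x hx => hg.1 n _ (hf.1 n x hx), fun x => by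
    rw [LinearMap.comp_apply, hf.2, hg.2, LinearMap.comp_apply]⟩

theorem IsMor.sgn {f : K →ₗ[R] L} (hf : IsMor K L f) (x : K) : f (K.sgn x) = L.sgn (f x) :=
  scale_natural _ f hf.1 x

theorem isMor_of_tmul {M : GrComplex.{u} R} {f : K ⊗[R] L →ₗ[R] M}
    (h1 : ∀ m n, ∀ x ∈ K.gr m, ∀ y ∈ L.gr n, f (x ⊗ₜ y) ∈ M.gr (m + n))
    (h2 : ∀ m n, ∀ x ∈ K.gr m, ∀ y ∈ L.gr n,
      f (K.d x ⊗ₜ y) + sg R (m : ZMod 2) • f (x ⊗ₜ L.d y) = M.d (f (x ⊗ₜ y))) :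
    IsMor (tensor K L) M f := by
  refine ⟨fun n x hx => ?_, fun z => ?_⟩
  · have : tensorGr K L n ≤ (M.gr n).comap f := by
      refine Submodule.span_le.2 ?_
      rintro _ ⟨a, b, rfl, x, hx, y, hy, rfl⟩
      exact h1 _ _ _ hx _ hy
    exact this hx
  · have : f ∘ₗ (tensor K L).d = M.d ∘ₗ f := tensor_hom_ext fun m n x hx y hy => by
      rw [LinearMap.comp_apply, tensor_d_tmul, map_add, sgn_eq K hx, ← TensorProduct.smul_tmul',
        map_smul, h2 _ _ _ hx _ hy, LinearMap.comp_apply]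
    exact LinearMap.congr_fun this z

theorem isMor_of_tprod {n : ℕ} {K : Fin n → GrComplex.{v} R} {M : GrComplex.{u} R}
    {f : (⨂[R] i, K i) →ₗ[R] M}
    (h1 : ∀ a : Fin n → ℤ, ∀ x : ∀ i, K i, (∀ i, x i ∈ (K i).gr (a i)) →
      f (PiTensorProduct.tprod R x) ∈ M.gr (∑ i, a i))
    (h2 : ∀ a : Fin n → ℤ, ∀ x : ∀ i, K i, (∀ i, x i ∈ (K i).gr (a i)) →
      ∑ k, sg R (∑ i, (if i < k then 1 else 0) * (a i : ZMod 2)) •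
        f (PiTensorProduct.tprod R (Function.update x k ((K k).d (x k)))) =
        M.d (f (PiTensorProduct.tprod R x))) :
    IsMor (piTensor K) M f := by
  refine ⟨fun n x hx => ?_, fun z => ?_⟩
  · have : piGr K n ≤ (M.gr n).comap f := by
      refine Submodule.span_le.2 ?_
      rintro _ ⟨a, rfl, x, hx, rfl⟩
      exact h1 _ _ hx
    exact this hx
  · have : f ∘ₗ (piTensor K).d = M.d ∘ₗ f := pi_hom_ext fun a x hx => by
      rw [LinearMap.comp_apply, piTensor_d_apply, map_sum, LinearMap.comp_apply, ← h2 a x hx]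
      exact Finset.sum_congr rfl fun k _ => by rw [piD_eq hx, map_smul]
    exact LinearMap.congr_fun this z

theorem IsMor.tensor {K' : GrComplex.{a} R} {L' : GrComplex.{b} R} {f : K →ₗ[R] L}
    {f' : K' →ₗ[R] L'} (hf : IsMor K L f) (hf' : IsMor K' L' f') :
    IsMor (tensor K K') (tensor L L') (TensorProduct.map f f') := by
  refine isMor_of_tmul (fun m n x hx y hy => tmul_mem (hf.1 _ _ hx) (hf'.1 _ _ hy))
    (fun m n x hx y hy => ?_)
  simp only [TensorProduct.map_tmul, hf.2, hf'.2, LinearMap.add_apply, LinearMap.id_apply,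
    sgn_eq L (hf.1 _ _ hx), TensorProduct.smul_tmul']

theorem isMor_assoc (K : GrComplex.{v} R) (L : GrComplex.{w} R) (M : GrComplex.{u} R) :
    IsMor (tensor (tensor K L) M) (tensor K (tensor L M))
      (TensorProduct.assoc R K L M).toLinearMap := by
  refine ⟨fun n x hx => ?_, fun z => ?_⟩
  · have : tensorGr (tensor K L) M n ≤ (tensorGr K (tensor L M) n).comap
        (TensorProduct.assoc R K L M).toLinearMap := by
      refine Submodule.span_le.2 ?_
      rintro _ ⟨a, b, rfl, x, hx, y, hy, rfl⟩
      have : tensorGr K L a ≤ (tensorGr K (tensor L M) (a + b)).comap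
          ((TensorProduct.assoc R K L M).toLinearMap ∘ₗ (TensorProduct.mk R _ _).flip y) := by
        refine Submodule.span_le.2 ?_
        rintro _ ⟨a, a', rfl, x, hx, x', hx', rfl⟩
        have := tmul_mem (L := tensor L M) hx (tmul_mem hx' hy)
        rw [← add_assoc] at this
        exact this
      exact this hx
    exact this hx
  · have : (TensorProduct.assoc R K L M).toLinearMap ∘ₗ (tensor (tensor K L) M).d =
        (tensor K (tensor L M)).d ∘ₗ (TensorProduct.assoc R K L M).toLinearMap := by
      refine TensorProduct.ext_threefold fun x y z => ?_
      have e : (tensor K L).sgn (x ⊗ₜ y) = K.sgn x ⊗ₜ L.sgn y := by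
        have : (tensor K L).sgn = TensorProduct.map K.sgn L.sgn :=
          tensor_hom_ext fun m n x hx y hy => by
            rw [sgn_eq (tensor K L) (tmul_mem hx hy), TensorProduct.map_tmul, sgn_eq K hx,
              sgn_eq L hy, Int.cast_add, sg_add, TensorProduct.smul_tmul_smul]
        exact LinearMap.congr_fun this _
      simp only [LinearMap.comp_apply, LinearMap.add_apply, TensorProduct.map_tmul,
        LinearMap.id_apply, map_add, LinearEquiv.coe_coe, TensorProduct.assoc_tmul, e,
        TensorProduct.add_tmul, TensorProduct.tmul_add]
      rw [add_assoc]
    exact LinearMap.congr_fun this z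

theorem scale_single_mem (K : GrComplex.{v} R) (n : ℤ) (x : K) :
    K.scale (Pi.single n 1) x ∈ K.gr n := by
  have : LinearMap.range (K.scale (Pi.single n 1)) ≤ K.gr n := by
    rw [LinearMap.range_eq_map, ← K.internal.submodule_iSup_eq_top, Submodule.map_iSup]
    refine iSup_le fun m => ?_
    rintro _ ⟨z, hz, rfl⟩
    rw [scale_of_mem K _ hz]
    by_cases hm : m = n
    · subst hm; exact Submodule.smul_mem _ _ hz
    · simp [Pi.single_eq_of_ne hm]
  exact this ⟨x, rfl⟩

/-- Preservation of degrees becomes an equality of linear maps, namely commutation with the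
projections onto the graded pieces. It can then be tested on any spanning set, not only on the one
that defines the grading. -/
theorem mem_gr_of_scale {f : K →ₗ[R] L}
    (hf : ∀ n, f ∘ₗ K.scale (Pi.single n 1) = L.scale (Pi.single n 1) ∘ₗ f) (n : ℤ) (x : K)
    (hx : x ∈ K.gr n) : f x ∈ L.gr n := by
  have := LinearMap.congr_fun (hf n) x
  simp only [LinearMap.comp_apply, scale_of_mem K _ hx, Pi.single_eq_same, one_smul] at this
  rw [this]
  exact scale_single_mem L n _

/-- A degree preserving isomorphism commutes with the projections onto the graded pieces, hence so
does its inverse. -/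
theorem isMor_symm (e : K ≃ₗ[R] L) (he : IsMor K L e.toLinearMap) :
    IsMor L K e.symm.toLinearMap := by
  refine ⟨fun n x hx => ?_, fun x => ?_⟩
  · have key : ∀ m, K.scale (Pi.single m 1) (e.symm x) = e.symm (L.scale (Pi.single m 1) x) := by
      intro m
      rw [LinearEquiv.eq_symm_apply]
      have := scale_natural (Pi.single m 1) e.toLinearMap he.1 (e.symm x)
      simpa using this
    have := scale_single_mem K n (e.symm x)
    rw [key, scale_of_mem L _ hx] at this
    simpa using this
  · have := he.2 (e.symm x)
    simp only [LinearEquiv.coe_coe, LinearEquiv.apply_symm_apply] at this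
    simp only [LinearEquiv.coe_coe]
    rw [← this, LinearEquiv.symm_apply_apply]

theorem isMor_swap (K : GrComplex.{v} R) (L : GrComplex.{w} R) :
    IsMor (tensor K L) (tensor L K) (swap K L) := by
  refine isMor_of_tmul (fun m n x hx y hy => ?_) (fun m n x hx y hy => ?_)
  · rw [swap_eq hx hy, add_comm]
    exact Submodule.smul_mem _ _ (tmul_mem hy hx)
  · rw [swap_eq (K.d_mem _ _ hx) hy, swap_eq hx (L.d_mem _ _ hy), swap_eq hx hy, map_smul,
      tensor_d_tmul, sgn_eq L hy]
    push_cast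
    simp only [smul_add, TensorProduct.smul_tmul', smul_smul, add_mul, mul_add, one_mul, mul_one, sg_add]
    rw [add_comm]
    congr 2
    rw [mul_left_comm, sg_mul_self, mul_one]

/-- The interchange `(x ⊗ y) ⊗ (z ⊗ w) ↦ ± (x ⊗ z) ⊗ (y ⊗ w)` of the two middle factors. -/
def interchange (A : GrComplex.{v} R) (B : GrComplex.{w} R) (C : GrComplex.{a} R)
    (D : GrComplex.{b} R) : (A ⊗[R] B) ⊗[R] (C ⊗[R] D) →ₗ[R] (A ⊗[R] C) ⊗[R] (B ⊗[R] D) :=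
  (TensorProduct.assoc R A C (B ⊗[R] D)).symm.toLinearMap ∘ₗ
    TensorProduct.map LinearMap.id
      ((TensorProduct.assoc R C B D).toLinearMap ∘ₗ
        TensorProduct.map (swap B C) LinearMap.id ∘ₗ (TensorProduct.assoc R B C D).symm.toLinearMap) ∘ₗ
    (TensorProduct.assoc R A B (C ⊗[R] D)).toLinearMap

theorem isMor_interchange (A : GrComplex.{v} R) (B : GrComplex.{w} R) (C : GrComplex.{a} R)
    (D : GrComplex.{b} R) : IsMor (tensor (tensor A B) (tensor C D))
      (tensor (tensor A C) (tensor B D)) (interchange A B C D) :=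
  (isMor_symm _ (isMor_assoc A C (tensor B D))).comp
    ((IsMor.id.tensor ((isMor_assoc C B D).comp (((isMor_swap B C).tensor IsMor.id).comp
      (isMor_symm _ (isMor_assoc B C D))))).comp (isMor_assoc A B (tensor C D)))

theorem interchange_eq {A : GrComplex.{v} R} {B : GrComplex.{w} R} {C : GrComplex.{a} R}
    {D : GrComplex.{b} R} {m n : ℤ} (x : A) {y : B} (hy : y ∈ B.gr m) {z : C} (hz : z ∈ C.gr n)
    (t : D) : interchange A B C D ((x ⊗ₜ y) ⊗ₜ (z ⊗ₜ t)) =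
      sg R ((m : ZMod 2) * (n : ZMod 2)) • ((x ⊗ₜ z) ⊗ₜ (y ⊗ₜ t)) := by
  simp only [interchange, LinearMap.comp_apply, LinearEquiv.coe_coe, TensorProduct.assoc_tmul,
    TensorProduct.map_tmul, TensorProduct.assoc_symm_tmul, swap_eq hy hz, LinearMap.id_apply,
    TensorProduct.smul_tmul', TensorProduct.tmul_smul]

theorem IsHomotopy.postcomp {M : GrComplex.{u} R} {f g h : K →ₗ[R] L} (H : IsHomotopy K L f g h)
    {e : L →ₗ[R] M} (he : IsMor L M e) : IsHomotopy K M (e ∘ₗ f) (e ∘ₗ g) (e ∘ₗ h) :=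
  ⟨fun n x hx => he.1 _ _ (H.1 n x hx), fun x => by
    simp only [LinearMap.comp_apply]
    rw [← map_sub, H.2, map_add, he.2]⟩

theorem IsHomotopy.tensor {f g h : K →ₗ[R] L} (H : IsHomotopy K L f g h) {K' : GrComplex.{a} R}
    {L' : GrComplex.{b} R} {e : K' →ₗ[R] L'} (he : IsMor K' L' e) :
    IsHomotopy (GrComplex.tensor K K') (GrComplex.tensor L L') (TensorProduct.map f e)
      (TensorProduct.map g e) (TensorProduct.map h e) := by
  constructor
  · intro n z hz
    have : tensorGr K K' n ≤ (tensorGr L L' (n - 1)).comap (TensorProduct.map h e) := by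
      refine Submodule.span_le.2 ?_
      rintro _ ⟨a, b, rfl, x, hx, y, hy, rfl⟩
      have := tmul_mem (H.1 a x hx) (he.1 b y hy)
      rw [sub_add_eq_add_sub] at this
      exact this
    exact this hz
  · intro z
    have : TensorProduct.map f e - TensorProduct.map g e =
        (GrComplex.tensor L L').d ∘ₗ TensorProduct.map h e +
          TensorProduct.map h e ∘ₗ (GrComplex.tensor K K').d :=
      tensor_hom_ext fun m n x hx y hy => by
        have h1 := sgn_eq L (H.1 m x hx)
        have h2 := sgn_eq K hx
        have h3 : f x = g x + (L.d (h x) + h (K.d x)) := by rw [← H.2]; abel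
        simp only [LinearMap.sub_apply, LinearMap.add_apply, LinearMap.comp_apply,
          TensorProduct.map_tmul, h1, h2, h3, LinearMap.id_apply, map_add, he.2, map_smul,
          TensorProduct.add_tmul]
        push_cast
        -- As `h` shifts the degree by one, `h x` has the sign opposite to that of `x`; this cancels
        -- the two cross terms `h x ⊗ d (e y)`.
        rw [CharTwo.sub_eq_add, sg_add, sg_one, mul_neg_one, neg_smul, TensorProduct.neg_tmul]
        abel
    exact LinearMap.congr_fun this z

end GrComplex

end

/-! ### Koszul signs of permutations and shuffles on tensor powers -/

section

namespace GrComplex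

variable {R : Type} [CommRing R]

/-- Applying `d` to the `k`-th factor raises its degree by one. This lemma and the next two give the
resulting change of a sign exponent when the second, the first, or both sets of degrees are
affected. -/
theorem sum_mul_delta {n : ℕ} (c : Fin n → Fin n → ZMod 2) (a b : Fin n → ZMod 2) (k : Fin n) :
    ∑ i, ∑ j, c i j * (a i * (b j + if j = k then 1 else 0)) =
      (∑ i, ∑ j, c i j * (a i * b j)) + ∑ i, c i k * a i := by
  simp only [mul_add, Finset.sum_add_distrib, mul_ite, mul_one, mul_zero]
  simp

theorem sum_delta_mul {n : ℕ} (c : Fin n → Fin n → ZMod 2) (a b : Fin n → ZMod 2) (k : Fin n) :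
    ∑ i, ∑ j, c i j * ((a i + if i = k then 1 else 0) * b j) =
      (∑ i, ∑ j, c i j * (a i * b j)) + ∑ j, c k j * b j := by
  simp only [mul_add, add_mul, Finset.sum_add_distrib, mul_ite, ite_mul, mul_zero,
    one_mul, zero_mul]
  congr 1
  rw [Finset.sum_comm]
  simp

theorem sum_delta_delta {n : ℕ} (c : Fin n → Fin n → ZMod 2) (hc : ∀ i, c i i = 0)
    (a : Fin n → ZMod 2) (k : Fin n) :
    ∑ i, ∑ j, c i j * ((a i + if i = k then 1 else 0) * (a j + if j = k then 1 else 0)) =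
      (∑ i, ∑ j, c i j * (a i * a j)) + ∑ i, (c i k + c k i) * a i := by
  rw [sum_mul_delta, sum_delta_mul]
  simp only [add_mul, Finset.sum_add_distrib, mul_add, mul_ite, mul_one, mul_zero]
  have : ∑ i, (if i = k then c i k else 0) = 0 := by simp [hc]
  rw [this]
  abel

theorem sum_add_mul_add {n : ℕ} (c : Fin n → Fin n → ZMod 2) (a b : Fin n → ZMod 2) :
    ∑ i, ∑ j, c i j * ((a i + b i) * (a j + b j)) =
      (∑ i, ∑ j, c i j * (a i * a j)) + (∑ i, ∑ j, c i j * (b i * b j)) +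
        ∑ i, ∑ j, (c i j + c j i) * (b i * a j) := by
  have h : ∑ i, ∑ j, c j i * (b i * a j) = ∑ i, ∑ j, c i j * (b j * a i) := Finset.sum_comm
  simp only [add_mul, mul_add, Finset.sum_add_distrib, h]
  simp only [mul_comm (b _) (a _)]
  ring

section

variable {n : ℕ} {K : Fin n → GrComplex.{v} R} {L : Fin n → GrComplex.{w} R}

theorem map_update {f : ∀ i, K i →ₗ[R] L i} (x : ∀ i, K i) (k : Fin n) (y : K k) :
    (fun i => f i (Function.update x k y i)) =
      Function.update (fun i => f i (x i)) k (f k y) := by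
  funext i
  by_cases h : i = k
  · subst h; simp
  · simp [h]

theorem isMor_piMap {f : ∀ i, K i →ₗ[R] L i} (hf : ∀ i, IsMor (K i) (L i) (f i)) :
    IsMor (piTensor K) (piTensor L) (PiTensorProduct.map f) := by
  refine isMor_of_tprod (fun a x hx => ?_) (fun a x hx => ?_)
  · rw [PiTensorProduct.map_tprod]
    exact tprod_mem fun i => (hf i).1 _ _ (hx i)
  · rw [PiTensorProduct.map_tprod, piTensor_d_apply]
    refine Finset.sum_congr rfl fun k _ => ?_
    rw [PiTensorProduct.map_tprod, piD_eq fun i => (hf i).1 _ _ (hx i), map_update, (hf k).2]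

theorem permute_natural (f : ∀ i, K i →ₗ[R] L i)
    (hf : ∀ i, ∀ m, ∀ x ∈ (K i).gr m, f i x ∈ (L i).gr m) (σ : Equiv.Perm (Fin n))
    (z : ⨂[R] i, K i) :
    PiTensorProduct.map (fun i => f (σ.symm i)) (permute K σ z) =
      permute L σ (PiTensorProduct.map f z) := by
  have : PiTensorProduct.map (fun i => f (σ.symm i)) ∘ₗ permute K σ =
      permute L σ ∘ₗ PiTensorProduct.map f := pi_hom_ext fun a x hx => by
    simp only [LinearMap.comp_apply]
    rw [permute_eq σ hx, PiTensorProduct.map_tprod, map_smul,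
      permute_eq σ fun i => hf i _ _ (hx i), PiTensorProduct.map_tprod]
  exact LinearMap.congr_fun this z

/-- The `k`-th summand of the differential corresponds to the `σ k`-th summand after permuting. The
signs agree because the pairs `{i, k}` inverted by `σ` are exactly those for which the truth values
of `i < k` and `σ i < σ k` differ. -/
theorem isMor_permute (K : Fin n → GrComplex.{v} R) (σ : Equiv.Perm (Fin n)) :
    IsMor (piTensor K) (piTensor fun i => K (σ.symm i)) (permute K σ) := by
  refine isMor_of_tprod (fun a x hx => ?_) (fun a x hx => ?_)
  · rw [permute_eq σ hx, ← Equiv.sum_comp σ.symm a]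
    exact Submodule.smul_mem _ _ (tprod_mem fun i => hx (σ.symm i))
  · rw [permute_eq σ hx, map_smul, piTensor_d_apply, Finset.smul_sum]
    refine Fintype.sum_equiv σ _ _ fun k => ?_
    rw [permute_eq σ (update_mem hx k), piD_eq (K := fun i => K (σ.symm i)) fun i => hx (σ.symm i),
      smul_smul, smul_smul, ← sg_add, ← sg_add]
    congr 1
    · congr 1
      push_cast
      rw [sum_delta_delta _ (by simp),
        ← Equiv.sum_comp σ fun i => (if i < σ k then 1 else 0) * (a (σ.symm i) : ZMod 2),
        add_left_comm]
      congr 1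
      rw [← Finset.sum_add_distrib]
      refine Finset.sum_congr rfl fun i _ => ?_
      rw [← add_mul, Equiv.symm_apply_apply]
      congr 1
      have hσ : σ i = σ k ↔ i = k := σ.injective.eq_iff
      rcases lt_trichotomy i k with h | h | h
      · rcases lt_or_gt_of_ne (fun e => h.ne (hσ.1 e)) with h' | h'
        · simp [h, h', h.not_gt, h'.not_gt]
        · simp [h, h', h.not_gt, h'.not_gt, CharTwo.add_self_eq_zero]
      · subst h; simp
      · rcases lt_or_gt_of_ne (fun e => h.ne' (hσ.1 e)) with h' | h'
        · simp [h, h', h.not_gt, h'.not_gt]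
        · simp [h, h', h.not_gt, h'.not_gt]
    · congr 1
      funext i
      by_cases h : i = σ k
      · subst h
        rw [Function.update_self]
        -- The factors have different types, and `σ.symm (σ k)` is only propositionally equal to
        -- `k`; hence the detour through an arbitrary index `l = k`.
        have : ∀ l (hl : l = k), Function.update x k ((K k).d (x k)) l = (K l).d (x l) := by
          rintro _ rfl; simp
        exact this _ (by simp)
      · rw [Function.update_of_ne h, Function.update_of_ne]
        intro h'
        exact h (by rw [← h']; simp)

end

section

variable (K : GrComplex.{v} R) (L : GrComplex.{w} R) {n : ℕ}

theorem permute_one (z : power K n) : permute (fun _ : Fin n => K) 1 z = z := by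
  have : permute (fun _ : Fin n => K) 1 = LinearMap.id := pi_hom_ext fun a x hx => by
    have h : ∀ i j : Fin n, ¬ (i < j ∧ j < i) := fun i j h => h.1.not_gt h.2
    rw [permute_eq 1 hx]
    simp [h]
    rfl
  exact LinearMap.congr_fun this z

/-- Modulo `2`, the inversions of `σ * τ` are those of `τ` together with those of `σ` pulled back
along `τ`: a pair inverted twice is not inverted by the product. -/
theorem permute_mul (σ τ : Equiv.Perm (Fin n)) (z : power K n) :
    permute (fun _ : Fin n => K) (σ * τ) z =
      permute (fun _ : Fin n => K) σ (permute (fun _ : Fin n => K) τ z) := by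
  have : permute (fun _ : Fin n => K) (σ * τ) =
      permute (fun _ : Fin n => K) σ ∘ₗ permute (fun _ : Fin n => K) τ :=
    pi_hom_ext fun a x hx => by
      rw [LinearMap.comp_apply, permute_eq (σ * τ) hx, permute_eq τ hx, map_smul,
        permute_eq (K := fun _ => K) σ fun i => hx (τ.symm i), smul_smul, ← sg_add]
      congr 2
      -- The exponent of `σ` is expressed in the positions before `τ` acts, so that all three
      -- exponents are quadratic in the same degrees `a`.
      rw [← Equiv.sum_comp τ (fun i => ∑ j, (if i < j ∧ σ j < σ i then (1 : ZMod 2) else 0) *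
        ((a (τ.symm i) : ZMod 2) * (a (τ.symm j) : ZMod 2)))]
      simp only [← Equiv.sum_comp τ (fun j => (if _ < j ∧ σ j < σ _ then (1 : ZMod 2) else 0) *
        ((a (τ.symm _) : ZMod 2) * (a (τ.symm j) : ZMod 2)))]
      simp only [Equiv.symm_apply_apply, ← Finset.sum_add_distrib, ← add_mul]
      refine sum_symm_congr _ _ (fun i => (a i : ZMod 2)) (fun i j hij => ?_) (by simp)
      have hτ : τ i ≠ τ j := fun h => hij.ne (τ.injective h)
      have hσ : σ (τ i) ≠ σ (τ j) := fun h => hτ (σ.injective h)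
      simp only [Equiv.Perm.mul_apply]
      rcases lt_or_gt_of_ne hτ with h | h <;> rcases lt_or_gt_of_ne hσ with h' | h' <;>
        simp [h, h', hij, h.not_gt, h'.not_gt, hij.not_gt, CharTwo.add_self_eq_zero]
  exact LinearMap.congr_fun this z

variable {K L}

/-- Linear maps on `(K ⊗ L)ⁿ` which agree on homogeneous decomposable tensors are equal. -/
theorem power_tensor_hom_ext {M : Type*} [AddCommGroup M] [Module R M]
    {f g : power (tensor K L) n →ₗ[R] M}
    (h : ∀ a b : Fin n → ℤ, ∀ x : Fin n → K, ∀ y : Fin n → L, (∀ i, x i ∈ K.gr (a i)) →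
      (∀ i, y i ∈ L.gr (b i)) →
      f (PiTensorProduct.tprod R fun i => x i ⊗ₜ y i) =
        g (PiTensorProduct.tprod R fun i => x i ⊗ₜ y i)) : f = g := by
  -- `S` indexes the pure tensors of homogeneous elements, which span `K ⊗ L`; their tensor products
  -- then span the power.
  let S : Type _ := {q : (ℤ × ℤ) × (K × L) // q.2.1 ∈ K.gr q.1.1 ∧ q.2.2 ∈ L.gr q.1.2}
  let e : S → K ⊗[R] L := fun q => q.1.2.1 ⊗ₜ q.1.2.2
  have he : Submodule.span R (Set.range e) = ⊤ := by
    rw [eq_top_iff, ← tensor_iSup K L]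
    refine iSup_le fun n => Submodule.span_mono ?_
    rintro _ ⟨a, b, -, x, hx, y, hy, rfl⟩
    exact ⟨⟨((a, b), (x, y)), hx, hy⟩, rfl⟩
  refine PiTensorProduct.ext_of_span_eq_top (fun _ : Fin n => he) fun q => ?_
  exact h (fun i => (q i).1.1.1) (fun i => (q i).1.1.2) (fun i => (q i).1.2.1)
    (fun i => (q i).1.2.2) (fun i => (q i).2.1) (fun i => (q i).2.2)

/-- The graded pieces of `(K ⊗ L)ⁿ` are by definition spanned by tensors of arbitrary homogeneous
elements of `K ⊗ L`, not of pure ones. The degree condition therefore goes through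
`mem_gr_of_scale`. -/
theorem isMor_of_power_tensor {M : GrComplex.{u} R} {f : power (tensor K L) n →ₗ[R] M}
    (h1 : ∀ a b : Fin n → ℤ, ∀ x : Fin n → K, ∀ y : Fin n → L, (∀ i, x i ∈ K.gr (a i)) →
      (∀ i, y i ∈ L.gr (b i)) →
      f (PiTensorProduct.tprod R fun i => x i ⊗ₜ y i) ∈ M.gr (∑ i, (a i + b i)))
    (h2 : ∀ a b : Fin n → ℤ, ∀ x : Fin n → K, ∀ y : Fin n → L, (∀ i, x i ∈ K.gr (a i)) →
      (∀ i, y i ∈ L.gr (b i)) →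
      ∑ k, sg R (∑ i, (if i < k then 1 else 0) * ((a i : ZMod 2) + (b i : ZMod 2))) •
        (f (PiTensorProduct.tprod R fun i => Function.update x k (K.d (x k)) i ⊗ₜ y i) +
          sg R (a k : ZMod 2) •
            f (PiTensorProduct.tprod R fun i => x i ⊗ₜ Function.update y k (L.d (y k)) i)) =
        M.d (f (PiTensorProduct.tprod R fun i => x i ⊗ₜ y i))) :
    IsMor (power (tensor K L) n) M f := by
  constructor
  · refine mem_gr_of_scale fun m => power_tensor_hom_ext fun a b x y hx hy => ?_
    have ht := tprod_mem (K := fun _ : Fin n => tensor K L) fun i => tmul_mem (hx i) (hy i)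
    simp only [LinearMap.comp_apply]
    erw [scale_of_mem _ _ ht]
    rw [map_smul, scale_of_mem M _ (h1 a b x y hx hy)]
  · intro z
    have : f ∘ₗ (power (tensor K L) n).d = M.d ∘ₗ f :=
      power_tensor_hom_ext fun a b x y hx hy => by
        simp only [LinearMap.comp_apply]
        rw [piTensor_d_apply, map_sum, ← h2 a b x y hx hy]
        refine Finset.sum_congr rfl fun k _ => ?_
        rw [piD_eq (K := fun _ : Fin n => tensor K L) fun i => tmul_mem (hx i) (hy i), map_smul,
          ← map_smul f (sg R (a k : ZMod 2)), ← map_add]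
        push_cast
        congr 2
        rw [tensor_d_tmul, MultilinearMap.map_update_add, sgn_eq K (hx k),
          ← TensorProduct.smul_tmul', MultilinearMap.map_update_smul]
        congr 2
        · funext i
          by_cases h : i = k
          · subst h; simp
          · simp [h]
        · congr 1
          funext i
          by_cases h : i = k
          · subst h; simp
          · simp [h]
    exact LinearMap.congr_fun this z

variable (K L)

/-- The terms where `d` hits `x k` or `y k` are compared separately for each `k`. For `x k`, the
degrees of the earlier `y i` occur twice in the exponent, once from `d` passing them and once from
the changed shuffling sign. -/
theorem isMor_unshuffle (n : ℕ) :
    IsMor (power (tensor K L) n) (tensor (power K n) (power L n)) (unshuffle K L n) := by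
  refine isMor_of_power_tensor (fun a b x y hx hy => ?_) (fun a b x y hx hy => ?_)
  · rw [unshuffle_eq hx hy, Finset.sum_add_distrib]
    exact Submodule.smul_mem _ _ (tmul_mem (tprod_mem hx) (tprod_mem hy))
  · rw [unshuffle_eq hx hy, map_smul, tensor_d_tmul,
      sgn_eq (power K n) (tprod_mem (K := fun _ => K) hx), piTensor_d_apply, piTensor_d_apply,
      TensorProduct.sum_tmul, TensorProduct.tmul_sum, ← Finset.sum_add_distrib, Finset.smul_sum]
    refine Finset.sum_congr rfl fun k _ => ?_
    rw [unshuffle_eq (update_mem (K := fun _ => K) hx k) hy,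
      unshuffle_eq hx (update_mem (K := fun _ => L) hy k), piD_eq (K := fun _ => K) hx,
      piD_eq (K := fun _ => L) hy]
    simp only [smul_add, TensorProduct.tmul_smul, ← TensorProduct.smul_tmul', smul_smul, ← sg_add]
    push_cast
    simp only [sum_mul_delta, sum_delta_mul]
    congr 3
    · rw [add_left_comm, ← Finset.sum_add_distrib]
      congr 1
      refine Finset.sum_congr rfl fun i _ => ?_
      rw [← mul_add, add_assoc, CharTwo.add_self_eq_zero, add_zero]
    -- In the target `d` reaches `y k` only after passing every `x i`. The total degree of the `x i`
    -- is split at `k`: the first two parts are passed in the source as well, and the last is the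
    -- change of the shuffling sign.
    · have h : ∑ i, (a i : ZMod 2) = (∑ i, (if i < k then 1 else 0) * (a i : ZMod 2)) + (a k : ZMod 2) +
          ∑ i, (if k < i then 1 else 0) * (a i : ZMod 2) := by
        rw [show (a k : ZMod 2) = ∑ i, (if i = k then 1 else 0) * (a i : ZMod 2) by simp,
          ← Finset.sum_add_distrib, ← Finset.sum_add_distrib]
        refine Finset.sum_congr rfl fun i _ => ?_
        rcases lt_trichotomy i k with h | h | h
        · simp [h, h.ne, h.not_gt]
        · subst h; simp
        · simp [h, h.ne', h.not_gt]
      rw [h]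
      simp only [mul_add, Finset.sum_add_distrib]
      ring

theorem unshuffle_permute (σ : Equiv.Perm (Fin n)) (z : power (tensor K L) n) :
    unshuffle K L n (permute (fun _ => tensor K L) σ z) =
      TensorProduct.map (permute (fun _ => K) σ) (permute (fun _ => L) σ) (unshuffle K L n z) := by
  have : unshuffle K L n ∘ₗ permute (fun _ => tensor K L) σ =
      TensorProduct.map (permute (fun _ => K) σ) (permute (fun _ => L) σ) ∘ₗ unshuffle K L n :=
    power_tensor_hom_ext fun a b x y hx hy => by
      simp only [LinearMap.comp_apply]
      rw [permute_eq (K := fun _ : Fin n => tensor K L) σ fun i => tmul_mem (hx i) (hy i), map_smul,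
        unshuffle_eq hx hy, map_smul, TensorProduct.map_tmul, permute_eq (K := fun _ => K) σ hx,
        permute_eq (K := fun _ => L) σ hy]
      erw [unshuffle_eq (fun i => hx (σ.symm i)) (fun i => hy (σ.symm i))]
      simp only [TensorProduct.tmul_smul, ← TensorProduct.smul_tmul', smul_smul, ← sg_add]
      congr 2
      rw [← Equiv.sum_comp σ (fun i => ∑ j, (if i < j then (1 : ZMod 2) else 0) *
        ((b (σ.symm i) : ZMod 2) * (a (σ.symm j) : ZMod 2)))]
      simp only [← Equiv.sum_comp σ (fun j => (if _ < j then (1 : ZMod 2) else 0) *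
        ((b (σ.symm _) : ZMod 2) * (a (σ.symm j) : ZMod 2)))]
      push_cast
      simp only [Equiv.symm_apply_apply]
      rw [sum_add_mul_add]
      -- The terms in `a` alone and in `b` alone agree on both sides. What remains are the mixed
      -- terms `b i * a j`: pairs whose relative order is changed by `σ`, plus pairs with `σ i < σ
      -- j`, give modulo `2` the pairs with `i < j`.
      have key : (∑ i, ∑ j, ((if i < j ∧ σ j < σ i then 1 else 0) +
          if j < i ∧ σ i < σ j then 1 else 0) * ((b i : ZMod 2) * (a j : ZMod 2))) +
          ∑ i, ∑ j, (if σ i < σ j then 1 else 0) * ((b i : ZMod 2) * (a j : ZMod 2)) =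
          ∑ i, ∑ j, (if i < j then 1 else 0) * ((b i : ZMod 2) * (a j : ZMod 2)) := by
        simp only [← Finset.sum_add_distrib, ← add_mul]
        refine Finset.sum_congr rfl fun i _ => Finset.sum_congr rfl fun j _ => ?_
        congr 1
        rcases lt_trichotomy i j with h | h | h
        · rcases lt_or_gt_of_ne (fun e => h.ne (σ.injective e)) with h' | h' <;>
            simp [h, h', h.not_gt, h'.not_gt]
        · subst h; simp
        · rcases lt_or_gt_of_ne (fun e => h.ne' (σ.injective e)) with h' | h' <;>
            simp [h, h', h.not_gt, h'.not_gt, CharTwo.add_self_eq_zero]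
      linear_combination key
  exact LinearMap.congr_fun this z

end

end GrComplex

end

section

/-! ### Contractions -/

namespace GrComplex

variable {R : Type} [CommRing R]

/-- `ε` is an augmentation of `K`. -/
structure IsAug (K : GrComplex.{v} R) (ε : K →ₗ[R] R) : Prop where
  of_ne : ∀ n, n ≠ 0 → ∀ x ∈ K.gr n, ε x = 0
  d : ∀ x, ε (K.d x) = 0

theorem IsAug.sgn {K : GrComplex.{v} R} {ε : K →ₗ[R] R} (h : IsAug K ε) (x : K) :
    ε (K.sgn x) = ε x := by
  have : ε ∘ₗ K.sgn = ε := K.hom_ext fun n x hx => by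
    rw [LinearMap.comp_apply, sgn_eq K hx]
    by_cases hn : n = 0
    · subst hn; simp
    · rw [map_smul, h.of_ne n hn x hx, smul_zero]
  exact LinearMap.congr_fun this x

/-- A contraction of `K` onto a point, with respect to an augmentation. -/
structure Contraction (K : GrComplex.{v} R) (ε : K →ₗ[R] R) where
  pt : K
  h : K →ₗ[R] K
  pt_mem : pt ∈ K.gr 0
  d_pt : K.d pt = 0
  h_mem : ∀ n, ∀ x ∈ K.gr n, h x ∈ K.gr (n - 1)
  eq : ∀ x, K.d (h x) + h (K.d x) = x - ε x • pt

/-- The augmentation of a tensor product. -/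
def augTensor {K : GrComplex.{v} R} {L : GrComplex.{w} R} (ε : K →ₗ[R] R) (ε' : L →ₗ[R] R) :
    K ⊗[R] L →ₗ[R] R := (TensorProduct.lid R R).toLinearMap ∘ₗ TensorProduct.map ε ε'

@[simp] theorem augTensor_tmul {K : GrComplex.{v} R} {L : GrComplex.{w} R} (ε : K →ₗ[R] R)
    (ε' : L →ₗ[R] R) (x : K) (y : L) : augTensor ε ε' (x ⊗ₜ y) = ε x * ε' y := by
  simp [augTensor]

/-- The augmentation of a tensor product of a family. -/
def augPi {n : ℕ} {K : Fin n → GrComplex.{v} R} (ε : ∀ i, K i →ₗ[R] R) : (⨂[R] i, K i) →ₗ[R] R :=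
  PiTensorProduct.lift (MultilinearMap.mkPiAlgebra R (Fin n) R) ∘ₗ PiTensorProduct.map ε

@[simp] theorem augPi_tprod {n : ℕ} {K : Fin n → GrComplex.{v} R} (ε : ∀ i, K i →ₗ[R] R)
    (x : ∀ i, K i) : augPi ε (PiTensorProduct.tprod R x) = ∏ i, ε i (x i) := by
  simp [augPi]

theorem IsAug.tensor {K : GrComplex.{v} R} {L : GrComplex.{w} R} {ε : K →ₗ[R] R}
    {ε' : L →ₗ[R] R} (h : IsAug K ε) (h' : IsAug L ε') :
    IsAug (tensor K L) (augTensor ε ε') := by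
  constructor
  · intro n hn z hz
    have : tensorGr K L n ≤ LinearMap.ker (augTensor ε ε') := by
      refine Submodule.span_le.2 ?_
      rintro _ ⟨a, b, rfl, x, hx, y, hy, rfl⟩
      by_cases ha : a = 0
      · simp [h'.of_ne b (by omega) y hy]
      · simp [h.of_ne a ha x hx]
    exact this hz
  · intro z
    induction z using TensorProduct.induction_on with
    | zero => simp
    | add x y hx hy => rw [map_add, map_add, hx, hy, add_zero]
    | tmul x y => simp [h.d, h'.d]

theorem IsAug.pi {n : ℕ} {K : Fin n → GrComplex.{v} R} {ε : ∀ i, K i →ₗ[R] R}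
    (h : ∀ i, IsAug (K i) (ε i)) : IsAug (piTensor K) (augPi ε) := by
  constructor
  · intro n hn z hz
    have : piGr K n ≤ LinearMap.ker (augPi ε) := by
      refine Submodule.span_le.2 ?_
      rintro _ ⟨a, rfl, x, hx, rfl⟩
      obtain ⟨i, hi⟩ : ∃ i, a i ≠ 0 := by
        by_contra! hc
        exact hn (by simp [hc])
      rw [SetLike.mem_coe, LinearMap.mem_ker, augPi_tprod]
      exact Finset.prod_eq_zero (Finset.mem_univ i) ((h i).of_ne _ hi _ (hx i))
    exact this hz
  · intro z
    have : augPi ε ∘ₗ (piTensor K).d = 0 := pi_hom_ext fun a x hx => by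
      rw [LinearMap.comp_apply, piTensor_d_apply, map_sum]
      refine Finset.sum_eq_zero fun k _ => ?_
      rw [piD_eq hx, map_smul, augPi_tprod,
        Finset.prod_eq_zero (Finset.mem_univ k) (by simp [(h k).d]), smul_zero]
    exact LinearMap.congr_fun this z

namespace Contraction

/-- The projection onto the point. -/
def e {K : GrComplex.{v} R} {ε : K →ₗ[R] R} (c : Contraction K ε) : K →ₗ[R] K :=
  ε.smulRight c.pt

theorem e_apply {K : GrComplex.{v} R} {ε : K →ₗ[R] R} (c : Contraction K ε) (x : K) :
    c.e x = ε x • c.pt := rfl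

theorem h_sgn {K : GrComplex.{v} R} {ε : K →ₗ[R] R} (c : Contraction K ε) (x : K) :
    c.h (K.sgn x) = - K.sgn (c.h x) := by
  have : c.h ∘ₗ K.sgn = - (K.sgn ∘ₗ c.h) := K.hom_ext fun n x hx => by
    rw [LinearMap.comp_apply, sgn_eq K hx, LinearMap.neg_apply, LinearMap.comp_apply,
      sgn_eq K (c.h_mem n x hx), map_smul]
    push_cast
    rw [CharTwo.sub_eq_add, sg_add, sg_one]
    simp
  exact LinearMap.congr_fun this x

theorem sgn_pt {K : GrComplex.{v} R} {ε : K →ₗ[R] R} (c : Contraction K ε) :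
    K.sgn c.pt = c.pt := by rw [sgn_eq K c.pt_mem]; simp

/-- The contraction of a tensor product. -/
def tensorProd {K : GrComplex.{v} R} {L : GrComplex.{w} R} {ε : K →ₗ[R] R}
    {ε' : L →ₗ[R] R} (hε : IsAug K ε) (c : Contraction K ε) (c' : Contraction L ε') :
    Contraction (tensor K L) (augTensor ε ε') where
  pt := c.pt ⊗ₜ c'.pt
  -- With `e` the projection onto the point, the two summands contribute `(1 - e) ⊗ 1` and `e ⊗ (1 -
  -- e')`, whose sum is `1 - e ⊗ e'`. The second summand carries no Koszul sign because `e` is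
  -- concentrated in degree `0`.
  h := TensorProduct.map c.h LinearMap.id + TensorProduct.map c.e c'.h
  pt_mem := by
    have := tmul_mem c.pt_mem c'.pt_mem
    rwa [add_zero] at this
  d_pt := (tensor_d_tmul c.pt c'.pt).trans (by
    rw [c.d_pt, c'.d_pt, TensorProduct.zero_tmul, TensorProduct.tmul_zero, add_zero])
  h_mem n z hz := by
    have : tensorGr K L n ≤ (tensorGr K L (n - 1)).comap
        (TensorProduct.map c.h LinearMap.id + TensorProduct.map c.e c'.h) := by
      refine Submodule.span_le.2 ?_
      rintro _ ⟨a, b, rfl, x, hx, y, hy, rfl⟩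
      refine (tensorGr K L (a + b - 1)).add_mem ?_ ?_
      · have := tmul_mem (c.h_mem a x hx) hy
        rwa [sub_add_eq_add_sub] at this
      · by_cases ha : a = 0
        · subst ha
          have := tmul_mem (Submodule.smul_mem _ (ε x) c.pt_mem) (c'.h_mem b y hy)
          rwa [← add_sub_assoc] at this
        · rw [TensorProduct.map_tmul, e_apply, hε.of_ne a ha x hx, zero_smul,
            TensorProduct.zero_tmul]
          exact Submodule.zero_mem _
    exact this hz
  eq z := by
    induction z using TensorProduct.induction_on with
    | zero => simp
    | add x y hx hy =>
      simp only [map_add, add_smul] at hx hy ⊢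
      rw [add_sub_add_comm, ← hx, ← hy]
      abel
    | tmul x y =>
      have h1 := c.eq x
      have h2 := c'.eq y
      simp only [LinearMap.add_apply, TensorProduct.map_tmul, LinearMap.id_apply, e_apply, map_add,
        map_smul, c.d_pt, c.sgn_pt, h_sgn, hε.d, hε.sgn, augTensor_tmul, zero_smul, smul_zero,
        TensorProduct.zero_tmul, TensorProduct.neg_tmul]
      have h3 : K.d (c.h x) = x - ε x • c.pt - c.h (K.d x) := by rw [← h1]; abel
      have h4 : L.d (c'.h y) = y - ε' y • c'.pt - c'.h (L.d y) := by rw [← h2]; abel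
      rw [h3, h4]
      simp only [TensorProduct.sub_tmul, TensorProduct.tmul_sub, TensorProduct.smul_tmul',
        TensorProduct.tmul_smul, smul_smul, mul_comm (ε' y)]
      abel

/-- The map of a pair of families with `f i` for `i < k`, `g` at `k`, and the identity above. -/
def step {n : ℕ} {K : Fin n → GrComplex.{v} R} (f : ∀ i, K i →ₗ[R] K i) (k : Fin n)
    (g : K k →ₗ[R] K k) : (⨂[R] i, K i) →ₗ[R] ⨂[R] i, K i :=
  PiTensorProduct.map (Function.update (fun i => if i < k then f i else LinearMap.id) k g)

theorem step_tprod {n : ℕ} {K : Fin n → GrComplex.{v} R} (f : ∀ i, K i →ₗ[R] K i) (k : Fin n)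
    (g : K k →ₗ[R] K k) (x : ∀ i, K i) : step f k g (PiTensorProduct.tprod R x) =
      PiTensorProduct.tprod R
        (Function.update (fun i => if i < k then f i (x i) else x i) k (g (x k))) := by
  rw [step, PiTensorProduct.map_tprod]
  congr 1
  funext i
  by_cases h : i = k
  · subst h; simp
  · by_cases h' : i < k <;> simp [h, h']

/-- A telescoping sum: the `k`-th summand replaces the identity by `f k` at the place `k`, all
earlier places having been replaced already. -/
theorem sum_step {n : ℕ} {K : Fin n → GrComplex.{v} R} (f : ∀ i, K i →ₗ[R] K i)
    (z : ⨂[R] i, K i) :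
    ∑ k, step f k (LinearMap.id - f k) z = z - PiTensorProduct.map f z := by
  have key : ∀ m ≤ n, ∑ k : Fin n, (if (k : ℕ) < m then step f k (LinearMap.id - f k) else 0) =
      LinearMap.id - PiTensorProduct.map fun i : Fin n => if (i : ℕ) < m then f i else
        LinearMap.id := by
    intro m
    induction m with
    | zero => intro _; simp
    | succ m ih =>
      intro hm
      have hs : ∀ k : Fin n, (if (k : ℕ) < m + 1 then step f k (LinearMap.id - f k) else 0) =
          (if (k : ℕ) < m then step f k (LinearMap.id - f k) else 0) +
            if k = ⟨m, hm⟩ then step f k (LinearMap.id - f k) else 0 := by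
        intro k
        rcases lt_trichotomy (k : ℕ) m with h | h | h
        · simp [h, h.trans (Nat.lt_succ_self m), Fin.ext_iff, h.ne]
        · simp [h, Fin.ext_iff]
        · simp [h.not_gt, Fin.ext_iff, h.ne', show ¬ (k : ℕ) < m + 1 by omega]
      rw [Finset.sum_congr rfl fun k _ => hs k, Finset.sum_add_distrib, ih (by omega),
        Finset.sum_ite_eq' Finset.univ (⟨m, hm⟩ : Fin n), if_pos (Finset.mem_univ _)]
      refine PiTensorProduct.ext (MultilinearMap.ext fun x => ?_)
      simp only [LinearMap.compMultilinearMap_apply, LinearMap.add_apply, LinearMap.sub_apply,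
        LinearMap.id_apply, step_tprod, PiTensorProduct.map_tprod, MultilinearMap.map_update_sub]
      have e1 : Function.update (fun i : Fin n => if i < ⟨m, hm⟩ then f i (x i) else x i) ⟨m, hm⟩
          (x ⟨m, hm⟩) = fun i : Fin n => (if (i : ℕ) < m then f i else LinearMap.id) (x i) := by
        funext i
        by_cases h : i = ⟨m, hm⟩
        · subst h; simp
        · by_cases h' : (i : ℕ) < m <;> simp [h, h', Fin.lt_def]
      have e2 : Function.update (fun i : Fin n => if i < ⟨m, hm⟩ then f i (x i) else x i) ⟨m, hm⟩
          (f ⟨m, hm⟩ (x ⟨m, hm⟩)) =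
          fun i : Fin n => (if (i : ℕ) < m + 1 then f i else LinearMap.id) (x i) := by
        funext i
        by_cases h : i = ⟨m, hm⟩
        · subst h; simp
        · have h2 : (i : ℕ) ≠ m := fun h3 => h (Fin.ext h3)
          by_cases h' : (i : ℕ) < m
          · simp [h, h', Fin.lt_def, h'.trans (Nat.lt_succ_self m)]
          · simp [h, h', Fin.lt_def, show ¬ (i : ℕ) < m + 1 by omega]
      rw [e1, e2]
      abel
  have := LinearMap.congr_fun (key n le_rfl) z
  simpa using this

/-- For `l < k` both terms vanish, since `d e = 0` and `e d = 0` at the place `l`. For `k < l` the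
two terms differ by the sign of moving `d` past `h` and cancel. For `l = k` the identity `d h + h d
= 1 - e` of the `k`-th contraction remains. -/
theorem piD_step {n : ℕ} {K : Fin n → GrComplex.{v} R} {ε : ∀ i, K i →ₗ[R] R}
    (hε : ∀ i, IsAug (K i) (ε i)) (c : ∀ i, Contraction (K i) (ε i)) (k l : Fin n)
    (z : ⨂[R] i, K i) :
    piD K l (step (fun i => (c i).e) k (c k).h z) + step (fun i => (c i).e) k (c k).h (piD K l z) =
      if l = k then step (fun i => (c i).e) k (LinearMap.id - (c k).e) z else 0 := by
  have key : piD K l ∘ₗ step (fun i => (c i).e) k (c k).h +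
      step (fun i => (c i).e) k (c k).h ∘ₗ piD K l =
      if l = k then step (fun i => (c i).e) k (LinearMap.id - (c k).e) else 0 := by
    refine PiTensorProduct.ext (MultilinearMap.ext fun x => ?_)
    have se : ∀ i (y : K i), (K i).sgn ((c i).e y) = (c i).e y := fun i y => by
      rw [e_apply, map_smul, sgn_pt]
    have es : ∀ i (y : K i), (c i).e ((K i).sgn y) = (c i).e y := fun i y => by
      rw [e_apply, e_apply, (hε i).sgn]
    rcases lt_trichotomy l k with h | h | h
    · rw [if_neg h.ne]
      simp only [LinearMap.compMultilinearMap_apply, LinearMap.add_apply, LinearMap.comp_apply,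
        piD, PiTensorProduct.map_tprod, step_tprod, LinearMap.zero_apply]
      rw [MultilinearMap.map_coord_zero _ l (by simp [h, h.ne, e_apply, (c l).d_pt]),
        MultilinearMap.map_coord_zero _ l (by simp [h, h.ne, e_apply, (hε l).d]), add_zero]
    · subst h
      rw [if_pos rfl]
      simp only [LinearMap.compMultilinearMap_apply, LinearMap.add_apply, LinearMap.comp_apply,
        piD, PiTensorProduct.map_tprod, step_tprod]
      have e1 : (fun i => (if i < l then (K i).sgn else if i = l then (K i).d else LinearMap.id)
          (Function.update (fun i => if i < l then (c i).e (x i) else x i) l ((c l).h (x l)) i)) =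
          Function.update (fun i => if i < l then (c i).e (x i) else x i) l
            ((K l).d ((c l).h (x l))) := by
        funext i
        rcases lt_trichotomy i l with h | h | h
        · simp [h, h.ne, se]
        · subst h; simp
        · simp [h.not_gt, h.ne']
      have e2 : Function.update (fun i => if i < l then
          (c i).e ((if i < l then (K i).sgn else if i = l then (K i).d else LinearMap.id) (x i))
          else (if i < l then (K i).sgn else if i = l then (K i).d else LinearMap.id) (x i)) l
          ((c l).h ((if l < l then (K l).sgn else if True then (K l).d else LinearMap.id) (x l))) =
          Function.update (fun i => if i < l then (c i).e (x i) else x i) l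
            ((c l).h ((K l).d (x l))) := by
        funext i
        rcases lt_trichotomy i l with h | h | h
        · simp [h, h.ne, es]
        · subst h; simp
        · simp [h.not_gt, h.ne']
      rw [e1, e2, ← MultilinearMap.map_update_add, (c l).eq]
      rfl
    · rw [if_neg h.ne']
      simp only [LinearMap.compMultilinearMap_apply, LinearMap.add_apply, LinearMap.comp_apply,
        piD, PiTensorProduct.map_tprod, step_tprod, LinearMap.zero_apply]
      have e1 : (fun i => (if i < l then (K i).sgn else if i = l then (K i).d else LinearMap.id)
          (Function.update (fun i => if i < k then (c i).e (x i) else x i) k ((c k).h (x k)) i)) =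
          Function.update (fun i => if i < k then (c i).e (x i) else
            (if i < l then (K i).sgn else if i = l then (K i).d else LinearMap.id) (x i)) k
            ((K k).sgn ((c k).h (x k))) := by
        funext i
        rcases lt_trichotomy i k with h' | h' | h'
        · simp [h', h'.ne, se, h'.trans h]
        · subst h'; simp [h]
        · simp [h'.not_gt, h'.ne']
      have e2 : Function.update (fun i => if i < k then
          (c i).e ((if i < l then (K i).sgn else if i = l then (K i).d else LinearMap.id) (x i))
          else (if i < l then (K i).sgn else if i = l then (K i).d else LinearMap.id) (x i)) k
          ((c k).h ((if k < l then (K k).sgn else if k = l then (K k).d else LinearMap.id) (x k))) =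
          Function.update (fun i => if i < k then (c i).e (x i) else
            (if i < l then (K i).sgn else if i = l then (K i).d else LinearMap.id) (x i)) k
            (- (K k).sgn ((c k).h (x k))) := by
        funext i
        rcases lt_trichotomy i k with h' | h' | h'
        · simp [h', h'.ne, es, h'.trans h]
        · subst h'; simp [h, h_sgn]
        · simp [h'.not_gt, h'.ne']
      rw [e1, e2, ← MultilinearMap.map_update_add, add_neg_cancel, MultilinearMap.map_update_zero]
  have := LinearMap.congr_fun key z
  simp only [LinearMap.add_apply, LinearMap.comp_apply] at this
  rw [this]
  split_ifs <;> rfl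

/-- The contraction of a tensor product of a family. -/
def piProd {n : ℕ} {K : Fin n → GrComplex.{v} R} {ε : ∀ i, K i →ₗ[R] R}
    (hε : ∀ i, IsAug (K i) (ε i)) (c : ∀ i, Contraction (K i) (ε i)) :
    Contraction (piTensor K) (augPi ε) where
  pt := PiTensorProduct.tprod R fun i => (c i).pt
  h := ∑ k, step (fun i => (c i).e) k (c k).h
  pt_mem := by simpa using tprod_mem (a := fun _ => 0) fun i => (c i).pt_mem
  d_pt := by
    rw [piTensor_d_apply]
    refine Finset.sum_eq_zero fun k _ => ?_
    rw [piD_eq fun i => (c i).pt_mem, (c k).d_pt, MultilinearMap.map_update_zero, smul_zero]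
  h_mem n z hz := by
    have : piGr K n ≤ (piGr K (n - 1)).comap (∑ k, step (fun i => (c i).e) k (c k).h) := by
      refine Submodule.span_le.2 ?_
      rintro _ ⟨a, rfl, x, hx, rfl⟩
      rw [SetLike.mem_coe, Submodule.mem_comap, LinearMap.sum_apply]
      refine Submodule.sum_mem _ fun k _ => ?_
      rw [step_tprod]
      have : ∑ i, a i - 1 = ∑ i, (a i - if i = k then 1 else 0) := by
        simp [Finset.sum_sub_distrib]
      rw [this]
      refine tprod_mem fun i => ?_
      by_cases h : i = k
      · subst h; simpa using (c i).h_mem _ _ (hx i)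
      · by_cases h' : i < k
        · by_cases ha : a i = 0
          · simpa [h, h', ha, e_apply] using Submodule.smul_mem _ _ (c i).pt_mem
          · simp [h, h', e_apply, (hε i).of_ne _ ha _ (hx i)]
        · simpa [h, h'] using hx i
    exact this hz
  eq z := by
    have hmap : PiTensorProduct.map (fun i => (c i).e) z = augPi ε z •
        PiTensorProduct.tprod R fun i => (c i).pt := by
      have : PiTensorProduct.map (fun i => (c i).e) =
          (augPi ε).smulRight (PiTensorProduct.tprod R fun i => (c i).pt) := by
        refine PiTensorProduct.ext (MultilinearMap.ext fun x => ?_)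
        simp only [LinearMap.compMultilinearMap_apply, PiTensorProduct.map_tprod,
          LinearMap.smulRight_apply, augPi_tprod, e_apply, MultilinearMap.map_smul_univ]
      exact LinearMap.congr_fun this z
    -- `d h + h d` is a double sum over `k` and `l` in which only the diagonal survives; by
    -- `sum_step` the diagonal adds up to `1 - e ⊗ ⋯ ⊗ e`.
    rw [← hmap, ← sum_step, piTensor_d_apply]
    simp only [LinearMap.sum_apply, map_sum, ← Finset.sum_add_distrib]
    rw [Finset.sum_comm]
    refine Finset.sum_congr rfl fun k _ => ?_
    rw [Finset.sum_congr rfl fun l _ => piD_step hε c k l z]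
    simp

/-- `f` is compatible with the contractions of its source and target. -/
structure Compat {K : GrComplex.{v} R} {ε : K →ₗ[R] R} {K' : GrComplex.{w} R} {ε' : K' →ₗ[R] R}
    (c : Contraction K ε) (c' : Contraction K' ε') (f : K →ₗ[R] K') : Prop where
  pt : f c.pt = c'.pt
  h : ∀ x, f (c.h x) = c'.h (f x)
  aug : ∀ x, ε' (f x) = ε x

theorem Compat.e {K : GrComplex.{v} R} {ε : K →ₗ[R] R} {K' : GrComplex.{w} R} {ε' : K' →ₗ[R] R}
    {c : Contraction K ε} {c' : Contraction K' ε'} {f : K →ₗ[R] K'} (hf : Compat c c' f) (x : K) :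
    f (c.e x) = c'.e (f x) := by
  rw [e_apply, e_apply, map_smul, hf.pt, hf.aug]

theorem Compat.tensor {K L K' L' : GrComplex.{v} R} {ε : K →ₗ[R] R} {η : L →ₗ[R] R}
    {ε' : K' →ₗ[R] R} {η' : L' →ₗ[R] R} {hε : IsAug K ε} {hε' : IsAug K' ε'}
    {c : Contraction K ε} {b : Contraction L η} {c' : Contraction K' ε'} {b' : Contraction L' η'}
    {f : K →ₗ[R] K'} {g : L →ₗ[R] L'} (hf : Compat c c' f) (hg : Compat b b' g) :
    Compat (c.tensorProd hε b) (c'.tensorProd hε' b') (TensorProduct.map f g) where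
  pt := by simp only [Contraction.tensorProd, TensorProduct.map_tmul, hf.pt, hg.pt]
  h z := by
    induction z using TensorProduct.induction_on with
    | zero => simp
    | add x y hx hy => simp only [map_add, hx, hy]
    | tmul x y =>
      simp only [Contraction.tensorProd, LinearMap.add_apply, map_add, TensorProduct.map_tmul, hf.h,
        hg.h, hf.e, LinearMap.id_apply]
  aug z := by
    induction z using TensorProduct.induction_on with
    | zero => simp
    | add x y hx hy => simp only [map_add, hx, hy]
    | tmul x y => simp [hf.aug, hg.aug]

theorem Compat.pi {n : ℕ} {K : Fin n → GrComplex.{v} R} {ε : ∀ i, K i →ₗ[R] R}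
    {K' : Fin n → GrComplex.{v} R} {ε' : ∀ i, K' i →ₗ[R] R}
    {hε : ∀ i, IsAug (K i) (ε i)} {hε' : ∀ i, IsAug (K' i) (ε' i)}
    {c : ∀ i, Contraction (K i) (ε i)} {c' : ∀ i, Contraction (K' i) (ε' i)}
    {f : ∀ i, K i →ₗ[R] K' i} (hf : ∀ i, Compat (c i) (c' i) (f i)) :
    Compat (Contraction.piProd hε c) (Contraction.piProd hε' c') (PiTensorProduct.map f) where
  pt := by
    simp only [Contraction.piProd, PiTensorProduct.map_tprod, (hf _).pt]
  h z := by
    simp only [Contraction.piProd, LinearMap.sum_apply, map_sum]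
    refine Finset.sum_congr rfl fun k _ => ?_
    have : PiTensorProduct.map f ∘ₗ step (fun i => (c i).e) k (c k).h =
        step (fun i => (c' i).e) k (c' k).h ∘ₗ PiTensorProduct.map f := by
      refine PiTensorProduct.ext (MultilinearMap.ext fun x => ?_)
      simp only [LinearMap.compMultilinearMap_apply, LinearMap.comp_apply, step_tprod,
        PiTensorProduct.map_tprod]
      congr 1
      funext i
      by_cases h : i = k
      · subst h; simp [(hf i).h]
      · by_cases h' : i < k <;> simp [h, h', (hf i).e]
    exact LinearMap.congr_fun this z
  aug z := by
    have : augPi ε' ∘ₗ PiTensorProduct.map f = augPi ε := by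
      refine PiTensorProduct.ext (MultilinearMap.ext fun x => ?_)
      simp [(hf _).aug]
    exact LinearMap.congr_fun this z

end Contraction

end GrComplex

end

section

namespace SSet

open Simplicial GrComplex

variable (R : Type) [CommRing R]

/-! ### The contraction of the chains of a standard simplex -/

theorem chains_gr_le {X : SSet.{u}} {m : ℤ} {P : Submodule R (chains R X)}
    (h : ∀ (n : ℕ) (x : X _⦋n⦌), m = -(n : ℤ) → simplexChain R x ∈ P) :
    (chains R X).gr m ≤ P := by
  dsimp only
  rw [Finsupp.supported_eq_span_single, Submodule.span_le]
  rintro _ ⟨s, rfl, rfl⟩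
  have := h s.dim s.simplex rfl
  rwa [simplexChain_N] at this

/-- The augmentation of the normalized chains. -/
def chainsAug (X : SSet.{u}) : chains R X →ₗ[R] R :=
  Finsupp.linearCombination R fun s : X.N => if s.dim = 0 then 1 else 0

theorem chainsAug_simplexChain {X : SSet.{u}} {n : ℕ} (x : X _⦋n⦌) :
    chainsAug R X (simplexChain R x) = if n = 0 then 1 else 0 :=
  linearCombination_simplexChain R (X := X) (fun {n} (_ : X _⦋n⦌) => if n = 0 then (1 : R) else 0)
    (fun {n} x hx => by
      cases n with
      | zero => simp at hx
      | succ n => simp) x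

theorem isAug_chainsAug (X : SSet.{u}) : IsAug (chains R X) (chainsAug R X) := by
  constructor
  · intro n hn x hx
    refine chains_gr_le R (P := LinearMap.ker (chainsAug R X)) (fun k x hk => ?_) hx
    rw [LinearMap.mem_ker, chainsAug_simplexChain, if_neg]
    intro h
    exact hn (by simp [hk, h])
  · intro x
    have : chainsAug R X ∘ₗ (chains R X).d = 0 := chains_hom_ext R fun n x => by
      rw [LinearMap.comp_apply, chains_d_simplexChain]
      match n, x with
      | 0, x => exact map_zero _
      | 1, x =>
        rw [faceSum_succ, map_sum, Fin.sum_univ_two, map_smul, map_smul, chainsAug_simplexChain,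
          chainsAug_simplexChain]
        simp
      | n + 2, x =>
        rw [faceSum_succ, map_sum]
        refine Finset.sum_eq_zero fun i _ => ?_
        rw [map_smul, chainsAug_simplexChain, if_neg (Nat.succ_ne_zero n), smul_zero]
    exact LinearMap.congr_fun this x

theorem chainsAug_map {X Y : SSet.{u}} (f : X ⟶ Y) (x : chains R X) :
    chainsAug R Y (chainsMap R f x) = chainsAug R X x := by
  have : chainsAug R Y ∘ₗ chainsMap R f = chainsAug R X := chains_hom_ext R fun n x => by
    rw [LinearMap.comp_apply, chainsMap_simplexChain, chainsAug_simplexChain,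
      chainsAug_simplexChain]
  exact LinearMap.congr_fun this x

theorem isMor_chainsMap {X Y : SSet.{u}} (f : X ⟶ Y) :
    IsMor (chains R X) (chains R Y) (chainsMap R f) :=
  ⟨fun n x hx => chainsMap_mem R f n x hx, chainsMap_d R f⟩

/-- An extra degeneracy of a simplicial set. -/
structure ExtraDegeneracy (X : SSet.{u}) where
  s : ∀ {k : ℕ}, X _⦋k⦌ → X _⦋k + 1⦌
  pt : X _⦋0⦌
  δ_zero : ∀ {k : ℕ} (x : X _⦋k⦌), X.δ 0 (s x) = x
  δ_succ : ∀ {k : ℕ} (x : X _⦋k + 1⦌) (i : Fin (k + 2)), X.δ i.succ (s x) = s (X.δ i x)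
  δ_one : ∀ x : X _⦋0⦌, X.δ 1 (s x) = pt
  s_σ : ∀ {k : ℕ} (x : X _⦋k⦌) (i : Fin (k + 1)), s (X.σ i x) = X.σ i.succ (s x)

namespace ExtraDegeneracy

variable {X : SSet.{u}} (E : ExtraDegeneracy X)

theorem s_degenerate {k : ℕ} {x : X _⦋k⦌} (hx : x ∈ X.degenerate k) :
    E.s x ∈ X.degenerate (k + 1) := by
  cases k with
  | zero => simp at hx
  | succ k =>
    rw [degenerate_eq_iUnion_range_σ] at hx
    obtain ⟨j, y, rfl⟩ := Set.mem_iUnion.1 hx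
    rw [E.s_σ]
    exact σ_mem_degenerate _ _ _

/-- The operator induced by an extra degeneracy on normalized chains. -/
def chainsOp : chains R X →ₗ[R] chains R X :=
  Finsupp.linearCombination R fun s => simplexChain R (E.s s.simplex)

theorem chainsOp_simplexChain {k : ℕ} (x : X _⦋k⦌) :
    E.chainsOp R (simplexChain R x) = simplexChain R (E.s x) :=
  linearCombination_simplexChain R (X := X) (fun x => simplexChain R (E.s x))
    (fun _ hx => simplexChain_degenerate R _ (E.s_degenerate hx)) x

/-- The contraction of the normalized chains given by an extra degeneracy. -/
def contraction : Contraction (chains R X) (chainsAug R X) where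
  pt := simplexChain R E.pt
  h := E.chainsOp R
  pt_mem := simplexChain_mem_gr R _
  d_pt := chains_d_simplexChain R _
  h_mem k x hx := by
    refine chains_gr_le R (P := ((chains R X).gr (k - 1)).comap (E.chainsOp R))
      (fun n x hn => ?_) hx
    rw [Submodule.mem_comap, chainsOp_simplexChain]
    have := simplexChain_mem_gr R (E.s x)
    rw [Nat.cast_succ, neg_add, ← hn] at this
    exact this
  eq x := by
    have : (chains R X).d ∘ₗ E.chainsOp R + E.chainsOp R ∘ₗ (chains R X).d = LinearMap.id -
        (chainsAug R X).smulRight (simplexChain R E.pt) := chains_hom_ext R fun k x => by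
      rw [LinearMap.add_apply, LinearMap.comp_apply, LinearMap.comp_apply, LinearMap.sub_apply,
        LinearMap.id_apply, LinearMap.smulRight_apply, chainsOp_simplexChain, chains_d_simplexChain,
        chains_d_simplexChain, chainsAug_simplexChain, faceSum_succ, Fin.sum_univ_succ, E.δ_zero]
      cases k with
      -- On a vertex `x` there is no term `s (∂ x)`; the face `δ 1` of `s x` supplies the point
      -- instead.
      | zero =>
        have : faceSum R x = 0 := rfl
        rw [this]
        simp [E.δ_one, sub_eq_add_neg]
      | succ k =>
        -- The face `i + 1` of `s x` is `s` of the face `i` of `x`, with the opposite sign, so that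
        -- only the face `δ 0 (s x) = x` is left.
        have h : ∀ i : Fin (k + 2), E.chainsOp R ((-1 : R) ^ (i : ℕ) • simplexChain R (X.δ i x)) =
            (-1 : R) ^ (i : ℕ) • simplexChain R (X.δ i.succ (E.s x)) := fun i => by
          rw [map_smul, chainsOp_simplexChain, E.δ_succ]
        rw [faceSum_succ, map_sum, Finset.sum_congr rfl fun i _ => h i]
        simp [pow_succ]
    exact LinearMap.congr_fun this x

theorem compat {Y : SSet.{u}} (E' : ExtraDegeneracy Y) (f : X ⟶ Y)
    (hpt : f.app _ E.pt = E'.pt)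
    (hs : ∀ (k : ℕ) (x : X _⦋k⦌), f.app _ (E.s x) = E'.s (f.app _ x)) :
    Contraction.Compat (E.contraction R) (E'.contraction R) (chainsMap R f) where
  pt := by
    refine (chainsMap_simplexChain R _ _).trans ?_
    rw [hpt]
    rfl
  h x := by
    have : chainsMap R f ∘ₗ E.chainsOp R = E'.chainsOp R ∘ₗ chainsMap R f :=
      chains_hom_ext R fun k x => by
        rw [LinearMap.comp_apply, LinearMap.comp_apply, chainsOp_simplexChain,
          chainsMap_simplexChain, chainsMap_simplexChain, chainsOp_simplexChain, hs]
    exact LinearMap.congr_fun this x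
  aug := chainsAug_map R _

end ExtraDegeneracy

/-- The join of a simplex of `Δ[n]` with the vertex `0`. -/
def cone {n k : ℕ} (x : (Δ[n] : SSet.{u}) _⦋k⦌) : (Δ[n] : SSet.{u}) _⦋k + 1⦌ :=
  stdSimplex.objEquiv.symm (Augmented.StandardSimplex.shift (stdSimplex.objEquiv x))

theorem cone_succ {n k : ℕ} (x : (Δ[n] : SSet.{u}) _⦋k⦌) (i : Fin (k + 1)) :
    cone x i.succ = x i := rfl

theorem δ_zero_cone {n k : ℕ} (x : (Δ[n] : SSet.{u}) _⦋k⦌) : Δ[n].δ 0 (cone x) = x := by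
  refine stdSimplex.ext _ _ fun i => ?_
  rw [stdSimplex.δ_apply]
  exact cone_succ x i

theorem δ_succ_cone {n k : ℕ} (x : (Δ[n] : SSet.{u}) _⦋k + 1⦌) (i : Fin (k + 2)) :
    Δ[n].δ i.succ (cone x) = cone (Δ[n].δ i x) := by
  refine stdSimplex.ext _ _ fun j => ?_
  rw [stdSimplex.δ_apply]
  refine Fin.cases ?_ (fun j => ?_) j
  · rw [Fin.succ_succAbove_zero]; rfl
  · rw [Fin.succ_succAbove_succ, cone_succ, cone_succ, stdSimplex.δ_apply]

theorem δ_one_cone {n : ℕ} (x : (Δ[n] : SSet.{u}) _⦋0⦌) :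
    Δ[n].δ 1 (cone x) = stdSimplex.const n 0 (op ⦋0⦌) := by
  refine stdSimplex.ext _ _ fun j => ?_
  obtain rfl : j = 0 := Fin.eq_zero j
  rfl

theorem cone_σ {n k : ℕ} (x : (Δ[n] : SSet.{u}) _⦋k⦌) (i : Fin (k + 1)) :
    cone (Δ[n].σ i x) = Δ[n].σ i.succ (cone x) := by
  refine stdSimplex.ext _ _ fun j => ?_
  rw [stdSimplex.σ_apply]
  refine Fin.cases ?_ (fun j => ?_) j
  · rw [Fin.predAbove_right_zero]; rfl
  · rw [Fin.succ_predAbove_succ, cone_succ, cone_succ, stdSimplex.σ_apply]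

/-- The vertex of the cone has to be preserved. All degeneracies do this, but the coface `δ 0` does
not, which is why the contractions are only required to be compatible with degeneracies. -/
theorem cone_map {n m k : ℕ} (f : ⦋n⦌ ⟶ ⦋m⦌) (hf : f.toOrderHom 0 = 0)
    (x : (Δ[n] : SSet.{u}) _⦋k⦌) :
    (SSet.stdSimplex.map f).app _ (cone x) = cone ((SSet.stdSimplex.map f).app _ x) := by
  refine stdSimplex.ext _ _ fun j => ?_
  refine Fin.cases ?_ (fun j => rfl) j
  exact hf

/-- The extra degeneracy of a standard simplex. -/
def coneDegeneracy (n : ℕ) : ExtraDegeneracy (Δ[n] : SSet.{u}) where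
  s := cone
  pt := stdSimplex.const n 0 (op ⦋0⦌)
  δ_zero := δ_zero_cone
  δ_succ := δ_succ_cone
  δ_one := δ_one_cone
  s_σ := cone_σ

theorem coneDegeneracy_compat {n m : ℕ} (f : ⦋n⦌ ⟶ ⦋m⦌) (hf : f.toOrderHom 0 = 0) :
    Contraction.Compat ((coneDegeneracy.{u} n).contraction R) ((coneDegeneracy m).contraction R)
      (chainsMap R (SSet.stdSimplex.map f)) :=
  ExtraDegeneracy.compat R _ _ _ (stdSimplex.ext _ _ fun _ => hf) fun _ x => cone_map f hf x

end SSet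

/-! ### Functors with contractible values on the standard simplices -/

open Simplicial SSet GrComplex

/-- A functor from simplicial sets to augmented complexes, with contractions of its values on the
standard simplices which are compatible with the degeneracies. -/
structure ChainFunctor (R : Type) [CommRing R] where
  obj : SSet.{u} → GrComplex.{u} R
  map : ∀ {L L' : SSet.{u}}, (L ⟶ L') → (obj L →ₗ[R] obj L')
  mor : ∀ {L L' : SSet.{u}} (f : L ⟶ L'), IsMor (obj L) (obj L') (map f)
  map_comp : ∀ {L L' L'' : SSet.{u}} (f : L ⟶ L') (g : L' ⟶ L'') x,
    map (f ≫ g) x = map g (map f x)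
  aug : ∀ L, obj L →ₗ[R] R
  isAug : ∀ L, IsAug (obj L) (aug L)
  con : ∀ n : ℕ, Contraction (obj Δ[n]) (aug Δ[n])
  compat : ∀ (n : ℕ) (j : Fin (n + 1)),
    Contraction.Compat (con (n + 1)) (con n) (map (SSet.stdSimplex.map (SimplexCategory.σ j)))

namespace ChainFunctor

variable (R : Type) [CommRing R]

/-- The normalized chains. -/
abbrev chains : ChainFunctor.{u} R where
  obj L := SSet.chains R L
  map f := chainsMap R f
  mor f := isMor_chainsMap R f
  map_comp f g x := chainsMap_comp R f g x
  aug L := chainsAug R L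
  isAug L := isAug_chainsAug R L
  con n := (coneDegeneracy n).contraction R
  compat _ j := coneDegeneracy_compat R _ (Fin.predAbove_right_zero (i := j))

variable {R}

/-- The tensor product of functors. -/
abbrev tensor (S T : ChainFunctor.{u} R) : ChainFunctor.{u} R where
  obj L := GrComplex.tensor (S.obj L) (T.obj L)
  map f := TensorProduct.map (S.map f) (T.map f)
  mor f := (S.mor f).tensor (T.mor f)
  map_comp f g x := by
    rw [← LinearMap.comp_apply, ← TensorProduct.map_comp]
    congr 2 <;> ext x
    · exact S.map_comp f g x
    · exact T.map_comp f g x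
  aug L := augTensor (S.aug L) (T.aug L)
  isAug L := (S.isAug L).tensor (T.isAug L)
  con n := (S.con n).tensorProd (S.isAug _) (T.con n)
  compat n j := (S.compat n j).tensor (T.compat n j)

/-- The tensor powers of a functor. -/
abbrev pow (T : ChainFunctor.{u} R) (k : ℕ) : ChainFunctor.{u} R where
  obj L := power (T.obj L) k
  map f := PiTensorProduct.map fun _ => T.map f
  mor f := isMor_piMap fun _ => T.mor f
  map_comp f g x := by
    rw [← LinearMap.comp_apply, ← PiTensorProduct.map_comp]
    congr 2
    funext i
    ext x
    exact T.map_comp f g x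
  aug L := augPi fun _ => T.aug L
  isAug L := IsAug.pi fun _ => T.isAug L
  con n := Contraction.piProd (fun _ => T.isAug _) fun _ => T.con n
  compat n j := Contraction.Compat.pi fun _ => T.compat n j

end ChainFunctor

end

section

open Simplicial SSet GrComplex

/-! ### The complex of natural operations -/

namespace ChainFunctor

variable {R : Type} [CommRing R] (T : ChainFunctor.{u} R)

/-- The natural transformations `C(L) → T(L)` of degree `k`. -/
def opGr (k : ℤ) : Submodule R (∀ L : SSet.{u}, SSet.chains R L →ₗ[R] T.obj L) where
  carrier := {τ | (∀ ⦃L L' : SSet.{u}⦄ (f : L ⟶ L') x, τ L' (chainsMap R f x) = T.map f (τ L x)) ∧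
    ∀ L a, ∀ x ∈ (SSet.chains R L).gr a, τ L x ∈ (T.obj L).gr (a + k)}
  zero_mem' := ⟨by simp, fun L a x _ => Submodule.zero_mem _⟩
  add_mem' := by
    rintro τ τ' ⟨h1, h2⟩ ⟨h1', h2'⟩
    refine ⟨fun L L' f x => ?_, fun L a x hx => Submodule.add_mem _ (h2 L a x hx) (h2' L a x hx)⟩
    simp [h1 f, h1' f]
  smul_mem' := by
    rintro c τ ⟨h1, h2⟩
    refine ⟨fun L L' f x => ?_, fun L a x hx => Submodule.smul_mem _ _ (h2 L a x hx)⟩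
    simp [h1 f]

/-- The natural transformations `C(L) → T(L)` which are sums of homogeneous ones. -/
abbrev opSubmodule : Submodule R (∀ L : SSet.{u}, SSet.chains R L →ₗ[R] T.obj L) := ⨆ k, T.opGr k

theorem opSubmodule_natural {τ : ∀ L : SSet.{u}, SSet.chains R L →ₗ[R] T.obj L}
    (hτ : τ ∈ T.opSubmodule) {L L' : SSet.{u}} (f : L ⟶ L') (x : SSet.chains R L) :
    τ L' (chainsMap R f x) = T.map f (τ L x) := by
  induction hτ using Submodule.iSup_induction' with
  | mem k τ h => exact h.1 f x
  | zero => simp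
  | add τ τ' _ _ h h' => simp [h, h']

/-- Independence is checked after evaluation on a chain of degree `a`: operations of degree `k` land
in degree `a + k`, and the graded pieces of `T(L)` are independent. -/
theorem op_internal : DirectSum.IsInternal fun k => (T.opGr k).comap T.opSubmodule.subtype := by
  classical
  refine DirectSum.isInternal_submodule_of_iSupIndep_of_iSup_eq_top ?_ ?_
  · rw [iSupIndep_def]
    intro k
    rw [Submodule.disjoint_def]
    intro τ hτ hτ'
    refine Subtype.ext (funext fun L => (SSet.chains R L).hom_ext fun a x hx => ?_)
    have ind := (T.obj L).internal.submodule_iSupIndep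
    rw [iSupIndep_def] at ind
    have h1 := ind (a + k)
    rw [Submodule.disjoint_def] at h1
    refine h1 _ (hτ.2 L a x hx) ?_
    have h2 : ⨆ j, ⨆ (_ : j ≠ k), (T.opGr j).comap T.opSubmodule.subtype ≤
        (⨆ j, ⨆ (_ : j ≠ a + k), (T.obj L).gr j).comap
          (LinearMap.applyₗ x ∘ₗ LinearMap.proj L ∘ₗ T.opSubmodule.subtype) := by
      refine iSup_le fun j => iSup_le fun hj τ hτ => ?_
      exact Submodule.mem_iSup_of_mem (a + j) (Submodule.mem_iSup_of_mem (by omega)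
        (hτ.2 L a x hx))
    exact h2 hτ'
  · rw [eq_top_iff]
    rintro ⟨τ, hτ⟩ -
    have key : ∀ τ (hτ : τ ∈ T.opSubmodule),
        (⟨τ, hτ⟩ : T.opSubmodule) ∈ ⨆ k, (T.opGr k).comap T.opSubmodule.subtype := by
      intro τ hτ
      induction hτ using Submodule.iSup_induction' with
      | mem k τ h => exact Submodule.mem_iSup_of_mem k h
      | zero => exact Submodule.zero_mem _
      | add τ τ' _ _ h h' => exact Submodule.add_mem _ h h'
    exact key τ hτ

/-- The differential `τ ↦ d τ - (-1) ^ deg τ • τ d` on families of maps. -/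
def opD : (∀ L : SSet.{u}, SSet.chains R L →ₗ[R] T.obj L) →ₗ[R]
    ∀ L : SSet.{u}, SSet.chains R L →ₗ[R] T.obj L :=
  LinearMap.pi fun L => (LinearMap.llcomp R _ _ _ (T.obj L).d -
    LinearMap.llcomp R _ _ _ (T.obj L).sgn ∘ₗ
      LinearMap.lcomp R _ ((SSet.chains R L).sgn ∘ₗ (SSet.chains R L).d)) ∘ₗ LinearMap.proj L

theorem opD_apply (τ : ∀ L : SSet.{u}, SSet.chains R L →ₗ[R] T.obj L) (L : SSet.{u})
    (x : SSet.chains R L) : T.opD τ L x = (T.obj L).d (τ L x) -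
      (T.obj L).sgn (τ L ((SSet.chains R L).sgn ((SSet.chains R L).d x))) := rfl

/-- Conjugating an operation of degree `k` with the sign involutions of source and target multiplies
it by `(-1) ^ k`. This is how `opD` encodes the sign without a decomposition into homogeneous parts.
-/
theorem opD_of_mem {k : ℤ} {τ : ∀ L : SSet.{u}, SSet.chains R L →ₗ[R] T.obj L}
    (hτ : τ ∈ T.opGr k) (L : SSet.{u}) (x : SSet.chains R L) :
    T.opD τ L x = (T.obj L).d (τ L x) - sg R (k : ZMod 2) • τ L ((SSet.chains R L).d x) := by
  rw [opD_apply]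
  congr 1
  have : (T.obj L).sgn ∘ₗ τ L ∘ₗ (SSet.chains R L).sgn = sg R (k : ZMod 2) • τ L :=
    (SSet.chains R L).hom_ext fun n x hx => by
      rw [LinearMap.comp_apply, LinearMap.comp_apply, sgn_eq _ hx, map_smul, map_smul,
        sgn_eq _ (hτ.2 L n x hx), smul_smul, ← sg_add, LinearMap.smul_apply]
      congr 2
      push_cast
      rw [← add_assoc, CharTwo.add_self_eq_zero, zero_add]
  exact LinearMap.congr_fun this _

theorem opD_mem {k : ℤ} {τ : ∀ L : SSet.{u}, SSet.chains R L →ₗ[R] T.obj L}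
    (hτ : τ ∈ T.opGr k) : T.opD τ ∈ T.opGr (k + 1) := by
  refine ⟨fun L L' f x => ?_, fun L a x hx => ?_⟩
  · rw [T.opD_of_mem hτ, T.opD_of_mem hτ, hτ.1, ← chainsMap_d, hτ.1, map_sub, map_smul,
      (T.mor f).2]
  · rw [T.opD_of_mem hτ]
    refine Submodule.sub_mem _ ?_ (Submodule.smul_mem _ _ ?_)
    · have := (T.obj L).d_mem _ _ (hτ.2 L a x hx)
      rwa [add_assoc] at this
    · have := hτ.2 L _ _ ((SSet.chains R L).d_mem a x hx)
      rwa [add_assoc, add_comm 1 k] at this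

/-- The complex of natural operations `C(L) → T(L)`. -/
abbrev ops : GrComplex.{u + 1} R where
  carrier := T.opSubmodule
  gr k := (T.opGr k).comap T.opSubmodule.subtype
  internal := T.op_internal
  d := T.opD.restrict fun τ hτ => by
    have : T.opSubmodule ≤ T.opSubmodule.comap T.opD :=
      iSup_le fun k τ hτ => Submodule.mem_iSup_of_mem (k + 1) (T.opD_mem hτ)
    exact this hτ
  d_mem k τ hτ := T.opD_mem hτ
  d_d τ := by
    refine Subtype.ext (funext fun L => LinearMap.ext fun x => ?_)
    change T.opD (T.opD τ.1) L x = 0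
    rw [opD_apply, opD_apply, opD_apply, map_sub, (T.obj L).d_d, map_sub, d_sgn, d_sgn, map_neg,
      map_neg, (SSet.chains R L).d_d]
    simp

theorem ops_d_apply {k : ℤ} {τ : T.ops} (hτ : τ ∈ T.ops.gr k) (L : SSet.{u})
    (x : SSet.chains R L) : (T.ops.d τ).1 L x =
      (T.obj L).d (τ.1 L x) - sg R (k : ZMod 2) • τ.1 L ((SSet.chains R L).d x) :=
  T.opD_of_mem hτ L x

variable {T} in
theorem ops_ext {τ τ' : T.ops}
    (h : ∀ (L : SSet.{u}) (n : ℕ) (x : L _⦋n⦌), τ.1 L (simplexChain R x) =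
      τ'.1 L (simplexChain R x)) : τ = τ' :=
  Subtype.ext (funext fun L => chains_hom_ext R (h L))

/-- A natural morphism `F ⊗ C(L) → T(L)`, as a map from `F` to the complex of operations. -/
def curry (F : GrComplex.{v} R) (g : ∀ L : SSet.{u}, F ⊗[R] SSet.chains R L →ₗ[R] T.obj L)
    (hg : ∀ L, IsMor (GrComplex.tensor F (SSet.chains R L)) (T.obj L) (g L))
    (nat : ∀ ⦃L L' : SSet.{u}⦄ (f : L ⟶ L') w x,
      g L' (w ⊗ₜ chainsMap R f x) = T.map f (g L (w ⊗ₜ x))) : F →ₗ[R] T.ops :=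
  LinearMap.codRestrict T.opSubmodule
    (LinearMap.pi fun L => TensorProduct.curry (g L)) fun w => by
      have hw : w ∈ ⨆ n, F.gr n := by rw [F.internal.submodule_iSup_eq_top]; trivial
      induction hw using Submodule.iSup_induction' with
      | mem k w h =>
        refine Submodule.mem_iSup_of_mem k ⟨fun L L' f x => nat f w x, fun L a x hx => ?_⟩
        have := (hg L).1 _ _ (tmul_mem h hx)
        rwa [add_comm] at this
      | zero => rw [map_zero]; exact Submodule.zero_mem _
      | add w w' _ _ h h' => rw [map_add]; exact Submodule.add_mem _ h h'

variable {T}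

theorem curry_apply {F : GrComplex.{v} R} {g : ∀ L : SSet.{u}, F ⊗[R] SSet.chains R L →ₗ[R] T.obj L}
    {hg : ∀ L, IsMor (GrComplex.tensor F (SSet.chains R L)) (T.obj L) (g L)}
    {nat : ∀ ⦃L L' : SSet.{u}⦄ (f : L ⟶ L') w x,
      g L' (w ⊗ₜ chainsMap R f x) = T.map f (g L (w ⊗ₜ x))} (w : F) (L : SSet.{u})
    (x : SSet.chains R L) : (T.curry F g hg nat w).1 L x = g L (w ⊗ₜ x) := rfl

theorem isMor_curry {F : GrComplex.{v} R}
    {g : ∀ L : SSet.{u}, F ⊗[R] SSet.chains R L →ₗ[R] T.obj L}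
    {hg : ∀ L, IsMor (GrComplex.tensor F (SSet.chains R L)) (T.obj L) (g L)}
    {nat : ∀ ⦃L L' : SSet.{u}⦄ (f : L ⟶ L') w x,
      g L' (w ⊗ₜ chainsMap R f x) = T.map f (g L (w ⊗ₜ x))} :
    IsMor F T.ops (T.curry F g hg nat) := by
  have h1 : ∀ n, ∀ w ∈ F.gr n, T.curry F g hg nat w ∈ T.ops.gr n := fun n w hw =>
    ⟨fun L L' f x => nat f w x, fun L a x hx => by
      have := (hg L).1 _ _ (tmul_mem hw hx)
      rwa [add_comm] at this⟩
  refine ⟨h1, fun w => ?_⟩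
  have : T.curry F g hg nat ∘ₗ F.d = T.ops.d ∘ₗ T.curry F g hg nat := F.hom_ext fun n w hw => by
    refine Subtype.ext (funext fun L => LinearMap.ext fun x => ?_)
    refine Eq.trans ?_ (T.ops_d_apply (h1 n w hw) L x).symm
    rw [curry_apply, curry_apply, ← (hg L).2, tensor_d_tmul, map_add, sgn_eq F hw,
      ← TensorProduct.smul_tmul', map_smul]
    exact (add_sub_cancel_right _ _).symm
  exact LinearMap.congr_fun this w

/-- Composition of operations with a natural morphism. -/
def postcomp {T' : ChainFunctor.{u} R} (g : ∀ L : SSet.{u}, T.obj L →ₗ[R] T'.obj L)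
    (hg : ∀ L, IsMor (T.obj L) (T'.obj L) (g L))
    (nat : ∀ ⦃L L' : SSet.{u}⦄ (f : L ⟶ L') x, g L' (T.map f x) = T'.map f (g L x)) :
    T.ops →ₗ[R] T'.ops :=
  LinearMap.restrict (LinearMap.pi fun L => LinearMap.llcomp R _ _ _ (g L) ∘ₗ LinearMap.proj L)
    fun τ hτ => by
      have : T.opSubmodule ≤ T'.opSubmodule.comap (LinearMap.pi fun L =>
          LinearMap.llcomp R (SSet.chains R L) _ _ (g L) ∘ₗ LinearMap.proj L) :=
        iSup_le fun k τ hτ => Submodule.mem_iSup_of_mem k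
          ⟨fun L L' f x => (congrArg (g L') (hτ.1 f x)).trans (nat f _),
            fun L a x hx => (hg L).1 _ _ (hτ.2 L a x hx)⟩
      exact this hτ

theorem isMor_postcomp {T' : ChainFunctor.{u} R} {g : ∀ L : SSet.{u}, T.obj L →ₗ[R] T'.obj L}
    {hg : ∀ L, IsMor (T.obj L) (T'.obj L) (g L)}
    {nat : ∀ ⦃L L' : SSet.{u}⦄ (f : L ⟶ L') x, g L' (T.map f x) = T'.map f (g L x)} :
    IsMor T.ops T'.ops (postcomp g hg nat) := by
  refine ⟨fun k τ hτ => ⟨fun L L' f x => (congrArg (g L') (hτ.1 f x)).trans (nat f _),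
    fun L a x hx => (hg L).1 _ _ (hτ.2 L a x hx)⟩, fun τ => ?_⟩
  refine Subtype.ext (funext fun L => LinearMap.ext fun x => ?_)
  change g L (T.opD τ.1 L x) = T'.opD (postcomp g hg nat τ).1 L x
  rw [opD_apply, opD_apply, map_sub, (hg L).2, (hg L).sgn]
  rfl

/-! ### Acyclicity of the complex of operations -/

/-- The augmentation of the complex of operations. -/
def opsAug (T : ChainFunctor.{u} R) : T.ops →ₗ[R] R :=
  T.aug Δ[0] ∘ₗ LinearMap.applyₗ (simplexChain R (yonedaEquiv (𝟙 Δ[0]))) ∘ₗ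
    LinearMap.proj Δ[0] ∘ₗ T.opSubmodule.subtype

theorem opsAug_apply (τ : T.ops) :
    T.opsAug τ = T.aug Δ[0] (τ.1 Δ[0] (simplexChain R (yonedaEquiv (𝟙 Δ[0])))) := rfl

section Filler

variable (T) (τ : ∀ L : SSet.{u}, SSet.chains R L →ₗ[R] T.obj L) (ε : R)

/-- The universal simplex. -/
abbrev universalSimplex (n : ℕ) : (Δ[n] : SSet.{u}) _⦋n⦌ := yonedaEquiv (𝟙 Δ[n])

/-- The values on the universal simplices of an operation whose boundary is `τ`. -/
def filler (n : ℕ) : T.obj Δ[n] :=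
  match n with
  | 0 => (T.con 0).h (τ Δ[0] (simplexChain R (universalSimplex 0)))
  -- Subtracting `ε` times the values already chosen on the faces is what makes the argument of the
  -- contraction a cycle when `τ` is one and `ε` is its sign.
  | n + 1 => (T.con (n + 1)).h (τ Δ[n + 1] (simplexChain R (universalSimplex (n + 1))) -
      ε • ∑ i : Fin (n + 2), (-1 : R) ^ (i : ℕ) •
        T.map (SSet.stdSimplex.map (SimplexCategory.δ i)) (filler n))

/-- The value of the operation defined by `filler` on a simplex. -/
def fillerVal {L : SSet.{u}} {n : ℕ} (x : L _⦋n⦌) : T.obj L :=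
  T.map (yonedaEquiv.symm x) (T.filler τ ε n)

theorem fillerVal_map {L L' : SSet.{u}} {n : ℕ} (x : L _⦋n⦌) (f : L ⟶ L') :
    T.fillerVal τ ε (f.app _ x) = T.map f (T.fillerVal τ ε x) := by
  rw [fillerVal, fillerVal, ← T.map_comp, yonedaEquiv_symm_comp]

theorem yoneda_δ {L : SSet.{u}} {n : ℕ} (x : L _⦋n + 1⦌) (i : Fin (n + 2)) :
    SSet.stdSimplex.map (SimplexCategory.δ i) ≫ yonedaEquiv.symm x =
      yonedaEquiv.symm (L.δ i x) := by
  rw [yonedaEquiv_symm_naturality_left]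
  rfl

theorem yoneda_σ {L : SSet.{u}} {n : ℕ} (x : L _⦋n⦌) (i : Fin (n + 1)) :
    SSet.stdSimplex.map (SimplexCategory.σ i) ≫ yonedaEquiv.symm x =
      yonedaEquiv.symm (L.σ i x) := by
  rw [yonedaEquiv_symm_naturality_left]
  rfl

theorem app_universalSimplex {L : SSet.{u}} {n : ℕ} (x : L _⦋n⦌) :
    (yonedaEquiv.symm x).app _ (universalSimplex n) = x := by
  have : yonedaEquiv (yonedaEquiv.symm x) = x := Equiv.apply_symm_apply _ _
  rw [← Category.id_comp (yonedaEquiv.symm x), yonedaEquiv_comp] at this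
  exact this

theorem fillerVal_succ {L : SSet.{u}} {n : ℕ} (x : L _⦋n + 1⦌) :
    ∑ i : Fin (n + 2), (-1 : R) ^ (i : ℕ) • T.fillerVal τ ε (L.δ i x) =
      T.map (yonedaEquiv.symm x) (∑ i : Fin (n + 2), (-1 : R) ^ (i : ℕ) •
        T.map (SSet.stdSimplex.map (SimplexCategory.δ i)) (T.filler τ ε n)) := by
  rw [map_sum]
  refine Finset.sum_congr rfl fun i _ => ?_
  rw [map_smul, ← T.map_comp, yoneda_δ]
  rfl

/-- `faceSum_degenerate` is applied through the linear map on normalized chains induced by `g`. As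
`g` is given in dimension `n` only, it is first extended by zero to the other dimensions. -/
theorem sum_faces_of_degenerate {L : SSet.{u}} {M : Type*} [AddCommGroup M] [Module R M] {n : ℕ}
    (g : L _⦋n⦌ → M) (hg : ∀ x ∈ L.degenerate n, g x = 0) {z : L _⦋n + 1⦌}
    (hz : z ∈ L.degenerate (n + 1)) :
    ∑ i : Fin (n + 2), (-1 : R) ^ (i : ℕ) • g (L.δ i z) = 0 := by
  let g' : ∀ {m : ℕ}, L _⦋m⦌ → M := fun {m} x => if h : m = n then g (h ▸ x) else 0
  have hg' : ∀ {m : ℕ} (x : L _⦋m⦌), x ∈ L.degenerate m → g' x = 0 := fun {m} x hx => by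
    by_cases h : m = n
    · subst h
      simpa [g'] using hg x hx
    · simp [g', h]
  have h0 : Finsupp.linearCombination R (fun s : L.N => g' s.simplex) (faceSum R z) = 0 := by
    rw [faceSum_degenerate R z hz, map_zero]
  rw [faceSum_succ, map_sum] at h0
  rw [← h0]
  refine Finset.sum_congr rfl fun i _ => ?_
  rw [map_smul, linearCombination_simplexChain R g' hg']
  simp [g']

variable {T τ ε}

/-- This makes the constructed operation well defined on normalized chains. The contractions commute
with degeneracies, so a degeneracy may be applied before contracting. It sends the argument of the
contraction to its analogue on a degenerate simplex, which is zero: the part with `τ` by naturality,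
the part with the faces by the induction hypothesis. -/
theorem fillerVal_degenerate
    (hτ : ∀ ⦃L L' : SSet.{u}⦄ (f : L ⟶ L') x, τ L' (chainsMap R f x) = T.map f (τ L x)) (n : ℕ) :
    ∀ (L : SSet.{u}) (x : L _⦋n⦌), x ∈ L.degenerate n → T.fillerVal τ ε x = 0 := by
  induction n with
  | zero => intro L x hx; simp at hx
  | succ n ih =>
    intro L x hx
    rw [degenerate_eq_iUnion_range_σ] at hx
    obtain ⟨j, y, rfl⟩ := Set.mem_iUnion.1 hx
    have e : SSet.stdSimplex.map (SimplexCategory.σ j) =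
        yonedaEquiv.symm ((Δ[n] : SSet.{u}).σ j (universalSimplex n)) := by
      rw [← yoneda_σ, Equiv.symm_apply_apply, Category.comp_id]
    have hs : (Δ[n] : SSet.{u}).σ j (universalSimplex n) ∈
        (Δ[n] : SSet.{u}).degenerate (n + 1) := σ_mem_degenerate _ _ _
    have h1 : T.map (SSet.stdSimplex.map (SimplexCategory.σ j)) (τ Δ[n + 1]
        (simplexChain R (universalSimplex (n + 1)))) = 0 := by
      rw [← hτ, chainsMap_simplexChain, e, app_universalSimplex, simplexChain_degenerate R _ hs,
        map_zero]
    have h2 : T.map (SSet.stdSimplex.map (SimplexCategory.σ j)) (∑ i : Fin (n + 2),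
        (-1 : R) ^ (i : ℕ) • T.map (SSet.stdSimplex.map (SimplexCategory.δ i))
          (T.filler τ ε n)) = 0 := by
      rw [e, ← fillerVal_succ]
      exact sum_faces_of_degenerate _ (ih Δ[n]) hs
    have h3 : T.map (SSet.stdSimplex.map (SimplexCategory.σ j)) (T.filler τ ε (n + 1)) = 0 := by
      refine ((T.compat n j).h _).trans ?_
      rw [map_sub, map_smul, h1, h2, smul_zero, sub_zero, map_zero]
    rw [fillerVal, ← yoneda_σ, T.map_comp, h3, map_zero]

variable (T τ ε) in
/-- The operation with the values `filler` on the universal simplices. -/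
def fillerOp (L : SSet.{u}) : SSet.chains R L →ₗ[R] T.obj L :=
  Finsupp.linearCombination R fun s => T.fillerVal τ ε s.simplex

theorem fillerOp_simplexChain
    (hτ : ∀ ⦃L L' : SSet.{u}⦄ (f : L ⟶ L') x, τ L' (chainsMap R f x) = T.map f (τ L x))
    {L : SSet.{u}} {n : ℕ} (x : L _⦋n⦌) :
    T.fillerOp τ ε L (simplexChain R x) = T.fillerVal τ ε x :=
  linearCombination_simplexChain R (X := L) (fun x => T.fillerVal τ ε x)
    (fun x hx => fillerVal_degenerate hτ _ L x hx) x

theorem fillerOp_map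
    (hτ : ∀ ⦃L L' : SSet.{u}⦄ (f : L ⟶ L') x, τ L' (chainsMap R f x) = T.map f (τ L x))
    ⦃L L' : SSet.{u}⦄ (f : L ⟶ L') (x : SSet.chains R L) :
    T.fillerOp τ ε L' (chainsMap R f x) = T.map f (T.fillerOp τ ε L x) := by
  have : T.fillerOp τ ε L' ∘ₗ chainsMap R f = T.map f ∘ₗ T.fillerOp τ ε L :=
    chains_hom_ext R fun n x => by
      rw [LinearMap.comp_apply, LinearMap.comp_apply, chainsMap_simplexChain,
        fillerOp_simplexChain hτ, fillerOp_simplexChain hτ, fillerVal_map]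
  exact LinearMap.congr_fun this x

/-- The chain which is contracted in the definition of `filler`. -/
theorem filler_eq
    (hτ : ∀ ⦃L L' : SSet.{u}⦄ (f : L ⟶ L') x, τ L' (chainsMap R f x) = T.map f (τ L x)) (n : ℕ) :
    T.filler τ ε n = (T.con n).h (τ Δ[n] (simplexChain R (universalSimplex n)) -
      ε • T.fillerOp τ ε Δ[n] ((SSet.chains R Δ[n]).d (simplexChain R (universalSimplex n)))) := by
  cases n with
  | zero =>
    rw [chains_d_simplexChain]
    have : faceSum R (universalSimplex.{u} 0) = 0 := rfl
    rw [this, map_zero, smul_zero, sub_zero]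
    rfl
  | succ n =>
    have : T.fillerOp τ ε Δ[n + 1] ((SSet.chains R Δ[n + 1]).d
        (simplexChain R (universalSimplex (n + 1)))) = ∑ i : Fin (n + 2), (-1 : R) ^ (i : ℕ) •
        T.map (SSet.stdSimplex.map (SimplexCategory.δ i)) (T.filler τ ε n) := by
      rw [chains_d_simplexChain, faceSum_succ, map_sum]
      refine Finset.sum_congr rfl fun i _ => ?_
      rw [map_smul, fillerOp_simplexChain hτ, fillerVal, ← yoneda_δ, Equiv.symm_apply_apply,
        Category.comp_id]
    rw [this]
    rfl

theorem filler_mem {k : ℤ} (hτ : τ ∈ T.opGr k) (n : ℕ) :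
    T.filler τ ε n ∈ (T.obj Δ[n]).gr (-(n : ℤ) + k - 1) := by
  induction n with
  | zero => exact (T.con 0).h_mem _ _ (hτ.2 _ _ _ (simplexChain_mem_gr R _))
  | succ n ih =>
    refine (T.con (n + 1)).h_mem _ _ (Submodule.sub_mem _ (hτ.2 _ _ _ (simplexChain_mem_gr R _))
      (Submodule.smul_mem _ _ (Submodule.sum_mem _ fun i _ => Submodule.smul_mem _ _ ?_)))
    have := (T.mor (SSet.stdSimplex.map (SimplexCategory.δ i))).1 _ _ ih
    rwa [show -(n : ℤ) + k - 1 = -((n + 1 : ℕ) : ℤ) + k by push_cast; ring] at this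

theorem fillerOp_mem {k : ℤ} (hτ : τ ∈ T.opGr k) : T.fillerOp τ ε ∈ T.opGr (k - 1) := by
  refine ⟨fillerOp_map hτ.1, fun L a x hx => ?_⟩
  refine chains_gr_le R (P := ((T.obj L).gr (a + (k - 1))).comap (T.fillerOp τ ε L))
    (fun n x hn => ?_) hx
  rw [Submodule.mem_comap, fillerOp_simplexChain hτ.1, hn, ← add_sub_assoc]
  exact (T.mor _).1 _ _ (filler_mem hτ n)

/-- By naturality the equation is needed only on the universal simplex. There the contraction yields
`d u = v`, provided that `v` is a cycle of augmentation zero. The cycle condition comes from the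
equation in the preceding dimension. -/
theorem d_fillerOp {k : ℕ} (hτ : τ ∈ T.opGr (-(k : ℤ)))
    (hd : ∀ (L : SSet.{u}) x, (T.obj L).d (τ L x) = ε • τ L ((SSet.chains R L).d x))
    (h0 : k = 0 → T.aug Δ[0] (τ Δ[0] (simplexChain R (universalSimplex 0))) = 0) (n : ℕ) :
    ∀ (L : SSet.{u}) (x : L _⦋n⦌), (T.obj L).d (T.fillerOp τ ε L (simplexChain R x)) =
      τ L (simplexChain R x) - ε • T.fillerOp τ ε L ((SSet.chains R L).d (simplexChain R x)) := by
  have key : ∀ n, (T.obj Δ[n]).d (T.fillerOp τ ε Δ[n]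
      ((SSet.chains R Δ[n]).d (simplexChain R (universalSimplex n)))) =
        τ Δ[n] ((SSet.chains R Δ[n]).d (simplexChain R (universalSimplex n))) →
      ∀ (L : SSet.{u}) (x : L _⦋n⦌), (T.obj L).d (T.fillerOp τ ε L (simplexChain R x)) =
        τ L (simplexChain R x) -
          ε • T.fillerOp τ ε L ((SSet.chains R L).d (simplexChain R x)) := by
    intro n hn L x
    set v := τ Δ[n] (simplexChain R (universalSimplex n)) -
      ε • T.fillerOp τ ε Δ[n] ((SSet.chains R Δ[n]).d (simplexChain R (universalSimplex n)))
      with hv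
    have dv : (T.obj Δ[n]).d v = 0 := by
      rw [hv, map_sub, map_smul, hn, hd, sub_self]
    have mv : v ∈ (T.obj Δ[n]).gr (-(n : ℤ) + -(k : ℤ)) := by
      refine Submodule.sub_mem _ (hτ.2 _ _ _ (simplexChain_mem_gr R _)) (Submodule.smul_mem _ _ ?_)
      have := (fillerOp_mem (ε := ε) hτ).2 _ _ _
        ((SSet.chains R Δ[n]).d_mem _ _ (simplexChain_mem_gr R (universalSimplex n)))
      rwa [show -(n : ℤ) + 1 + (-(k : ℤ) - 1) = -(n : ℤ) + -(k : ℤ) by ring] at this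
    -- The degree of `v` is `-n - k`, so its augmentation vanishes automatically unless `n = k = 0`.
    -- Only in that case is `h0` used.
    have av : T.aug Δ[n] v = 0 := by
      by_cases hnk : n = 0 ∧ k = 0
      · obtain ⟨rfl, hk⟩ := hnk
        have : faceSum R (universalSimplex.{u} 0) = 0 := rfl
        rw [hv, chains_d_simplexChain, this, map_zero, smul_zero, sub_zero, h0 hk]
      · exact (T.isAug _).of_ne _ (by omega) _ mv
    have hu : (T.obj Δ[n]).d (T.filler τ ε n) = v := by
      have := (T.con n).eq v
      rwa [dv, map_zero, add_zero, av, zero_smul, sub_zero, hv, ← filler_eq hτ.1] at this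
    have e : chainsMap R (yonedaEquiv.symm x) (simplexChain R (universalSimplex n)) =
        simplexChain R x := by
      rw [chainsMap_simplexChain, app_universalSimplex]
    rw [fillerOp_simplexChain hτ.1, fillerVal, ← (T.mor _).2, hu, hv, map_sub, map_smul, ← hτ.1,
      ← fillerOp_map hτ.1, chainsMap_d, e]
  induction n with
  | zero =>
    refine key 0 ?_
    have : faceSum R (universalSimplex.{u} 0) = 0 := rfl
    rw [chains_d_simplexChain, this, map_zero, map_zero, map_zero]
  | succ n ih =>
    refine key (n + 1) ?_
    set S := T.fillerOp τ ε Δ[n + 1]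
    have h : ∀ z ∈ (SSet.chains R Δ[n + 1]).gr (-(n : ℤ)), (T.obj Δ[n + 1]).d (S z) =
        τ Δ[n + 1] z - ε • S ((SSet.chains R Δ[n + 1]).d z) := by
      intro z hz
      have := chains_gr_le R (P := LinearMap.eqLocus ((T.obj Δ[n + 1]).d ∘ₗ S)
        (τ Δ[n + 1] - ε • S ∘ₗ (SSet.chains R Δ[n + 1]).d)) (fun m x hm => ?_) hz
      · exact this
      · obtain rfl : n = m := by omega
        exact ih _ x
    -- The induction hypothesis is applied to the boundary of the universal simplex; its correction
    -- term contains `d ∘ d` and drops out.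
    rw [h, (SSet.chains R Δ[n + 1]).d_d, map_zero, smul_zero, sub_zero]
    have := (SSet.chains R Δ[n + 1]).d_mem _ _ (simplexChain_mem_gr R (universalSimplex (n + 1)))
    rwa [show -((n + 1 : ℕ) : ℤ) + 1 = -(n : ℤ) by push_cast; ring] at this

end Filler

theorem isAug_opsAug (T : ChainFunctor.{u} R) : IsAug T.ops T.opsAug := by
  constructor
  · intro k hk τ hτ
    rw [opsAug_apply]
    refine (T.isAug _).of_ne k hk _ ?_
    have := hτ.2 _ _ _ (simplexChain_mem_gr R (universalSimplex.{u} 0))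
    simpa using this
  · intro τ
    rw [opsAug_apply]
    change T.aug Δ[0] (T.opD τ.1 Δ[0] (simplexChain R (universalSimplex.{u} 0))) = 0
    have : faceSum R (universalSimplex.{u} 0) = 0 := rfl
    rw [opD_apply, map_sub, (T.isAug _).d, chains_d_simplexChain, this]
    simp

/-- The complex of operations is acyclic in the degrees `≤ 0`. -/
theorem ops_acyclic (T : ChainFunctor.{u} R) (k : ℕ) (τ : T.ops) (hτ : τ ∈ T.ops.gr (-(k : ℤ)))
    (hd : T.ops.d τ = 0) (h0 : T.opsAug τ = 0) : ∃ y ∈ T.ops.gr (-(k : ℤ) - 1), T.ops.d y = τ := by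
  -- A cycle of degree `-k` commutes with `d` up to the sign `(-1) ^ k`; this sign is taken as the
  -- parameter `ε` of the construction.
  have hd' : ∀ (L : SSet.{u}) x, (T.obj L).d (τ.1 L x) =
      sg R ((-(k : ℤ) : ℤ) : ZMod 2) • τ.1 L ((SSet.chains R L).d x) := fun L x => by
    have := T.ops_d_apply hτ L x
    rw [hd] at this
    exact (sub_eq_zero.1 this.symm)
  have hm := fillerOp_mem (ε := sg R ((-(k : ℤ) : ℤ) : ZMod 2)) hτ
  refine ⟨⟨_, Submodule.mem_iSup_of_mem _ hm⟩, hm, ops_ext fun L n x => ?_⟩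
  refine (T.opD_of_mem hm L _).trans ?_
  rw [d_fillerOp hτ hd' (fun _ => h0), sub_sub, ← add_smul]
  -- The primitive has degree one less than `τ`, so its own sign in the differential is `-ε` and the
  -- two terms `S ∘ d` cancel.
  have : sg R ((-(k : ℤ) : ℤ) : ZMod 2) + sg R ((-(k : ℤ) - 1 : ℤ) : ZMod 2) = 0 := by
    have h : ((-(k : ℤ) - 1 : ℤ) : ZMod 2) = ((-(k : ℤ) : ℤ) : ZMod 2) + 1 := by
      rw [Int.cast_sub, Int.cast_one, sub_eq_add_neg, CharTwo.neg_eq (1 : ZMod 2)]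
    rw [h, sg_add, sg_one, mul_neg_one, add_neg_cancel]
  rw [this, zero_smul, sub_zero]
  rfl

end ChainFunctor

end

section

open GrComplex

/-! ### Comparison of a free complex with an acyclic complex -/

/-- A complex in degrees `≤ 0` of free modules over the group ring of `Γ`. -/
structure FreeComplex (R : Type) [CommRing R] (Γ : Type) [Group Γ] where
  cx : GrComplex.{w} R
  act : Γ →* (cx →ₗ[R] cx)
  act_mor : ∀ σ, IsMor cx cx (act σ)
  B : Type w
  b : Module.Basis (Γ × B) R cx
  deg : B → ℕ
  b_mem : ∀ β, b (1, β) ∈ cx.gr (-(deg β : ℤ))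
  b_eq : ∀ σ β, b (σ, β) = act σ (b (1, β))

namespace FreeComplex

variable {R : Type} [CommRing R] {Γ : Type} [Group Γ] (F : FreeComplex.{w} R Γ)

theorem b_mem' (i : Γ × F.B) : F.b i ∈ F.cx.gr (-(F.deg i.2 : ℤ)) := by
  rw [show i = (i.1, i.2) from rfl, F.b_eq]
  exact (F.act_mor _).1 _ _ (F.b_mem _)

theorem act_b (σ : Γ) (i : Γ × F.B) : F.act σ (F.b i) = F.b (σ * i.1, i.2) := by
  rw [show i = (i.1, i.2) from rfl, F.b_eq, F.b_eq (σ * i.1), map_mul]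
  rfl

/-- The basis is homogeneous, so the projection onto degree `n` kills the basis elements of other
degrees. Hence the part of degree `n` is spanned by translates of the generators of that degree. -/
theorem gr_le {n : ℤ} {P : Submodule R F.cx}
    (h : ∀ σ β, -(F.deg β : ℤ) = n → F.act σ (F.b (1, β)) ∈ P) : F.cx.gr n ≤ P := by
  classical
  intro x hx
  have key : ∀ y, F.cx.scale (Pi.single n 1) y ∈ P := by
    have : (⊤ : Submodule R F.cx) ≤ P.comap (F.cx.scale (Pi.single n 1)) := by
      rw [← F.b.span_eq, Submodule.span_le]
      rintro _ ⟨i, rfl⟩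
      change F.cx.scale _ (F.b i) ∈ P
      rw [scale_of_mem _ _ (F.b_mem' i)]
      by_cases hi : -(F.deg i.2 : ℤ) = n
      · rw [hi, Pi.single_eq_same, one_smul]
        have := h i.1 i.2 hi
        rwa [← F.b_eq] at this
      · rw [Pi.single_eq_of_ne hi, zero_smul]
        exact P.zero_mem
    exact fun y => this Submodule.mem_top
  have := key x
  rwa [scale_of_mem _ _ hx, Pi.single_eq_same, one_smul] at this

theorem gr_pos {n : ℤ} (hn : 0 < n) {x : F.cx} (hx : x ∈ F.cx.gr n) : x = 0 :=
  F.gr_le (P := ⊥) (fun σ β h => by omega) hx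

theorem gr_hom_ext {M : Type*} [AddCommGroup M] [Module R M] {f g : F.cx →ₗ[R] M}
    (h : ∀ n : ℕ, ∀ x ∈ F.cx.gr (-(n : ℤ)), f x = g x) : f = g := by
  refine F.cx.hom_ext fun n x hx => ?_
  rcases lt_or_ge 0 n with hn | hn
  · rw [F.gr_pos hn hx, map_zero, map_zero]
  · obtain ⟨k, rfl⟩ : ∃ k : ℕ, n = -k := ⟨n.natAbs, by omega⟩
    exact h k x hx

variable {E : GrComplex.{v} R} (actE : Γ →* (E →ₗ[R] E))

/-- The equivariant map with prescribed values on generators. -/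
def lift (y : F.B → E) : F.cx →ₗ[R] E := F.b.constr R fun i => actE i.1 (y i.2)

variable {actE}

theorem lift_b (y : F.B → E) (β : F.B) : F.lift actE y (F.b (1, β)) = y β := by
  rw [lift, Module.Basis.constr_basis, map_one]
  rfl

theorem lift_act (y : F.B → E) (σ : Γ) (x : F.cx) :
    F.lift actE y (F.act σ x) = actE σ (F.lift actE y x) := by
  have : F.lift actE y ∘ₗ F.act σ = actE σ ∘ₗ F.lift actE y := F.b.ext fun i => by
    rw [LinearMap.comp_apply, LinearMap.comp_apply, act_b, lift, Module.Basis.constr_basis,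
      Module.Basis.constr_basis, map_mul]
    rfl
  exact LinearMap.congr_fun this x

/-- The equations up to degree `n` for an equivariant map `L` of degree `-s` with augmentation `ε`
such that `d L = G + c L d`. -/
def Solves (augE : E →ₗ[R] R) (s : ℤ) (G : F.cx →ₗ[R] E) (c : R) (ε : F.cx →ₗ[R] R)
    (L : F.cx →ₗ[R] E) (n : ℕ) : Prop :=
  ∀ x ∈ F.cx.gr (-(n : ℤ)), L x ∈ E.gr (-(n : ℤ) - s) ∧ E.d (L x) = G x + c • L (F.cx.d x) ∧
    augE (L x) = ε x

theorem solves_of_generators (hE : ∀ σ, IsMor E E (actE σ)) {augE : E →ₗ[R] R}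
    (hA : ∀ σ x, augE (actE σ x) = augE x) {s : ℤ}
    {G : F.cx →ₗ[R] E} (hG : ∀ σ x, G (F.act σ x) = actE σ (G x)) {c : R} {ε : F.cx →ₗ[R] R}
    (hε : ∀ σ x, ε (F.act σ x) = ε x) {L : F.cx →ₗ[R] E}
    (hL : ∀ σ x, L (F.act σ x) = actE σ (L x)) {n : ℕ}
    (h : ∀ β, F.deg β = n → L (F.b (1, β)) ∈ E.gr (-(n : ℤ) - s) ∧
      E.d (L (F.b (1, β))) = G (F.b (1, β)) + c • L (F.cx.d (F.b (1, β))) ∧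
      augE (L (F.b (1, β))) = ε (F.b (1, β))) : F.Solves augE s G c ε L n := by
  have := F.gr_le (n := -(n : ℤ)) (P := (E.gr (-(n : ℤ) - s)).comap L ⊓
    LinearMap.eqLocus (E.d ∘ₗ L) (G + c • L ∘ₗ F.cx.d) ⊓ LinearMap.eqLocus (augE ∘ₗ L) ε)
    (fun σ β hβ => by
      obtain ⟨h1, h2, h3⟩ := h β (by omega)
      refine ⟨⟨?_, ?_⟩, ?_⟩
      · change L _ ∈ E.gr (-(n : ℤ) - s)
        rw [hL]
        exact (hE σ).1 _ _ h1
      · change E.d (L _) = G _ + c • L (F.cx.d _)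
        rw [hL, ← (hE σ).2, h2, hG, ← (F.act_mor σ).2, hL, map_add, map_smul]
      · change augE (L _) = ε _
        rw [hL, hA, hε, h3])
  intro x hx
  obtain ⟨⟨h1, h2⟩, h3⟩ := this hx
  exact ⟨h1, h2, h3⟩

section Recursion

variable (actE) (y₀ : F.B → E) (s : ℤ) (augE : E →ₗ[R] R) (G : F.cx →ₗ[R] E) (c : R)
  (ε : F.cx →ₗ[R] R)

open scoped Classical in
/-- The stages of the construction of an equivariant map. -/
def stage (n : ℕ) : F.cx →ₗ[R] E :=
  match n with
  | 0 => F.lift actE y₀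
  -- New values are given only to generators of degree `n + 1`. All others keep the preceding value,
  -- so the equations already satisfied in lower degrees persist.
  | n + 1 => F.lift actE fun β => if h : F.deg β = n + 1 ∧ ∃ z ∈ E.gr (-((n + 1 : ℕ) : ℤ) - s),
      E.d z = G (F.b (1, β)) + c • stage n (F.cx.d (F.b (1, β))) ∧ augE z = ε (F.b (1, β))
    then h.2.choose else stage n (F.b (1, β))

theorem stage_act (n : ℕ) (σ : Γ) (x : F.cx) : F.stage actE y₀ s augE G c ε n (F.act σ x) =
    actE σ (F.stage actE y₀ s augE G c ε n x) := by
  cases n <;> exact F.lift_act _ σ x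

theorem stage_succ (n m : ℕ) (hm : m ≤ n) {x : F.cx} (hx : x ∈ F.cx.gr (-(m : ℤ))) :
    F.stage actE y₀ s augE G c ε (n + 1) x = F.stage actE y₀ s augE G c ε n x := by
  refine F.gr_le (P := LinearMap.eqLocus (F.stage actE y₀ s augE G c ε (n + 1))
    (F.stage actE y₀ s augE G c ε n)) (fun σ β hβ => ?_) hx
  change F.stage _ _ _ _ _ _ _ _ _ = F.stage _ _ _ _ _ _ _ _ _
  rw [stage_act, stage_act, stage, lift_b, dif_neg]
  rintro ⟨h, -⟩
  omega

end Recursion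

/-- The common induction behind the construction of morphisms (`s = 0`, `G = 0`, `c = 1`) and of
homotopies (`s = 1`, `G = f - g`, `c = -1`). The hypothesis `step` solves the equations on one
generator of degree `n + 1`, given a solution in degree `n`; freeness extends the choice
equivariantly. -/
theorem exists_solution (hE : ∀ σ, IsMor E E (actE σ)) {augE : E →ₗ[R] R}
    (hA : ∀ σ x, augE (actE σ x) = augE x) (s : ℤ)
    {G : F.cx →ₗ[R] E} (hG : ∀ σ x, G (F.act σ x) = actE σ (G x)) (c : R) {ε : F.cx →ₗ[R] R}
    (hε : ∀ σ x, ε (F.act σ x) = ε x) (y₀ : F.B → E)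
    (h₀ : ∀ β, F.deg β = 0 → y₀ β ∈ E.gr (-s) ∧ E.d (y₀ β) = G (F.b (1, β)) ∧
      augE (y₀ β) = ε (F.b (1, β)))
    (step : ∀ (L : F.cx →ₗ[R] E) (n : ℕ), F.Solves augE s G c ε L n →
      ∀ β, F.deg β = n + 1 → ∃ z ∈ E.gr (-((n + 1 : ℕ) : ℤ) - s),
        E.d z = G (F.b (1, β)) + c • L (F.cx.d (F.b (1, β))) ∧ augE z = ε (F.b (1, β))) :
    ∃ L : F.cx →ₗ[R] E, (∀ σ x, L (F.act σ x) = actE σ (L x)) ∧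
      (∀ n, F.Solves augE s G c ε L n) ∧ ∀ β, F.deg β = 0 → L (F.b (1, β)) = y₀ β := by
  set Λ := F.stage actE y₀ s augE G c ε with hΛ
  have dΛ : ∀ n x, x ∈ F.cx.gr (-((n + 1 : ℕ) : ℤ)) → F.cx.d x ∈ F.cx.gr (-(n : ℤ)) := by
    intro n x hx
    have := F.cx.d_mem _ _ hx
    rwa [show -((n + 1 : ℕ) : ℤ) + 1 = -(n : ℤ) by push_cast; ring] at this
  have d0 : ∀ x, x ∈ F.cx.gr (-((0 : ℕ) : ℤ)) → F.cx.d x = 0 := fun x hx =>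
    F.gr_pos (by simp) (F.cx.d_mem _ _ hx)
  have key : ∀ n, F.Solves augE s G c ε (Λ n) n := by
    intro n
    induction n with
    | zero =>
      refine F.solves_of_generators hE hA hG hε (F.stage_act _ _ _ _ _ _ _ _) fun β hβ => ?_
      have e : Λ 0 (F.b (1, β)) = y₀ β := F.lift_b _ _
      rw [d0 _ (by rw [← hβ]; exact F.b_mem β), map_zero, smul_zero, add_zero, e]
      simpa using h₀ β hβ
    | succ n ih =>
      refine F.solves_of_generators hE hA hG hε (F.stage_act _ _ _ _ _ _ _ _) fun β hβ => ?_
      have h := step (Λ n) n ih β hβ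
      have e : Λ (n + 1) (F.b (1, β)) = h.choose :=
        (F.lift_b _ β).trans (dif_pos ⟨hβ, h⟩)
      have e' : Λ (n + 1) (F.cx.d (F.b (1, β))) = Λ n (F.cx.d (F.b (1, β))) :=
        F.stage_succ _ _ _ _ _ _ _ n n le_rfl (dΛ n _ (by rw [← hβ]; exact F.b_mem β))
      rw [e, e']
      exact h.choose_spec
  -- The stages become constant in each degree; on a generator of degree `m` the limit is read off
  -- at stage `m`.
  set L := F.lift actE fun β => Λ (F.deg β) (F.b (1, β)) with hL
  have eL : ∀ n : ℕ, ∀ x ∈ F.cx.gr (-(n : ℤ)), L x = Λ n x := fun n x hx =>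
    F.gr_le (P := LinearMap.eqLocus L (Λ n)) (fun σ β hβ => by
      change L _ = Λ n _
      rw [F.lift_act, F.stage_act, F.lift_b]
      have : F.deg β = n := by omega
      rw [this]) hx
  refine ⟨L, F.lift_act _, fun n x hx => ?_, fun β hβ => ?_⟩
  · obtain ⟨h1, h2, h3⟩ := key n x hx
    have e : L (F.cx.d x) = Λ n (F.cx.d x) := by
      cases n with
      | zero => rw [d0 x hx, map_zero, map_zero]
      | succ n => rw [eL n _ (dΛ n x hx), hΛ, F.stage_succ _ _ _ _ _ _ _ n n le_rfl (dΛ n x hx)]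
    rw [eL n x hx, e]
    exact ⟨h1, h2, h3⟩
  · rw [F.lift_b, hβ]
    exact F.lift_b _ _

/-- `E` is acyclic in the degrees `≤ 0`. -/
def Acyclic (E : GrComplex.{v} R) (augE : E →ₗ[R] R) : Prop :=
  ∀ (k : ℕ) (y : E), y ∈ E.gr (-(k : ℤ)) → E.d y = 0 → augE y = 0 →
    ∃ z ∈ E.gr (-(k : ℤ) - 1), E.d z = y

/-- `L (d b)` is a cycle of augmentation `ε (d b) = 0`, so acyclicity gives a value for `L b`. The
values on generators of degree `0` are prescribed as multiples of `A` because a Steenrod diagonal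
has to be the Alexander-Whitney map on `e₀`. -/
theorem exists_mor (hE : ∀ σ, IsMor E E (actE σ)) {augE : E →ₗ[R] R} (haug : IsAug E augE)
    (hA : ∀ σ x, augE (actE σ x) = augE x) (hac : Acyclic E augE) {ε : F.cx →ₗ[R] R}
    (hε : ∀ σ x, ε (F.act σ x) = ε x) (hε' : IsAug F.cx ε) {A : E} (hA0 : A ∈ E.gr 0)
    (dA : E.d A = 0) (augA : augE A = 1) :
    ∃ L : F.cx →ₗ[R] E, IsMor F.cx E L ∧ (∀ σ x, L (F.act σ x) = actE σ (L x)) ∧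
      (∀ x, augE (L x) = ε x) ∧ ∀ β, F.deg β = 0 → L (F.b (1, β)) = ε (F.b (1, β)) • A := by
  refine Exists.elim (F.exists_solution hE hA 0 (G := 0) (by simp) 1 hε
    (fun β => ε (F.b (1, β)) • A) (fun β hβ => ?_) (fun L n hL β hβ => ?_)) ?_
  · refine ⟨?_, ?_, ?_⟩
    · rw [neg_zero]; exact Submodule.smul_mem _ _ hA0
    · rw [map_smul, dA, smul_zero]; rfl
    · rw [map_smul, augA, smul_eq_mul, mul_one]
  · have hb := F.b_mem β
    have hdb := F.cx.d_mem _ _ hb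
    rw [hβ, show -((n + 1 : ℕ) : ℤ) + 1 = -(n : ℤ) by push_cast; ring] at hdb
    obtain ⟨m1, m2, m3⟩ := hL _ hdb
    rw [F.cx.d_d, map_zero, smul_zero, add_zero] at m2
    rw [hε'.d] at m3
    rw [sub_zero] at m1
    obtain ⟨z, hz, hz'⟩ := hac n _ m1 m2 m3
    rw [show -(n : ℤ) - 1 = -((n + 1 : ℕ) : ℤ) by push_cast; ring] at hz
    refine ⟨z, by rwa [sub_zero], by simpa using hz', ?_⟩
    rw [haug.of_ne _ (by omega) z hz, hε'.of_ne _ (by omega) _ hb]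
  · rintro L ⟨h1, h2, h3⟩
    refine ⟨L, ⟨fun n x hx => ?_, fun x => ?_⟩, h1, fun x => ?_, h3⟩
    · rcases lt_or_ge 0 n with hn | hn
      · rw [F.gr_pos hn hx, map_zero]
        exact Submodule.zero_mem _
      · obtain ⟨k, rfl⟩ : ∃ k : ℕ, n = -k := ⟨n.natAbs, by omega⟩
        simpa using (h2 k x hx).1
    · exact LinearMap.congr_fun (F.gr_hom_ext (f := L ∘ₗ F.cx.d) (g := E.d ∘ₗ L)
        fun n x hx => by simpa using (h2 n x hx).2.1.symm) x
    · exact LinearMap.congr_fun (F.gr_hom_ext (f := augE ∘ₗ L) (g := ε)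
        fun n x hx => (h2 n x hx).2.2) x

/-- In degree `0` the element `(f - g) b` is a cycle, of augmentation zero because `f` and `g` have
the same augmentation. On generators of higher dimension `(f - g) b - t (d b)` is a cycle in nonzero
degree, where the augmentation vanishes anyway. -/
theorem exists_homotopy (hE : ∀ σ, IsMor E E (actE σ)) {augE : E →ₗ[R] R} (haug : IsAug E augE)
    (hA : ∀ σ x, augE (actE σ x) = augE x) (hac : Acyclic E augE) {f g : F.cx →ₗ[R] E}
    (hf : IsMor F.cx E f) (hg : IsMor F.cx E g) (hf' : ∀ σ x, f (F.act σ x) = actE σ (f x))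
    (hg' : ∀ σ x, g (F.act σ x) = actE σ (g x)) (haugs : ∀ x, augE (f x) = augE (g x)) :
    ∃ t : F.cx →ₗ[R] E, IsHomotopy F.cx E f g t ∧ ∀ σ x, t (F.act σ x) = actE σ (t x) := by
  have z0 : ∀ β, F.deg β = 0 → ∃ z ∈ E.gr (-1), E.d z = (f - g) (F.b (1, β)) := by
    intro β hβ
    have hb := F.b_mem β
    rw [hβ] at hb
    have hd : F.cx.d (F.b (1, β)) = 0 := F.gr_pos (by simp) (F.cx.d_mem _ _ hb)
    obtain ⟨z, hz, hz'⟩ := hac 0 ((f - g) (F.b (1, β)))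
      (Submodule.sub_mem _ (hf.1 _ _ hb) (hg.1 _ _ hb))
      (by rw [LinearMap.sub_apply, map_sub, ← hf.2, ← hg.2, hd, map_zero, map_zero, sub_zero])
      (by rw [LinearMap.sub_apply, map_sub, haugs, sub_self])
    exact ⟨z, by simpa using hz, hz'⟩
  classical
  refine Exists.elim (F.exists_solution hE hA 1 (G := f - g)
    (fun σ x => by simp [hf', hg']) (-1) (ε := 0) (by simp)
    (fun β => if h : F.deg β = 0 then (z0 β h).choose else 0) (fun β hβ => ?_)
    (fun L n hL β hβ => ?_)) ?_
  · rw [dif_pos hβ]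
    obtain ⟨h1, h2⟩ := (z0 β hβ).choose_spec
    exact ⟨h1, h2, haug.of_ne _ (by omega) _ h1⟩
  · have hb := F.b_mem β
    have hdb := F.cx.d_mem _ _ hb
    have hdb' := hdb
    rw [hβ, show -((n + 1 : ℕ) : ℤ) + 1 = -(n : ℤ) by push_cast; ring] at hdb
    obtain ⟨m1, m2, -⟩ := hL _ hdb
    rw [F.cx.d_d, map_zero, smul_zero, add_zero] at m2
    rw [show -(n : ℤ) - 1 = -((n + 1 : ℕ) : ℤ) by push_cast; ring] at m1
    rw [hβ] at hb
    have mem : (f - g) (F.b (1, β)) + (-1 : R) • L (F.cx.d (F.b (1, β))) ∈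
        E.gr (-((n + 1 : ℕ) : ℤ)) := Submodule.add_mem _
      (Submodule.sub_mem _ (hf.1 _ _ hb) (hg.1 _ _ hb)) (Submodule.smul_mem _ _ m1)
    obtain ⟨z, hz, hz'⟩ := hac (n + 1) _ mem
      (by
        rw [map_add, map_smul, m2, LinearMap.sub_apply, LinearMap.sub_apply, map_sub, hf.2, hg.2]
        simp)
      (haug.of_ne _ (by omega) _ mem)
    exact ⟨z, hz, hz', haug.of_ne _ (by omega) _ hz⟩
  · rintro L ⟨h1, h2, -⟩
    refine ⟨L, ⟨fun n x hx => ?_, fun x => ?_⟩, h1⟩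
    · rcases lt_or_ge 0 n with hn | hn
      · rw [F.gr_pos hn hx, map_zero]
        exact Submodule.zero_mem _
      · obtain ⟨k, rfl⟩ : ∃ k : ℕ, n = -k := ⟨n.natAbs, by omega⟩
        exact (h2 k x hx).1
    · exact LinearMap.congr_fun (F.gr_hom_ext (f := f - g) (g := E.d ∘ₗ L + L ∘ₗ F.cx.d)
        fun n x hx => by simp [(h2 n x hx).2.1]) x

end FreeComplex

end

section

namespace SSet

open Simplicial GrComplex

/-! ### The Alexander-Whitney diagonal is a coassociative morphism of complexes -/

section Faces

variable {X : SSet.{u}}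

/-- The inclusion of the vertices `a, …, a + l`. -/
def segmentHom (n a l : ℕ) : ⦋l⦌ ⟶ ⦋n⦌ :=
  SimplexCategory.mkHom
    { toFun := fun j : Fin (l + 1) => (⟨min (a + j) n, by omega⟩ : Fin (n + 1))
      monotone' := fun i j hij => by
        have : (i : ℕ) ≤ j := hij
        simp only [Fin.mk_le_mk]
        omega }

theorem segment_eq {n : ℕ} (x : X _⦋n⦌) (a l : ℕ) :
    segment x a l = X.map (segmentHom n a l).op x := rfl

/-- The `k`-th face of a simplex, with `k` taken as a natural number. -/
def face {n : ℕ} (x : X _⦋n + 1⦌) (k : ℕ) : X _⦋n⦌ := X.δ (Fin.ofNat (n + 2) k) x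

theorem face_eq {n : ℕ} (x : X _⦋n + 1⦌) (k : ℕ) :
    face x k = X.map (SimplexCategory.δ (Fin.ofNat (n + 2) k)).op x := rfl

/-- Identities between faces and segments are reduced to the underlying maps of vertices, that is,
to arithmetic of natural numbers. -/
theorem map_map_eq {l m m' n : ℕ} (f : ⦋l⦌ ⟶ ⦋m⦌) (g : ⦋m⦌ ⟶ ⦋n⦌) (f' : ⦋l⦌ ⟶ ⦋m'⦌)
    (g' : ⦋m'⦌ ⟶ ⦋n⦌) (x : X _⦋n⦌)
    (h : ∀ j : Fin (l + 1), (g.toOrderHom (f.toOrderHom j) : ℕ) =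
      g'.toOrderHom (f'.toOrderHom j)) :
    X.map f.op (X.map g.op x) = X.map f'.op (X.map g'.op x) := by
  have : f ≫ g = f' ≫ g' := SimplexCategory.Hom.ext _ _ (OrderHom.ext _ _ (funext fun j =>
    Fin.ext (h j)))
  rw [← ConcreteCategory.comp_apply, ← Functor.map_comp, ← op_comp, this, op_comp,
    Functor.map_comp, ConcreteCategory.comp_apply]

theorem map_map_eq' {l m n : ℕ} (f : ⦋l⦌ ⟶ ⦋m⦌) (g : ⦋m⦌ ⟶ ⦋n⦌) (g' : ⦋l⦌ ⟶ ⦋n⦌) (x : X _⦋n⦌)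
    (h : ∀ j : Fin (l + 1), (g.toOrderHom (f.toOrderHom j) : ℕ) = g'.toOrderHom j) :
    X.map f.op (X.map g.op x) = X.map g'.op x := by
  have : f ≫ g = g' := SimplexCategory.Hom.ext _ _ (OrderHom.ext _ _ (funext fun j =>
    Fin.ext (h j)))
  rw [← ConcreteCategory.comp_apply, ← Functor.map_comp, ← op_comp, this]

theorem segmentHom_apply (n a l : ℕ) (j : Fin (l + 1)) :
    ((segmentHom n a l).toOrderHom j : ℕ) = min (a + j) n := rfl

theorem δ_ofNat_apply {n k : ℕ} (hk : k ≤ n + 1) (j : Fin (n + 1)) :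
    ((SimplexCategory.δ (Fin.ofNat (n + 2) k)).toOrderHom j : ℕ) =
      if (j : ℕ) < k then (j : ℕ) else j + 1 := by
  change ((Fin.succAbove (Fin.ofNat (n + 2) k) j : Fin (n + 2)) : ℕ) = _
  have : (Fin.ofNat (n + 2) k : ℕ) = k := Nat.mod_eq_of_lt (by omega)
  rw [Fin.succAbove]
  simp only [Fin.lt_def, this, Fin.val_castSucc]
  split_ifs <;> rfl

theorem segment_segment {n : ℕ} (x : X _⦋n⦌) {a l a' l' : ℕ} (h : a + l ≤ n) (h' : a' + l' ≤ l) :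
    segment (segment x a l) a' l' = segment x (a + a') l' := by
  simp only [segment_eq]
  refine map_map_eq' _ _ _ x fun j => ?_
  have : (j : ℕ) < l' + 1 := j.is_lt
  rw [segmentHom_apply, segmentHom_apply, segmentHom_apply]
  omega

theorem segment_self {n : ℕ} (x : X _⦋n⦌) : segment x 0 n = x := by
  have : segmentHom n 0 n = 𝟙 _ := SimplexCategory.Hom.ext _ _ (OrderHom.ext _ _ (funext fun j =>
    Fin.ext (by
      have : (j : ℕ) < n + 1 := j.is_lt
      change min (0 + (j : ℕ)) n = j
      omega)))
  rw [segment_eq, this, op_id, X.map_id]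
  rfl

theorem segment_face_zero {n : ℕ} (x : X _⦋n + 1⦌) {a k : ℕ} (hk : k ≤ a) (ha : a ≤ n) :
    segment (face x k) 0 a = face (segment x 0 (a + 1)) k := by
  simp only [segment_eq, face_eq]
  refine map_map_eq _ _ _ _ x fun j => ?_
  have : (j : ℕ) < a + 1 := j.is_lt
  rw [δ_ofNat_apply (by omega), segmentHom_apply, segmentHom_apply, δ_ofNat_apply (by omega)]
  split_ifs <;> omega

theorem segment_face_of_le {n : ℕ} (x : X _⦋n + 1⦌) {a b k : ℕ} (hk : k ≤ a) (h : a + b ≤ n) :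
    segment (face x k) a b = segment x (a + 1) b := by
  simp only [segment_eq, face_eq]
  refine map_map_eq' _ _ _ x fun j => ?_
  have : (j : ℕ) < b + 1 := j.is_lt
  rw [δ_ofNat_apply (by omega), segmentHom_apply, segmentHom_apply]
  split_ifs <;> omega

theorem segment_face_of_lt {n : ℕ} (x : X _⦋n + 1⦌) {a k : ℕ} (hk : a < k) (hk' : k ≤ n + 1) :
    segment (face x k) 0 a = segment x 0 a := by
  simp only [segment_eq, face_eq]
  refine map_map_eq' _ _ _ x fun j => ?_
  have : (j : ℕ) < a + 1 := j.is_lt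
  rw [δ_ofNat_apply (by omega), segmentHom_apply, segmentHom_apply]
  split_ifs <;> omega

theorem segment_face_add {n : ℕ} (x : X _⦋n + 1⦌) {a b k : ℕ} (h : a + b = n) (hk : k ≤ b) :
    segment (face x (a + k + 1)) a b = face (segment x a (b + 1)) (k + 1) := by
  simp only [segment_eq, face_eq]
  refine map_map_eq _ _ _ _ x fun j => ?_
  have : (j : ℕ) < b + 1 := j.is_lt
  rw [δ_ofNat_apply (by omega), segmentHom_apply, segmentHom_apply, δ_ofNat_apply (by omega)]
  split_ifs <;> omega

theorem face_last {n : ℕ} (x : X _⦋n⦌) (a : ℕ) :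
    face (segment x 0 (a + 1)) (a + 1) = segment x 0 a := by
  simp only [segment_eq, face_eq]
  refine map_map_eq' _ _ _ x fun j => ?_
  have : (j : ℕ) < a + 1 := j.is_lt
  rw [segmentHom_apply, segmentHom_apply, δ_ofNat_apply (by omega)]
  split_ifs
  omega

theorem face_zero {n : ℕ} (x : X _⦋n⦌) (a b : ℕ) :
    face (segment x a (b + 1)) 0 = segment x (a + 1) b := by
  simp only [segment_eq, face_eq]
  refine map_map_eq' _ _ _ x fun j => ?_
  have : (j : ℕ) < b + 1 := j.is_lt
  rw [segmentHom_apply, segmentHom_apply, δ_ofNat_apply (by omega)]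
  split_ifs <;> omega

end Faces

variable (R : Type) [CommRing R] {X : SSet.{u}}

theorem faceSum_range {n : ℕ} (x : X _⦋n + 1⦌) :
    faceSum R x = ∑ k ∈ Finset.range (n + 2), (-1 : R) ^ k • simplexChain R (face x k) := by
  rw [faceSum_succ, Finset.sum_range]
  refine Finset.sum_congr rfl fun k _ => ?_
  rw [face, Fin.ofNat_val_eq_self]

/-- For a cut at the vertex `i`, the faces of `x` up to `i` are faces of the front segment of length
`i + 1`, and the later ones are faces of the back segment starting at `i`. Two further faces delete
the vertex at which the simplex is cut: the last face of a front segment and the zeroth face of the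
back segment of the neighbouring cut. They cancel. -/
theorem isMor_chainsDiag (X : SSet.{u}) :
    IsMor (chains R X) (GrComplex.tensor (chains R X) (chains R X)) (chainsDiag R X) := by
  refine ⟨fun n x hx => ?_, fun x => ?_⟩
  · refine chains_gr_le R (P := (tensorGr (chains R X) (chains R X) n).comap (chainsDiag R X))
      (fun m x hm => ?_) hx
    change chainsDiag R X _ ∈ tensorGr (chains R X) (chains R X) n
    rw [chainsDiag_simplexChain]
    refine Submodule.sum_mem _ fun ij hij => ?_
    rw [Finset.HasAntidiagonal.mem_antidiagonal] at hij
    have := tmul_mem (simplexChain_mem_gr R (segment x 0 ij.1))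
      (simplexChain_mem_gr R (segment x ij.1 ij.2))
    rwa [show -(ij.1 : ℤ) + -(ij.2 : ℤ) = n by omega] at this
  · have : chainsDiag R X ∘ₗ (chains R X).d =
        (GrComplex.tensor (chains R X) (chains R X)).d ∘ₗ chainsDiag R X := by
      refine chains_hom_ext (X := X) (M := chains R X ⊗[R] chains R X) R fun n x => ?_
      rw [LinearMap.comp_apply, LinearMap.comp_apply, chains_d_simplexChain,
        chainsDiag_simplexChain, map_sum]
      have hterm : ∀ (i j : ℕ), (GrComplex.tensor (chains R X) (chains R X)).d
          (simplexChain R (segment x 0 i) ⊗ₜ[R] simplexChain R (segment x i j)) =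
          faceSum R (segment x 0 i) ⊗ₜ simplexChain R (segment x i j) +
            ((-1 : R) ^ i • simplexChain R (segment x 0 i)) ⊗ₜ faceSum R (segment x i j) := by
        intro i j
        refine (tensor_d_tmul (K := chains R X) (L := chains R X) _ _).trans ?_
        rw [chains_d_simplexChain, chains_d_simplexChain,
          sgn_eq (chains R X) (simplexChain_mem_gr R _)]
        congr 2
        rw [Int.cast_neg, CharTwo.neg_eq, Int.cast_natCast, sg_natCast]
      rw [Finset.sum_congr rfl fun ij _ => hterm ij.1 ij.2, Finset.sum_add_distrib]
      cases n with
      | zero =>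
        have h0 : ∀ y : X _⦋0⦌, faceSum R y = 0 := fun _ => rfl
        simp [h0]
      | succ n =>
        have h0 : ∀ y : X _⦋0⦌, faceSum R y = 0 := fun _ => rfl
        -- A segment of length `0` has no boundary. Dropping these cuts indexes both sums, one over
        -- `(i + 1, j)` and one over `(i, j + 1)`, by the cuts `(i, j)` of `n`.
        rw [Finset.Nat.sum_antidiagonal_succ, Finset.Nat.sum_antidiagonal_succ']
        rw [h0, h0, TensorProduct.zero_tmul, TensorProduct.tmul_zero, zero_add, zero_add,
          ← Finset.sum_add_distrib, faceSum_range, map_sum]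
        have e : ∀ k, chainsDiag R X ((-1 : R) ^ k • simplexChain R (face x k)) =
            ∑ ij ∈ Finset.HasAntidiagonal.antidiagonal n, (-1 : R) ^ k •
              simplexChain R (segment (face x k) 0 ij.1) ⊗ₜ[R]
              simplexChain R (segment (face x k) ij.1 ij.2) := fun k => by
          rw [map_smul, chainsDiag_simplexChain, Finset.smul_sum]
        rw [Finset.sum_congr rfl fun k _ => e k, Finset.sum_comm]
        refine Finset.sum_congr rfl fun ij hij => ?_
        obtain ⟨i, j⟩ := ij
        rw [Finset.HasAntidiagonal.mem_antidiagonal] at hij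
        dsimp only at hij ⊢
        have f1 : faceSum R (segment x 0 (i + 1)) = ∑ k ∈ Finset.range (i + 1),
            (-1 : R) ^ k • simplexChain R (face (segment x 0 (i + 1)) k) +
              (-1 : R) ^ (i + 1) • simplexChain R (segment x 0 i) := by
          rw [faceSum_range, Finset.sum_range_succ, face_last]
        have f2 : faceSum R (segment x i (j + 1)) = ∑ k ∈ Finset.range (j + 1),
            (-1 : R) ^ (k + 1) • simplexChain R (face (segment x i (j + 1)) (k + 1)) +
              simplexChain R (segment x (i + 1) j) := by
          rw [faceSum_range, Finset.sum_range_succ', face_zero, pow_zero, one_smul]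
        have e1 : ∀ k ∈ Finset.range (i + 1), (-1 : R) ^ k •
              simplexChain R (segment (face x k) 0 i) ⊗ₜ[R]
              simplexChain R (segment (face x k) i j) =
            ((-1 : R) ^ k • simplexChain R (face (segment x 0 (i + 1)) k)) ⊗ₜ[R]
              simplexChain R (segment x (i + 1) j) := fun k hk => by
          rw [Finset.mem_range] at hk
          rw [segment_face_zero x (by omega) (by omega), segment_face_of_le x (by omega) (by omega)]
          rfl
        have e2 : ∀ k ∈ Finset.range (j + 1), (-1 : R) ^ (i + 1 + k) •
              simplexChain R (segment (face x (i + 1 + k)) 0 i) ⊗ₜ[R]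
              simplexChain R (segment (face x (i + 1 + k)) i j) =
            ((-1 : R) ^ i • simplexChain R (segment x 0 i)) ⊗ₜ[R]
              ((-1 : R) ^ (k + 1) • simplexChain R (face (segment x i (j + 1)) (k + 1))) :=
          fun k hk => by
          rw [Finset.mem_range] at hk
          rw [segment_face_of_lt x (by omega) (by omega), show i + 1 + k = i + k + 1 by ring,
            segment_face_add x hij (by omega), TensorProduct.smul_tmul_smul]
          congr 1
          ring
        -- The faces `0, …, i` go to the front segment and `i + 1, …, n + 1` to the back segment.
        rw [show n + 2 = (i + 1) + (j + 1) by omega, Finset.sum_range_add,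
          Finset.sum_congr rfl e1, Finset.sum_congr rfl e2, f1, f2, TensorProduct.add_tmul,
          TensorProduct.tmul_add, TensorProduct.sum_tmul, ← TensorProduct.tmul_sum,
          pow_succ (-1 : R) i, mul_neg_one, neg_smul, TensorProduct.neg_tmul, add_assoc,
          add_comm (((-1 : R) ^ i • simplexChain R (segment x 0 i)) ⊗ₜ[R]
            ∑ k ∈ Finset.range (j + 1), _), neg_add_cancel_left]
    exact LinearMap.congr_fun this x

end SSet

end

/-! ### The iterated Alexander-Whitney diagonal -/

section

namespace GrComplex

variable {R : Type} [CommRing R] (K : GrComplex.{v} R) (n : ℕ)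

/-- `(x₁ ⊗ ⋯ ⊗ x_n) ⊗ y ↦ x₁ ⊗ ⋯ ⊗ x_n ⊗ y`. -/
def snocTensor : (power K n) ⊗[R] K →ₗ[R] power K (n + 1) :=
  TensorProduct.lift (PiTensorProduct.lift
    ((PiTensorProduct.tprod R (s := fun _ : Fin (n + 1) => K)).curryRight))

variable {K n}

theorem snocTensor_tmul (x : Fin n → K) (y : K) :
    snocTensor K n (PiTensorProduct.tprod R x ⊗ₜ y) =
      PiTensorProduct.tprod R (Fin.snoc x y : Fin (n + 1) → K) := by
  rw [snocTensor, TensorProduct.lift.tmul, PiTensorProduct.lift.tprod]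
  rfl

theorem pi_tensor_hom_ext {L : GrComplex.{w} R} {M : Type*} [AddCommGroup M] [Module R M]
    {f g : (power K n) ⊗[R] L →ₗ[R] M}
    (h : ∀ (a : Fin n → ℤ) (b : ℤ) (x : Fin n → K) (y : L), (∀ i, x i ∈ K.gr (a i)) → y ∈ L.gr b →
      f (PiTensorProduct.tprod R x ⊗ₜ y) = g (PiTensorProduct.tprod R x ⊗ₜ y)) : f = g :=
  TensorProduct.ext (pi_hom_ext fun a x hx => L.hom_ext fun b y hy => h a b x y hx hy)

theorem snoc_mem {a : Fin n → ℤ} {b : ℤ} {x : Fin n → K} {y : K} (hx : ∀ i, x i ∈ K.gr (a i))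
    (hy : y ∈ K.gr b) (i : Fin (n + 1)) :
    (Fin.snoc x y : Fin (n + 1) → K) i ∈ K.gr ((Fin.snoc a b : Fin (n + 1) → ℤ) i) := by
  refine Fin.lastCases ?_ (fun i => ?_) i
  · simpa using hy
  · simpa using hx i

theorem isMor_snocTensor (K : GrComplex.{v} R) (n : ℕ) :
    IsMor (tensor (power K n) K) (power K (n + 1)) (snocTensor K n) := by
  refine ⟨fun m z hz => ?_, fun z => ?_⟩
  · have : tensorGr (power K n) K m ≤ ((power K (n + 1)).gr m).comap (snocTensor K n) := by
      refine Submodule.span_le.2 ?_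
      rintro _ ⟨a, b, rfl, x, hx, y, hy, rfl⟩
      have : (power K n).gr a ≤ ((power K (n + 1)).gr (a + b)).comap
          (snocTensor K n ∘ₗ (TensorProduct.mk R _ _).flip y) := by
        refine Submodule.span_le.2 ?_
        rintro _ ⟨a, rfl, x, hx, rfl⟩
        change snocTensor K n (PiTensorProduct.tprod R x ⊗ₜ y) ∈ (power K (n + 1)).gr _
        rw [snocTensor_tmul]
        have := tprod_mem (R := R) (K := fun _ => K) (snoc_mem hx hy)
        rw [Fin.sum_univ_castSucc] at this
        simpa using this
      exact this hx
    exact this hz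
  · have : snocTensor K n ∘ₗ (tensor (power K n) K).d =
        (power K (n + 1)).d ∘ₗ snocTensor K n := pi_tensor_hom_ext fun a b x y hx hy => by
      rw [LinearMap.comp_apply, LinearMap.comp_apply,
        tensor_d_tmul (K := power K n) (L := K) _ _, snocTensor_tmul, piTensor_d_apply,
        piTensor_d_apply, Fin.sum_univ_castSucc, TensorProduct.sum_tmul, map_add, map_sum,
        sgn_eq (power K n) (tprod_mem (K := fun _ => K) hx), ← TensorProduct.smul_tmul', map_smul,
        snocTensor_tmul]
      have hs := snoc_mem hx hy
      congr 1
      · refine Finset.sum_congr rfl fun k _ => ?_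
        rw [piD_eq (K := fun _ => K) hx, piD_eq (K := fun _ => K) hs, ← TensorProduct.smul_tmul',
          map_smul, snocTensor_tmul, Fin.sum_univ_castSucc, Fin.snoc_update]
        simp [Fin.castSucc_lt_castSucc_iff, (Fin.castSucc_lt_last k).not_gt]
      · rw [piD_eq (K := fun _ => K) hs, Fin.sum_univ_castSucc, Fin.update_snoc_last]
        simp [Fin.castSucc_lt_last]
    exact LinearMap.congr_fun this z

theorem snocTensor_natural {L : GrComplex.{w} R} (f : K →ₗ[R] L) (z : (power K n) ⊗[R] K) :
    PiTensorProduct.map (fun _ => f) (snocTensor K n z) =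
      snocTensor L n (TensorProduct.map (PiTensorProduct.map fun _ => f) f z) := by
  have : PiTensorProduct.map (fun _ => f) ∘ₗ snocTensor K n =
      snocTensor L n ∘ₗ TensorProduct.map (PiTensorProduct.map fun _ => f) f :=
    pi_tensor_hom_ext fun a b x y _ _ => by
      rw [LinearMap.comp_apply, LinearMap.comp_apply, snocTensor_tmul, TensorProduct.map_tmul,
        PiTensorProduct.map_tprod, PiTensorProduct.map_tprod, snocTensor_tmul]
      congr 1
      funext i
      refine Fin.lastCases ?_ (fun i => ?_) i <;> simp
  exact LinearMap.congr_fun this z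

end GrComplex

namespace SSet

open Simplicial GrComplex

variable (R : Type) [CommRing R]

/-- Both sides are the sum over all ways to cut a simplex into three consecutive segments; they
differ only in which cut is made first. -/
theorem chainsDiag_coassoc (X : SSet.{u}) (x : chains R X) :
    TensorProduct.assoc R _ _ _
      (TensorProduct.map (chainsDiag R X) LinearMap.id (chainsDiag R X x)) =
      TensorProduct.map LinearMap.id (chainsDiag R X) (chainsDiag R X x) := by
  have : (TensorProduct.assoc R _ _ _).toLinearMap ∘ₗ
      TensorProduct.map (chainsDiag R X) LinearMap.id ∘ₗ chainsDiag R X =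
      TensorProduct.map LinearMap.id (chainsDiag R X) ∘ₗ chainsDiag R X := by
    refine chains_hom_ext (X := X) R fun n x => ?_
    simp only [LinearMap.comp_apply]
    rw [chainsDiag_simplexChain, map_sum, map_sum, map_sum]
    have e1 : ∀ ij ∈ Finset.HasAntidiagonal.antidiagonal n,
        (TensorProduct.assoc R _ _ _).toLinearMap
          (TensorProduct.map (chainsDiag R X) LinearMap.id
            (simplexChain R (segment x 0 ij.1) ⊗ₜ[R] simplexChain R (segment x ij.1 ij.2))) =
        ∑ kl ∈ Finset.HasAntidiagonal.antidiagonal ij.1, simplexChain R (segment x 0 kl.1) ⊗ₜ[R]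
          (simplexChain R (segment x kl.1 kl.2) ⊗ₜ[R] simplexChain R (segment x ij.1 ij.2)) := by
      rintro ⟨i, j⟩ hij
      rw [Finset.HasAntidiagonal.mem_antidiagonal] at hij
      dsimp only at hij ⊢
      rw [TensorProduct.map_tmul, chainsDiag_simplexChain, TensorProduct.sum_tmul, map_sum]
      refine Finset.sum_congr rfl fun kl hkl => ?_
      rw [Finset.HasAntidiagonal.mem_antidiagonal] at hkl
      rw [segment_segment x (by omega) (by omega), segment_segment x (by omega) (by omega),
        zero_add, zero_add]
      rfl
    have e2 : ∀ ij ∈ Finset.HasAntidiagonal.antidiagonal n,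
        TensorProduct.map LinearMap.id (chainsDiag R X)
            (simplexChain R (segment x 0 ij.1) ⊗ₜ[R] simplexChain R (segment x ij.1 ij.2)) =
        ∑ kl ∈ Finset.HasAntidiagonal.antidiagonal ij.2, simplexChain R (segment x 0 ij.1) ⊗ₜ[R]
          (simplexChain R (segment x ij.1 kl.1) ⊗ₜ[R]
            simplexChain R (segment x (ij.1 + kl.1) kl.2)) := by
      rintro ⟨i, j⟩ hij
      rw [Finset.HasAntidiagonal.mem_antidiagonal] at hij
      dsimp only at hij ⊢
      rw [TensorProduct.map_tmul, chainsDiag_simplexChain, TensorProduct.tmul_sum]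
      refine Finset.sum_congr rfl fun kl hkl => ?_
      rw [Finset.HasAntidiagonal.mem_antidiagonal] at hkl
      rw [segment_segment x (by omega) (by omega), segment_segment x (by omega) (by omega),
        add_zero]
      rfl
    rw [Finset.sum_congr rfl e1, Finset.sum_congr rfl e2, Finset.sum_sigma', Finset.sum_sigma']
    refine Finset.sum_nbij' (fun q => ⟨(q.2.1, q.2.2 + q.1.2), (q.2.2, q.1.2)⟩)
      (fun q => ⟨(q.1.1 + q.2.1, q.2.2), (q.1.1, q.2.1)⟩) ?_ ?_ ?_ ?_ ?_
    · rintro ⟨⟨i, j⟩, ⟨k, l⟩⟩ h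
      simp only [Finset.mem_sigma, Finset.HasAntidiagonal.mem_antidiagonal] at h ⊢
      exact ⟨by omega, trivial⟩
    · rintro ⟨⟨i, j⟩, ⟨k, l⟩⟩ h
      simp only [Finset.mem_sigma, Finset.HasAntidiagonal.mem_antidiagonal] at h ⊢
      exact ⟨by omega, trivial⟩
    · rintro ⟨⟨i, j⟩, ⟨k, l⟩⟩ h
      simp only [Finset.mem_sigma, Finset.HasAntidiagonal.mem_antidiagonal] at h ⊢
      rw [h.2]
    · rintro ⟨⟨i, j⟩, ⟨k, l⟩⟩ h
      simp only [Finset.mem_sigma, Finset.HasAntidiagonal.mem_antidiagonal] at h ⊢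
      rw [h.2]
    · rintro ⟨⟨i, j⟩, ⟨k, l⟩⟩ h
      simp only [Finset.mem_sigma, Finset.HasAntidiagonal.mem_antidiagonal] at h ⊢
      rw [h.2]
  exact LinearMap.congr_fun this x

/-- The iterated Alexander-Whitney diagonal `C(X) → C(X)ⁿ`. -/
def iterDiag (n : ℕ) (X : SSet.{u}) : chains R X →ₗ[R] power (chains R X) n :=
  match n with
  | 0 => (chainsAug R X).smulRight (PiTensorProduct.tprod R Fin.elim0)
  | n + 1 => snocTensor (chains R X) n ∘ₗ TensorProduct.map (iterDiag n X) LinearMap.id ∘ₗ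
      chainsDiag R X

theorem iterDiag_succ (n : ℕ) (X : SSet.{u}) (x : chains R X) : iterDiag R (n + 1) X x =
    snocTensor (chains R X) n
      (TensorProduct.map (iterDiag R n X) LinearMap.id (chainsDiag R X x)) := rfl

theorem isMor_iterDiag (n : ℕ) (X : SSet.{u}) :
    IsMor (chains R X) (power (chains R X) n) (iterDiag R n X) := by
  induction n with
  | zero =>
    refine ⟨fun m x hx => ?_, fun x => ?_⟩
    · change chainsAug R X x • PiTensorProduct.tprod R _ ∈ (power (chains R X) 0).gr m
      by_cases hm : m = 0
      · subst hm
        refine Submodule.smul_mem _ _ ?_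
        exact tprod_mem (K := fun _ => chains R X) (a := fun _ => 0) fun i => Fin.elim0 i
      · rw [(isAug_chainsAug R X).of_ne m hm x hx, zero_smul]
        exact Submodule.zero_mem _
    · change chainsAug R X _ • PiTensorProduct.tprod R _ = (power (chains R X) 0).d _
      rw [(isAug_chainsAug R X).d, zero_smul, piTensor_d_apply]
      rfl
  | succ n ih =>
    exact (isMor_snocTensor _ n).comp ((ih.tensor IsMor.id).comp (isMor_chainsDiag R X))

theorem iterDiag_natural (n : ℕ) {X Y : SSet.{u}} (f : X ⟶ Y) (x : chains R X) :
    iterDiag R n Y (chainsMap R f x) =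
      PiTensorProduct.map (fun _ => chainsMap R f) (iterDiag R n X x) := by
  induction n generalizing x with
  | zero =>
    change chainsAug R Y _ • PiTensorProduct.tprod R _ =
      PiTensorProduct.map _ (chainsAug R X _ • PiTensorProduct.tprod R _)
    rw [chainsAug_map, map_smul, PiTensorProduct.map_tprod]
    congr 2
    exact Subsingleton.elim _ _
  | succ n ih =>
    rw [iterDiag_succ, iterDiag_succ, snocTensor_natural, ← chainsDiag_natural]
    generalize chainsDiag R X x = z
    congr 1
    induction z using TensorProduct.induction_on with
    | zero => simp only [map_zero]
    | add y z hy hz => rw [map_add, map_add, map_add, map_add, hy, hz]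
    | tmul y z => simp only [TensorProduct.map_tmul, ih, LinearMap.id_apply]

/-- The recursion splits off the last of the consecutive segments, which corresponds to `Fin.snoc`
on the lengths. The recursive form gives the formal properties; this formula identifies it with
`alexanderWhitney`. -/
theorem iterDiag_simplexChain (n : ℕ) {X : SSet.{u}} {m : ℕ} (x : X _⦋m⦌) :
    iterDiag R n X (simplexChain R x) =
      ∑ l ∈ Finset.piAntidiag (Finset.univ : Finset (Fin n)) m, PiTensorProduct.tprod R fun k =>
        simplexChain R (segment x (∑ i ∈ Finset.univ.filter (· < k), l i) (l k)) := by
  induction n generalizing m with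
  | zero =>
    change chainsAug R X _ • PiTensorProduct.tprod R _ = _
    rw [chainsAug_simplexChain]
    split_ifs with h
    · subst h
      rw [one_smul]
      simp
      congr 1
      exact Subsingleton.elim _ _
    · simp [h]
  | succ n ih =>
    rw [iterDiag_succ, chainsDiag_simplexChain, map_sum, map_sum]
    have e : ∀ ij ∈ Finset.HasAntidiagonal.antidiagonal m,
        snocTensor (chains R X) n (TensorProduct.map (iterDiag R n X) LinearMap.id
          (simplexChain R (segment x 0 ij.1) ⊗ₜ[R] simplexChain R (segment x ij.1 ij.2))) =
        ∑ l ∈ Finset.piAntidiag (Finset.univ : Finset (Fin n)) ij.1, PiTensorProduct.tprod R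
          fun k => simplexChain R (segment x (∑ i ∈ Finset.univ.filter (· < k),
            (Fin.snoc l ij.2 : Fin (n + 1) → ℕ) i) ((Fin.snoc l ij.2 : Fin (n + 1) → ℕ) k)) := by
      rintro ⟨i, j⟩ hij
      rw [Finset.HasAntidiagonal.mem_antidiagonal] at hij
      dsimp only at hij ⊢
      rw [TensorProduct.map_tmul, ih, TensorProduct.sum_tmul, map_sum]
      refine Finset.sum_congr rfl fun l hl => ?_
      rw [LinearMap.id_apply, snocTensor_tmul]
      congr 1
      have hl' : ∑ i, l i = i := (Finset.mem_piAntidiag.1 hl).1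
      funext k
      refine Fin.lastCases ?_ (fun k => ?_) k
      · have e : (Fin.snoc l j : Fin (n + 1) → ℕ) (Fin.last n) = j := Fin.snoc_last _ _
        rw [e, Fin.snoc_last, Finset.sum_filter, Fin.sum_univ_castSucc]
        simp [Fin.castSucc_lt_last, hl']
      · have hk : ∑ i ∈ Finset.univ.filter (· < k), l i + l k ≤ i := by
          rw [← hl', ← Finset.sum_filter_add_sum_filter_not Finset.univ (· < k)]
          refine Nat.add_le_add_left (Finset.single_le_sum (f := l) (fun _ _ => Nat.zero_le _) ?_) _
          simp
        have e : (Fin.snoc l j : Fin (n + 1) → ℕ) k.castSucc = l k := Fin.snoc_castSucc _ _ _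
        rw [e, Fin.snoc_castSucc, segment_segment x (by omega) hk, zero_add, Finset.sum_filter,
          Finset.sum_filter, Fin.sum_univ_castSucc]
        simp [Fin.castSucc_lt_castSucc_iff, (Fin.castSucc_lt_last k).not_gt]
    rw [Finset.sum_congr rfl e, Finset.sum_sigma']
    refine Finset.sum_nbij' (fun q => (Fin.snoc q.2 q.1.2 : Fin (n + 1) → ℕ))
      (fun l => ⟨(∑ i : Fin n, l i.castSucc, l (Fin.last n)), fun i => l i.castSucc⟩)
      ?_ ?_ ?_ ?_ ?_
    · rintro ⟨⟨i, j⟩, l⟩ h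
      simp only [Finset.mem_sigma, Finset.HasAntidiagonal.mem_antidiagonal,
        Finset.mem_piAntidiag] at h ⊢
      refine ⟨?_, by simp⟩
      rw [Fin.sum_univ_castSucc]
      simp [h.2.1, h.1]
    · intro l h
      simp only [Finset.mem_sigma, Finset.HasAntidiagonal.mem_antidiagonal,
        Finset.mem_piAntidiag] at h ⊢
      refine ⟨?_, by simp⟩
      rw [← h.1, Fin.sum_univ_castSucc]
    · rintro ⟨⟨i, j⟩, l⟩ h
      simp only [Finset.mem_sigma, Finset.HasAntidiagonal.mem_antidiagonal,
        Finset.mem_piAntidiag] at h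
      simp [h.2.1]
    · intro l h
      funext k
      refine Fin.lastCases ?_ (fun k => ?_) k <;> simp
    · rintro ⟨⟨i, j⟩, l⟩ h
      rfl

/-- The projection of a product on a factor. -/
def piProj {n : ℕ} (L : Fin n → SSet.{u}) (i : Fin n) : piSSet L ⟶ L i where
  app Δ := TypeCat.ofHom fun x => x i

/-- The map of several variables is recovered from the diagonal of the single simplicial set `piSSet
L` by projecting the factors. The same device turns operations `C(L) → C(L)^p` into a Steenrod
diagonal. -/
theorem alexanderWhitney_eq {n : ℕ} (L : Fin n → SSet.{u}) (x : chains R (piSSet L)) :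
    alexanderWhitney R L x =
      PiTensorProduct.map (fun i => chainsMap R (piProj L i)) (iterDiag R n (piSSet L) x) := by
  have : alexanderWhitney R L =
      PiTensorProduct.map (fun i => chainsMap R (piProj L i)) ∘ₗ iterDiag R n (piSSet L) := by
    refine Finsupp.lhom_ext' fun s => LinearMap.ext_ring ?_
    change alexanderWhitney R L (Finsupp.single s 1) =
      PiTensorProduct.map _ (iterDiag R n (piSSet L) (Finsupp.single s 1))
    rw [← simplexChain_N, iterDiag_simplexChain, simplexChain_N, alexanderWhitney,
      Finsupp.linearCombination_single, one_smul, map_sum]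
    refine Finset.sum_congr rfl fun l _ => ?_
    rw [PiTensorProduct.map_tprod]
    congr 1
    funext i
    rw [chainsMap_simplexChain]
    rfl
  exact LinearMap.congr_fun this x

end SSet

end

section

open GrComplex

/-! ### The cyclic resolution and its coproduct -/

section Cyclic

variable (p : ℕ)

theorem cyclicAct_basis (σ : cyclicSubgroup p) (n : ℕ) (τ : cyclicSubgroup p) :
    cyclicAct p σ (cyclicBasis p n τ) = cyclicBasis p n (σ * τ) :=
  Finsupp.mapDomain_single

theorem cyclicBasis_mem (n : ℕ) (τ : cyclicSubgroup p) :
    cyclicBasis p n τ ∈ (cyclicResolution p).gr (-(n : ℤ)) :=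
  Finsupp.single_mem_supported _ _ rfl

theorem cyclicAct_tmul (σ : cyclicSubgroup p) (m n : ℕ) (τ υ : cyclicSubgroup p) :
    TensorProduct.map (cyclicAct p σ) (cyclicAct p σ)
      (cyclicBasis p m τ ⊗ₜ cyclicBasis p n υ) =
      cyclicBasis p m (σ * τ) ⊗ₜ cyclicBasis p n (σ * υ) := by
  rw [TensorProduct.map_tmul, cyclicAct_basis, cyclicAct_basis]

theorem cyclic_hom_ext {M : Type*} [AddCommGroup M] [Module (ZMod p) M]
    {f g : cyclicResolution p →ₗ[ZMod p] M}
    (h : ∀ n τ, f (cyclicBasis p n τ) = g (cyclicBasis p n τ)) : f = g :=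
  Finsupp.lhom_ext' fun s => LinearMap.ext_ring (h s.1 s.2)

theorem cyclic_gr_le {n : ℤ} {P : Submodule (ZMod p) (cyclicResolution p)}
    (h : ∀ (m : ℕ) τ, n = -(m : ℤ) → cyclicBasis p m τ ∈ P) : (cyclicResolution p).gr n ≤ P := by
  dsimp only
  rw [Finsupp.supported_eq_span_single, Submodule.span_le]
  rintro _ ⟨s, rfl, rfl⟩
  exact h s.1 s.2 rfl

theorem cyclic_d_zero (τ : cyclicSubgroup p) :
    (cyclicResolution p).d (cyclicBasis p 0 τ) = 0 := by
  refine (Finsupp.linearCombination_single _ _ _).trans ?_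
  rw [one_smul]
  rfl

theorem cyclic_d_of_even {n : ℕ} (hn : Even n) (τ : cyclicSubgroup p) :
    (cyclicResolution p).d (cyclicBasis p (n + 1) τ) =
      cyclicBasis p n (τ * cyclicGen p) - cyclicBasis p n τ := by
  refine (Finsupp.linearCombination_single _ _ _).trans ?_
  rw [one_smul]
  exact if_pos hn

theorem cyclic_d_of_odd {n : ℕ} (hn : ¬ Even n) (τ : cyclicSubgroup p) :
    (cyclicResolution p).d (cyclicBasis p (n + 1) τ) =
      ∑ k ∈ Finset.range p, cyclicBasis p n (τ * cyclicGen p ^ k) := by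
  refine (Finsupp.linearCombination_single _ _ _).trans ?_
  rw [one_smul]
  exact if_neg hn

theorem cyclicAct_one : cyclicAct p 1 = LinearMap.id :=
  cyclic_hom_ext p fun n τ => by rw [cyclicAct_basis, one_mul]; rfl

theorem cyclicAct_mul (σ τ : cyclicSubgroup p) :
    cyclicAct p (σ * τ) = cyclicAct p σ ∘ₗ cyclicAct p τ :=
  cyclic_hom_ext p fun n υ => by
    rw [LinearMap.comp_apply, cyclicAct_basis, cyclicAct_basis, cyclicAct_basis, mul_assoc]

theorem isMor_cyclicAct (σ : cyclicSubgroup p) :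
    IsMor (cyclicResolution p) (cyclicResolution p) (cyclicAct p σ) := by
  refine ⟨fun n x hx => ?_, fun x => ?_⟩
  · have : (cyclicResolution p).gr n ≤ ((cyclicResolution p).gr n).comap (cyclicAct p σ) := by
      refine cyclic_gr_le p fun m τ hm => ?_
      rw [Submodule.mem_comap, cyclicAct_basis, hm]
      exact cyclicBasis_mem p _ _
    exact this hx
  · have : cyclicAct p σ ∘ₗ (cyclicResolution p).d = (cyclicResolution p).d ∘ₗ cyclicAct p σ :=
      cyclic_hom_ext p fun n τ => by
        rw [LinearMap.comp_apply, LinearMap.comp_apply, cyclicAct_basis]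
        cases n with
        | zero => rw [cyclic_d_zero, cyclic_d_zero, map_zero]
        | succ n =>
          by_cases hn : Even n
          · rw [cyclic_d_of_even p hn, cyclic_d_of_even p hn, map_sub, cyclicAct_basis,
              cyclicAct_basis, mul_assoc]
          · rw [cyclic_d_of_odd p hn, cyclic_d_of_odd p hn, map_sum]
            refine Finset.sum_congr rfl fun k _ => ?_
            rw [cyclicAct_basis, mul_assoc]
    exact LinearMap.congr_fun this x

/-- The cyclic resolution as a complex of free modules. -/
def cyclicFree : FreeComplex.{0} (ZMod p) (cyclicSubgroup p) where
  cx := cyclicResolution p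
  act :=
    { toFun := cyclicAct p
      map_one' := cyclicAct_one p
      map_mul' := cyclicAct_mul p }
  act_mor := isMor_cyclicAct p
  B := ℕ
  b := (Finsupp.basisSingleOne (R := ZMod p)).reindex (Equiv.prodComm ℕ (cyclicSubgroup p))
  deg n := n
  b_mem n := by
    rw [Module.Basis.reindex_apply, Finsupp.coe_basisSingleOne]
    exact cyclicBasis_mem p n 1
  b_eq σ n := by
    rw [Module.Basis.reindex_apply, Finsupp.coe_basisSingleOne, Module.Basis.reindex_apply,
      Finsupp.coe_basisSingleOne]
    refine ((cyclicAct_basis p σ n 1).trans ?_).symm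
    rw [mul_one]
    rfl

theorem cyclicFree_b (σ : cyclicSubgroup p) (n : ℕ) :
    (cyclicFree p).b (σ, n) = cyclicBasis p n σ := by
  refine (Module.Basis.reindex_apply (Finsupp.basisSingleOne (R := ZMod p))
    (Equiv.prodComm ℕ (cyclicSubgroup p)) (σ, n)).trans ?_
  rw [Finsupp.coe_basisSingleOne]
  rfl

theorem cyclicAug_basis (n : ℕ) (τ : cyclicSubgroup p) :
    cyclicAug p (cyclicBasis p n τ) = if n = 0 then 1 else 0 := by
  refine (Finsupp.linearCombination_single _ _ _).trans ?_
  rw [one_smul]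

theorem isAug_cyclicAug : IsAug (cyclicResolution p) (cyclicAug p) := by
  refine ⟨fun n hn x hx => SteenrodDiagonal.cyclicAug_of_ne hn hx, fun x => ?_⟩
  have : cyclicAug p ∘ₗ (cyclicResolution p).d = 0 := cyclic_hom_ext p fun n τ => by
    rw [LinearMap.comp_apply]
    match n with
    | 0 => rw [cyclic_d_zero, map_zero]; rfl
    | 1 =>
      rw [cyclic_d_of_even p (by simp), map_sub, cyclicAug_basis, cyclicAug_basis, sub_self]
      rfl
    | n + 2 =>
      by_cases hn : Even (n + 1)
      · rw [cyclic_d_of_even p hn, map_sub, cyclicAug_basis, cyclicAug_basis, sub_self]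
        rfl
      · rw [cyclic_d_of_odd p hn, map_sum]
        exact Finset.sum_eq_zero fun k _ => cyclicAug_basis p (n + 1) _
  exact LinearMap.congr_fun this x

theorem cyclicAug_act (σ : cyclicSubgroup p) (x : cyclicResolution p) :
    cyclicAug p (cyclicAct p σ x) = cyclicAug p x := by
  have : cyclicAug p ∘ₗ cyclicAct p σ = cyclicAug p := cyclic_hom_ext p fun n τ => by
    rw [LinearMap.comp_apply, cyclicAct_basis, cyclicAug_basis, cyclicAug_basis]
  exact LinearMap.congr_fun this x

theorem cyclicCoprod_basis (n : ℕ) (τ : cyclicSubgroup p) :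
    cyclicCoprod p (cyclicBasis p n τ) = TensorProduct.map (cyclicAct p τ) (cyclicAct p τ)
      (∑ ij ∈ Finset.HasAntidiagonal.antidiagonal n, cyclicCoprodTerm p ij.1 ij.2) := by
  refine (Finsupp.linearCombination_single _ _ _).trans ?_
  rw [one_smul]

theorem cyclicCoprod_act (σ : cyclicSubgroup p) (x : cyclicResolution p) :
    cyclicCoprod p (cyclicAct p σ x) =
      TensorProduct.map (cyclicAct p σ) (cyclicAct p σ) (cyclicCoprod p x) := by
  have : cyclicCoprod p ∘ₗ cyclicAct p σ =
      TensorProduct.map (cyclicAct p σ) (cyclicAct p σ) ∘ₗ cyclicCoprod p :=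
    cyclic_hom_ext p fun n τ => by
      rw [LinearMap.comp_apply, LinearMap.comp_apply, cyclicAct_basis, cyclicCoprod_basis,
        cyclicCoprod_basis, cyclicAct_mul, TensorProduct.map_comp]
      rfl
  exact LinearMap.congr_fun this x

theorem cyclicCoprod_basis_one (n : ℕ) : cyclicCoprod p (cyclicBasis p n 1) =
    ∑ ij ∈ Finset.HasAntidiagonal.antidiagonal n, cyclicCoprodTerm p ij.1 ij.2 := by
  rw [cyclicCoprod_basis, cyclicAct_one, TensorProduct.map_id]
  rfl

theorem cyclicCoprodTerm_of_even {a : ℕ} (ha : Even a) (b : ℕ) :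
    cyclicCoprodTerm p a b = cyclicBasis p a 1 ⊗ₜ cyclicBasis p b 1 := if_pos ha

theorem cyclicCoprodTerm_of_odd_of_even {a b : ℕ} (ha : ¬ Even a) (hb : Even b) :
    cyclicCoprodTerm p a b = cyclicBasis p a 1 ⊗ₜ cyclicBasis p b (cyclicGen p) := by
  rw [cyclicCoprodTerm, if_neg ha, if_pos hb]

theorem cyclicCoprodTerm_of_odd_of_odd {a b : ℕ} (ha : ¬ Even a) (hb : ¬ Even b) :
    cyclicCoprodTerm p a b = ∑ s ∈ Finset.range p, ∑ r ∈ Finset.range s,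
      cyclicBasis p a (cyclicGen p ^ r) ⊗ₜ cyclicBasis p b (cyclicGen p ^ s) := by
  rw [cyclicCoprodTerm, if_neg ha, if_neg hb]

theorem cyclicCoprodTerm_mem (a b : ℕ) : cyclicCoprodTerm p a b ∈
    (GrComplex.tensor (cyclicResolution p) (cyclicResolution p)).gr (-((a + b : ℕ) : ℤ)) := by
  have h : ∀ σ τ, cyclicBasis p a σ ⊗ₜ cyclicBasis p b τ ∈
      (GrComplex.tensor (cyclicResolution p) (cyclicResolution p)).gr (-((a + b : ℕ) : ℤ)) := by
    intro σ τ
    have := tmul_mem (cyclicBasis_mem p a σ) (cyclicBasis_mem p b τ)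
    rwa [← neg_add, ← Nat.cast_add] at this
  rw [cyclicCoprodTerm]
  split_ifs
  · exact h _ _
  · exact h _ _
  · exact Submodule.sum_mem _ fun s _ => Submodule.sum_mem _ fun r _ => h _ _

theorem cyclic_sgn (a : ℕ) (τ : cyclicSubgroup p) :
    (cyclicResolution p).sgn (cyclicBasis p a τ) =
      (if Even a then (1 : ZMod p) else -1) • cyclicBasis p a τ := by
  rw [sgn_of_mem _ (cyclicBasis_mem p a τ)]
  simp

/-- The differences telescope along the lines `s - r = const` of the triangle `r < s`. This computes
the diagonal action of `α - 1` on `∑ α ^ r ⊗ α ^ s`. -/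
theorem sum_triangle_diagonal {M : Type*} [AddCommGroup M] (f : ℕ → ℕ → M) (n : ℕ) :
    ∑ s ∈ Finset.range n, ∑ r ∈ Finset.range s, (f (r + 1) (s + 1) - f r s) =
      ∑ r ∈ Finset.range n, f r n - ∑ s ∈ Finset.range n, f 0 (s + 1) := by
  induction n with
  | zero => simp
  | succ n ih =>
    rw [Finset.sum_range_succ, ih, Finset.sum_sub_distrib, Finset.sum_range_succ',
      Finset.sum_range_succ (fun s => f 0 (s + 1))]
    abel

/-- The differences telescope in `s` for each fixed `r`. This computes the action of `α - 1` on the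
second factor of `∑ α ^ r ⊗ α ^ s`. -/
theorem sum_triangle_vertical {M : Type*} [AddCommGroup M] (f : ℕ → ℕ → M) (n : ℕ) :
    ∑ s ∈ Finset.range n, ∑ r ∈ Finset.range s, (f r (s + 1) - f r s) =
      ∑ r ∈ Finset.range n, f r n - ∑ r ∈ Finset.range n, f r (r + 1) := by
  induction n with
  | zero => simp
  | succ n ih =>
    rw [Finset.sum_range_succ, ih, Finset.sum_sub_distrib, Finset.sum_range_succ,
      Finset.sum_range_succ (fun r => f r (r + 1))]
    abel

/-- That the coproduct commutes with `d` is checked separately in each bidegree `(a, b)`. For `a +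
b` even the differential of `e_{a+b+1}` is given by `α - 1`, which acts diagonally on the right-hand
side. -/
theorem cyclicCoprodTerm_d_of_even {a b : ℕ} (h : Even (a + b)) :
    TensorProduct.map (cyclicResolution p).d LinearMap.id (cyclicCoprodTerm p (a + 1) b) +
      TensorProduct.map (cyclicResolution p).sgn (cyclicResolution p).d
        (cyclicCoprodTerm p a (b + 1)) =
      TensorProduct.map (cyclicAct p (cyclicGen p)) (cyclicAct p (cyclicGen p))
        (cyclicCoprodTerm p a b) - cyclicCoprodTerm p a b := by
  by_cases ha : Even a
  · have hb : Even b := (Nat.even_add.1 h).1 ha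
    have ha' : ¬ Even (a + 1) := by simpa [Nat.even_add_one] using ha
    rw [cyclicCoprodTerm_of_odd_of_even p ha' hb, cyclicCoprodTerm_of_even p ha,
      cyclicCoprodTerm_of_even p ha, TensorProduct.map_tmul, TensorProduct.map_tmul,
      TensorProduct.map_tmul, cyclic_d_of_even p ha, cyclic_d_of_even p hb, cyclic_sgn, if_pos ha,
      one_smul, cyclicAct_basis, cyclicAct_basis, mul_one, one_mul, LinearMap.id_apply,
      TensorProduct.sub_tmul, TensorProduct.tmul_sub]
    abel
  · have hb : ¬ Even b := fun hb => ha ((Nat.even_add.1 h).2 hb)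
    have ha' : Even (a + 1) := by simpa [Nat.even_add_one] using ha
    have hb' : Even (b + 1) := by simpa [Nat.even_add_one] using hb
    rw [cyclicCoprodTerm_of_even p ha', cyclicCoprodTerm_of_odd_of_even p ha hb',
      cyclicCoprodTerm_of_odd_of_odd p ha hb, TensorProduct.map_tmul, TensorProduct.map_tmul,
      cyclic_d_of_odd p ha, cyclic_d_of_odd p hb, cyclic_sgn, if_neg ha, LinearMap.id_apply,
      neg_one_smul, TensorProduct.neg_tmul, ← sub_eq_add_neg]
    have := sum_triangle_diagonal (fun r s => cyclicBasis p a (cyclicGen p ^ r) ⊗ₜ[ZMod p]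
      cyclicBasis p b (cyclicGen p ^ s)) p
    -- Since `α ^ p = 1`, the edge `s = p` of the triangle gives the norm in the first factor; the
    -- edge `r = 0` gives it in the second.
    simp only [cyclicGen_pow, pow_zero] at this
    rw [TensorProduct.sum_tmul, TensorProduct.tmul_sum]
    simp only [← pow_succ', one_mul]
    rw [← this, map_sum]
    refine Eq.trans ?_ (Finset.sum_sub_distrib _ _)
    refine Finset.sum_congr rfl fun s _ => ?_
    rw [map_sum]
    refine Eq.trans ?_ (Finset.sum_sub_distrib _ _)
    refine Finset.sum_congr rfl fun r _ => ?_
    rw [cyclicAct_tmul, ← pow_succ', ← pow_succ']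

/-- The same check for `a + b` odd, where the differential of `e_{a+b+1}` is given by the norm,
acting diagonally. -/
theorem cyclicCoprodTerm_d_of_odd {a b : ℕ} (h : ¬ Even (a + b)) :
    TensorProduct.map (cyclicResolution p).d LinearMap.id (cyclicCoprodTerm p (a + 1) b) +
      TensorProduct.map (cyclicResolution p).sgn (cyclicResolution p).d
        (cyclicCoprodTerm p a (b + 1)) =
      ∑ k ∈ Finset.range p, TensorProduct.map (cyclicAct p (cyclicGen p ^ k))
        (cyclicAct p (cyclicGen p ^ k)) (cyclicCoprodTerm p a b) := by
  rw [Nat.even_add] at h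
  by_cases ha : Even a
  · have hb : ¬ Even b := fun hb => h ⟨fun _ => hb, fun _ => ha⟩
    have ha' : ¬ Even (a + 1) := by simpa [Nat.even_add_one] using ha
    rw [cyclicCoprodTerm_of_odd_of_odd p ha' hb, cyclicCoprodTerm_of_even p ha,
      cyclicCoprodTerm_of_even p ha, TensorProduct.map_tmul, cyclic_d_of_odd p hb, cyclic_sgn,
      if_pos ha, one_smul]
    rw [TensorProduct.tmul_sum, map_sum, ← Finset.sum_add_distrib]
    refine Finset.sum_congr rfl fun s _ => ?_
    -- For fixed `s` the sum over `r < s` telescopes to `(α ^ s - 1) e_a ⊗ α ^ s e_b`; the part with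
    -- `-1` cancels the `s`-th term of `e_a ⊗ d e_{b+1}`.
    have e : ∀ r ∈ Finset.range s, TensorProduct.map (cyclicResolution p).d LinearMap.id
        (cyclicBasis p (a + 1) (cyclicGen p ^ r) ⊗ₜ cyclicBasis p b (cyclicGen p ^ s)) =
        cyclicBasis p a (cyclicGen p ^ (r + 1)) ⊗ₜ cyclicBasis p b (cyclicGen p ^ s) -
        cyclicBasis p a (cyclicGen p ^ r) ⊗ₜ cyclicBasis p b (cyclicGen p ^ s) := fun r _ => by
      rw [TensorProduct.map_tmul, cyclic_d_of_even p ha, LinearMap.id_apply,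
        TensorProduct.sub_tmul, pow_succ]
    rw [map_sum, Finset.sum_congr rfl e,
      Finset.sum_range_sub (fun r => cyclicBasis p a (cyclicGen p ^ r) ⊗ₜ[ZMod p]
        cyclicBasis p b (cyclicGen p ^ s)) s, pow_zero, one_mul, sub_add_cancel, cyclicAct_tmul,
      mul_one]
  · have hb : Even b := by
      by_contra hb
      exact h ⟨fun h => absurd h ha, fun h => absurd h hb⟩
    have ha' : Even (a + 1) := by simpa [Nat.even_add_one] using ha
    have hb' : ¬ Even (b + 1) := by simpa [Nat.even_add_one] using hb
    rw [cyclicCoprodTerm_of_even p ha', cyclicCoprodTerm_of_odd_of_odd p ha hb',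
      cyclicCoprodTerm_of_odd_of_even p ha hb, TensorProduct.map_tmul, cyclic_d_of_odd p ha]
    -- With the sign of the odd degree `a`, the edge `s = p`, where `α ^ p = 1`, cancels `d e_{a+1}
    -- ⊗ e_b`. What is left is the lower edge, the sum of the `α ^ r e_a ⊗ α ^ (r + 1) e_b`.
    have := sum_triangle_vertical (fun r s => cyclicBasis p a (cyclicGen p ^ r) ⊗ₜ[ZMod p]
      cyclicBasis p b (cyclicGen p ^ s)) p
    simp only [cyclicGen_pow] at this
    have e : ∀ s ∈ Finset.range p, TensorProduct.map (cyclicResolution p).sgn (cyclicResolution p).d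
        (∑ r ∈ Finset.range s, cyclicBasis p a (cyclicGen p ^ r) ⊗ₜ
          cyclicBasis p (b + 1) (cyclicGen p ^ s)) =
        -∑ r ∈ Finset.range s, (cyclicBasis p a (cyclicGen p ^ r) ⊗ₜ
            cyclicBasis p b (cyclicGen p ^ (s + 1)) -
          cyclicBasis p a (cyclicGen p ^ r) ⊗ₜ cyclicBasis p b (cyclicGen p ^ s)) := fun s _ => by
      rw [map_sum, ← Finset.sum_neg_distrib]
      refine Finset.sum_congr rfl fun r _ => ?_
      rw [TensorProduct.map_tmul, cyclic_d_of_even p hb, cyclic_sgn, if_neg ha, neg_one_smul,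
        TensorProduct.neg_tmul, TensorProduct.tmul_sub, pow_succ]
    have e' : ∀ k ∈ Finset.range p, TensorProduct.map (cyclicAct p (cyclicGen p ^ k))
        (cyclicAct p (cyclicGen p ^ k)) (cyclicBasis p a 1 ⊗ₜ cyclicBasis p b (cyclicGen p)) =
        cyclicBasis p a (cyclicGen p ^ k) ⊗ₜ cyclicBasis p b (cyclicGen p ^ (k + 1)) :=
      fun k _ => by rw [cyclicAct_tmul, mul_one, pow_succ]
    rw [map_sum, Finset.sum_congr rfl e, Finset.sum_congr rfl e', Finset.sum_neg_distrib, this,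
      LinearMap.id_apply, TensorProduct.sum_tmul]
    simp only [one_mul]
    abel

theorem isMor_cyclicCoprod : IsMor (cyclicResolution p)
    (GrComplex.tensor (cyclicResolution p) (cyclicResolution p)) (cyclicCoprod p) := by
  have hact : ∀ τ, IsMor (GrComplex.tensor (cyclicResolution p) (cyclicResolution p))
      (GrComplex.tensor (cyclicResolution p) (cyclicResolution p))
      (TensorProduct.map (cyclicAct p τ) (cyclicAct p τ)) := fun τ =>
    (isMor_cyclicAct p τ).tensor (isMor_cyclicAct p τ)
  refine ⟨fun n x hx => ?_, fun x => ?_⟩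
  · have : (cyclicResolution p).gr n ≤ ((GrComplex.tensor (cyclicResolution p)
        (cyclicResolution p)).gr n).comap (cyclicCoprod p) := by
      refine cyclic_gr_le p fun m τ hm => ?_
      rw [Submodule.mem_comap, cyclicCoprod_basis, hm]
      refine (hact _).1 _ _ (Submodule.sum_mem _ fun ij hij => ?_)
      rw [← Finset.HasAntidiagonal.mem_antidiagonal.1 hij]
      exact cyclicCoprodTerm_mem p _ _
    exact this hx
  · have key : ∀ n, cyclicCoprod p ((cyclicResolution p).d (cyclicBasis p n 1)) =
        (GrComplex.tensor (cyclicResolution p) (cyclicResolution p)).d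
          (cyclicCoprod p (cyclicBasis p n 1)) := by
      intro n
      rw [cyclicCoprod_basis_one]
      cases n with
      | zero =>
        rw [cyclic_d_zero, map_zero]
        rw [Finset.Nat.antidiagonal_zero, Finset.sum_singleton,
          cyclicCoprodTerm_of_even p (a := 0) (by simp),
          tensor_d_tmul (K := cyclicResolution p) (L := cyclicResolution p), cyclic_d_zero,
          TensorProduct.zero_tmul, TensorProduct.tmul_zero, add_zero]
      | succ n =>
        have e : (GrComplex.tensor (cyclicResolution p) (cyclicResolution p)).d
            (∑ ij ∈ Finset.HasAntidiagonal.antidiagonal (n + 1), cyclicCoprodTerm p ij.1 ij.2) =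
            ∑ ij ∈ Finset.HasAntidiagonal.antidiagonal n,
              (TensorProduct.map (cyclicResolution p).d LinearMap.id
                (cyclicCoprodTerm p (ij.1 + 1) ij.2) +
              TensorProduct.map (cyclicResolution p).sgn (cyclicResolution p).d
                (cyclicCoprodTerm p ij.1 (ij.2 + 1))) := by
          rw [Finset.sum_add_distrib]
          refine (LinearMap.add_apply _ _ _).trans ?_
          rw [map_sum, map_sum, Finset.Nat.sum_antidiagonal_succ, Finset.Nat.sum_antidiagonal_succ']
          have h1 : TensorProduct.map (cyclicResolution p).d LinearMap.id
              (cyclicCoprodTerm p 0 (n + 1)) = 0 := by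
            rw [cyclicCoprodTerm_of_even p (a := 0) (by simp), TensorProduct.map_tmul,
              cyclic_d_zero, TensorProduct.zero_tmul]
          have h2 : TensorProduct.map (cyclicResolution p).sgn (cyclicResolution p).d
              (cyclicCoprodTerm p (n + 1) 0) = 0 := by
            by_cases hn : Even (n + 1)
            · rw [cyclicCoprodTerm_of_even p hn, TensorProduct.map_tmul,
                cyclic_d_zero, TensorProduct.tmul_zero]
            · rw [cyclicCoprodTerm_of_odd_of_even p hn (by simp), TensorProduct.map_tmul,
                cyclic_d_zero, TensorProduct.tmul_zero]
          rw [h1, h2, zero_add, zero_add]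
        rw [e]
        by_cases hn : Even n
        · rw [cyclic_d_of_even p hn, map_sub, cyclicCoprod_basis_one, one_mul, cyclicCoprod_basis,
            map_sum, ← Finset.sum_sub_distrib]
          refine Finset.sum_congr rfl fun ij hij => (cyclicCoprodTerm_d_of_even p ?_).symm
          rwa [Finset.HasAntidiagonal.mem_antidiagonal.1 hij]
        · rw [cyclic_d_of_odd p hn, map_sum]
          have e' : ∀ k ∈ Finset.range p,
              cyclicCoprod p (cyclicBasis p n (1 * cyclicGen p ^ k)) =
              ∑ ij ∈ Finset.HasAntidiagonal.antidiagonal n,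
                TensorProduct.map (cyclicAct p (cyclicGen p ^ k)) (cyclicAct p (cyclicGen p ^ k))
                  (cyclicCoprodTerm p ij.1 ij.2) := fun k _ => by
            rw [one_mul, cyclicCoprod_basis, map_sum]
          rw [Finset.sum_congr rfl e', Finset.sum_comm]
          refine Finset.sum_congr rfl fun ij hij => (cyclicCoprodTerm_d_of_odd p ?_).symm
          rwa [Finset.HasAntidiagonal.mem_antidiagonal.1 hij]
    have : cyclicCoprod p ∘ₗ (cyclicResolution p).d =
        (GrComplex.tensor (cyclicResolution p) (cyclicResolution p)).d ∘ₗ cyclicCoprod p :=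
      cyclic_hom_ext p fun n τ => by
        have hτ : cyclicBasis p n τ = cyclicAct p τ (cyclicBasis p n 1) := by
          rw [cyclicAct_basis, mul_one]
        rw [LinearMap.comp_apply, LinearMap.comp_apply, hτ, ← (isMor_cyclicAct p τ).2,
          cyclicCoprod_act, cyclicCoprod_act, key, (hact τ).2]
    exact LinearMap.congr_fun this x

/-- Only the component of the coproduct in `W_n ⊗ W_0` survives the augmentation. This identity is
what makes the constructed `Φ` the identity on `W ⊗ C₀`. -/
theorem cyclicCoprod_counit (x : cyclicResolution p) :
    TensorProduct.rid (ZMod p) (cyclicResolution p)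
      (TensorProduct.map LinearMap.id (cyclicAug p) (cyclicCoprod p x)) = x := by
  have key : ∀ n, TensorProduct.rid (ZMod p) (cyclicResolution p)
      (TensorProduct.map LinearMap.id (cyclicAug p) (cyclicCoprod p (cyclicBasis p n 1))) =
        cyclicBasis p n 1 := by
    intro n
    rw [cyclicCoprod_basis_one, map_sum, map_sum]
    rw [Finset.sum_eq_single_of_mem (n, 0) (by simp)]
    · by_cases hn : Even n
      · rw [cyclicCoprodTerm_of_even p hn, TensorProduct.map_tmul, cyclicAug_basis, if_pos rfl,
          TensorProduct.rid_tmul, one_smul, LinearMap.id_apply]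
      · rw [cyclicCoprodTerm_of_odd_of_even p hn (by simp), TensorProduct.map_tmul,
          cyclicAug_basis, if_pos rfl, TensorProduct.rid_tmul, one_smul, LinearMap.id_apply]
    · rintro ⟨i, j⟩ hij hne
      have hj : j ≠ 0 := by
        rintro rfl
        rw [Finset.HasAntidiagonal.mem_antidiagonal] at hij
        exact hne (by rw [← hij]; rfl)
      have h0 : ∀ σ τ, TensorProduct.map LinearMap.id (cyclicAug p)
          (cyclicBasis p i σ ⊗ₜ cyclicBasis p j τ) = 0 := fun σ τ => by
        rw [TensorProduct.map_tmul, cyclicAug_basis, if_neg hj, TensorProduct.tmul_zero]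
      have h1 : TensorProduct.map LinearMap.id (cyclicAug p) (cyclicCoprodTerm p i j) = 0 := by
        rw [cyclicCoprodTerm]
        split_ifs
        · exact h0 _ _
        · exact h0 _ _
        · rw [map_sum]
          refine Finset.sum_eq_zero fun s _ => ?_
          rw [map_sum]
          exact Finset.sum_eq_zero fun r _ => h0 _ _
      rw [h1, map_zero]
  have hact : ∀ (τ : cyclicSubgroup p) (z : cyclicResolution p ⊗[ZMod p] cyclicResolution p),
      TensorProduct.rid (ZMod p) (cyclicResolution p) (TensorProduct.map LinearMap.id (cyclicAug p)
        (TensorProduct.map (cyclicAct p τ) (cyclicAct p τ) z)) =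
      cyclicAct p τ (TensorProduct.rid (ZMod p) (cyclicResolution p)
        (TensorProduct.map LinearMap.id (cyclicAug p) z)) := by
    intro τ z
    induction z using TensorProduct.induction_on with
    | zero => simp only [map_zero]
    | add y z hy hz => simp only [map_add, hy, hz]
    | tmul y z =>
      rw [TensorProduct.map_tmul, TensorProduct.map_tmul, TensorProduct.map_tmul,
        cyclicAug_act, TensorProduct.rid_tmul, TensorProduct.rid_tmul, map_smul,
        LinearMap.id_apply, LinearMap.id_apply]
  have : (TensorProduct.rid (ZMod p) (cyclicResolution p)).toLinearMap ∘ₗ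
      TensorProduct.map LinearMap.id (cyclicAug p) ∘ₗ cyclicCoprod p = LinearMap.id :=
    cyclic_hom_ext p fun n τ => by
      have hτ : cyclicBasis p n τ = cyclicAct p τ (cyclicBasis p n 1) := by
        rw [cyclicAct_basis, mul_one]
      rw [LinearMap.comp_apply, LinearMap.comp_apply, LinearEquiv.coe_coe, hτ, cyclicCoprod_act,
        hact, key]
      rfl
  exact LinearMap.congr_fun this x

theorem augTensor_cyclicCoprod (x : cyclicResolution p) :
    augTensor (cyclicAug p) (cyclicAug p) (cyclicCoprod p x) = cyclicAug p x := by
  conv_rhs => rw [← cyclicCoprod_counit p x]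
  generalize cyclicCoprod p x = z
  induction z using TensorProduct.induction_on with
  | zero => simp only [map_zero]
  | add y z hy hz => simp only [map_add, hy, hz]
  | tmul y z =>
    rw [augTensor_tmul, TensorProduct.map_tmul, TensorProduct.rid_tmul, map_smul, smul_eq_mul,
      mul_comm]
    rfl

end Cyclic

end

/-! ### Pairings of complexes of cochains with functorial complexes -/

section

open GrComplex

theorem two_eq_zero_mod_two : (2 : ZMod 2) = 0 := rfl

namespace GrComplex

variable {R : Type} [CommRing R]

theorem map_koszul {K : GrComplex.{v} R} {K' : GrComplex.{a} R} {L : GrComplex.{w} R}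
    {L' : GrComplex.{b} R} {g : K →ₗ[R] K'} {h : L →ₗ[R] L'}
    (hg : ∀ n, ∀ x ∈ K.gr n, g x ∈ K'.gr n) (hh : ∀ n, ∀ x ∈ L.gr n, h x ∈ L'.gr n)
    (z : K ⊗[R] L) :
    TensorProduct.map g h (koszul K L z) = koszul K' L' (TensorProduct.map g h z) := by
  have : TensorProduct.map g h ∘ₗ koszul K L = koszul K' L' ∘ₗ TensorProduct.map g h :=
    tensor_hom_ext fun m n x hx y hy => by
      rw [LinearMap.comp_apply, LinearMap.comp_apply, koszul_eq hx hy, map_smul,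
        TensorProduct.map_tmul, koszul_eq (hg m x hx) (hh n y hy)]
  exact LinearMap.congr_fun this z

end GrComplex

namespace OrbitTriple

variable {p : ℕ} {G : Type a} [Group G] (X : OrbitTriple.{u, a, b, c} p G)

/-- A simplicial map and an algebra map which are compatible with all cochains. -/
def Compatible {H K : (OrbitCat G)ᵒᵖ} (t : X.T.obj H ⟶ X.T.obj K)
    (m : X.M.obj H →ₐ[ZMod p] X.M.obj K) : Prop :=
  ∀ (f : X.cochains) x, X.evalAt K f (SSet.chainsMap (ZMod p) t x) = m (X.evalAt H f x)

/-- A natural pairing of the complexes `T(X_H)` with a complex `Q`, with values in the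
coefficients. -/
structure Pairing (T : ChainFunctor.{u} (ZMod p)) (Q : GrComplex.{w} (ZMod p)) where
  ev : ∀ H : (OrbitCat G)ᵒᵖ, Q →ₗ[ZMod p] T.obj (X.T.obj H) →ₗ[ZMod p] X.M.obj H
  natural : ∀ {H K : (OrbitCat G)ᵒᵖ} {t : X.T.obj H ⟶ X.T.obj K}
    {m : X.M.obj H →ₐ[ZMod p] X.M.obj K}, X.Compatible t m →
    ∀ q y, ev K q (T.map t y) = m (ev H q y)
  ev_of_ne : ∀ (H : (OrbitCat G)ᵒᵖ) {k l : ℤ} {q : Q} {y : T.obj (X.T.obj H)}, q ∈ Q.gr k →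
    y ∈ (T.obj (X.T.obj H)).gr l → l ≠ -k → ev H q y = 0
  ev_d : ∀ (H : (OrbitCat G)ᵒᵖ) q y,
    ev H (Q.d q) y = ev H q ((T.obj (X.T.obj H)).d ((T.obj (X.T.obj H)).sgn y))

namespace Pairing

/-- The evaluation of cochains on chains. -/
abbrev chains : X.Pairing (ChainFunctor.chains (ZMod p)) X.cochains where
  ev := X.evalAt
  natural h := h
  ev_of_ne H _ l _ y hq hy hl := hq H l hl y hy
  ev_d _ _ _ := rfl

variable {X} {S T : ChainFunctor.{u} (ZMod p)} {P : GrComplex.{v} (ZMod p)}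
  {Q : GrComplex.{w} (ZMod p)} (A : X.Pairing S P) (B : X.Pairing T Q)

/-- Signs depend on parities only. With this form of the vanishing, a sign identity needs proof only
when the degrees of cochains and chains agree modulo `2`; otherwise both sides are zero. -/
theorem ev_eq_zero {H : (OrbitCat G)ᵒᵖ} {k l : ℤ} {q : Q} {y : T.obj (X.T.obj H)} (hq : q ∈ Q.gr k)
    (hy : y ∈ (T.obj (X.T.obj H)).gr l) (hl : (l : ZMod 2) ≠ k) : B.ev H q y = 0 := by
  refine B.ev_of_ne H hq hy fun h => hl ?_
  rw [h, Int.cast_neg, CharTwo.neg_eq]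

theorem ev_d_mem {H : (OrbitCat G)ᵒᵖ} {l : ℤ} (q : Q) {y : T.obj (X.T.obj H)}
    (hy : y ∈ (T.obj (X.T.obj H)).gr l) :
    B.ev H (Q.d q) y = sg (ZMod p) (l : ZMod 2) • B.ev H q ((T.obj (X.T.obj H)).d y) := by
  rw [B.ev_d, sgn_eq _ hy, map_smul, map_smul]

/-- The evaluation of `f ⊗ g` on `x ⊗ y`. -/
def tensorEv (H : (OrbitCat G)ᵒᵖ) : P ⊗[ZMod p] Q →ₗ[ZMod p]
    S.obj (X.T.obj H) ⊗[ZMod p] T.obj (X.T.obj H) →ₗ[ZMod p] X.M.obj H :=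
  LinearMap.compr₂ (TensorProduct.homTensorHomMap (RingHom.id (ZMod p)) _ _ _ _ ∘ₗ
      TensorProduct.map (A.ev H) (B.ev H)) (LinearMap.mul' (ZMod p) (X.M.obj H)) |>.compl₂
    (koszul (S.obj (X.T.obj H)) (T.obj (X.T.obj H)))

theorem tensorEv_apply (H : (OrbitCat G)ᵒᵖ) (f : P) (g : Q)
    (z : S.obj (X.T.obj H) ⊗[ZMod p] T.obj (X.T.obj H)) :
    A.tensorEv B H (f ⊗ₜ g) z = LinearMap.mul' (ZMod p) (X.M.obj H)
      (TensorProduct.map (A.ev H f) (B.ev H g) (koszul _ _ z)) := rfl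

theorem tensorEv_tmul (H : (OrbitCat G)ᵒᵖ) (f : P) (g : Q) {m n : ℤ} {x : S.obj (X.T.obj H)}
    {y : T.obj (X.T.obj H)} (hx : x ∈ (S.obj (X.T.obj H)).gr m)
    (hy : y ∈ (T.obj (X.T.obj H)).gr n) :
    A.tensorEv B H (f ⊗ₜ g) (x ⊗ₜ y) =
      sg (ZMod p) ((m : ZMod 2) * (n : ZMod 2)) • (A.ev H f x * B.ev H g y) := by
  rw [tensorEv_apply, koszul_eq hx hy, map_smul, map_smul, TensorProduct.map_tmul,
    LinearMap.mul'_apply]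

/-- The tensor product of two pairings. -/
@[simps]
abbrev tensor : X.Pairing (S.tensor T) (GrComplex.tensor P Q) where
  ev := A.tensorEv B
  natural {H K t m} h q y := by
    have : (A.tensorEv B K).compl₂ (TensorProduct.map (S.map t) (T.map t)) =
        (A.tensorEv B H).compr₂ m.toLinearMap := by
      refine tensor_hom_ext fun i j f _ g _ => tensor_hom_ext fun k l x hx y hy => ?_
      rw [LinearMap.compl₂_apply, LinearMap.compr₂_apply, TensorProduct.map_tmul,
        A.tensorEv_tmul B K f g ((S.mor t).1 _ _ hx) ((T.mor t).1 _ _ hy),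
        A.tensorEv_tmul B H f g hx hy, A.natural h, B.natural h, AlgHom.toLinearMap_apply,
        map_smul, map_mul]
    exact LinearMap.congr_fun (LinearMap.congr_fun this q) y
  ev_of_ne H k l q y hq hy hkl := by
    have : tensorGr P Q k ≤ LinearMap.ker ((A.tensorEv B H).domRestrict₂
        (tensorGr (S.obj (X.T.obj H)) (T.obj (X.T.obj H)) l)) := by
      refine Submodule.span_le.2 ?_
      rintro _ ⟨i, j, rfl, f, hf, g, hg, rfl⟩
      refine LinearMap.ext fun y => ?_
      have : tensorGr (S.obj (X.T.obj H)) (T.obj (X.T.obj H)) l ≤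
          LinearMap.ker (A.tensorEv B H (f ⊗ₜ g)) := by
        refine Submodule.span_le.2 ?_
        rintro _ ⟨i', j', rfl, x, hx, y, hy, rfl⟩
        refine (A.tensorEv_tmul B H f g hx hy).trans ?_
        by_cases h : i' = -i
        · rw [B.ev_of_ne H hg hy (by omega), mul_zero, smul_zero]
        · rw [A.ev_of_ne H hf hx h, zero_mul, smul_zero]
      exact this y.2
    exact LinearMap.congr_fun (this hq) ⟨y, hy⟩
  ev_d H q y := by
    have : A.tensorEv B H ∘ₗ (GrComplex.tensor P Q).d = (A.tensorEv B H).compl₂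
        ((GrComplex.tensor (S.obj (X.T.obj H)) (T.obj (X.T.obj H))).d ∘ₗ
          (GrComplex.tensor (S.obj (X.T.obj H)) (T.obj (X.T.obj H))).sgn) := by
      refine tensor_hom_ext fun i j f hf g hg => tensor_hom_ext fun k l x hx y hy => ?_
      rw [LinearMap.comp_apply, LinearMap.compl₂_apply, LinearMap.comp_apply,
        tensor_d_tmul (K := P) (L := Q),
        sgn_eq (GrComplex.tensor (S.obj (X.T.obj H)) (T.obj (X.T.obj H))) (tmul_mem hx hy),
        map_smul, map_smul,
        tensor_d_tmul (K := S.obj (X.T.obj H)) (L := T.obj (X.T.obj H)), map_add, map_add,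
        LinearMap.add_apply, sgn_eq P hf, sgn_eq _ hx, ← TensorProduct.smul_tmul',
        ← TensorProduct.smul_tmul', map_smul, map_smul, LinearMap.smul_apply,
        A.tensorEv_tmul B H _ _ hx hy, A.tensorEv_tmul B H _ _ hx hy,
        A.tensorEv_tmul B H _ _ ((S.obj (X.T.obj H)).d_mem _ _ hx) hy,
        A.tensorEv_tmul B H _ _ hx ((T.obj (X.T.obj H)).d_mem _ _ hy),
        A.ev_d_mem f hx, B.ev_d_mem g hy, smul_add]
      congr 1
      · rw [smul_mul_assoc, smul_smul, smul_smul, ← sg_add, ← sg_add]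
        congr 2
        push_cast
        linear_combination (-(l : ZMod 2)) * two_eq_zero_mod_two
      · rw [mul_smul_comm, smul_smul, smul_smul, smul_smul, smul_smul, ← sg_add, ← sg_add,
          ← sg_add, ← sg_add]
        -- Here `f` is not differentiated, so it must match `x` in parity; the sign `(-1) ^ deg f`
        -- on the left then equals `(-1) ^ deg x` on the right.
        by_cases h : (k : ZMod 2) = i
        · congr 2
          push_cast
          rw [h]
          linear_combination (-(i : ZMod 2)) * two_eq_zero_mod_two
        · rw [A.ev_eq_zero hf hx h, zero_mul, smul_zero, smul_zero]
    exact LinearMap.congr_fun (LinearMap.congr_fun this q) y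

section Pow

variable (n : ℕ)

/-- The evaluation of `f₁ ⊗ ⋯ ⊗ f_n` on `x₁ ⊗ ⋯ ⊗ x_n`. -/
def powEv (H : (OrbitCat G)ᵒᵖ) :
    power Q n →ₗ[ZMod p] power (T.obj (X.T.obj H)) n →ₗ[ZMod p] X.M.obj H :=
  LinearMap.compr₂ (PiTensorProduct.piTensorHomMap ∘ₗ PiTensorProduct.map fun _ => B.ev H)
    (PiTensorProduct.lift (MultilinearMap.mkPiAlgebra (ZMod p) (Fin n) (X.M.obj H))) |>.compl₂
    (evalSign fun _ => T.obj (X.T.obj H))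

variable {n}

theorem powEv_tprod (H : (OrbitCat G)ᵒᵖ) (f : Fin n → Q) {l : Fin n → ℤ}
    {x : Fin n → T.obj (X.T.obj H)} (hx : ∀ i, x i ∈ (T.obj (X.T.obj H)).gr (l i)) :
    B.powEv n H (PiTensorProduct.tprod (ZMod p) f) (PiTensorProduct.tprod (ZMod p) x) =
      sg (ZMod p) (∑ i, ∑ j, (if i < j then 1 else 0) * ((l i : ZMod 2) * (l j : ZMod 2))) •
        ∏ i, B.ev H (f i) (x i) := by
  change PiTensorProduct.lift _ (PiTensorProduct.piTensorHomMap _ (evalSign _ _)) = _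
  rw [evalSign_eq (K := fun _ => T.obj (X.T.obj H)) hx, map_smul, map_smul,
    PiTensorProduct.map_tprod, PiTensorProduct.piTensorHomMap_tprod_tprod,
    PiTensorProduct.lift.tprod, MultilinearMap.mkPiAlgebra_apply]

theorem powEv_eq_zero {H : (OrbitCat G)ᵒᵖ} {f : Fin n → Q} {k : Fin n → ℤ}
    (hf : ∀ i, f i ∈ Q.gr (k i)) {l : Fin n → ℤ} {x : Fin n → T.obj (X.T.obj H)}
    (hx : ∀ i, x i ∈ (T.obj (X.T.obj H)).gr (l i)) {i : Fin n} (hi : (l i : ZMod 2) ≠ k i) :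
    B.powEv n H (PiTensorProduct.tprod (ZMod p) f) (PiTensorProduct.tprod (ZMod p) x) = 0 := by
  rw [B.powEv_tprod H f hx, Finset.prod_eq_zero (Finset.mem_univ i)
    (B.ev_eq_zero (hf i) (hx i) hi), smul_zero]

variable (n)

/-- The tensor powers of a pairing. -/
@[simps]
abbrev pow : X.Pairing (T.pow n) (power Q n) where
  ev := B.powEv n
  natural {H K t m} h q y := by
    have : (B.powEv n K).compl₂ (PiTensorProduct.map fun _ => T.map t) =
        (B.powEv n H).compr₂ m.toLinearMap := by
      refine pi_hom_ext (K := fun _ => Q) fun k f _ =>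
        pi_hom_ext (K := fun _ => T.obj (X.T.obj H)) fun l x hx => ?_
      rw [LinearMap.compl₂_apply, LinearMap.compr₂_apply, PiTensorProduct.map_tprod,
        B.powEv_tprod K f fun i => (T.mor t).1 _ _ (hx i), B.powEv_tprod H f hx,
        AlgHom.toLinearMap_apply, map_smul, map_prod]
      congr 1
      exact Finset.prod_congr rfl fun i _ => B.natural h _ _
    exact LinearMap.congr_fun (LinearMap.congr_fun this q) y
  ev_of_ne H k l q y hq hy hkl := by
    have : piGr (fun _ : Fin n => Q) k ≤ LinearMap.ker ((B.powEv n H).domRestrict₂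
        (piGr (fun _ : Fin n => T.obj (X.T.obj H)) l)) := by
      refine Submodule.span_le.2 ?_
      rintro _ ⟨i, rfl, f, hf, rfl⟩
      refine LinearMap.ext fun y => ?_
      have : piGr (fun _ : Fin n => T.obj (X.T.obj H)) l ≤
          LinearMap.ker (B.powEv n H (PiTensorProduct.tprod (ZMod p) f)) := by
        refine Submodule.span_le.2 ?_
        rintro _ ⟨j, rfl, x, hx, rfl⟩
        refine (B.powEv_tprod H f hx).trans ?_
        obtain ⟨s, hs⟩ : ∃ s, j s ≠ -i s := by
          by_contra! hc
          exact hkl (by rw [← Finset.sum_neg_distrib]; exact Finset.sum_congr rfl fun s _ => hc s)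
        rw [Finset.prod_eq_zero (Finset.mem_univ s) (B.ev_of_ne H (hf s) (hx s) hs), smul_zero]
      exact this y.2
    exact LinearMap.congr_fun (this hq) ⟨y, hy⟩
  ev_d H q y := by
    have : B.powEv n H ∘ₗ (power Q n).d = (B.powEv n H).compl₂
        ((power (T.obj (X.T.obj H)) n).d ∘ₗ (power (T.obj (X.T.obj H)) n).sgn) := by
      refine pi_hom_ext (K := fun _ => Q) fun k f hf =>
        pi_hom_ext (K := fun _ => T.obj (X.T.obj H)) fun l x hx => ?_
      rw [LinearMap.comp_apply, LinearMap.compl₂_apply, LinearMap.comp_apply,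
        sgn_eq (power (T.obj (X.T.obj H)) n) (tprod_mem (K := fun _ => T.obj (X.T.obj H)) hx),
        map_smul, map_smul, piTensor_d_apply, piTensor_d_apply, map_sum, map_sum,
        LinearMap.sum_apply, Finset.smul_sum]
      refine Finset.sum_congr rfl fun s _ => ?_
      rw [piD_eq (K := fun _ => Q) hf, piD_eq (K := fun _ => T.obj (X.T.obj H)) hx, map_smul,
        map_smul, LinearMap.smul_apply, B.powEv_tprod H _ hx,
        B.powEv_tprod H f (update_mem (K := fun _ => T.obj (X.T.obj H)) hx s),
        ← Finset.mul_prod_erase _ _ (Finset.mem_univ s),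
        ← Finset.mul_prod_erase _ _ (Finset.mem_univ s), Function.update_self,
        Function.update_self, B.ev_d_mem (f s) (hx s)]
      have e1 : ∏ i ∈ Finset.univ.erase s, B.ev H (Function.update f s (Q.d (f s)) i) (x i) =
          ∏ i ∈ Finset.univ.erase s, B.ev H (f i) (x i) :=
        Finset.prod_congr rfl fun i hi => by
          rw [Function.update_of_ne (Finset.ne_of_mem_erase hi)]
      have e2 : ∏ i ∈ Finset.univ.erase s, B.ev H (f i)
            (Function.update x s ((T.obj (X.T.obj H)).d (x s)) i) =
          ∏ i ∈ Finset.univ.erase s, B.ev H (f i) (x i) :=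
        Finset.prod_congr rfl fun i hi => by
          rw [Function.update_of_ne (Finset.ne_of_mem_erase hi)]
      rw [e1, e2, smul_mul_assoc, smul_smul, smul_smul, smul_smul, smul_smul, ← sg_add, ← sg_add,
        ← sg_add, ← sg_add]
      -- In the `s`-th summand only the `s`-th factor is differentiated. The other factors must
      -- match in parity for the product not to vanish, so no condition is put on the index `s`.
      by_cases h : ∀ i ≠ s, (l i : ZMod 2) = k i
      · congr 2
        have e3 : ∀ i, (((l i + if i = s then 1 else 0 : ℤ)) : ZMod 2) =
            (l i : ZMod 2) + if i = s then 1 else 0 := fun i => by push_cast; rfl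
        simp only [e3]
        rw [sum_delta_delta _ (by simp)]
        have e4 : ∀ i, (if i < s then (1 : ZMod 2) else 0) * (k i : ZMod 2) =
            (if i < s then 1 else 0) * (l i : ZMod 2) := fun i => by
          split_ifs with hi
          · rw [h i hi.ne]
          · rw [zero_mul, zero_mul]
        simp only [e4]
        -- Differentiating `x s` changes the evaluation sign by the total degree of the other
        -- factors, which is the full total plus `l s` modulo `2`.
        have e5 : ∑ i, ((if i < s then (1 : ZMod 2) else 0) + if s < i then 1 else 0) *
            (l i : ZMod 2) = ∑ i, (l i : ZMod 2) + l s := by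
          rw [← Finset.add_sum_erase _ _ (Finset.mem_univ s),
            ← Finset.add_sum_erase Finset.univ (fun i => (l i : ZMod 2)) (Finset.mem_univ s)]
          have : ∑ i ∈ Finset.univ.erase s, ((if i < s then (1 : ZMod 2) else 0) +
              if s < i then 1 else 0) * (l i : ZMod 2) =
              ∑ i ∈ Finset.univ.erase s, (l i : ZMod 2) :=
            Finset.sum_congr rfl fun i hi => by
              rcases lt_or_gt_of_ne (Finset.ne_of_mem_erase hi) with h | h <;>
                simp [h, h.not_gt]
          rw [this]
          simp only [lt_irrefl, if_false, add_zero, zero_mul, zero_add]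
          rw [add_right_comm, CharTwo.add_self_eq_zero, zero_add]
        rw [e5]
        push_cast
        generalize ∑ i, (l i : ZMod 2) = t
        linear_combination (-t) * two_eq_zero_mod_two
      · push Not at h
        obtain ⟨i, hi, h⟩ := h
        rw [Finset.prod_eq_zero (Finset.mem_erase.2 ⟨hi, Finset.mem_univ i⟩)
          (B.ev_eq_zero (hf i) (hx i) h), mul_zero, smul_zero, smul_zero]
    exact LinearMap.congr_fun (LinearMap.congr_fun this q) y

end Pow

end Pairing

end OrbitTriple

end

section

open GrComplex

theorem sg_add_one {R : Type} [CommRing R] (x : ZMod 2) : sg R (x + 1) = -sg R x := by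
  rw [sg_add, sg_one, mul_neg_one]

theorem sg_sum {R : Type} [CommRing R] {ι : Type*} (s : Finset ι) (f : ι → ZMod 2) :
    sg R (∑ i ∈ s, f i) = ∏ i ∈ s, sg R (f i) := by
  classical
  induction s using Finset.induction_on with
  | empty => simp
  | insert i s hi ih => rw [Finset.sum_insert hi, Finset.prod_insert hi, sg_add, ih]

/-- The identity of exponents behind `powEv_tensor`. On the left are the evaluation signs of the `n`
pairs `f i ⊗ g i` together with the sign inside each pair; on the right, those of the two `n`-fold
tensors and the sign between them. -/
theorem sum_pairs_add {n : ℕ} (a b : Fin n → ZMod 2) :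
    ∑ i, ∑ j, (if i < j then 1 else 0) * ((a i + b i) * (a j + b j)) + ∑ i, a i * b i =
      (∑ i, a i) * ∑ i, b i + (∑ i, ∑ j, (if i < j then 1 else 0) * (a i * a j) +
        ∑ i, ∑ j, (if i < j then 1 else 0) * (b i * b j)) := by
  rw [sum_add_mul_add, mul_comm (∑ i, a i), Finset.sum_mul_sum]
  have e : ∑ i, ∑ j, ((if i < j then (1 : ZMod 2) else 0) + if j < i then 1 else 0) *
      (b i * a j) + ∑ i, a i * b i = ∑ i, ∑ j, b i * a j := by
    rw [← Finset.sum_add_distrib]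
    refine Finset.sum_congr rfl fun i _ => ?_
    have : a i * b i = ∑ j, if i = j then b i * a j else 0 := by
      rw [Finset.sum_ite_eq, if_pos (Finset.mem_univ i), mul_comm]
    rw [this, ← Finset.sum_add_distrib]
    refine Finset.sum_congr rfl fun j _ => ?_
    rcases lt_trichotomy i j with h | h | h
    · simp [h, h.not_gt, h.ne]
    · simp [h]
    · simp [h, h.not_gt, h.ne']
  rw [add_assoc, e, add_comm]

namespace OrbitTriple

variable {p : ℕ} {G : Type a} [Group G] {X : OrbitTriple.{u, a, b, c} p G}

namespace Pairing

variable {S T : ChainFunctor.{u} (ZMod p)} {P : GrComplex.{v} (ZMod p)}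
  {Q : GrComplex.{w} (ZMod p)}

/-! ### Operations on cochains defined by operations on chains -/

section Product

variable (B : X.Pairing T Q)

/-- The map `τ ⊗ q ↦ (x ↦ q(τ x))`. -/
def productEv : T.ops ⊗[ZMod p] Q →ₗ[ZMod p] ∀ H, X.C H →ₗ[ZMod p] X.M.obj H :=
  LinearMap.pi fun H => TensorProduct.lift
    (LinearMap.flip (LinearMap.llcomp (ZMod p) _ _ _ ∘ₗ B.ev H) ∘ₗ
      LinearMap.proj (X.T.obj H) ∘ₗ T.opSubmodule.subtype)

theorem productEv_tmul (τ : T.ops) (q : Q) (H : (OrbitCat G)ᵒᵖ) (x : X.C H) :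
    B.productEv (τ ⊗ₜ q) H x = B.ev H q (τ.1 (X.T.obj H) x) := rfl

theorem productEv_mem_of_mem {k l : ℤ} {τ : T.ops} (hτ : τ ∈ T.ops.gr k) {q : Q}
    (hq : q ∈ Q.gr l) : B.productEv (τ ⊗ₜ q) ∈ X.cochainSubmodule := by
  have nat : ∀ {H K : (OrbitCat G)ᵒᵖ} {t : X.T.obj H ⟶ X.T.obj K}
      {m : X.M.obj H →ₐ[ZMod p] X.M.obj K}, X.Compatible t m → ∀ x,
      B.productEv (τ ⊗ₜ q) K (SSet.chainsMap (ZMod p) t x) = m (B.productEv (τ ⊗ₜ q) H x) := by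
    intro H K t m h x
    rw [productEv_tmul, productEv_tmul, T.opSubmodule_natural τ.2, B.natural h]
  -- The cochain `q ∘ τ` can be nonzero only in dimension `k + l`, which the bound exceeds.
  refine ⟨fun H K g x => ?_, fun H σ x => ?_, k.natAbs + l.natAbs + 1, fun H n hn x hx => ?_⟩
  · exact nat (m := (X.M.map g).hom) (fun f => f.2.1 g) x
  · exact nat (m := (End.asHom (X.actM.act H σ)).hom) (fun f => f.2.2.1 H σ) x
  · rw [productEv_tmul]
    exact B.ev_of_ne H hq (hτ.2 _ _ x hx) (by omega)

theorem productEv_mem (z : T.ops ⊗[ZMod p] Q) : B.productEv z ∈ X.cochainSubmodule := by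
  have hz : z ∈ ⨆ n, tensorGr T.ops Q n := by rw [tensor_iSup]; trivial
  induction hz using Submodule.iSup_induction' with
  | zero => rw [map_zero]; exact Submodule.zero_mem _
  | add y z _ _ hy hz => rw [map_add]; exact Submodule.add_mem _ hy hz
  | mem n z hz =>
    have : tensorGr T.ops Q n ≤ X.cochainSubmodule.comap B.productEv := by
      refine Submodule.span_le.2 ?_
      rintro _ ⟨k, l, -, τ, hτ, q, hq, rfl⟩
      exact B.productEv_mem_of_mem hτ hq
    exact this hz

/-- The morphism `τ ⊗ q ↦ (x ↦ ± q(τ x))`, with the sign `(-1) ^ (deg τ * deg q)`. -/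
def product : GrComplex.tensor T.ops Q →ₗ[ZMod p] X.cochains :=
  LinearMap.codRestrict X.cochainSubmodule B.productEv B.productEv_mem ∘ₗ koszul T.ops Q

theorem evalAt_product {k l : ℤ} {τ : T.ops} (hτ : τ ∈ T.ops.gr k) {q : Q} (hq : q ∈ Q.gr l)
    (H : (OrbitCat G)ᵒᵖ) (x : X.C H) : X.evalAt H (B.product (τ ⊗ₜ q)) x =
      sg (ZMod p) ((k : ZMod 2) * (l : ZMod 2)) • B.ev H q (τ.1 (X.T.obj H) x) := by
  change B.productEv (koszul T.ops Q (τ ⊗ₜ q)) H x = _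
  rw [koszul_eq hτ hq, map_smul]
  rfl

/-- The bridge from chains to cochains: after tensoring with a morphism into `Q`, a homotopy between
maps into `T.ops` turns into a homotopy between maps into `C_ρ(T; M)`. -/
theorem isMor_product : IsMor (GrComplex.tensor T.ops Q) X.cochains B.product := by
  refine isMor_of_tmul (fun k l τ hτ q hq H n hn x hx => ?_) fun k l τ hτ q hq => ?_
  · refine (B.evalAt_product hτ hq H x).trans ?_
    have : B.ev H q (τ.1 (X.T.obj H) x) = 0 := B.ev_of_ne H hq (hτ.2 _ _ x hx) (by omega)
    rw [this, smul_zero]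
  · refine X.cochain_ext fun H n x hx => ?_
    have hτx : τ.1 (X.T.obj H) x ∈ (T.obj (X.T.obj H)).gr (n + k) := hτ.2 _ n x hx
    have hd := T.ops_d_apply hτ (X.T.obj H) x
    have e1 := B.evalAt_product (T.ops.d_mem _ _ hτ) hq H x
    have e2 := B.evalAt_product hτ (Q.d_mem _ _ hq) H x
    have e3 := B.evalAt_product hτ hq H ((X.C H).d ((X.C H).sgn x))
    change X.evalAt H (B.product (T.ops.d τ ⊗ₜ q)) x + sg (ZMod p) (k : ZMod 2) •
      X.evalAt H (B.product (τ ⊗ₜ Q.d q)) x =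
      X.evalAt H (B.product (τ ⊗ₜ q)) ((X.C H).d ((X.C H).sgn x))
    rw [e1, e2, e3, hd, sgn_eq _ hx, map_smul, map_smul, map_smul, B.ev_d_mem q hτx, map_sub,
      map_smul, smul_sub, smul_smul, smul_smul, smul_smul, smul_smul, ← sg_add, ← sg_add, ← sg_add,
      ← sg_add]
    have m1 := (T.obj (X.T.obj H)).d_mem _ _ hτx
    have m2 : τ.1 (X.T.obj H) ((X.C H).d x) ∈ (T.obj (X.T.obj H)).gr (n + 1 + k) :=
      hτ.2 _ _ _ ((X.C H).d_mem _ _ hx)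
    -- Both `d (τ x)` and `τ (d x)` have degree `n + k + 1`, so `q` vanishes on them unless its
    -- degree has this parity; in that case `l` can be eliminated from the signs.
    by_cases h : (l : ZMod 2) = k + n + 1
    · have s1 : (k : ZMod 2) + k * (l + 1 : ℤ) + (n + k : ℤ) = (k + 1 : ℤ) * l + 1 := by
        push_cast
        rw [h]
        linear_combination (k - 1 : ZMod 2) * two_eq_zero_mod_two
      have s2 : (k : ZMod 2) * l + n = (k + 1 : ℤ) * l + k + 1 := by
        push_cast
        rw [h]
        linear_combination (-k - 1 : ZMod 2) * two_eq_zero_mod_two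
      rw [s1, s2, sg_add_one, sg_add_one, neg_smul, neg_smul]
      abel
    · rw [B.ev_eq_zero hq m1, B.ev_eq_zero hq m2]
      · simp only [smul_zero, sub_zero, add_zero]
      · intro h'
        refine h (h'.symm.trans ?_)
        push_cast
        ring
      · intro h'
        refine h (h'.symm.trans ?_)
        push_cast
        ring

end Product

/-! ### Compatibility of the pairings with the structure maps of tensor products -/

/-- If the parities match, the signs of the two permutations cancel. The evaluation sign runs over
unordered pairs and so does not depend on the order, and the product of the values can be reordered
because the coefficients commute. -/
theorem powEv_permute (B : X.Pairing T Q) {n : ℕ} (σ : Equiv.Perm (Fin n)) (H : (OrbitCat G)ᵒᵖ)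
    (q : power Q n) (y : power (T.obj (X.T.obj H)) n) :
    B.powEv n H (permute (fun _ => Q) σ q) (permute (fun _ => T.obj (X.T.obj H)) σ y) =
      B.powEv n H q y := by
  have : (B.powEv n H ∘ₗ permute (fun _ => Q) σ).compl₂
      (permute (fun _ => T.obj (X.T.obj H)) σ) = B.powEv n H := by
    refine pi_hom_ext (K := fun _ => Q) fun k f hf =>
      pi_hom_ext (K := fun _ => T.obj (X.T.obj H)) fun l x hx => ?_
    rw [LinearMap.compl₂_apply, LinearMap.comp_apply, permute_eq (K := fun _ => Q) σ hf,
      permute_eq (K := fun _ => T.obj (X.T.obj H)) σ hx, map_smul, map_smul, LinearMap.smul_apply]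
    by_cases h : ∀ i, (l i : ZMod 2) = k i
    · rw [B.powEv_tprod H _ fun i => hx (σ.symm i), B.powEv_tprod H f hx, smul_smul, smul_smul,
        ← sg_add, ← sg_add]
      congr 1
      · simp only [h]
        rw [CharTwo.add_self_eq_zero, zero_add]
        congr 1
        rw [← Equiv.sum_comp σ]
        have e : ∀ i, ∑ j, (if σ i < j then (1 : ZMod 2) else 0) *
            ((k (σ.symm (σ i)) : ZMod 2) * (k (σ.symm j) : ZMod 2)) =
            ∑ j, (if σ i < σ j then 1 else 0) * ((k i : ZMod 2) * (k j : ZMod 2)) := fun i => by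
          rw [← Equiv.sum_comp σ]
          simp
        simp only [e]
        refine sum_symm_congr _ _ _ (fun i j hij => ?_) fun i => by simp
        have hne : σ i ≠ σ j := fun h => hij.ne (σ.injective h)
        rcases lt_or_gt_of_ne hne with h | h <;> simp [h, h.not_gt, hij, hij.not_gt]
      · exact Equiv.prod_comp σ.symm fun i => B.ev H (f i) (x i)
    · push Not at h
      obtain ⟨i, hi⟩ := h
      rw [B.powEv_eq_zero hf hx hi, B.powEv_eq_zero (fun i => hf (σ.symm i))
        (fun i => hx (σ.symm i)) (i := σ i) (by simpa using hi), smul_zero, smul_zero]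
  exact LinearMap.congr_fun (LinearMap.congr_fun this q) y

/-- If the parities match, the shuffling signs of cochains and chains are equal and cancel;
`sum_pairs_add` compares the evaluation signs. Commutativity of the coefficients separates the
values of the `f s` from those of the `g s`. -/
theorem powEv_tensor (A : X.Pairing S P) (B : X.Pairing T Q) {n : ℕ} (H : (OrbitCat G)ᵒᵖ)
    (q : power (GrComplex.tensor P Q) n)
    (y : power (GrComplex.tensor (S.obj (X.T.obj H)) (T.obj (X.T.obj H))) n) :
    (A.tensor B).powEv n H q y =
      (A.pow n).tensorEv (B.pow n) H (unshuffle P Q n q) (unshuffle _ _ n y) := by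
  have : (A.tensor B).powEv n H = (((A.pow n).tensorEv (B.pow n) H) ∘ₗ unshuffle P Q n).compl₂
      (unshuffle (S.obj (X.T.obj H)) (T.obj (X.T.obj H)) n) := by
    refine power_tensor_hom_ext fun i j f g hf hg => power_tensor_hom_ext fun k l x y hx hy => ?_
    rw [LinearMap.compl₂_apply, LinearMap.comp_apply, unshuffle_eq hf hg, unshuffle_eq hx hy,
      map_smul, map_smul, LinearMap.smul_apply]
    have e1 := (A.tensor B).powEv_tprod H (fun s => f s ⊗ₜ[ZMod p] g s)
      (fun s => tmul_mem (hx s) (hy s))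
    have e2 := (A.pow n).tensorEv_tmul (B.pow n) H (PiTensorProduct.tprod (ZMod p) f)
      (PiTensorProduct.tprod (ZMod p) g)
      (tprod_mem (K := fun _ => S.obj (X.T.obj H)) hx)
      (tprod_mem (K := fun _ => T.obj (X.T.obj H)) hy)
    have e3 : ∀ s, (A.tensor B).ev H (f s ⊗ₜ[ZMod p] g s) (x s ⊗ₜ[ZMod p] y s) =
        sg (ZMod p) ((k s : ZMod 2) * (l s : ZMod 2)) • (A.ev H (f s) (x s) * B.ev H (g s) (y s)) :=
      fun s => A.tensorEv_tmul B H (f s) (g s) (hx s) (hy s)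
    rw [e1, e2, Finset.prod_congr rfl fun s _ => e3 s, Finset.prod_smul, Finset.prod_mul_distrib,
      powEv_tprod _ _ _ hx, powEv_tprod _ _ _ hy, smul_mul_smul_comm, smul_smul, smul_smul,
      smul_smul, ← sg_add]
    by_cases h : (∀ s, (k s : ZMod 2) = i s) ∧ ∀ s, (l s : ZMod 2) = j s
    · simp only [← h.1, ← h.2]
      rw [CharTwo.add_self_eq_zero, sg_zero, one_mul, smul_smul, ← sg_sum, ← sg_add, ← sg_add,
        ← sg_add]
      congr 2
      push_cast
      exact sum_pairs_add _ _
    · have : (∏ s, A.ev H (f s) (x s)) * ∏ s, B.ev H (g s) (y s) = 0 := by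
        rw [not_and_or] at h
        push Not at h
        rcases h with ⟨s, hs⟩ | ⟨s, hs⟩
        · rw [Finset.prod_eq_zero (f := fun s => A.ev H (f s) (x s)) (Finset.mem_univ s)
            (A.ev_eq_zero (hf s) (hx s) hs), zero_mul]
        · rw [Finset.prod_eq_zero (f := fun s => B.ev H (g s) (y s)) (Finset.mem_univ s)
            (B.ev_eq_zero (hg s) (hy s) hs), mul_zero]
      rw [this, smul_zero, smul_zero, smul_zero]
  exact LinearMap.congr_fun (LinearMap.congr_fun this q) y

theorem tensorEv_assoc {S' : ChainFunctor.{u} (ZMod p)} {P' : GrComplex.{v'} (ZMod p)}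
    (A : X.Pairing S P) (B : X.Pairing T Q) (C : X.Pairing S' P') (H : (OrbitCat G)ᵒᵖ)
    (q : (P ⊗[ZMod p] Q) ⊗[ZMod p] P')
    (y : (S.obj (X.T.obj H) ⊗[ZMod p] T.obj (X.T.obj H)) ⊗[ZMod p] S'.obj (X.T.obj H)) :
    (A.tensor B).tensorEv C H q y = A.tensorEv (B.tensor C) H
      (TensorProduct.assoc (ZMod p) P Q P' q)
      (TensorProduct.assoc (ZMod p) (S.obj (X.T.obj H)) (T.obj (X.T.obj H))
        (S'.obj (X.T.obj H)) y) := by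
  have : (A.tensor B).tensorEv C H = (A.tensorEv (B.tensor C) H ∘ₗ
      (TensorProduct.assoc (ZMod p) P Q P').toLinearMap).compl₂
        (TensorProduct.assoc (ZMod p) (S.obj (X.T.obj H)) (T.obj (X.T.obj H))
          (S'.obj (X.T.obj H))).toLinearMap := by
    refine TensorProduct.ext_threefold fun f g h => ?_
    refine LinearMap.ext fun y => ?_
    refine LinearMap.congr_fun (TensorProduct.ext (tensor_hom_ext fun k l x hx y hy =>
      GrComplex.hom_ext _ fun m z hz => ?_)) y
    have e1 := (A.tensor B).tensorEv_tmul C H (f ⊗ₜ g) h (tmul_mem hx hy) hz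
    have e2 := A.tensorEv_tmul (B.tensor C) H f (g ⊗ₜ h) hx (tmul_mem hy hz)
    have e3 := A.tensorEv_tmul B H f g hx hy
    have e4 := B.tensorEv_tmul C H g h hy hz
    refine e1.trans (Eq.trans ?_ e2.symm)
    rw [tensor_ev, tensor_ev, e3, e4, smul_mul_assoc, mul_smul_comm, smul_smul, smul_smul,
      ← sg_add, ← sg_add, mul_assoc]
    congr 2
    push_cast
    ring
  exact LinearMap.congr_fun (LinearMap.congr_fun this q) y

theorem powEv_snoc (B : X.Pairing T Q) {n : ℕ} (H : (OrbitCat G)ᵒᵖ) (q : power Q n ⊗[ZMod p] Q)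
    (y : power (T.obj (X.T.obj H)) n ⊗[ZMod p] T.obj (X.T.obj H)) :
    B.powEv (n + 1) H (snocTensor Q n q) (snocTensor (T.obj (X.T.obj H)) n y) =
      (B.pow n).tensorEv B H q y := by
  have : (B.powEv (n + 1) H ∘ₗ snocTensor Q n).compl₂ (snocTensor (T.obj (X.T.obj H)) n) =
      (B.pow n).tensorEv B H := by
    refine pi_tensor_hom_ext fun i j f g _ _ => pi_tensor_hom_ext fun k l x y hx hy => ?_
    rw [LinearMap.compl₂_apply, LinearMap.comp_apply, snocTensor_tmul, snocTensor_tmul,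
      B.powEv_tprod H _ (snoc_mem hx hy),
      tensorEv_tmul _ _ _ _ _ (tprod_mem (K := fun _ => T.obj (X.T.obj H)) hx) hy, pow_ev,
      B.powEv_tprod H f hx, smul_mul_assoc, smul_smul, ← sg_add, Fin.prod_univ_castSucc]
    simp only [Fin.snoc_castSucc, Fin.snoc_last]
    congr 2
    rw [Fin.sum_univ_castSucc]
    simp [Fin.sum_univ_castSucc, Fin.castSucc_lt_castSucc_iff, Fin.castSucc_lt_last,
      (Fin.castSucc_lt_last _).not_gt, Finset.sum_add_distrib, Finset.sum_mul]
    rw [add_comm]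
  exact LinearMap.congr_fun (LinearMap.congr_fun this q) y

/-- Used with `h` the Alexander-Whitney diagonal and `g` the cup product, which are adjoint by the
definition of the latter: an identity on chains then gives one on cochains. -/
theorem powEv_adjoint {A : X.Pairing T P} {B : X.Pairing S Q} {n : ℕ} {H : (OrbitCat G)ᵒᵖ}
    {g : P →ₗ[ZMod p] Q} {h : S.obj (X.T.obj H) →ₗ[ZMod p] T.obj (X.T.obj H)}
    (hh : ∀ n, ∀ x ∈ (S.obj (X.T.obj H)).gr n, h x ∈ (T.obj (X.T.obj H)).gr n)
    (adj : ∀ q y, A.ev H q (h y) = B.ev H (g q) y) (q : power P n)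
    (y : power (S.obj (X.T.obj H)) n) :
    A.powEv n H q (PiTensorProduct.map (fun _ => h) y) =
      B.powEv n H (PiTensorProduct.map (fun _ => g) q) y := by
  have : (A.powEv n H).compl₂ (PiTensorProduct.map fun _ => h) =
      B.powEv n H ∘ₗ PiTensorProduct.map fun _ => g := by
    refine pi_hom_ext (K := fun _ => P) fun k f _ =>
      pi_hom_ext (K := fun _ => S.obj (X.T.obj H)) fun l x hx => ?_
    rw [LinearMap.compl₂_apply, LinearMap.comp_apply, PiTensorProduct.map_tprod,
      PiTensorProduct.map_tprod, A.powEv_tprod H f fun i => hh _ _ (hx i), B.powEv_tprod H _ hx]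
    simp only [adj]
  exact LinearMap.congr_fun (LinearMap.congr_fun this q) y

theorem tensorEv_adjoint {S' T' : ChainFunctor.{u} (ZMod p)} {P' : GrComplex.{v'} (ZMod p)}
    {Q' : GrComplex.{w'} (ZMod p)} {A : X.Pairing T P} {B : X.Pairing S Q} {A' : X.Pairing T' P'}
    {B' : X.Pairing S' Q'} {H : (OrbitCat G)ᵒᵖ}
    {g : P →ₗ[ZMod p] Q} {h : S.obj (X.T.obj H) →ₗ[ZMod p] T.obj (X.T.obj H)}
    {g' : P' →ₗ[ZMod p] Q'} {h' : S'.obj (X.T.obj H) →ₗ[ZMod p] T'.obj (X.T.obj H)}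
    (hh : ∀ n, ∀ x ∈ (S.obj (X.T.obj H)).gr n, h x ∈ (T.obj (X.T.obj H)).gr n)
    (hh' : ∀ n, ∀ x ∈ (S'.obj (X.T.obj H)).gr n, h' x ∈ (T'.obj (X.T.obj H)).gr n)
    (adj : ∀ q y, A.ev H q (h y) = B.ev H (g q) y)
    (adj' : ∀ q y, A'.ev H q (h' y) = B'.ev H (g' q) y) (q : P ⊗[ZMod p] P')
    (y : S.obj (X.T.obj H) ⊗[ZMod p] S'.obj (X.T.obj H)) :
    A.tensorEv A' H q (TensorProduct.map h h' y) =
      B.tensorEv B' H (TensorProduct.map g g' q) y := by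
  have : (A.tensorEv A' H).compl₂ (TensorProduct.map h h') =
      B.tensorEv B' H ∘ₗ TensorProduct.map g g' := by
    refine tensor_hom_ext fun i j f _ f' _ => tensor_hom_ext fun k l x hx x' hx' => ?_
    rw [LinearMap.compl₂_apply, LinearMap.comp_apply, TensorProduct.map_tmul,
      TensorProduct.map_tmul, A.tensorEv_tmul A' H f f' (hh _ _ hx) (hh' _ _ hx'),
      B.tensorEv_tmul B' H _ _ hx hx', adj, adj']
  exact LinearMap.congr_fun (LinearMap.congr_fun this q) y

end Pairing

end OrbitTriple

end

/-! ### Steenrod diagonals as families of natural operations -/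

section

open GrComplex

namespace GrComplex

variable {R : Type} [CommRing R]

theorem isMor_lid_aug {K : GrComplex.{v} R} {ε : K →ₗ[R] R} (hε : IsAug K ε)
    (L : GrComplex.{w} R) :
    IsMor (tensor K L) L ((TensorProduct.lid R L).toLinearMap ∘ₗ
      TensorProduct.map ε LinearMap.id) := by
  refine isMor_of_tmul (fun m n x hx y hy => ?_) fun m n x hx y hy => ?_
  · rw [LinearMap.comp_apply, TensorProduct.map_tmul, LinearEquiv.coe_coe, TensorProduct.lid_tmul]
    by_cases hm : m = 0
    · subst hm
      rw [zero_add]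
      exact Submodule.smul_mem _ _ hy
    · rw [hε.of_ne m hm x hx, zero_smul]
      exact Submodule.zero_mem _
  · simp only [LinearMap.comp_apply, TensorProduct.map_tmul, LinearEquiv.coe_coe,
      TensorProduct.lid_tmul, LinearMap.id_apply, hε.d, zero_smul, zero_add, map_smul]
    by_cases hm : m = 0
    · subst hm
      rw [Int.cast_zero, sg_zero, one_smul]
    · rw [hε.of_ne m hm x hx, zero_smul, smul_zero]

theorem augPi_permute {K : GrComplex.{v} R} {ε : K →ₗ[R] R} (hε : IsAug K ε) {n : ℕ}
    (σ : Equiv.Perm (Fin n)) (z : power K n) :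
    augPi (fun _ : Fin n => ε) (permute (fun _ => K) σ z) = augPi (fun _ : Fin n => ε) z := by
  have : augPi (fun _ : Fin n => ε) ∘ₗ permute (fun _ => K) σ = augPi fun _ : Fin n => ε :=
    pi_hom_ext fun a x hx => by
      rw [LinearMap.comp_apply, permute_eq (K := fun _ => K) σ hx, map_smul, augPi_tprod]
      by_cases h : ∀ i, a i = 0
      · rw [augPi_tprod]
        simp only [h, Int.cast_zero, mul_zero, Finset.sum_const_zero, sg_zero, one_smul]
        exact Equiv.prod_comp σ.symm fun i => ε (x i)
      · push Not at h
        obtain ⟨i, hi⟩ := h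
        have h0 : ε (x i) = 0 := hε.of_ne _ hi _ (hx i)
        rw [Finset.prod_eq_zero (Finset.mem_univ (σ i)) (by rwa [Equiv.symm_apply_apply]),
          augPi_tprod, Finset.prod_eq_zero (Finset.mem_univ i) h0, smul_zero]
  exact LinearMap.congr_fun this z

end GrComplex

namespace SteenrodDiagonal

variable {p : ℕ} (D : SteenrodDiagonal.{u} p)

theorem isMor_diag (L : SSet.{u}) :
    IsMor (GrComplex.tensor (cyclicResolution p) (SSet.chains (ZMod p) L))
      (power (SSet.chains (ZMod p) L) p) (D.diag L) :=
  (isMor_lid_aug (isAug_cyclicAug p) _).comp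
    ((D.mor fun _ => L).comp (IsMor.id.tensor (SSet.isMor_chainsMap (ZMod p) _)))

theorem diag_act (L : SSet.{u}) (σ : cyclicSubgroup p) (w : cyclicResolution p)
    (x : SSet.chains (ZMod p) L) :
    D.diag L (cyclicAct p σ w ⊗ₜ x) =
      permute (fun _ => SSet.chains (ZMod p) L) σ (D.diag L (w ⊗ₜ x)) := by
  have h := D.equivariant (fun _ => L) σ
    (w ⊗ₜ SSet.chainsMap (ZMod p) (SSet.piDiag p L) x)
  rw [TensorProduct.map_tmul, ← SSet.chainsMap_comp] at h
  have h' : (TensorProduct.lid (ZMod p) (power (SSet.chains (ZMod p) L) p))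
      (TensorProduct.map (cyclicAug p) LinearMap.id (D.Φ (fun _ => L)
        (cyclicAct p σ w ⊗ₜ SSet.chainsMap (ZMod p) (SSet.piDiag p L) x))) =
      (TensorProduct.lid (ZMod p) (power (SSet.chains (ZMod p) L) p))
      (TensorProduct.map (cyclicAug p) LinearMap.id (TensorProduct.map (cyclicAct p σ)
        (permute (fun _ => SSet.chains (ZMod p) L) σ)
          (D.Φ (fun _ => L) (w ⊗ₜ SSet.chainsMap (ZMod p) (SSet.piDiag p L) x)))) :=
    congrArg (fun z => (TensorProduct.lid (ZMod p) (power (SSet.chains (ZMod p) L) p))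
      (TensorProduct.map (cyclicAug p) LinearMap.id z)) h
  refine h'.trans ?_
  change _ = permute _ _ ((TensorProduct.lid (ZMod p) (power (SSet.chains (ZMod p) L) p))
      (TensorProduct.map (cyclicAug p) LinearMap.id (D.Φ (fun _ => L)
        (w ⊗ₜ SSet.chainsMap (ZMod p) (SSet.piDiag p L) x))))
  generalize D.Φ (fun _ => L) (w ⊗ₜ SSet.chainsMap (ZMod p) (SSet.piDiag p L) x) = z
  induction z using TensorProduct.induction_on with
  | zero => simp only [map_zero]
  | add y z hy hz => simp only [map_add, hy, hz]
  | tmul y z =>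
    rw [TensorProduct.map_tmul, TensorProduct.map_tmul, TensorProduct.map_tmul, cyclicAug_act,
      TensorProduct.lid_tmul, TensorProduct.lid_tmul, map_smul]
    rfl

theorem diag_basis_zero (L : SSet.{u}) (x : SSet.chains (ZMod p) L) :
    D.diag L (cyclicBasis p 0 1 ⊗ₜ x) = SSet.iterDiag (ZMod p) p L x := by
  change (TensorProduct.lid (ZMod p) (power (SSet.chains (ZMod p) L) p))
    (TensorProduct.map (cyclicAug p) LinearMap.id (D.Φ (fun _ => L)
      (cyclicBasis p 0 1 ⊗ₜ SSet.chainsMap (ZMod p) (SSet.piDiag p L) x))) = _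
  rw [D.aw, TensorProduct.map_tmul, cyclicAug_basis, if_pos rfl, TensorProduct.lid_tmul, one_smul,
    LinearMap.id_apply, SSet.alexanderWhitney_eq, SSet.iterDiag_natural]
  have : (PiTensorProduct.map fun i => SSet.chainsMap (ZMod p) (SSet.piProj (fun _ : Fin p => L) i))
      ∘ₗ (PiTensorProduct.map fun _ => SSet.chainsMap (ZMod p) (SSet.piDiag p L)) =
      LinearMap.id := by
    rw [← PiTensorProduct.map_comp]
    refine Eq.trans ?_ PiTensorProduct.map_id
    congr 1
    funext i
    refine SSet.chains_hom_ext (X := L) (ZMod p) fun n x => ?_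
    rw [LinearMap.comp_apply, SSet.chainsMap_simplexChain, SSet.chainsMap_simplexChain]
    rfl
  exact LinearMap.congr_fun this _

/-- For degree reasons only `τ e₀` on a vertex matters, where `Δ` is known from the condition on `W
⊗ C₀`. This determines the augmentation of `D.toOps`, on which all uniqueness statements rest. -/
theorem augPi_diag (L : SSet.{u}) (w : cyclicResolution p) (x : SSet.chains (ZMod p) L) :
    augPi (fun _ : Fin p => SSet.chainsAug (ZMod p) L) (D.diag L (w ⊗ₜ x)) =
      cyclicAug p w * SSet.chainsAug (ZMod p) L x := by
  have : augPi (fun _ : Fin p => SSet.chainsAug (ZMod p) L) ∘ₗ D.diag L =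
      augTensor (cyclicAug p) (SSet.chainsAug (ZMod p) L) := by
    refine TensorProduct.ext (cyclic_hom_ext p fun m τ => SSet.chains_hom_ext (X := L) (ZMod p)
      fun n x => ?_)
    change augPi (fun _ : Fin p => SSet.chainsAug (ZMod p) L)
        (D.diag L (cyclicBasis p m τ ⊗ₜ SSet.simplexChain (ZMod p) x)) =
      augTensor (K := cyclicResolution p) (L := SSet.chains (ZMod p) L) _ _
        (cyclicBasis p m τ ⊗ₜ SSet.simplexChain (ZMod p) x)
    rw [augTensor_tmul, cyclicAug_basis, SSet.chainsAug_simplexChain]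
    by_cases h : m = 0 ∧ n = 0
    · obtain ⟨rfl, rfl⟩ := h
      change augPi _ ((TensorProduct.lid (ZMod p) (power (SSet.chains (ZMod p) L) p))
        (TensorProduct.map (cyclicAug p) LinearMap.id (D.Φ (fun _ => L)
          (cyclicBasis p 0 τ ⊗ₜ SSet.chainsMap (ZMod p) (SSet.piDiag p L)
            (SSet.simplexChain (ZMod p) x))))) = _
      rw [SSet.chainsMap_simplexChain, D.zero, TensorProduct.map_tmul, cyclicAug_basis, if_pos rfl,
        TensorProduct.lid_tmul, one_smul, LinearMap.id_apply, augPi_tprod]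
      refine Eq.trans ?_ (one_mul 1).symm
      refine Finset.prod_eq_one fun i _ => ?_
      exact (SSet.chainsAug_simplexChain (ZMod p) x).trans (if_pos rfl)
    · have hm := (D.isMor_diag L).1 _ _
        (tmul_mem (cyclicBasis_mem p m τ) (SSet.simplexChain_mem_gr (ZMod p) x))
      rw [(IsAug.pi fun _ => SSet.isAug_chainsAug (ZMod p) L).of_ne _ (by omega) _ hm]
      rw [not_and_or] at h
      rcases h with h | h
      · rw [if_neg h, zero_mul]
      · rw [if_neg h, mul_zero]
  exact LinearMap.congr_fun this (w ⊗ₜ x)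

/-- The operations `Δ(w ⊗ -)`. -/
def toOps : cyclicResolution p →ₗ[ZMod p] ((ChainFunctor.chains.{u} (ZMod p)).pow p).ops :=
  ChainFunctor.curry (T := (ChainFunctor.chains.{u} (ZMod p)).pow p) (cyclicResolution p)
    (fun L => D.diag L) (fun L => D.isMor_diag L) fun _ _ f w x => D.diag_natural f w x

theorem toOps_apply (w : cyclicResolution p) (L : SSet.{u}) (x : SSet.chains (ZMod p) L) :
    (D.toOps w).1 L x = D.diag L (w ⊗ₜ x) := rfl

theorem isMor_toOps :
    IsMor (cyclicResolution p) ((ChainFunctor.chains.{u} (ZMod p)).pow p).ops D.toOps :=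
  ChainFunctor.isMor_curry

theorem opsAug_toOps (w : cyclicResolution p) :
    ((ChainFunctor.chains.{u} (ZMod p)).pow p).opsAug (D.toOps w) = cyclicAug p w := by
  rw [ChainFunctor.opsAug_apply, toOps_apply]
  refine (D.augPi_diag _ _ _).trans ?_
  rw [SSet.chainsAug_simplexChain, if_pos rfl, mul_one]

end SteenrodDiagonal

namespace ChainFunctor

variable {R : Type} [CommRing R] (T : ChainFunctor.{u} R) (n : ℕ)

/-- The action of the symmetric group on the operations `C(L) → T(L)ⁿ`. -/
def permuteOps : Equiv.Perm (Fin n) →* ((T.pow n).ops →ₗ[R] (T.pow n).ops) where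
  toFun σ := postcomp (T := T.pow n) (T' := T.pow n) (fun L => permute (fun _ => T.obj L) σ)
    (fun L => isMor_permute (fun _ => T.obj L) σ)
    fun _ _ f x => (permute_natural (fun _ => T.map f) (fun _ => (T.mor f).1) σ x).symm
  map_one' := LinearMap.ext fun τ => Subtype.ext (funext fun L => LinearMap.ext fun x =>
    permute_one (T.obj L) (τ.1 L x))
  map_mul' σ σ' := LinearMap.ext fun τ => Subtype.ext (funext fun L => LinearMap.ext fun x =>
    permute_mul (T.obj L) σ σ' (τ.1 L x))

theorem permuteOps_apply (σ : Equiv.Perm (Fin n)) (τ : (T.pow n).ops) (L : SSet.{u})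
    (x : SSet.chains R L) :
    (T.permuteOps n σ τ).1 L x = permute (fun _ => T.obj L) σ (τ.1 L x) := rfl

theorem isMor_permuteOps (σ : Equiv.Perm (Fin n)) :
    IsMor (T.pow n).ops (T.pow n).ops (T.permuteOps n σ) :=
  isMor_postcomp (T := T.pow n) (T' := T.pow n) (g := fun L => permute (fun _ => T.obj L) σ)
    (hg := fun L => isMor_permute (fun _ => T.obj L) σ)
    (nat := fun _ _ f x => (permute_natural (fun _ => T.map f) (fun _ => (T.mor f).1) σ x).symm)

theorem opsAug_permuteOps (σ : Equiv.Perm (Fin n)) (τ : (T.pow n).ops) :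
    (T.pow n).opsAug (T.permuteOps n σ τ) = (T.pow n).opsAug τ :=
  augPi_permute (T.isAug _) σ _

end ChainFunctor

namespace SteenrodDiagonal

variable {p : ℕ} (D : SteenrodDiagonal.{u} p)

theorem toOps_act (σ : cyclicSubgroup p) (w : cyclicResolution p) :
    D.toOps (cyclicAct p σ w) =
      (ChainFunctor.chains.{u} (ZMod p)).permuteOps p σ (D.toOps w) :=
  Subtype.ext (funext fun L => LinearMap.ext fun x => D.diag_act L σ w x)

end SteenrodDiagonal

namespace ChainFunctor

variable {R : Type} [CommRing R] {T : ChainFunctor.{u} R}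

/-- A natural morphism `C(L) → T(L)` as an operation. -/
def natOp (g : ∀ L : SSet.{u}, SSet.chains R L →ₗ[R] T.obj L)
    (hg : ∀ L, IsMor (SSet.chains R L) (T.obj L) (g L))
    (nat : ∀ ⦃L L' : SSet.{u}⦄ (f : L ⟶ L') x, g L' (SSet.chainsMap R f x) = T.map f (g L x)) :
    T.ops :=
  ⟨g, Submodule.mem_iSup_of_mem 0 ⟨nat, fun L a x hx => by
    rw [add_zero]
    exact (hg L).1 a x hx⟩⟩

variable {g : ∀ L : SSet.{u}, SSet.chains R L →ₗ[R] T.obj L}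
  {hg : ∀ L, IsMor (SSet.chains R L) (T.obj L) (g L)}
  {nat : ∀ ⦃L L' : SSet.{u}⦄ (f : L ⟶ L') x, g L' (SSet.chainsMap R f x) = T.map f (g L x)}

theorem natOp_mem : natOp g hg nat ∈ T.ops.gr 0 :=
  ⟨nat, fun L a x hx => by
    rw [add_zero]
    exact (hg L).1 a x hx⟩

theorem d_natOp : T.ops.d (natOp g hg nat) = 0 := by
  refine Subtype.ext (funext fun L => LinearMap.ext fun x => ?_)
  refine (T.ops_d_apply natOp_mem L x).trans ?_
  change (T.obj L).d (g L x) - _ • g L _ = 0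
  rw [Int.cast_zero, sg_zero, one_smul, (hg L).2, sub_self]

/-- The map `F ⊗ C(L) → T(L)` given by a family of operations. -/
def uncurry {F : GrComplex.{v} R} (Ψ : F →ₗ[R] T.ops) (L : SSet.{u}) :
    F ⊗[R] SSet.chains R L →ₗ[R] T.obj L :=
  TensorProduct.lift (LinearMap.proj L ∘ₗ T.opSubmodule.subtype ∘ₗ Ψ)

theorem uncurry_tmul {F : GrComplex.{v} R} (Ψ : F →ₗ[R] T.ops) (L : SSet.{u}) (w : F)
    (x : SSet.chains R L) : uncurry Ψ L (w ⊗ₜ x) = (Ψ w).1 L x := rfl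

theorem isMor_uncurry {F : GrComplex.{v} R} {Ψ : F →ₗ[R] T.ops} (hΨ : IsMor F T.ops Ψ)
    (L : SSet.{u}) : IsMor (GrComplex.tensor F (SSet.chains R L)) (T.obj L) (uncurry Ψ L) := by
  refine isMor_of_tmul (fun m n w hw x hx => ?_) fun m n w hw x hx => ?_
  · rw [add_comm]
    exact (hΨ.1 m w hw).2 L n x hx
  · rw [uncurry_tmul, uncurry_tmul, uncurry_tmul, hΨ.2]
    have := T.ops_d_apply (hΨ.1 m w hw) L x
    rw [this]
    exact sub_add_cancel _ _

end ChainFunctor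

namespace SSet

open Simplicial

variable (R : Type) [CommRing R] (n : ℕ)

/-- The iterated Alexander-Whitney diagonal as an operation. -/
def iterDiagOp : ((ChainFunctor.chains.{u} R).pow n).ops :=
  ChainFunctor.natOp (T := (ChainFunctor.chains.{u} R).pow n) (fun L => iterDiag R n L)
    (fun L => isMor_iterDiag R n L) fun _ _ f x => iterDiag_natural R n f x

theorem iterDiagOp_apply (L : SSet.{u}) (x : chains R L) :
    (iterDiagOp.{u} R n).1 L x = iterDiag R n L x := rfl

theorem iterDiag_vertex {L : SSet.{u}} (x : L _⦋0⦌) :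
    iterDiag R n L (simplexChain R x) = PiTensorProduct.tprod R fun _ => simplexChain R x := by
  rw [iterDiag_simplexChain, Finset.piAntidiag_zero, Finset.sum_singleton]
  congr 1
  funext i
  change simplexChain R (segment x (∑ i ∈ _, 0) 0) = _
  rw [Finset.sum_const_zero, segment_self]

theorem opsAug_iterDiagOp :
    ((ChainFunctor.chains.{u} R).pow n).opsAug (iterDiagOp R n) = 1 := by
  rw [ChainFunctor.opsAug_apply, iterDiagOp_apply, iterDiag_vertex]
  refine (augPi_tprod (K := fun _ : Fin n => chains R Δ[0]) _ _).trans ?_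
  refine Finset.prod_eq_one fun i _ => ?_
  exact (chainsAug_simplexChain R _).trans (if_pos rfl)

theorem chains_stdSimplex_gr {j : ℕ} {k : ℤ} (hk : k < -(j : ℤ))
    {x : chains R (Δ[j] : SSet.{u})} (hx : x ∈ (chains R (Δ[j] : SSet.{u})).gr k) : x = 0 := by
  have : (chains R (Δ[j] : SSet.{u})).gr k ≤ ⊥ := by
    refine chains_gr_le R (P := ⊥) (fun m y hm => ?_)
    rw [simplexChain_degenerate, Submodule.mem_bot]
    rw [degenerate_eq_univ_of_hasDimensionLT _ (j + 1) m (by omega)]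
    trivial
  exact this hx

end SSet

namespace GrComplex

variable {R : Type} [CommRing R]

theorem power_gr_eq_zero {K : GrComplex.{v} R} {j : ℕ}
    (hK : ∀ k : ℤ, k < -(j : ℤ) → ∀ x ∈ K.gr k, x = 0) {n : ℕ} {k : ℤ} (hk : k < -((n * j : ℕ) : ℤ))
    {x : power K n} (hx : x ∈ (power K n).gr k) : x = 0 := by
  have : (power K n).gr k ≤ ⊥ := by
    refine Submodule.span_le.2 ?_
    rintro _ ⟨a, ha, x, hx, rfl⟩
    obtain ⟨i, hi⟩ : ∃ i, a i < -(j : ℤ) := by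
      by_contra! hc
      have := Finset.sum_le_sum fun i (_ : i ∈ Finset.univ) => hc i
      simp only [Finset.sum_const, Finset.card_univ, Fintype.card_fin, ha] at this
      push_cast at hk
      simp at this
      omega
    rw [SetLike.mem_coe, Submodule.mem_bot]
    exact (PiTensorProduct.tprod R).map_coord_zero i (hK _ hi _ (hx i))
  exact this hx

end GrComplex

namespace ChainFunctor

open SSet Simplicial

variable {R : Type} [CommRing R]

/-- It suffices to consider the universal `j`-simplex. The normalized chains of `Δ[j]` vanish above
dimension `j`, their `n`-th tensor power vanishes above `n * j`, and the value has dimension `m +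
j`. -/
theorem ops_pow_apply_eq_zero {n j m : ℕ} (hm : n * j < m + j)
    {τ : ((ChainFunctor.chains.{u} R).pow n).ops}
    (hτ : τ ∈ ((ChainFunctor.chains.{u} R).pow n).ops.gr (-(m : ℤ))) {L : SSet.{u}} (x : L _⦋j⦌) :
    τ.1 L (simplexChain R x) = 0 := by
  have h := hτ.1 (yonedaEquiv.symm x) (simplexChain R (universalSimplex j))
  have h0 : τ.1 Δ[j] (simplexChain R (universalSimplex j)) = 0 :=
    power_gr_eq_zero (K := SSet.chains R Δ[j]) (fun k hk y hy => chains_stdSimplex_gr R hk hy)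
      (by push_cast; omega) (hτ.2 Δ[j] _ _ (simplexChain_mem_gr R (universalSimplex j)))
  rw [chainsMap_simplexChain, app_universalSimplex] at h
  refine h.trans ?_
  exact (congrArg _ h0).trans (map_zero _)

end ChainFunctor

end

section

open GrComplex

/-! ### Existence of a Steenrod diagonal -/

namespace SteenrodDiagonal

variable (p : ℕ)

theorem exists_operations :
    ∃ Ψ : cyclicResolution p →ₗ[ZMod p] ((ChainFunctor.chains.{u} (ZMod p)).pow p).ops,
      IsMor (cyclicResolution p) ((ChainFunctor.chains.{u} (ZMod p)).pow p).ops Ψ ∧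
      (∀ (σ : cyclicSubgroup p) w, Ψ (cyclicAct p σ w) =
        (ChainFunctor.chains.{u} (ZMod p)).permuteOps p σ (Ψ w)) ∧
      Ψ (cyclicBasis p 0 1) = SSet.iterDiagOp (ZMod p) p := by
  let T : ChainFunctor.{u} (ZMod p) := ChainFunctor.chains (ZMod p)
  obtain ⟨Ψ, h1, h2, -, h3⟩ := (cyclicFree p).exists_mor
    (actE := (T.permuteOps p).comp (cyclicSubgroup p).subtype)
    (fun σ => T.isMor_permuteOps p σ) (ChainFunctor.isAug_opsAug (T.pow p))
    (fun σ τ => T.opsAug_permuteOps p σ τ) (fun k τ => ChainFunctor.ops_acyclic (T.pow p) k τ)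
    (ε := cyclicAug p) (cyclicAug_act p) (isAug_cyclicAug p) (A := SSet.iterDiagOp (ZMod p) p)
    ChainFunctor.natOp_mem ChainFunctor.d_natOp (SSet.opsAug_iterDiagOp (ZMod p) p)
  refine ⟨Ψ, h1, h2, ?_⟩
  have h := h3 (0 : ℕ) rfl
  rw [cyclicFree_b] at h
  have e : cyclicAug p (cyclicBasis p 0 1) = 1 := by rw [cyclicAug_basis, if_pos rfl]
  exact h.trans ((congrArg (fun c => c • SSet.iterDiagOp (ZMod p) p) e).trans (one_smul _ _))

variable {p}
  (Ψ : cyclicResolution p →ₗ[ZMod p] ((ChainFunctor.chains.{u} (ZMod p)).pow p).ops)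

/-- The map `W ⊗ C(L₁ × ⋯ × L_p) → C(L₁) ⊗ ⋯ ⊗ C(L_p)` given by a family of operations. -/
def multiDiag (L : Fin p → SSet.{u}) :
    cyclicResolution p ⊗[ZMod p] SSet.chains (ZMod p) (SSet.piSSet L) →ₗ[ZMod p]
      piTensor fun i => SSet.chains (ZMod p) (L i) :=
  (PiTensorProduct.map fun i => SSet.chainsMap (ZMod p) (SSet.piProj L i)) ∘ₗ
    ChainFunctor.uncurry Ψ (SSet.piSSet L)

theorem multiDiag_tmul (L : Fin p → SSet.{u}) (w : cyclicResolution p)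
    (x : SSet.chains (ZMod p) (SSet.piSSet L)) :
    multiDiag Ψ L (w ⊗ₜ x) = PiTensorProduct.map
      (fun i => SSet.chainsMap (ZMod p) (SSet.piProj L i)) ((Ψ w).1 (SSet.piSSet L) x) := rfl

variable {Ψ}

theorem isMor_multiDiag
    (hΨ : IsMor (cyclicResolution p) ((ChainFunctor.chains.{u} (ZMod p)).pow p).ops Ψ)
    (L : Fin p → SSet.{u}) :
    IsMor (GrComplex.tensor (cyclicResolution p) (SSet.chains (ZMod p) (SSet.piSSet L)))
      (piTensor fun i => SSet.chains (ZMod p) (L i)) (multiDiag Ψ L) :=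
  (isMor_piMap fun i => SSet.isMor_chainsMap (ZMod p) (SSet.piProj L i)).comp
    (ChainFunctor.isMor_uncurry hΨ _)

theorem multiDiag_natural {L L' : Fin p → SSet.{u}} (f : ∀ i, L i ⟶ L' i)
    (w : cyclicResolution p) (x : SSet.chains (ZMod p) (SSet.piSSet L)) :
    multiDiag Ψ L' (w ⊗ₜ SSet.chainsMap (ZMod p) (SSet.piSSetMap f) x) =
      PiTensorProduct.map (fun i => SSet.chainsMap (ZMod p) (f i)) (multiDiag Ψ L (w ⊗ₜ x)) := by
  have h := ChainFunctor.opSubmodule_natural _ (Ψ w).2 (SSet.piSSetMap f) x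
  rw [multiDiag_tmul, multiDiag_tmul, h]
  change (PiTensorProduct.map _ ∘ₗ PiTensorProduct.map _) _ =
    (PiTensorProduct.map _ ∘ₗ PiTensorProduct.map _) _
  rw [← PiTensorProduct.map_comp, ← PiTensorProduct.map_comp]
  congr 2
  funext i
  refine LinearMap.ext fun x => ?_
  change SSet.chainsMap _ _ (SSet.chainsMap _ _ x) = SSet.chainsMap _ _ (SSet.chainsMap _ _ x)
  rw [← SSet.chainsMap_comp, ← SSet.chainsMap_comp]
  rfl

theorem multiDiag_act (hact : ∀ (σ : cyclicSubgroup p) w, Ψ (cyclicAct p σ w) =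
      (ChainFunctor.chains.{u} (ZMod p)).permuteOps p σ (Ψ w))
    (L : Fin p → SSet.{u}) (σ : cyclicSubgroup p) (w : cyclicResolution p)
    (x : SSet.chains (ZMod p) (SSet.piSSet L)) :
    multiDiag Ψ (fun i => L (σ.1.symm i))
        (cyclicAct p σ w ⊗ₜ SSet.chainsMap (ZMod p) (SSet.piPermute L σ) x) =
      permute (fun i => SSet.chains (ZMod p) (L i)) σ (multiDiag Ψ L (w ⊗ₜ x)) := by
  have h := ChainFunctor.opSubmodule_natural _ (Ψ w).2 (SSet.piPermute L σ) x
  rw [multiDiag_tmul, multiDiag_tmul, hact, ChainFunctor.permuteOps_apply, h,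
    ← permute_natural (K := fun _ => SSet.chains (ZMod p) (SSet.piSSet L))
      (L := fun i => SSet.chains (ZMod p) (L i))
      (fun i => SSet.chainsMap (ZMod p) (SSet.piProj L i))
      (fun i => SSet.chainsMap_mem (ZMod p) (SSet.piProj L i)) σ]
  have e := permute_natural (K := fun _ => SSet.chains (ZMod p) (SSet.piSSet L))
    (L := fun _ => SSet.chains (ZMod p) (SSet.piSSet fun i => L (σ.1.symm i)))
    (fun _ => SSet.chainsMap (ZMod p) (SSet.piPermute L σ))
    (fun _ => SSet.chainsMap_mem (ZMod p) (SSet.piPermute L σ)) σ ((Ψ w).1 _ x)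
  refine (congrArg _ e.symm).trans ?_
  change (PiTensorProduct.map _ ∘ₗ PiTensorProduct.map _) _ = _
  rw [← PiTensorProduct.map_comp]
  congr 2
  funext i
  refine LinearMap.ext fun x => ?_
  change SSet.chainsMap _ _ (SSet.chainsMap _ _ x) = SSet.chainsMap _ _ x
  rw [← SSet.chainsMap_comp]
  rfl

theorem multiDiag_eq_zero
    (hΨ : IsMor (cyclicResolution p) ((ChainFunctor.chains.{u} (ZMod p)).pow p).ops Ψ)
    (L : Fin p → SSet.{u}) {m j : ℕ} (hm : p * j < m + j) {w : cyclicResolution p}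
    (hw : w ∈ (cyclicResolution p).gr (-(m : ℤ))) {x : SSet.chains (ZMod p) (SSet.piSSet L)}
    (hx : x ∈ (SSet.chains (ZMod p) (SSet.piSSet L)).gr (-(j : ℤ))) :
    multiDiag Ψ L (w ⊗ₜ x) = 0 := by
  have : (SSet.chains (ZMod p) (SSet.piSSet L)).gr (-(j : ℤ)) ≤
      LinearMap.ker (multiDiag Ψ L ∘ₗ TensorProduct.mk (ZMod p) _ _ w) := by
    refine SSet.chains_gr_le (ZMod p) fun k y hk => ?_
    obtain rfl : j = k := by omega
    rw [LinearMap.mem_ker, LinearMap.comp_apply]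
    refine (multiDiag_tmul Ψ L w _).trans ?_
    have e := ChainFunctor.ops_pow_apply_eq_zero hm (hΨ.1 _ _ hw) y
    exact (congrArg _ e).trans (map_zero _)
  exact this hx

theorem multiDiag_basis_zero (h0 : Ψ (cyclicBasis p 0 1) = SSet.iterDiagOp (ZMod p) p)
    (L : Fin p → SSet.{u}) (x : SSet.chains (ZMod p) (SSet.piSSet L)) :
    multiDiag Ψ L (cyclicBasis p 0 1 ⊗ₜ x) = SSet.alexanderWhitney (ZMod p) L x := by
  rw [multiDiag_tmul, h0, SSet.alexanderWhitney_eq]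
  rfl

/-- On a vertex the elements of `W` of positive dimension act as zero by the dimension bound with `j
= 0`. The elements `τ e₀` act by a permuted Alexander-Whitney diagonal, which on a vertex is a
symmetric tensor in degree `0`. -/
theorem multiDiag_vertex
    (hΨ : IsMor (cyclicResolution p) ((ChainFunctor.chains.{u} (ZMod p)).pow p).ops Ψ)
    (hact : ∀ (σ : cyclicSubgroup p) w, Ψ (cyclicAct p σ w) =
      (ChainFunctor.chains.{u} (ZMod p)).permuteOps p σ (Ψ w))
    (h0 : Ψ (cyclicBasis p 0 1) = SSet.iterDiagOp (ZMod p) p) (L : Fin p → SSet.{u})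
    (w : cyclicResolution p) (x : (SSet.piSSet L).obj (op (SimplexCategory.mk 0))) :
    multiDiag Ψ L (w ⊗ₜ SSet.simplexChain (ZMod p) x) = cyclicAug p w •
      PiTensorProduct.tprod (ZMod p) fun i => SSet.simplexChain (ZMod p) (X := L i) (x i) := by
  have : multiDiag Ψ L ∘ₗ (TensorProduct.mk (ZMod p) (cyclicResolution p)
        (SSet.chains (ZMod p) (SSet.piSSet L))).flip (SSet.simplexChain (ZMod p) x) =
      (cyclicAug p).smulRight (PiTensorProduct.tprod (ZMod p) fun i =>
        SSet.simplexChain (ZMod p) (X := L i) (x i)) := by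
    refine cyclic_hom_ext p fun m τ => ?_
    rw [LinearMap.comp_apply, LinearMap.smulRight_apply, cyclicAug_basis]
    change multiDiag Ψ L (cyclicBasis p m τ ⊗ₜ SSet.simplexChain (ZMod p) x) = _
    by_cases hm : m = 0
    · subst hm
      have hτ : cyclicBasis p 0 τ = cyclicAct p τ (cyclicBasis p 0 1) := by
        rw [cyclicAct_basis, mul_one]
      rw [if_pos rfl, one_smul, multiDiag_tmul, hτ, hact, ChainFunctor.permuteOps_apply, h0,
        SSet.iterDiagOp_apply, SSet.iterDiag_vertex]
      have e := permute_eq (K := fun _ : Fin p => SSet.chains (ZMod p) (SSet.piSSet L)) τ.1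
        (a := fun _ => 0) (x := fun _ => SSet.simplexChain (ZMod p) x)
        fun _ => by simpa using SSet.simplexChain_mem_gr (ZMod p) x
      refine (congrArg _ e).trans ?_
      simp only [Int.cast_zero, mul_zero, Finset.sum_const_zero, sg_zero, one_smul]
      rw [PiTensorProduct.map_tprod]
      congr 1
      funext i
      rw [SSet.chainsMap_simplexChain]
      rfl
    · rw [if_neg hm, zero_smul]
      exact multiDiag_eq_zero hΨ L (j := 0) (by omega) (cyclicBasis_mem p m τ)
        (SSet.simplexChain_mem_gr (ZMod p) x)
  exact LinearMap.congr_fun this w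

/-- For `w` of dimension `m` the value has dimension `m + j`. Either this is at most `p * j`, or the
value is zero. -/
theorem multiDiag_mem_span
    (hΨ : IsMor (cyclicResolution p) ((ChainFunctor.chains.{u} (ZMod p)).pow p).ops Ψ)
    (L : Fin p → SSet.{u}) (j : ℕ) (w' w : cyclicResolution p)
    {x : SSet.chains (ZMod p) (SSet.piSSet L)}
    (hx : x ∈ (SSet.chains (ZMod p) (SSet.piSSet L)).gr (-(j : ℤ))) :
    w' ⊗ₜ multiDiag Ψ L (w ⊗ₜ x) ∈ Submodule.span (ZMod p) {z | ∃ w' : cyclicResolution p,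
      ∃ k : ℕ, k ≤ p * j ∧ ∃ y ∈ (piTensor fun i => SSet.chains (ZMod p) (L i)).gr (-(k : ℤ)),
        z = w' ⊗ₜ[ZMod p] y} := by
  have hw : w ∈ ⨆ n, (cyclicResolution p).gr n := by
    rw [(cyclicResolution p).internal.submodule_iSup_eq_top]; trivial
  induction hw using Submodule.iSup_induction' with
  | zero =>
    rw [TensorProduct.zero_tmul, map_zero, TensorProduct.tmul_zero]
    exact Submodule.zero_mem _
  | add w₁ w₂ _ _ h h' =>
    rw [TensorProduct.add_tmul, map_add, TensorProduct.tmul_add]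
    exact Submodule.add_mem _ h h'
  | mem n w hw =>
    rcases lt_or_ge 0 n with hn | hn
    · rw [ofBasis_gr_pos (fun b => by simp) hn hw, TensorProduct.zero_tmul, map_zero,
        TensorProduct.tmul_zero]
      exact Submodule.zero_mem _
    · obtain ⟨m, rfl⟩ : ∃ m : ℕ, n = -m := ⟨n.natAbs, by omega⟩
      by_cases hm : p * j < m + j
      · rw [multiDiag_eq_zero hΨ L hm hw hx, TensorProduct.tmul_zero]
        exact Submodule.zero_mem _
      · refine Submodule.subset_span ⟨w', m + j, by omega, _, ?_, rfl⟩
        have := (isMor_multiDiag hΨ L).1 _ _ (tmul_mem hw hx)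
        rwa [show -((m + j : ℕ) : ℤ) = -(m : ℤ) + -(j : ℤ) by push_cast; ring]

variable (Ψ) in
/-- The map `Φ` given by the coproduct of `W` and a family of operations. -/
def phi (L : Fin p → SSet.{u}) :
    GrComplex.tensor (cyclicResolution p) (SSet.chains (ZMod p) (SSet.piSSet L)) →ₗ[ZMod p]
      GrComplex.tensor (cyclicResolution p) (piTensor fun i => SSet.chains (ZMod p) (L i)) :=
  TensorProduct.map LinearMap.id (multiDiag Ψ L) ∘ₗ
    (TensorProduct.assoc (ZMod p) (cyclicResolution p) (cyclicResolution p)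
      (SSet.chains (ZMod p) (SSet.piSSet L))).toLinearMap ∘ₗ
    TensorProduct.map (cyclicCoprod p) LinearMap.id

variable (Ψ) in
/-- The map `(w' ⊗ w) ⊗ x ↦ w' ⊗ Δ(w ⊗ x)`. -/
def phiAux (L : Fin p → SSet.{u}) (x : SSet.chains (ZMod p) (SSet.piSSet L)) :
    cyclicResolution p ⊗[ZMod p] cyclicResolution p →ₗ[ZMod p]
      cyclicResolution p ⊗[ZMod p] (⨂[ZMod p] i, SSet.chains (ZMod p) (L i)) :=
  TensorProduct.map LinearMap.id (multiDiag Ψ L ∘ₗ (TensorProduct.mk (ZMod p) (cyclicResolution p)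
    (SSet.chains (ZMod p) (SSet.piSSet L))).flip x)

theorem phiAux_tmul (L : Fin p → SSet.{u}) (x : SSet.chains (ZMod p) (SSet.piSSet L))
    (w' w : cyclicResolution p) : phiAux Ψ L x (w' ⊗ₜ w) = w' ⊗ₜ multiDiag Ψ L (w ⊗ₜ x) := rfl

theorem phi_tmul (L : Fin p → SSet.{u}) (w : cyclicResolution p)
    (x : SSet.chains (ZMod p) (SSet.piSSet L)) :
    phi Ψ L (w ⊗ₜ x) = phiAux Ψ L x (cyclicCoprod p w) := by
  rw [phi, LinearMap.comp_apply, LinearMap.comp_apply, TensorProduct.map_tmul]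
  generalize cyclicCoprod p w = z
  induction z using TensorProduct.induction_on with
  | zero => rw [TensorProduct.zero_tmul, map_zero, map_zero, map_zero]
  | add y z hy hz => rw [TensorProduct.add_tmul, map_add, map_add, map_add, hy, hz]
  | tmul y z => rfl

theorem isMor_phi
    (hΨ : IsMor (cyclicResolution p) ((ChainFunctor.chains.{u} (ZMod p)).pow p).ops Ψ)
    (L : Fin p → SSet.{u}) :
    IsMor (GrComplex.tensor (cyclicResolution p) (SSet.chains (ZMod p) (SSet.piSSet L)))
      (GrComplex.tensor (cyclicResolution p) (piTensor fun i => SSet.chains (ZMod p) (L i)))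
      (phi Ψ L) :=
  (IsMor.id.tensor (isMor_multiDiag hΨ L)).comp
    ((isMor_assoc _ _ _).comp ((isMor_cyclicCoprod p).tensor IsMor.id))

/-- The Steenrod diagonal given by a family of operations. -/
def ofOperations
    (hΨ : IsMor (cyclicResolution p) ((ChainFunctor.chains.{u} (ZMod p)).pow p).ops Ψ)
    (hact : ∀ (σ : cyclicSubgroup p) w, Ψ (cyclicAct p σ w) =
      (ChainFunctor.chains.{u} (ZMod p)).permuteOps p σ (Ψ w))
    (h0 : Ψ (cyclicBasis p 0 1) = SSet.iterDiagOp (ZMod p) p) : SteenrodDiagonal.{u} p where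
  Φ := phi Ψ
  mor := isMor_phi hΨ
  natural L L' f z := by
    induction z using TensorProduct.induction_on with
    | zero => simp only [map_zero]
    | add y z hy hz => simp only [map_add, hy, hz]
    | tmul w x =>
      rw [TensorProduct.map_tmul, phi_tmul, phi_tmul, LinearMap.id_apply]
      generalize cyclicCoprod p w = z
      induction z using TensorProduct.induction_on with
      | zero => simp only [map_zero]
      | add y z hy hz => simp only [map_add, hy, hz]
      | tmul w' w =>
        rw [phiAux_tmul, phiAux_tmul, TensorProduct.map_tmul, multiDiag_natural]
        rfl
  equivariant L σ z := by
    induction z using TensorProduct.induction_on with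
    | zero => simp only [map_zero]
    | add y z hy hz => simp only [map_add, hy, hz]
    | tmul w x =>
      rw [TensorProduct.map_tmul, phi_tmul, phi_tmul, cyclicCoprod_act]
      generalize cyclicCoprod p w = z
      induction z using TensorProduct.induction_on with
      | zero => simp only [map_zero]
      | add y z hy hz => simp only [map_add, hy, hz]
      | tmul w' w =>
        rw [phiAux_tmul, TensorProduct.map_tmul, TensorProduct.map_tmul, phiAux_tmul,
          multiDiag_act hact]
  zero L w x := by
    -- On a vertex the second factor of the coproduct enters only through its augmentation, so the
    -- counit identity gives back `w`.
    have key : ∀ z : cyclicResolution p ⊗[ZMod p] cyclicResolution p,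
        phiAux Ψ L (SSet.simplexChain (ZMod p) x) z =
          (TensorProduct.rid (ZMod p) (cyclicResolution p)
            (TensorProduct.map LinearMap.id (cyclicAug p) z)) ⊗ₜ
          PiTensorProduct.tprod (ZMod p) fun i => SSet.simplexChain (ZMod p) (X := L i) (x i) := by
      intro z
      induction z using TensorProduct.induction_on with
      | zero => simp only [map_zero, TensorProduct.zero_tmul]
      | add y z hy hz => simp only [map_add, hy, hz, TensorProduct.add_tmul]
      | tmul w' w =>
        rw [phiAux_tmul, multiDiag_vertex hΨ hact h0, TensorProduct.map_tmul,
          TensorProduct.rid_tmul, TensorProduct.tmul_smul, TensorProduct.smul_tmul']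
        rfl
    rw [phi_tmul, key, cyclicCoprod_counit]
  aw L x := by
    rw [phi_tmul, cyclicCoprod_basis_one, Finset.Nat.antidiagonal_zero, Finset.sum_singleton,
      cyclicCoprodTerm_of_even p (a := 0) (by simp), phiAux_tmul, multiDiag_basis_zero h0]
  bound L w j x hx := by
    rw [phi_tmul]
    generalize cyclicCoprod p w = z
    induction z using TensorProduct.induction_on with
    | zero => rw [map_zero]; exact Submodule.zero_mem _
    | add y z hy hz => rw [map_add]; exact Submodule.add_mem _ hy hz
    | tmul w' w =>
      rw [phiAux_tmul]
      exact multiDiag_mem_span hΨ L j w' w hx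

variable (p) in
theorem nonempty : Nonempty (SteenrodDiagonal.{u} p) := by
  obtain ⟨Ψ, h1, h2, h3⟩ := exists_operations.{u} p
  exact ⟨ofOperations h1 h2 h3⟩

end SteenrodDiagonal

end

/-! ### Naturality of the product of operations and cochains -/

section

open GrComplex

namespace FreeResolution

variable {R : Type} [CommRing R] {Γ : Type} [Group Γ] (V : FreeResolution.{w} R Γ)

theorem isAug_aug : IsAug V.cx V.aug := ⟨V.aug_of_ne, V.aug_d⟩

theorem exists_freeComplex [Nontrivial R] : ∃ F : FreeComplex.{w} R Γ, F.cx = V.cx ∧ HEq F.act V.act := by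
  obtain ⟨B, b, deg, hb, hact⟩ := V.free
  -- A generator of positive degree would be zero, which a basis vector over a nontrivial ring is
  -- not.
  have hdeg : ∀ β, deg β ≤ 0 := fun β => by
    by_contra! h
    have := hb β
    rw [V.gr_pos _ h, Submodule.mem_bot] at this
    exact b.ne_zero _ this
  refine ⟨⟨V.cx, V.act, V.act_mor, B, b, fun β => (deg β).natAbs, fun β => ?_, hact⟩, rfl, HEq.rfl⟩
  have := hb β
  rwa [show deg β = -((deg β).natAbs : ℤ) by have := hdeg β; omega] at this

end FreeResolution

namespace OrbitTriple

variable {p : ℕ} {G : Type a} [Group G] {X : OrbitTriple.{u, a, b, c} p G}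

namespace Pairing

variable {S T : ChainFunctor.{u} (ZMod p)} {P : GrComplex.{v} (ZMod p)}
  {Q : GrComplex.{w} (ZMod p)}

theorem product_congr {E : GrComplex.{0} (ZMod p)} {P' : GrComplex.{v'} (ZMod p)}
    {A : X.Pairing S P} {B : X.Pairing T Q} {f : E →ₗ[ZMod p] S.ops} {f' : E →ₗ[ZMod p] T.ops}
    {g : P' →ₗ[ZMod p] P} {g' : P' →ₗ[ZMod p] Q}
    (hf : ∀ n, ∀ x ∈ E.gr n, f x ∈ S.ops.gr n) (hf' : ∀ n, ∀ x ∈ E.gr n, f' x ∈ T.ops.gr n)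
    (hg : ∀ n, ∀ x ∈ P'.gr n, g x ∈ P.gr n) (hg' : ∀ n, ∀ x ∈ P'.gr n, g' x ∈ Q.gr n)
    (h : ∀ H w q x, A.ev H (g q) ((f w).1 _ x) = B.ev H (g' q) ((f' w).1 _ x)) (z : E ⊗[ZMod p] P') :
    A.product (TensorProduct.map f g z) = B.product (TensorProduct.map f' g' z) := by
  have : A.product ∘ₗ TensorProduct.map f g = B.product ∘ₗ TensorProduct.map f' g' :=
    tensor_hom_ext fun m n x hx y hy => by
      refine X.cochain_ext fun H k y' _ => ?_
      refine (A.evalAt_product (hf _ _ hx) (hg _ _ hy) H y').trans ?_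
      refine Eq.trans ?_ (B.evalAt_product (hf' _ _ hx) (hg' _ _ hy) H y').symm
      rw [h]
  exact LinearMap.congr_fun this z

theorem product_permuteOps (B : X.Pairing T Q) (n : ℕ) (σ : Equiv.Perm (Fin n))
    (z : (T.pow n).ops ⊗[ZMod p] power Q n) :
    (B.pow n).product (TensorProduct.map (T.permuteOps n σ) (permute (fun _ => Q) σ) z) =
      (B.pow n).product z := by
  have key : ∀ k l, ∀ x ∈ (T.pow n).ops.gr k, ∀ y ∈ (power Q n).gr l,
      (B.pow n).product (T.permuteOps n σ x ⊗ₜ permute (fun _ => Q) σ y) =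
        (B.pow n).product (x ⊗ₜ y) := by
    intro k l x hx y hy
    refine X.cochain_ext fun H m y' _ => ?_
    refine ((B.pow n).evalAt_product ((T.isMor_permuteOps n σ).1 _ _ hx)
      ((isMor_permute (fun _ => Q) σ).1 _ _ hy) H y').trans ?_
    refine Eq.trans ?_ ((B.pow n).evalAt_product hx hy H y').symm
    exact congrArg _ (B.powEv_permute σ H y (x.1 _ y'))
  have : (B.pow n).product ∘ₗ TensorProduct.map (T.permuteOps n σ) (permute (fun _ => Q) σ) =
      (B.pow n).product := tensor_hom_ext (K := (T.pow n).ops) (L := power Q n) key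
  exact LinearMap.congr_fun this z

theorem evalAt_product_zero (B : X.Pairing T Q) {τ : T.ops} (hτ : τ ∈ T.ops.gr 0) (q : Q)
    (H : (OrbitCat G)ᵒᵖ) (x : X.C H) :
    X.evalAt H (B.product (τ ⊗ₜ q)) x = B.ev H q (τ.1 (X.T.obj H) x) := by
  have : (LinearMap.applyₗ x ∘ₗ X.evalAt H) ∘ₗ B.product ∘ₗ TensorProduct.mk (ZMod p) T.ops Q τ =
      (B.ev H).flip (τ.1 (X.T.obj H) x) :=
    Q.hom_ext fun n q hq => by
      refine (B.evalAt_product hτ hq H x).trans ?_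
      rw [Int.cast_zero, zero_mul, sg_zero, one_smul]
      rfl
  exact LinearMap.congr_fun this q

theorem isMor_product_left (B : X.Pairing T Q) {τ : T.ops} (hτ : τ ∈ T.ops.gr 0)
    (hd : T.ops.d τ = 0) :
    IsMor Q X.cochains (B.product ∘ₗ TensorProduct.mk (ZMod p) T.ops Q τ) := by
  refine ⟨fun n q hq => ?_, fun q => ?_⟩
  · have := B.isMor_product.1 _ _ (tmul_mem hτ hq)
    rwa [zero_add] at this
  · have h := B.isMor_product.2 (τ ⊗ₜ q)
    refine Eq.trans ?_ h
    refine congrArg B.product ?_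
    have : ∀ q : Q, (GrComplex.tensor T.ops Q).d (τ ⊗ₜ q) = τ ⊗ₜ Q.d q := fun q => by
      refine (tensor_d_tmul (K := T.ops) (L := Q) τ q).trans ?_
      rw [hd, sgn_eq T.ops hτ, Int.cast_zero, sg_zero, one_smul, TensorProduct.zero_tmul, zero_add]
    exact (this q).symm

end Pairing

/-! ### The cup product -/

variable (X)

/-- The Alexander-Whitney diagonal as an operation. -/
def diagOp (p : ℕ) : ((ChainFunctor.chains.{u} (ZMod p)).tensor (ChainFunctor.chains (ZMod p))).ops :=
  ChainFunctor.natOp (T := (ChainFunctor.chains.{u} (ZMod p)).tensor (ChainFunctor.chains (ZMod p)))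
    (fun L => SSet.chainsDiag (ZMod p) L) (fun L => SSet.isMor_chainsDiag (ZMod p) L)
    fun _ _ f x => (SSet.chainsDiag_natural (ZMod p) f x).symm

theorem cup_eq : X.cup = ((Pairing.chains X).tensor (Pairing.chains X)).product ∘ₗ
    TensorProduct.mk (ZMod p) _ _ (diagOp p) :=
  LinearMap.ext fun z => X.cochain_ext fun H _ x _ =>
    (((Pairing.chains X).tensor (Pairing.chains X)).evalAt_product_zero
      ChainFunctor.natOp_mem z H x).symm

theorem isMor_cup : IsMor (GrComplex.tensor X.cochains X.cochains) X.cochains X.cup := by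
  rw [cup_eq]
  exact Pairing.isMor_product_left _ ChainFunctor.natOp_mem ChainFunctor.d_natOp

/-- The cup product is adjoint to the diagonal, so the two bracketings are evaluations on the two
iterated diagonals. These agree by coassociativity, and the evaluations agree by `tensorEv_assoc`;
the associativity is strict. -/
theorem cup_assoc (z : (X.cochains ⊗[ZMod p] X.cochains) ⊗[ZMod p] X.cochains) :
    X.cup (TensorProduct.map X.cup LinearMap.id z) = X.cup (TensorProduct.map LinearMap.id X.cup
      (TensorProduct.assoc (ZMod p) X.cochains X.cochains X.cochains z)) := by
  refine X.cochain_ext fun H _ x _ => ?_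
  have hd := fun L => (SSet.isMor_chainsDiag.{u} (ZMod p) L).1
  let C : ChainFunctor.{u} (ZMod p) := ChainFunctor.chains (ZMod p)
  have e1 := Pairing.tensorEv_adjoint (S := C) (T := C.tensor C) (S' := C) (T' := C)
    (A := (Pairing.chains X).tensor (Pairing.chains X)) (B := Pairing.chains X)
    (A' := Pairing.chains X) (B' := Pairing.chains X) (H := H) (g := X.cup)
    (h := SSet.chainsDiag (ZMod p) (X.T.obj H)) (g' := LinearMap.id) (h' := LinearMap.id)
    (hd _) (fun _ _ h => h) (fun _ _ => rfl) (fun _ _ => rfl) z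
    (SSet.chainsDiag (ZMod p) (X.T.obj H) x)
  have e2 := Pairing.tensorEv_adjoint (S := C) (T := C) (S' := C) (T' := C.tensor C)
    (A := Pairing.chains X) (B := Pairing.chains X)
    (A' := (Pairing.chains X).tensor (Pairing.chains X)) (B' := Pairing.chains X) (H := H)
    (g := LinearMap.id) (h := LinearMap.id) (g' := X.cup)
    (h' := SSet.chainsDiag (ZMod p) (X.T.obj H))
    (fun _ _ h => h) (hd _) (fun _ _ => rfl) (fun _ _ => rfl)
    (TensorProduct.assoc (ZMod p) X.cochains X.cochains X.cochains z)
    (SSet.chainsDiag (ZMod p) (X.T.obj H) x)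
  refine e1.symm.trans (Eq.trans ?_ e2)
  refine ((Pairing.chains X).tensorEv_assoc (Pairing.chains X) (Pairing.chains X) H z _).trans ?_
  exact congrArg _ (SSet.chainsDiag_coassoc (ZMod p) (X.T.obj H) x)

/-! ### The iterated cup product -/

/-- The iterated cup product. -/
def iterCup (n : ℕ) : power X.cochains n →ₗ[ZMod p] X.cochains :=
  ((Pairing.chains X).pow n).product ∘ₗ
    TensorProduct.mk (ZMod p) _ _ (SSet.iterDiagOp (ZMod p) n)

theorem evalAt_iterCup (n : ℕ) (q : power X.cochains n) (H : (OrbitCat G)ᵒᵖ) (x : X.C H) :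
    X.evalAt H (X.iterCup n q) x =
      (Pairing.chains X).powEv n H q (SSet.iterDiag (ZMod p) n (X.T.obj H) x) :=
  ((Pairing.chains X).pow n).evalAt_product_zero ChainFunctor.natOp_mem q H x

/-- The recursion of `iterDiag` splits off the last factor, so its adjoint is the product associated
to the left. -/
theorem iterCup_snoc (n : ℕ) (z : power X.cochains n ⊗[ZMod p] X.cochains) :
    X.iterCup (n + 1) (snocTensor X.cochains n z) =
      X.cup (TensorProduct.map (X.iterCup n) LinearMap.id z) := by
  refine X.cochain_ext fun H _ x _ => ?_
  refine (X.evalAt_iterCup (n + 1) _ H x).trans ?_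
  rw [SSet.iterDiag_succ]
  refine ((Pairing.chains X).powEv_snoc H z _).trans ?_
  let C : ChainFunctor.{u} (ZMod p) := ChainFunctor.chains (ZMod p)
  exact Pairing.tensorEv_adjoint (S := C) (T := C.pow n) (S' := C) (T' := C)
    (A := (Pairing.chains X).pow n) (B := Pairing.chains X)
    (A' := Pairing.chains X) (B' := Pairing.chains X) (H := H) (g := X.iterCup n)
    (h := SSet.iterDiag (ZMod p) n (X.T.obj H)) (g' := LinearMap.id) (h' := LinearMap.id)
    (SSet.isMor_iterDiag (ZMod p) n _).1 (fun _ _ h => h)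
    (fun q y => (X.evalAt_iterCup n q H y).symm) (fun _ _ => rfl) z _

theorem iterCup_one (x : Fin 1 → X.cochains) :
    X.iterCup 1 (PiTensorProduct.tprod (ZMod p) x) = x 0 := by
  refine X.cochain_ext fun H _ y _ => ?_
  refine (X.evalAt_iterCup 1 _ H y).trans ?_
  have : (Pairing.chains X).powEv 1 H (PiTensorProduct.tprod (ZMod p) x) ∘ₗ
      SSet.iterDiag (ZMod p) 1 (X.T.obj H) = X.evalAt H (x 0) := by
    refine SSet.chains_hom_ext (X := X.T.obj H) (ZMod p) fun n y => ?_
    rw [LinearMap.comp_apply, SSet.iterDiag_simplexChain]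
    have hf : Finset.piAntidiag (Finset.univ : Finset (Fin 1)) n = {fun _ => n} := by
      ext f
      rw [Finset.mem_piAntidiag, Finset.mem_singleton]
      constructor
      · rintro ⟨h, -⟩
        funext i
        rw [Subsingleton.elim i 0]
        simpa using h
      · rintro rfl
        simp
    rw [hf, Finset.sum_singleton]
    refine ((Pairing.chains X).powEv_tprod H x (l := fun _ => -(n : ℤ)) fun i =>
      SSet.simplexChain_mem_gr (ZMod p) _).trans ?_
    have hs : ∑ i : Fin 1 with i < (0 : Fin 1), n = 0 := by simp
    simp only [Finset.univ_unique, Finset.prod_singleton, Fin.default_eq_zero,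
      Finset.sum_singleton, lt_self_iff_false, if_false, zero_mul, sg_zero, one_smul]
    refine congrArg (X.evalAt H (x 0)) ?_
    refine (congrArg (fun k => SSet.simplexChain (ZMod p) (SSet.segment y k n)) hs).trans ?_
    rw [SSet.segment_self]
  exact LinearMap.congr_fun this y

theorem isIteratedProduct_iterCup (D : SteenrodDiagonal.{u} p) (n : ℕ) :
    IsIteratedProduct (X.gamma D) (n + 1) fun x =>
      X.iterCup (n + 1) (PiTensorProduct.tprod (ZMod p) x) := by
  induction n with
  | zero =>
    have : (fun x : Fin 1 → X.cochains => X.iterCup 1 (PiTensorProduct.tprod (ZMod p) x)) =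
        fun x => x 0 := funext X.iterCup_one
    exact this ▸ IsIteratedProduct.one
  | succ n ih =>
    have h := IsIteratedProduct.mul ih IsIteratedProduct.one
    have : (fun x : Fin (n + 1 + 1) → X.cochains =>
        X.iterCup (n + 1 + 1) (PiTensorProduct.tprod (ZMod p) x)) = fun x =>
        X.cup (X.iterCup (n + 1) (PiTensorProduct.tprod (ZMod p) fun i => x (Fin.castAdd 1 i)) ⊗ₜ
          x (Fin.natAdd (n + 1) 0)) := by
      funext x
      have e := X.iterCup_snoc (n + 1) (PiTensorProduct.tprod (ZMod p)
        (fun i => x (Fin.castAdd 1 i)) ⊗ₜ x (Fin.natAdd (n + 1) 0))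
      rw [snocTensor_tmul] at e
      refine Eq.trans (congrArg _ (congrArg _ (funext fun i => ?_))) e
      refine Fin.lastCases ?_ (fun i => ?_) i
      · rw [Fin.snoc_last]; rfl
      · rw [Fin.snoc_castSucc]; rfl
    exact this ▸ h

/-! ### The power operation -/

/-- `θ` is thereby controlled by the map `D.toOps` from `W` to an acyclic complex. The sign in its
definition is the Koszul sign built into `product`, since `D.toOps` preserves degrees. -/
theorem steenrodOperation_eq (D : SteenrodDiagonal.{u} p) : X.steenrodOperation D =
    ((Pairing.chains X).pow p).product ∘ₗ TensorProduct.map D.toOps LinearMap.id := by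
  have h : ∀ z, X.steenrodEval D z = ((Pairing.chains X).pow p).productEv
      (TensorProduct.map D.toOps LinearMap.id z) := fun z => by
    have : X.steenrodEval D = ((Pairing.chains X).pow p).productEv ∘ₗ
        TensorProduct.map D.toOps LinearMap.id := TensorProduct.ext rfl
    exact LinearMap.congr_fun this z
  refine LinearMap.ext fun z => Subtype.ext ?_
  refine (h _).trans ?_
  have := map_koszul (K := cyclicResolution p) (L := power X.cochains p) (L' := power X.cochains p)
    D.isMor_toOps.1 (h := LinearMap.id) (fun _ _ h => h) z
  exact congrArg _ this

end OrbitTriple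

end

/-! ### The cochain complex as an object of the category -/

section

open GrComplex

namespace FreeResolution

variable {R : Type} [CommRing R] {Γ : Type} [Group Γ] (V : FreeResolution.{w} R Γ)

theorem exists_mor [Nontrivial R] {E : GrComplex.{v} R} {actE : Γ →* (E →ₗ[R] E)}
    (hE : ∀ σ, IsMor E E (actE σ)) {augE : E →ₗ[R] R} (haug : IsAug E augE)
    (hA : ∀ σ x, augE (actE σ x) = augE x)
    (hac : ∀ k : ℕ, ∀ z ∈ E.gr (-(k : ℤ)), E.d z = 0 → augE z = 0 →
      ∃ y ∈ E.gr (-(k : ℤ) - 1), E.d y = z)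
    {A : E} (hA0 : A ∈ E.gr 0) (dA : E.d A = 0) (augA : augE A = 1) :
    ∃ L : V.cx →ₗ[R] E, IsMor V.cx E L ∧ (∀ σ x, L (V.act σ x) = actE σ (L x)) ∧
      ∀ x, augE (L x) = V.aug x := by
  obtain ⟨⟨K, act, hact, B, b, deg, hb, hb'⟩, rfl, h⟩ := V.exists_freeComplex
  obtain rfl := eq_of_heq h
  obtain ⟨L, h1, h2, h3, -⟩ := FreeComplex.exists_mor ⟨V.cx, V.act, hact, B, b, deg, hb, hb'⟩
    hE haug hA hac V.aug_act V.isAug_aug hA0 dA augA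
  exact ⟨L, h1, h2, h3⟩

end FreeResolution

namespace OrbitTriple

variable {p : ℕ} {G : Type a} [Group G] {X : OrbitTriple.{u, a, b, c} p G}

/-- Permuting the outputs of the operations and the cochains simultaneously does not change
evaluations. Hence equivariance of a map into operations becomes invariance of the map into
cochains. -/
theorem Pairing.product_equivariant {T : ChainFunctor.{u} (ZMod p)} {Q : GrComplex.{w} (ZMod p)}
    (B : X.Pairing T Q) {n : ℕ} {F : GrComplex.{v} (ZMod p)} {f : F →ₗ[ZMod p] (T.pow n).ops}
    {act : F →ₗ[ZMod p] F} {σ : Equiv.Perm (Fin n)} (hf : ∀ x, f (act x) = T.permuteOps n σ (f x))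
    (z : F ⊗[ZMod p] power Q n) :
    (B.pow n).product (TensorProduct.map f LinearMap.id
      (TensorProduct.map act (permute (fun _ => Q) σ) z)) =
      (B.pow n).product (TensorProduct.map f LinearMap.id z) := by
  refine Eq.trans ?_ (B.product_permuteOps n σ _)
  congr 1
  induction z using TensorProduct.induction_on with
  | zero => simp only [map_zero]
  | add y z hy hz => simp only [map_add, hy, hz]
  | tmul x y => simp only [TensorProduct.map_tmul, hf, LinearMap.id_apply]

variable (X) (D : SteenrodDiagonal.{u} p)

theorem isMor_steenrodOperation :
    IsMor (GrComplex.tensor (cyclicResolution p) (power X.cochains p)) X.cochains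
      (X.steenrodOperation D) := by
  rw [steenrodOperation_eq]
  exact (Pairing.isMor_product _).comp (D.isMor_toOps.tensor IsMor.id)

theorem steenrodOperation_act (σ : cyclicSubgroup p)
    (z : cyclicResolution p ⊗[ZMod p] power X.cochains p) :
    X.steenrodOperation D (cyclicPowerAct p X.cochains σ z) = X.steenrodOperation D z := by
  rw [steenrodOperation_eq]
  exact (Pairing.chains X).product_equivariant (fun x => D.toOps_act σ x) z

theorem steenrodOperation_basis_zero (q : power X.cochains p) :
    X.steenrodOperation D (cyclicBasis p 0 1 ⊗ₜ q) = X.iterCup p q := by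
  refine X.cochain_ext fun H _ x _ => ?_
  rw [steenrodOperation_eq]
  refine (((Pairing.chains X).pow p).evalAt_product_zero
    (D.isMor_toOps.1 _ _ (cyclicBasis_mem p 0 1)) q H x).trans ?_
  refine Eq.trans ?_ (X.evalAt_iterCup p q H x).symm
  exact congrArg _ (D.diag_basis_zero _ x)

/-- Acyclicity gives a `Σ_p`-equivariant `Ψ` from `V` to the operations `C(L) → C(L)^p`. Both `Ψ ∘ₗ
j.map` and `D.toOps` are `π`-maps from the free complex `W` over the augmentation of `W`, so they
are `π`-homotopic; `product` carries the homotopy to cochains. -/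
theorem exists_symmetric [Nontrivial (ZMod p)]
    (V : FreeResolution.{v} (ZMod p) (Equiv.Perm (Fin p))) (j : ResolutionMap p V) :
    ∃ φ : GrComplex.tensor V.cx (power X.cochains p) →ₗ[ZMod p] X.cochains,
      IsMor (GrComplex.tensor V.cx (power X.cochains p)) X.cochains φ ∧
      (∀ (σ : Equiv.Perm (Fin p)) x,
        φ (TensorProduct.map (V.act σ) (permute (fun _ : Fin p => X.cochains) σ) x) = φ x) ∧
      EquivHomotopic (GrComplex.tensor (cyclicResolution p) (power X.cochains p)) X.cochains
        (cyclicPowerAct p X.cochains) (X.steenrodOperation D)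
        (φ ∘ₗ TensorProduct.map j.map LinearMap.id) := by
  let T : ChainFunctor.{u} (ZMod p) := ChainFunctor.chains (ZMod p)
  obtain ⟨Ψ, h1, h2, h3⟩ := V.exists_mor (actE := T.permuteOps p)
    (fun σ => T.isMor_permuteOps p σ) (ChainFunctor.isAug_opsAug (T.pow p))
    (fun σ τ => T.opsAug_permuteOps p σ τ) (fun k τ => ChainFunctor.ops_acyclic (T.pow p) k τ)
    (A := SSet.iterDiagOp (ZMod p) p) ChainFunctor.natOp_mem ChainFunctor.d_natOp
    (SSet.opsAug_iterDiagOp (ZMod p) p)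
  obtain ⟨t, ht, ht'⟩ := (cyclicFree p).exists_homotopy (f := D.toOps) (g := Ψ ∘ₗ j.map)
    (actE := (T.permuteOps p).comp (cyclicSubgroup p).subtype)
    (fun σ => T.isMor_permuteOps p σ) (ChainFunctor.isAug_opsAug (T.pow p))
    (fun σ τ => T.opsAug_permuteOps p σ τ) (fun k τ => ChainFunctor.ops_acyclic (T.pow p) k τ)
    D.isMor_toOps (h1.comp j.mor) (fun σ x => D.toOps_act σ x)
    (fun σ x => (congrArg Ψ (j.equivariant σ x)).trans (h2 σ (j.map x)))
    (fun x => (D.opsAug_toOps x).trans ((j.aug x).symm.trans (h3 (j.map x)).symm))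
  refine ⟨((Pairing.chains X).pow p).product ∘ₗ TensorProduct.map Ψ LinearMap.id,
    (Pairing.isMor_product _).comp (h1.tensor IsMor.id),
    fun σ x => (Pairing.chains X).product_equivariant (fun x => h2 σ x) x,
    ((Pairing.chains X).pow p).product ∘ₗ TensorProduct.map t LinearMap.id, ?_,
    fun σ x => (Pairing.chains X).product_equivariant (fun x => ht' σ x) x⟩
  have h := (ht.tensor (IsMor.id (K := power X.cochains p))).postcomp
    ((Pairing.chains X).pow p).isMor_product
  rw [steenrodOperation_eq, LinearMap.comp_assoc, ← TensorProduct.map_comp, LinearMap.id_comp]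
  exact h

/-- Associativity and the condition on `e₀` hold strictly, with homotopy zero; only the symmetry
condition needs a genuine homotopy. -/
theorem isMayObject_gamma [Nontrivial (ZMod p)] (hp : p ≠ 0)
    (V : FreeResolution.{v} (ZMod p) (Equiv.Perm (Fin p))) (j : ResolutionMap p V) :
    IsMayObject V j (X.gamma D) where
  mul_mor := X.isMor_cup
  mul_assoc := ⟨0, fun n x _ => Submodule.zero_mem _, fun x => by
    have h := X.cup_assoc x
    rw [LinearMap.zero_apply, LinearMap.zero_apply, map_zero, add_zero]
    exact sub_eq_zero.2 h⟩
  θ_mor := X.isMor_steenrodOperation D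
  θ_equivariant := X.steenrodOperation_act D
  iterated := by
    refine ⟨X.iterCup p, ?_, 0, fun n x _ => Submodule.zero_mem _, fun x => ?_⟩
    · have : ∀ n, n ≠ 0 → IsIteratedProduct (X.gamma D) n fun x =>
          X.iterCup n (PiTensorProduct.tprod (ZMod p) x) := by
        rintro (_ | n) hn
        · exact absurd rfl hn
        · exact X.isIteratedProduct_iterCup D n
      exact this p hp
    · rw [LinearMap.zero_apply, LinearMap.zero_apply, map_zero, add_zero]
      exact sub_eq_zero.2 (X.steenrodOperation_basis_zero D x)
  symmetric := X.exists_symmetric D V j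

end OrbitTriple

end

/-! ### Operations with values in two tensor powers -/

section

open GrComplex

namespace GrComplex

variable {R : Type} [CommRing R]

theorem tensor_hom_ext₄ {A : GrComplex.{v} R} {B : GrComplex.{w} R} {C : GrComplex.{v'} R}
    {D : GrComplex.{w'} R} {M : Type*} [AddCommGroup M] [Module R M]
    {f g : (A ⊗[R] B) ⊗[R] (C ⊗[R] D) →ₗ[R] M}
    (h : ∀ k l m n, ∀ x ∈ A.gr k, ∀ y ∈ B.gr l, ∀ z ∈ C.gr m, ∀ t ∈ D.gr n,
      f ((x ⊗ₜ y) ⊗ₜ (z ⊗ₜ t)) = g ((x ⊗ₜ y) ⊗ₜ (z ⊗ₜ t))) : f = g :=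
  TensorProduct.ext (tensor_hom_ext fun k l x hx y hy => tensor_hom_ext fun m n z hz t ht =>
    h k l m n x hx y hy z hz t ht)

theorem unshuffle_natural {K K' : GrComplex.{v} R} {L L' : GrComplex.{w} R} {n : ℕ}
    {f : K →ₗ[R] K'} {g : L →ₗ[R] L'} (hf : ∀ m, ∀ x ∈ K.gr m, f x ∈ K'.gr m)
    (hg : ∀ m, ∀ x ∈ L.gr m, g x ∈ L'.gr m) (z : power (tensor K L) n) :
    unshuffle K' L' n (PiTensorProduct.map (fun _ => TensorProduct.map f g) z) =
      TensorProduct.map (PiTensorProduct.map fun _ => f) (PiTensorProduct.map fun _ => g)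
        (unshuffle K L n z) := by
  have : unshuffle K' L' n ∘ₗ PiTensorProduct.map (fun _ => TensorProduct.map f g) =
      TensorProduct.map (PiTensorProduct.map fun _ => f) (PiTensorProduct.map fun _ => g) ∘ₗ
        unshuffle K L n := power_tensor_hom_ext fun k l x y hx hy => by
    simp only [LinearMap.comp_apply]
    rw [unshuffle_eq hx hy, PiTensorProduct.map_tprod, map_smul, TensorProduct.map_tmul,
      PiTensorProduct.map_tprod, PiTensorProduct.map_tprod]
    exact unshuffle_eq (fun i => hf _ _ (hx i)) (fun i => hg _ _ (hy i))
  exact LinearMap.congr_fun this z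

theorem augTensor_unshuffle {K : GrComplex.{v} R} {L : GrComplex.{w} R} {ε : K →ₗ[R] R}
    {ε' : L →ₗ[R] R} (hε : IsAug K ε) {n : ℕ} (z : power (tensor K L) n) :
    augTensor (K := power K n) (L := power L n) (augPi fun _ => ε) (augPi fun _ => ε')
      (unshuffle K L n z) = augPi (K := fun _ => tensor K L) (fun _ => augTensor ε ε') z := by
  have : augTensor (K := power K n) (L := power L n) (augPi fun _ => ε) (augPi fun _ => ε') ∘ₗ
      unshuffle K L n = augPi (K := fun _ => tensor K L) (fun _ => augTensor ε ε') :=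
    power_tensor_hom_ext fun k l x y hx hy => by
      rw [LinearMap.comp_apply, unshuffle_eq hx hy, map_smul, augTensor_tmul]
      rw [augPi_tprod (K := fun _ => K), augPi_tprod (K := fun _ => L),
        augPi_tprod (K := fun _ => tensor K L)]
      simp only [augTensor_tmul]
      rw [Finset.prod_mul_distrib]
      by_cases h : ∀ i, k i = 0
      · simp only [h, Int.cast_zero, mul_zero, Finset.sum_const_zero, sg_zero, one_smul]
      · push Not at h
        obtain ⟨i, hi⟩ := h
        rw [Finset.prod_eq_zero (f := fun i => ε (x i)) (Finset.mem_univ i)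
          (hε.of_ne _ hi _ (hx i)), zero_mul, smul_zero]
  exact LinearMap.congr_fun this z

end GrComplex

namespace SSet

open Simplicial

variable (R : Type) [CommRing R]

theorem augTensor_chainsDiag (X : SSet.{u}) (x : chains R X) :
    augTensor (chainsAug R X) (chainsAug R X) (chainsDiag R X x) = chainsAug R X x := by
  have : augTensor (chainsAug R X) (chainsAug R X) ∘ₗ chainsDiag R X = chainsAug R X := by
    refine chains_hom_ext (X := X) R fun n x => ?_
    rw [LinearMap.comp_apply, chainsAug_simplexChain]
    by_cases hn : n = 0
    · subst hn
      rw [chainsDiag_simplexChain, map_sum, Finset.Nat.antidiagonal_zero, Finset.sum_singleton,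
        augTensor_tmul, chainsAug_simplexChain, if_pos rfl, mul_one]
    · rw [if_neg hn]
      exact ((isAug_chainsAug R X).tensor (isAug_chainsAug R X)).of_ne _ (by omega) _
        ((isMor_chainsDiag R X).1 _ _ (simplexChain_mem_gr R x))
  exact LinearMap.congr_fun this x

end SSet

namespace ChainFunctor

variable {R : Type} [CommRing R] (T : ChainFunctor.{u} R) (n : ℕ)

variable {n} in
theorem map_permute_natural (σ : Equiv.Perm (Fin n)) {L L' : SSet.{u}} (f : L ⟶ L')
    (z : ((T.pow n).tensor (T.pow n)).obj L) :
    TensorProduct.map (permute (fun _ => T.obj L') σ) (permute (fun _ => T.obj L') σ)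
        (((T.pow n).tensor (T.pow n)).map f z) =
      ((T.pow n).tensor (T.pow n)).map f
        (TensorProduct.map (permute (fun _ => T.obj L) σ) (permute (fun _ => T.obj L) σ) z) := by
  have h := fun x => (permute_natural (n := n) (fun _ => T.map f) (fun _ => (T.mor f).1) σ x).symm
  change (TensorProduct.map _ _ ∘ₗ TensorProduct.map _ _) z =
    (TensorProduct.map _ _ ∘ₗ TensorProduct.map _ _) z
  rw [← TensorProduct.map_comp, ← TensorProduct.map_comp]
  congr 2 <;> exact LinearMap.ext h

/-- The diagonal action of the symmetric group on the operations `C(L) → T(L)ⁿ ⊗ T(L)ⁿ`. -/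
def permuteOps₂ : Equiv.Perm (Fin n) →*
    (((T.pow n).tensor (T.pow n)).ops →ₗ[R] ((T.pow n).tensor (T.pow n)).ops) where
  toFun σ := postcomp (T := (T.pow n).tensor (T.pow n)) (T' := (T.pow n).tensor (T.pow n))
    (fun L => TensorProduct.map (permute (fun _ => T.obj L) σ) (permute (fun _ => T.obj L) σ))
    (fun L => (isMor_permute (fun _ => T.obj L) σ).tensor (isMor_permute (fun _ => T.obj L) σ))
    fun _ _ f z => T.map_permute_natural σ f z
  map_one' := LinearMap.ext fun τ => Subtype.ext (funext fun L => LinearMap.ext fun x => by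
    have h : permute (fun _ : Fin n => T.obj L) 1 = LinearMap.id :=
      LinearMap.ext fun y => permute_one (T.obj L) y
    change TensorProduct.map (permute (fun _ : Fin n => T.obj L) 1)
      (permute (fun _ : Fin n => T.obj L) 1) (τ.1 L x) = τ.1 L x
    rw [h]
    exact LinearMap.congr_fun TensorProduct.map_id _)
  map_mul' σ σ' := LinearMap.ext fun τ => Subtype.ext (funext fun L => LinearMap.ext fun x => by
    have h : permute (fun _ : Fin n => T.obj L) (σ * σ') =
        permute (fun _ : Fin n => T.obj L) σ ∘ₗ permute (fun _ : Fin n => T.obj L) σ' :=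
      LinearMap.ext fun y => permute_mul (T.obj L) σ σ' y
    change TensorProduct.map (permute (fun _ : Fin n => T.obj L) (σ * σ'))
      (permute (fun _ : Fin n => T.obj L) (σ * σ')) (τ.1 L x) = _
    rw [h]
    exact LinearMap.congr_fun (TensorProduct.map_comp _ _ _ _) _)

theorem permuteOps₂_apply (σ : Equiv.Perm (Fin n)) (τ : ((T.pow n).tensor (T.pow n)).ops)
    (L : SSet.{u}) (x : SSet.chains R L) : (T.permuteOps₂ n σ τ).1 L x =
      TensorProduct.map (permute (fun _ => T.obj L) σ) (permute (fun _ => T.obj L) σ) (τ.1 L x) :=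
  rfl

theorem isMor_permuteOps₂ (σ : Equiv.Perm (Fin n)) :
    IsMor ((T.pow n).tensor (T.pow n)).ops ((T.pow n).tensor (T.pow n)).ops (T.permuteOps₂ n σ) :=
  isMor_postcomp (T := (T.pow n).tensor (T.pow n)) (T' := (T.pow n).tensor (T.pow n))
    (hg := fun L => (isMor_permute (fun _ => T.obj L) σ).tensor (isMor_permute (fun _ => T.obj L) σ))
    (nat := fun _ _ f z => T.map_permute_natural σ f z)

theorem opsAug_permuteOps₂ (σ : Equiv.Perm (Fin n)) (τ : ((T.pow n).tensor (T.pow n)).ops) :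
    ((T.pow n).tensor (T.pow n)).opsAug (T.permuteOps₂ n σ τ) =
      ((T.pow n).tensor (T.pow n)).opsAug τ := by
  rw [opsAug_apply, opsAug_apply, permuteOps₂_apply]
  generalize τ.1 _ _ = z
  change augTensor _ _ _ = augTensor _ _ _
  induction z using TensorProduct.induction_on with
  | zero => simp only [map_zero]
  | add y z hy hz => simp only [map_add, hy, hz]
  | tmul y z =>
    rw [TensorProduct.map_tmul, augTensor_tmul, augTensor_tmul]
    exact congrArg₂ _ (augPi_permute (T.isAug _) σ y) (augPi_permute (T.isAug _) σ z)

end ChainFunctor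

namespace SteenrodDiagonal

variable {p : ℕ} (D : SteenrodDiagonal.{u} p)

/-- The map `(w ⊗ w') ⊗ (x ⊗ x') ↦ ± Δ(w ⊗ x) ⊗ Δ(w' ⊗ x')`. -/
def diag₂ (L : SSet.{u}) : (cyclicResolution p ⊗[ZMod p] cyclicResolution p) ⊗[ZMod p]
    (SSet.chains (ZMod p) L ⊗[ZMod p] SSet.chains (ZMod p) L) →ₗ[ZMod p]
      power (SSet.chains (ZMod p) L) p ⊗[ZMod p] power (SSet.chains (ZMod p) L) p :=
  TensorProduct.map (D.diag L) (D.diag L) ∘ₗ interchange (cyclicResolution p) (cyclicResolution p)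
    (SSet.chains (ZMod p) L) (SSet.chains (ZMod p) L)

theorem isMor_diag₂ (L : SSet.{u}) :
    IsMor (GrComplex.tensor (GrComplex.tensor (cyclicResolution p) (cyclicResolution p))
      (GrComplex.tensor (SSet.chains (ZMod p) L) (SSet.chains (ZMod p) L)))
      (GrComplex.tensor (power (SSet.chains (ZMod p) L) p) (power (SSet.chains (ZMod p) L) p))
      (D.diag₂ L) :=
  ((D.isMor_diag L).tensor (D.isMor_diag L)).comp (isMor_interchange _ _ _ _)

theorem diag₂_tmul {L : SSet.{u}} (w : cyclicResolution p) {w' : cyclicResolution p} {m n : ℤ}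
    (hw : w' ∈ (cyclicResolution p).gr m) {x : SSet.chains (ZMod p) L}
    (hx : x ∈ (SSet.chains (ZMod p) L).gr n) (x' : SSet.chains (ZMod p) L) :
    D.diag₂ L ((w ⊗ₜ w') ⊗ₜ (x ⊗ₜ x')) = sg (ZMod p) ((m : ZMod 2) * (n : ZMod 2)) •
      (D.diag L (w ⊗ₜ x) ⊗ₜ D.diag L (w' ⊗ₜ x')) := by
  rw [diag₂, LinearMap.comp_apply, interchange_eq w hw hx x', map_smul, TensorProduct.map_tmul]

theorem diag₂_natural {L L' : SSet.{u}} (f : L ⟶ L')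
    (z : cyclicResolution p ⊗[ZMod p] cyclicResolution p)
    (y : SSet.chains (ZMod p) L ⊗[ZMod p] SSet.chains (ZMod p) L) :
    D.diag₂ L' (z ⊗ₜ TensorProduct.map (SSet.chainsMap (ZMod p) f) (SSet.chainsMap (ZMod p) f) y) =
      TensorProduct.map (PiTensorProduct.map fun _ => SSet.chainsMap (ZMod p) f)
        (PiTensorProduct.map fun _ => SSet.chainsMap (ZMod p) f) (D.diag₂ L (z ⊗ₜ y)) := by
  have : D.diag₂ L' ∘ₗ TensorProduct.map LinearMap.id
        (TensorProduct.map (SSet.chainsMap (ZMod p) f) (SSet.chainsMap (ZMod p) f)) =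
      TensorProduct.map (PiTensorProduct.map fun _ => SSet.chainsMap (ZMod p) f)
        (PiTensorProduct.map fun _ => SSet.chainsMap (ZMod p) f) ∘ₗ D.diag₂ L :=
    tensor_hom_ext₄ fun k l m n w _ w' hw x hx x' _ => by
      rw [LinearMap.comp_apply, LinearMap.comp_apply, TensorProduct.map_tmul, LinearMap.id_apply,
        TensorProduct.map_tmul, D.diag₂_tmul w hw hx, map_smul,
        D.diag₂_tmul w hw (SSet.chainsMap_mem (ZMod p) f _ _ hx), D.diag_natural, D.diag_natural]
      rfl
  exact LinearMap.congr_fun this (z ⊗ₜ y)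

theorem diag₂_act (L : SSet.{u}) (σ : cyclicSubgroup p)
    (z : cyclicResolution p ⊗[ZMod p] cyclicResolution p)
    (y : SSet.chains (ZMod p) L ⊗[ZMod p] SSet.chains (ZMod p) L) :
    D.diag₂ L (TensorProduct.map (cyclicAct p σ) (cyclicAct p σ) z ⊗ₜ y) =
      TensorProduct.map (permute (fun _ => SSet.chains (ZMod p) L) σ)
        (permute (fun _ => SSet.chains (ZMod p) L) σ) (D.diag₂ L (z ⊗ₜ y)) := by
  have : D.diag₂ L ∘ₗ TensorProduct.map
        (TensorProduct.map (cyclicAct p σ) (cyclicAct p σ)) LinearMap.id =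
      TensorProduct.map (permute (fun _ => SSet.chains (ZMod p) L) σ)
        (permute (fun _ => SSet.chains (ZMod p) L) σ) ∘ₗ D.diag₂ L :=
    tensor_hom_ext₄ fun k l m n w _ w' hw x hx x' _ => by
      rw [LinearMap.comp_apply, LinearMap.comp_apply, TensorProduct.map_tmul, LinearMap.id_apply,
        TensorProduct.map_tmul, D.diag₂_tmul w hw hx, map_smul,
        D.diag₂_tmul _ ((isMor_cyclicAct p σ).1 _ _ hw) hx, D.diag_act, D.diag_act]
      rfl
  exact LinearMap.congr_fun this (z ⊗ₜ y)

theorem augTensor_diag₂ (L : SSet.{u}) (z : cyclicResolution p ⊗[ZMod p] cyclicResolution p)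
    (y : SSet.chains (ZMod p) L ⊗[ZMod p] SSet.chains (ZMod p) L) :
    augTensor (K := power (SSet.chains (ZMod p) L) p) (L := power (SSet.chains (ZMod p) L) p)
      (augPi fun _ => SSet.chainsAug (ZMod p) L) (augPi fun _ => SSet.chainsAug (ZMod p) L)
      (D.diag₂ L (z ⊗ₜ y)) = augTensor (cyclicAug p) (cyclicAug p) z *
        augTensor (SSet.chainsAug (ZMod p) L) (SSet.chainsAug (ZMod p) L) y := by
  have : augTensor (K := power (SSet.chains (ZMod p) L) p) (L := power (SSet.chains (ZMod p) L) p)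
      (augPi fun _ => SSet.chainsAug (ZMod p) L) (augPi fun _ => SSet.chainsAug (ZMod p) L) ∘ₗ
      D.diag₂ L = augTensor (K := GrComplex.tensor (cyclicResolution p) (cyclicResolution p))
        (L := GrComplex.tensor (SSet.chains (ZMod p) L) (SSet.chains (ZMod p) L))
        (augTensor (cyclicAug p) (cyclicAug p))
        (augTensor (SSet.chainsAug (ZMod p) L) (SSet.chainsAug (ZMod p) L)) :=
    tensor_hom_ext₄ fun k l m n w _ w' hw x hx x' _ => by
      rw [LinearMap.comp_apply, D.diag₂_tmul w hw hx, map_smul, augTensor_tmul, D.augPi_diag,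
        D.augPi_diag]
      refine Eq.trans ?_ (augTensor_tmul (K := GrComplex.tensor (cyclicResolution p) (cyclicResolution p))
        (L := GrComplex.tensor (SSet.chains (ZMod p) L) (SSet.chains (ZMod p) L)) _ _ _ _).symm
      rw [augTensor_tmul, augTensor_tmul]
      -- The interchange sign involves the degree of `w'`: it is trivial in degree `0`, and in every
      -- other degree the augmentation of `w'` is zero.
      by_cases hl : l = 0
      · subst hl
        rw [Int.cast_zero, zero_mul, sg_zero, one_smul]
        ring
      · rw [cyclicAug_of_ne hl hw, zero_mul, mul_zero, smul_zero, mul_zero, zero_mul]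
  exact (LinearMap.congr_fun this (z ⊗ₜ y)).trans (augTensor_tmul _ _ _ _)

end SteenrodDiagonal

end

/-! ### The Cartan formula -/

section

open GrComplex

namespace TensorProduct

variable {R : Type*} [CommRing R] {A B C D : Type*} [AddCommGroup A] [Module R A]
  [AddCommGroup B] [Module R B] [AddCommGroup C] [Module R C] [AddCommGroup D] [Module R D]

theorem map_id_map {E : Type*} [AddCommGroup E] [Module R E] (f : A →ₗ[R] B) (g : B →ₗ[R] C)
    (h : D →ₗ[R] E) (z : A ⊗[R] D) :
    map g LinearMap.id (map f h z) = map (g ∘ₗ f) h z := by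
  rw [← LinearMap.comp_apply, ← map_comp, LinearMap.id_comp]

theorem map_map_comm {f : A →ₗ[R] B} {g : C →ₗ[R] D} {a : A →ₗ[R] A} {b : B →ₗ[R] B}
    {c : C →ₗ[R] C} {d : D →ₗ[R] D} (hf : ∀ x, f (a x) = b (f x)) (hg : ∀ x, g (c x) = d (g x))
    (z : A ⊗[R] C) : map f g (map a c z) = map b d (map f g z) := by
  have h1 : f ∘ₗ a = b ∘ₗ f := LinearMap.ext hf
  have h2 : g ∘ₗ c = d ∘ₗ g := LinearMap.ext hg
  rw [← LinearMap.comp_apply, ← LinearMap.comp_apply, ← map_comp, ← map_comp, h1, h2]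

end TensorProduct

namespace SteenrodDiagonal

variable {p : ℕ} (D : SteenrodDiagonal.{u} p)

/-- The operations `C(L) → C(L)^p ⊗ C(L)^p` given by `Δ` followed by the Alexander-Whitney diagonal
in each factor. -/
def diagOps : cyclicResolution p →ₗ[ZMod p] (((ChainFunctor.chains.{u} (ZMod p)).pow p).tensor
    ((ChainFunctor.chains (ZMod p)).pow p)).ops :=
  ChainFunctor.curry (T := ((ChainFunctor.chains.{u} (ZMod p)).pow p).tensor
      ((ChainFunctor.chains (ZMod p)).pow p)) (cyclicResolution p)
    (fun L => unshuffle (SSet.chains (ZMod p) L) (SSet.chains (ZMod p) L) p ∘ₗ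
      PiTensorProduct.map (fun _ => SSet.chainsDiag (ZMod p) L) ∘ₗ D.diag L)
    (fun L => (isMor_unshuffle _ _ p).comp
      ((isMor_piMap fun _ => SSet.isMor_chainsDiag (ZMod p) L).comp (D.isMor_diag L)))
    fun L L' f w x => by
      have h : PiTensorProduct.map (fun _ : Fin p => SSet.chainsDiag (ZMod p) L') ∘ₗ
          PiTensorProduct.map (fun _ : Fin p => SSet.chainsMap (ZMod p) f) =
          PiTensorProduct.map (fun _ : Fin p => TensorProduct.map (SSet.chainsMap (ZMod p) f)
            (SSet.chainsMap (ZMod p) f)) ∘ₗ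
          PiTensorProduct.map (fun _ : Fin p => SSet.chainsDiag (ZMod p) L) := by
        rw [← PiTensorProduct.map_comp, ← PiTensorProduct.map_comp]
        congr 1
        funext i
        exact LinearMap.ext fun y => (SSet.chainsDiag_natural (ZMod p) f y).symm
      rw [LinearMap.comp_apply, LinearMap.comp_apply, D.diag_natural]
      refine (congrArg _ (LinearMap.congr_fun h (D.diag L (w ⊗ₜ x)))).trans ?_
      exact unshuffle_natural (SSet.chainsMap_mem (ZMod p) f) (SSet.chainsMap_mem (ZMod p) f) _

theorem diagOps_apply (w : cyclicResolution p) (L : SSet.{u}) (x : SSet.chains (ZMod p) L) :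
    (D.diagOps w).1 L x = unshuffle (SSet.chains (ZMod p) L) (SSet.chains (ZMod p) L) p
      (PiTensorProduct.map (fun _ => SSet.chainsDiag (ZMod p) L) (D.diag L (w ⊗ₜ x))) := rfl

theorem isMor_diagOps : IsMor (cyclicResolution p)
    (((ChainFunctor.chains.{u} (ZMod p)).pow p).tensor ((ChainFunctor.chains (ZMod p)).pow p)).ops
    D.diagOps :=
  ChainFunctor.isMor_curry

theorem diagOps_act (σ : cyclicSubgroup p) (w : cyclicResolution p) :
    D.diagOps (cyclicAct p σ w) =
      (ChainFunctor.chains.{u} (ZMod p)).permuteOps₂ p σ (D.diagOps w) := by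
  refine Subtype.ext (funext fun L => LinearMap.ext fun x => ?_)
  refine (D.diagOps_apply _ L x).trans ?_
  rw [D.diag_act]
  have h := permute_natural (K := fun _ : Fin p => SSet.chains (ZMod p) L)
    (L := fun _ => GrComplex.tensor (SSet.chains (ZMod p) L) (SSet.chains (ZMod p) L))
    (fun _ => SSet.chainsDiag (ZMod p) L) (fun _ => (SSet.isMor_chainsDiag (ZMod p) L).1) σ.1
    (D.diag L (w ⊗ₜ x))
  exact (congrArg _ h).trans (unshuffle_permute _ _ σ.1 _)

theorem opsAug_diagOps (w : cyclicResolution p) :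
    (((ChainFunctor.chains.{u} (ZMod p)).pow p).tensor ((ChainFunctor.chains (ZMod p)).pow p)).opsAug
      (D.diagOps w) = cyclicAug p w := by
  refine Eq.trans ?_ (D.opsAug_toOps w)
  rw [ChainFunctor.opsAug_apply, ChainFunctor.opsAug_apply, diagOps_apply, toOps_apply]
  refine (augTensor_unshuffle (SSet.isAug_chainsAug (ZMod p) _) _).trans ?_
  generalize D.diag _ _ = z
  have : augPi (K := fun _ : Fin p => GrComplex.tensor (SSet.chains (ZMod p) (SSet.stdSimplex.{u}.obj
        (SimplexCategory.mk 0))) (SSet.chains (ZMod p) (SSet.stdSimplex.{u}.obj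
        (SimplexCategory.mk 0)))) (fun _ => augTensor (SSet.chainsAug (ZMod p) _)
        (SSet.chainsAug (ZMod p) _)) ∘ₗ
      PiTensorProduct.map (fun _ : Fin p => SSet.chainsDiag (ZMod p) _) =
      augPi (K := fun _ : Fin p => SSet.chains (ZMod p) _) fun _ => SSet.chainsAug (ZMod p) _ :=
    pi_hom_ext fun k x _ => by
      rw [LinearMap.comp_apply, PiTensorProduct.map_tprod, augPi_tprod, augPi_tprod]
      exact Finset.prod_congr rfl fun i _ => SSet.augTensor_chainsDiag (ZMod p) _ (x i)
  exact LinearMap.congr_fun this z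

/-- The operations `C(L) → C(L)^p ⊗ C(L)^p` given by the Alexander-Whitney diagonal followed by
`Δ ⊗ Δ`. -/
def diagOps₂ : cyclicResolution p ⊗[ZMod p] cyclicResolution p →ₗ[ZMod p]
    (((ChainFunctor.chains.{u} (ZMod p)).pow p).tensor
      ((ChainFunctor.chains (ZMod p)).pow p)).ops :=
  ChainFunctor.curry (T := ((ChainFunctor.chains.{u} (ZMod p)).pow p).tensor
      ((ChainFunctor.chains (ZMod p)).pow p))
    (GrComplex.tensor (cyclicResolution p) (cyclicResolution p))
    (fun L => D.diag₂ L ∘ₗ TensorProduct.map LinearMap.id (SSet.chainsDiag (ZMod p) L))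
    (fun L => (D.isMor_diag₂ L).comp (IsMor.id.tensor (SSet.isMor_chainsDiag (ZMod p) L)))
    fun L L' f z x => by
      rw [LinearMap.comp_apply, LinearMap.comp_apply, TensorProduct.map_tmul,
        TensorProduct.map_tmul, ← SSet.chainsDiag_natural]
      exact D.diag₂_natural f z _

theorem diagOps₂_apply (z : cyclicResolution p ⊗[ZMod p] cyclicResolution p) (L : SSet.{u})
    (x : SSet.chains (ZMod p) L) :
    (D.diagOps₂ z).1 L x = D.diag₂ L (z ⊗ₜ SSet.chainsDiag (ZMod p) L x) := rfl

theorem isMor_diagOps₂ : IsMor (GrComplex.tensor (cyclicResolution p) (cyclicResolution p))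
    (((ChainFunctor.chains.{u} (ZMod p)).pow p).tensor ((ChainFunctor.chains (ZMod p)).pow p)).ops
    D.diagOps₂ :=
  ChainFunctor.isMor_curry

theorem diagOps₂_act (σ : cyclicSubgroup p)
    (z : cyclicResolution p ⊗[ZMod p] cyclicResolution p) :
    D.diagOps₂ (TensorProduct.map (cyclicAct p σ) (cyclicAct p σ) z) =
      (ChainFunctor.chains.{u} (ZMod p)).permuteOps₂ p σ (D.diagOps₂ z) :=
  Subtype.ext (funext fun L => LinearMap.ext fun _ => D.diag₂_act L σ z _)

theorem opsAug_diagOps₂ (z : cyclicResolution p ⊗[ZMod p] cyclicResolution p) :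
    (((ChainFunctor.chains.{u} (ZMod p)).pow p).tensor ((ChainFunctor.chains (ZMod p)).pow p)).opsAug
      (D.diagOps₂ z) = augTensor (cyclicAug p) (cyclicAug p) z := by
  rw [ChainFunctor.opsAug_apply, diagOps₂_apply]
  refine (D.augTensor_diag₂ _ z _).trans ?_
  rw [SSet.augTensor_chainsDiag, SSet.chainsAug_simplexChain, if_pos rfl, mul_one]

/-- The Cartan formula for the operations of a Steenrod diagonal. -/
theorem exists_cartan_homotopy :
    ∃ t : cyclicResolution p →ₗ[ZMod p] (((ChainFunctor.chains.{u} (ZMod p)).pow p).tensor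
        ((ChainFunctor.chains (ZMod p)).pow p)).ops,
      IsHomotopy (cyclicResolution p) (((ChainFunctor.chains.{u} (ZMod p)).pow p).tensor
        ((ChainFunctor.chains (ZMod p)).pow p)).ops (D.diagOps₂ ∘ₗ cyclicCoprod p) D.diagOps t ∧
      ∀ (σ : cyclicSubgroup p) w,
        t (cyclicAct p σ w) = (ChainFunctor.chains.{u} (ZMod p)).permuteOps₂ p σ (t w) := by
  let T : ChainFunctor.{u} (ZMod p) := ChainFunctor.chains (ZMod p)
  -- No formula for the homotopy is needed. Both maps are `π`-equivariant morphisms into an acyclic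
  -- complex with augmentation that of `W`; for the first one this uses that the coproduct is an
  -- equivariant, augmentation preserving morphism.
  exact (cyclicFree p).exists_homotopy (f := D.diagOps₂ ∘ₗ cyclicCoprod p) (g := D.diagOps)
    (actE := (T.permuteOps₂ p).comp (cyclicSubgroup p).subtype)
    (fun σ => T.isMor_permuteOps₂ p σ)
    (ChainFunctor.isAug_opsAug ((T.pow p).tensor (T.pow p)))
    (fun σ τ => T.opsAug_permuteOps₂ p σ τ)
    (fun k τ => ChainFunctor.ops_acyclic ((T.pow p).tensor (T.pow p)) k τ)
    (D.isMor_diagOps₂.comp (isMor_cyclicCoprod p)) D.isMor_diagOps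
    (fun σ x => (congrArg D.diagOps₂ (cyclicCoprod_act p σ x)).trans (D.diagOps₂_act σ _))
    (fun σ x => D.diagOps_act σ x)
    (fun x => (D.opsAug_diagOps₂ _).trans ((augTensor_cyclicCoprod p x).trans
      (D.opsAug_diagOps x).symm))

end SteenrodDiagonal

namespace OrbitTriple

variable {p : ℕ} {G : Type a} [Group G] (X : OrbitTriple.{u, a, b, c} p G)
  (D : SteenrodDiagonal.{u} p)

/-- The evaluation of `C_ρ(T; M)^p ⊗ C_ρ(T; M)^p` on `C(T(G/H))^p ⊗ C(T(G/H))^p`. -/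
abbrev pairing₂ : X.Pairing (((ChainFunctor.chains.{u} (ZMod p)).pow p).tensor
    ((ChainFunctor.chains (ZMod p)).pow p))
    (GrComplex.tensor (power X.cochains p) (power X.cochains p)) :=
  ((Pairing.chains X).pow p).tensor ((Pairing.chains X).pow p)

theorem pairing₂_permute (σ : Equiv.Perm (Fin p)) (H : (OrbitCat G)ᵒᵖ)
    (q : power X.cochains p ⊗[ZMod p] power X.cochains p)
    (y : power (X.C H) p ⊗[ZMod p] power (X.C H) p) :
    X.pairing₂.ev H
        (TensorProduct.map (permute (fun _ => X.cochains) σ) (permute (fun _ => X.cochains) σ) q)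
        (TensorProduct.map (permute (fun _ => X.C H) σ) (permute (fun _ => X.C H) σ) y) =
      X.pairing₂.ev H q y := by
  have : (X.pairing₂.ev H ∘ₗ TensorProduct.map (permute (fun _ => X.cochains) σ)
      (permute (fun _ => X.cochains) σ)).compl₂ (TensorProduct.map (permute (fun _ => X.C H) σ)
        (permute (fun _ => X.C H) σ)) = X.pairing₂.ev H := by
    refine tensor_hom_ext (K := power X.cochains p) (L := power X.cochains p) fun m n f _ g _ =>
      tensor_hom_ext (K := power (X.C H) p) (L := power (X.C H) p) fun k l x hx y hy => ?_
    have h1 := (isMor_permute (fun _ : Fin p => X.C H) σ).1 _ _ hx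
    have h2 := (isMor_permute (fun _ : Fin p => X.C H) σ).1 _ _ hy
    refine (((Pairing.chains X).pow p).tensorEv_tmul ((Pairing.chains X).pow p) H
      (permute (fun _ => X.cochains) σ f) (permute (fun _ => X.cochains) σ g) h1 h2).trans ?_
    refine Eq.trans ?_ (((Pairing.chains X).pow p).tensorEv_tmul ((Pairing.chains X).pow p) H f g
      hx hy).symm
    exact congrArg _ (congrArg₂ _ ((Pairing.chains X).powEv_permute σ H f x)
      ((Pairing.chains X).powEv_permute σ H g y))
  exact LinearMap.congr_fun (LinearMap.congr_fun this q) y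

theorem product_permuteOps₂ (σ : Equiv.Perm (Fin p)) (z : (((ChainFunctor.chains.{u} (ZMod p)).pow
      p).tensor ((ChainFunctor.chains (ZMod p)).pow p)).ops ⊗[ZMod p]
      (power X.cochains p ⊗[ZMod p] power X.cochains p)) :
    X.pairing₂.product (TensorProduct.map ((ChainFunctor.chains.{u} (ZMod p)).permuteOps₂ p σ)
      (TensorProduct.map (permute (fun _ => X.cochains) σ) (permute (fun _ => X.cochains) σ)) z) =
      X.pairing₂.product z := by
  let T : ChainFunctor.{u} (ZMod p) := ChainFunctor.chains (ZMod p)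
  have key : ∀ k l, ∀ x ∈ ((T.pow p).tensor (T.pow p)).ops.gr k,
      ∀ y ∈ (GrComplex.tensor (power X.cochains p) (power X.cochains p)).gr l,
      X.pairing₂.product (T.permuteOps₂ p σ x ⊗ₜ TensorProduct.map
        (permute (fun _ => X.cochains) σ) (permute (fun _ => X.cochains) σ) y) =
        X.pairing₂.product (x ⊗ₜ y) := by
    intro k l x hx y hy
    refine X.cochain_ext fun H m y' _ => ?_
    refine (X.pairing₂.evalAt_product ((T.isMor_permuteOps₂ p σ).1 _ _ hx)
      (((isMor_permute (fun _ => X.cochains) σ).tensor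
        (isMor_permute (fun _ => X.cochains) σ)).1 _ _ hy) H y').trans ?_
    refine Eq.trans ?_ (X.pairing₂.evalAt_product hx hy H y').symm
    exact congrArg _ (X.pairing₂_permute σ H y (x.1 _ y'))
  have : X.pairing₂.product ∘ₗ TensorProduct.map (T.permuteOps₂ p σ)
      (TensorProduct.map (permute (fun _ => X.cochains) σ) (permute (fun _ => X.cochains) σ)) =
      X.pairing₂.product :=
    tensor_hom_ext (K := ((T.pow p).tensor (T.pow p)).ops)
      (L := GrComplex.tensor (power X.cochains p) (power X.cochains p)) key
  exact LinearMap.congr_fun this z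

/-- By adjointness the `p` cup products of cochains are moved to `p` diagonals of chains, applied
after `Δ`. Regrouping the `2p` factors with `powEv_tensor` costs one shuffle on chains, absorbed in
`diagOps`, and one on cochains. -/
theorem steenrodOperation_cup (z : cyclicResolution p ⊗[ZMod p]
      power (GrComplex.tensor X.cochains X.cochains) p) :
    X.steenrodOperation D
        (TensorProduct.map LinearMap.id (PiTensorProduct.map fun _ => X.cup) z) =
      X.pairing₂.product (TensorProduct.map D.diagOps (unshuffle X.cochains X.cochains p) z) := by
  have h : X.steenrodOperation D
        (TensorProduct.map LinearMap.id (PiTensorProduct.map fun _ => X.cup) z) =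
      ((Pairing.chains X).pow p).product
        (TensorProduct.map D.toOps (PiTensorProduct.map fun _ => X.cup) z) := by
    rw [steenrodOperation_eq]
    refine congrArg ((Pairing.chains X).pow p).product ?_
    induction z using TensorProduct.induction_on with
    | zero => simp only [map_zero]
    | add y z hy hz => simp only [map_add, hy, hz]
    | tmul y z => rfl
  refine h.trans ?_
  refine Pairing.product_congr D.isMor_toOps.1 D.isMor_diagOps.1
    (isMor_piMap fun _ => X.isMor_cup).1 (isMor_unshuffle _ _ p).1 (fun H w q x => ?_) z
  have e1 := (Pairing.chains X).powEv_tensor (Pairing.chains X) H q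
    (PiTensorProduct.map (fun _ => SSet.chainsDiag (ZMod p) (X.T.obj H)) ((D.toOps w).1 _ x))
  let C : ChainFunctor.{u} (ZMod p) := ChainFunctor.chains (ZMod p)
  have e2 := Pairing.powEv_adjoint (S := C) (T := C.tensor C)
    (A := (Pairing.chains X).tensor (Pairing.chains X)) (B := Pairing.chains X) (H := H)
    (g := X.cup) (h := SSet.chainsDiag (ZMod p) (X.T.obj H))
    (SSet.isMor_chainsDiag (ZMod p) _).1 (fun _ _ => rfl) q ((D.toOps w).1 _ x)
  exact e2.symm.trans e1

theorem evalAt_steenrodOperation {m n : ℤ} {w : cyclicResolution p} {f : power X.cochains p}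
    (hw : w ∈ (cyclicResolution p).gr m) (hf : f ∈ (power X.cochains p).gr n)
    (H : (OrbitCat G)ᵒᵖ) (x : X.C H) : X.evalAt H (X.steenrodOperation D (w ⊗ₜ f)) x =
      sg (ZMod p) ((m : ZMod 2) * (n : ZMod 2)) •
        (Pairing.chains X).powEv p H f (D.diag (X.T.obj H) (w ⊗ₜ x)) := by
  rw [steenrodOperation_eq]
  exact ((Pairing.chains X).pow p).evalAt_product (D.isMor_toOps.1 _ _ hw) hf H x

/-- The cup product of two operations evaluates both on the diagonal of `x`, that is, the pair of
cochain tensors on `Δ ⊗ Δ` of that diagonal. The content is the comparison of the signs of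
interchanging operators, cochains and chains. -/
theorem cup_steenrodOperation (z : (cyclicResolution p ⊗[ZMod p] cyclicResolution p) ⊗[ZMod p]
      (power X.cochains p ⊗[ZMod p] power X.cochains p)) :
    X.cup (TensorProduct.map (X.steenrodOperation D) (X.steenrodOperation D)
        (interchange (cyclicResolution p) (cyclicResolution p) (power X.cochains p)
          (power X.cochains p) z)) =
      X.pairing₂.product (TensorProduct.map D.diagOps₂ LinearMap.id z) := by
  have key : ∀ k l m n, ∀ w ∈ (cyclicResolution p).gr k, ∀ w' ∈ (cyclicResolution p).gr l,
      ∀ f ∈ (power X.cochains p).gr m, ∀ g ∈ (power X.cochains p).gr n,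
      X.cup (TensorProduct.map (X.steenrodOperation D) (X.steenrodOperation D)
        (interchange (cyclicResolution p) (cyclicResolution p) (power X.cochains p)
          (power X.cochains p) ((w ⊗ₜ w') ⊗ₜ (f ⊗ₜ g)))) =
      X.pairing₂.product (D.diagOps₂ (w ⊗ₜ w') ⊗ₜ (f ⊗ₜ g)) := by
    intro k l m n w hw w' hw' f hf g hg
    rw [interchange_eq w hw' hf g, map_smul, map_smul, TensorProduct.map_tmul]
    refine X.cochain_ext fun H j x _ => ?_
    refine Eq.trans ?_ (X.pairing₂.evalAt_product (D.isMor_diagOps₂.1 _ _ (tmul_mem hw hw'))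
      (tmul_mem hf hg) H x).symm
    have e : ∀ y : X.C H ⊗[ZMod p] X.C H,
        sg (ZMod p) ((l : ZMod 2) * (m : ZMod 2)) •
          (Pairing.chains X).tensorEv (Pairing.chains X) H
            (X.steenrodOperation D (w ⊗ₜ f) ⊗ₜ X.steenrodOperation D (w' ⊗ₜ g)) y =
        sg (ZMod p) (((k + l : ℤ) : ZMod 2) * ((m + n : ℤ) : ZMod 2)) •
          X.pairing₂.ev H (f ⊗ₜ g) (D.diag₂ (X.T.obj H) ((w ⊗ₜ w') ⊗ₜ y)) := by
      intro y
      have : sg (ZMod p) ((l : ZMod 2) * (m : ZMod 2)) •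
          (Pairing.chains X).tensorEv (Pairing.chains X) H
            (X.steenrodOperation D (w ⊗ₜ f) ⊗ₜ X.steenrodOperation D (w' ⊗ₜ g)) =
          sg (ZMod p) (((k + l : ℤ) : ZMod 2) * ((m + n : ℤ) : ZMod 2)) •
          (X.pairing₂.ev H (f ⊗ₜ g) ∘ₗ D.diag₂ (X.T.obj H) ∘ₗ
            TensorProduct.mk (ZMod p) _ _ (w ⊗ₜ w')) := by
        refine tensor_hom_ext fun s t x hx y hy => ?_
        have h1 := D.diag_mem (X.T.obj H) hw hx
        have h2 := D.diag_mem (X.T.obj H) hw' hy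
        have h3 := ((Pairing.chains X).pow p).tensorEv_tmul ((Pairing.chains X).pow p) H f g h1 h2
        rw [LinearMap.smul_apply, LinearMap.smul_apply, LinearMap.comp_apply,
          LinearMap.comp_apply, TensorProduct.mk_apply, D.diag₂_tmul w hw' hx y, map_smul,
          (Pairing.chains X).tensorEv_tmul (Pairing.chains X) H _ _ hx hy]
        refine Eq.trans ?_ (congrArg (fun c => sg (ZMod p) (((k + l : ℤ) : ZMod 2) *
          ((m + n : ℤ) : ZMod 2)) • sg (ZMod p) ((l : ZMod 2) * (s : ZMod 2)) • c) h3).symm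
        refine (congrArg (fun c => sg (ZMod p) ((l : ZMod 2) * (m : ZMod 2)) •
          sg (ZMod p) ((s : ZMod 2) * (t : ZMod 2)) • c) (congrArg₂ (· * ·)
            (X.evalAt_steenrodOperation D hw hf H x)
            (X.evalAt_steenrodOperation D hw' hg H y))).trans ?_
        -- Unless the parity of `Δ (w ⊗ x)` is that of `f`, and likewise for `w'`, `y` and `g`, both
        -- sides vanish.
        by_cases hm : ((k + s : ℤ) : ZMod 2) = m
        · by_cases hn : ((l + t : ℤ) : ZMod 2) = n
          · dsimp only
            rw [smul_mul_smul_comm, smul_smul, smul_smul, smul_smul, smul_smul, ← sg_add,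
              ← sg_add, ← sg_add, ← sg_add, ← sg_add]
            congr 2
            push_cast at hm hn ⊢
            rw [← hm, ← hn]
            -- With `m` and `n` eliminated, the exponents are polynomials in four variables over
            -- `ZMod 2`, compared on all sixteen values.
            generalize (k : ZMod 2) = k, (l : ZMod 2) = l, (s : ZMod 2) = s, (t : ZMod 2) = t
            revert k l s t
            decide
          · have h0 := ((Pairing.chains X).pow p).ev_eq_zero hg h2 hn
            dsimp only at h0 ⊢
            rw [h0, smul_zero, mul_zero, mul_zero, smul_zero, smul_zero, smul_zero, smul_zero,
              smul_zero]
        · have h0 := ((Pairing.chains X).pow p).ev_eq_zero hf h1 hm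
          dsimp only at h0 ⊢
          rw [h0, smul_zero, zero_mul, zero_mul, smul_zero, smul_zero, smul_zero, smul_zero,
            smul_zero]
      exact LinearMap.congr_fun this y
    exact e _
  have : X.cup ∘ₗ TensorProduct.map (X.steenrodOperation D) (X.steenrodOperation D) ∘ₗ
      interchange (cyclicResolution p) (cyclicResolution p) (power X.cochains p)
        (power X.cochains p) =
      X.pairing₂.product ∘ₗ TensorProduct.map D.diagOps₂ LinearMap.id :=
    tensor_hom_ext₄ key
  exact LinearMap.congr_fun this z

/-- The homotopy of operations, tensored with the shuffle of the cochains and followed by `product`,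
is the required homotopy of maps on `W ⊗ (K ⊗ K)^p`. Its invariance combines the equivariance of the
homotopy, that of the shuffle, and the invariance of evaluation. -/
theorem isMayMorphism_cup :
    IsMayMorphism ((X.gamma D).toMayPair.tensor (X.gamma D).toMayPair) (X.gamma D).toMayPair
      X.cup := by
  refine ⟨X.isMor_cup, ?_⟩
  obtain ⟨t, ht, ht'⟩ := D.exists_cartan_homotopy
  refine ⟨X.pairing₂.product ∘ₗ TensorProduct.map t (unshuffle X.cochains X.cochains p), ?_, ?_⟩
  · have h := (ht.tensor (isMor_unshuffle X.cochains X.cochains p)).postcomp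
      X.pairing₂.isMor_product
    refine ⟨h.1, fun z => Eq.trans ?_ (h.2 z)⟩
    refine congrArg₂ (· - ·) ?_ (X.steenrodOperation_cup D z)
    refine (X.cup_steenrodOperation D (TensorProduct.map (cyclicCoprod p)
      (unshuffle X.cochains X.cochains p) z)).trans ?_
    refine congrArg X.pairing₂.product ?_
    exact TensorProduct.map_id_map (cyclicCoprod p) D.diagOps₂
      (unshuffle X.cochains X.cochains p) z
  · intro σ z
    refine Eq.trans ?_ (X.product_permuteOps₂ σ.1 _)
    refine congrArg X.pairing₂.product ?_
    exact TensorProduct.map_map_comm (fun w => ht' σ w)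
      (fun q => unshuffle_permute X.cochains X.cochains σ.1 q) z

end OrbitTriple

end

end

theorem proposition5p11 (p : ℕ) [Fact p.Prime] (hp : p ≠ 2) {G : Type a} [Group G]
    (X : OrbitTriple.{u, a, b, c} p G)
    (V : FreeResolution.{v} (ZMod p) (Equiv.Perm (Fin p))) (j : ResolutionMap p V) :
    Nonempty (SteenrodDiagonal.{u} p) ∧
      ∀ D : SteenrodDiagonal.{u} p, IsCartanObject V j (X.gamma D) := by
  -- This makes `ZMod p` nontrivial, as the passage from `V` to a free complex in degrees `≤ 0`
  -- requires.
  have : Fact (1 < p) := ⟨(Fact.out : p.Prime).one_lt⟩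
  exact ⟨SteenrodDiagonal.nonempty p, fun D =>
    ⟨X.isMayObject_gamma D (Fact.out : p.Prime).ne_zero V j, X.isMayMorphism_cup D⟩⟩
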